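/- Let $\mathcal C$ be the supersingular curve $y^2-y=x^3$ over $\mathbb F_4$. Its automorphisms are the changes of variables $\gamma=(l,r,s,t)$, $(x,y)\mapsto(l^2x+r,\,l^3y+l^2sx+t)$, that preserve the equation. Let $\zeta\in\mathbb F_4$ be a primitive cube root of unity, let $\omega=(\zeta,0,0,0)$ generate $C_3\subset\mathrm{Aut}(\mathcal C)$, let $Q_8\subset\mathrm{Aut}(\mathcal C)$ be the quaternion subgroup of automorphisms with $l=1$ (it is generated by $i=(1,1,1,\zeta)$ and $j=\omega i\omega^{-1}$), let $C_2=\{\pm1\}\subset Q_8$ and $V=Q_8/C_2$. The group $\mathrm{Aut}(\mathcal C)$ acts on $(E_{\mathcal C})_*V(0)=\mathbb F_4[[u_1]][u^{\pm1}]$ through its action on the universal deformation of the formal group of $\mathcal C$, namely by continuous $\mathbb F_4$-algebra maps $\phi_\gamma$ with $\phi_\gamma(u)=t_0(\gamma)u$ and $\phi_\gamma(u_1)=t_0(\gamma)u_1$, where $t_0(\gamma)=(l^{-1}+ru_1)^{-1}$. The element $v_1=u_1u^{-1}$ is invariant, $C_2$ acts trivially, and $Q_8$ acts trivially modulo $v_1$.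 For $G=Q_8$ or $G=V$ let $E_r^{*,*,*}(G)$ be the $v_1$-Bockstein spectral sequence computing $H^*(G;(E_{\mathcal C})_*V(0))$: it is the spectral sequence of the $v_1$-adic filtration of the cochains of $G$ with values in $(E_{\mathcal C})_*V(0)$. Its first page in each filtration is $H^*(G;\mathbb F_4[u^{\pm1}])\cong H^*(G;\mathbb F_4)\otimes\mathbb F_4[u^{\pm1}]$, and $d_r(x)=y$ means that $x$ is represented by a cocycle with a lift $\tilde x$ to a cochain with values in $\mathbb F_4[[u_1]][u^{\pm1}]$ such that $d\tilde x=v_1^r\tilde y$, where $\tilde y$ reduces modulo $v_1$ to a representative of $y$. Below, a class of $E_\infty$ is named by the class of the first page that detects it. The group $C_3$ acts on the first page by $(\phi_\omega f)(x_1,\dots,x_s)=\phi_\omega(f(\omega^{-1}x_1\omega,\dots,\omega^{-1}x_s\omega))$. On the first page, multiplication by elements of $H^*(G;\mathbb F_4)$ and by $u^{\pm4}$ and the action of $C_3$ preserve permanent cycles and, in each filtration, boundaries, so they act on $E_\infty$. (1) There are an isomorphism of $\mathbb F_4$-algebras $$H^*(Q_8;\mathbb F_4)\cong\mathbb F_4[g_0,h_{1,0},h_{1,1}]/(h_{1,0}h_{1,1},\;h_{1,0}^3+h_{1,1}^3),$$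 with $h_{1,i}$ of cohomological degree $1$ and $g_0$ of cohomological degree $4$, and a direct sum decomposition $$E_\infty^{*,*,*}(Q_8)=\mathbb F_4[g_0,u^{\pm4}]\otimes\Big(\mathbb F_4[v_1]\{1,\,h_{1,0}u^{-1},\,h_{1,0}^2u^{-2},\,h_{1,0}^3u^{-3}\}\oplus\mathbb F_4[v_1]/(v_1^2)\{h_{1,0},\,h_{1,0}^2,\,h_{1,0}^2u^{-1},\,h_{1,0}^3u^{-1}\}\oplus\mathbb F_4\{h_{1,1},\,h_{1,1}^2,\,h_{1,1}^3,\,h_{1,1}u^{-2},\,h_{1,1}^2u^{-2},\,h_{1,1}^3u^{-2}\}\Big).$$ The action of $C_3$ is determined by $\phi_\omega(u)=\zeta u$, $\phi_\omega(h_{1,i})=\zeta^{2^i}h_{1,i}$ for $i=0,1$, and $\phi_\omega(g_0)=g_0$. (2) There are an isomorphism of $\mathbb F_4$-algebras $H^*(V;\mathbb F_4)\cong\mathbb F_4[h_{1,0},h_{1,1}]$, with $h_{1,i}$ of cohomological degree $1$, and in cohomological degrees $s\le3$ a direct sum decomposition $$E_\infty^{s\le3,*,*}(V)=\mathbb F_4[u^{\pm4}]\otimes\Big(\mathbb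 F_4[v_1]\{1\}\oplus\mathbb F_4[v_1]/(v_1^2)\{h_{1,0},h_{1,0}^2,h_{1,0}^3\}\oplus\mathbb F_4\{z,\;zu^{-2}\;:\;z=h_{1,1},\,h_{1,1}^2,\,h_{1,0}h_{1,1},\,h_{1,0}^2h_{1,1},\,h_{1,0}h_{1,1}^2,\,h_{1,1}^3\}\Big).$$ The action of $C_3$ is determined by $\phi_\omega(u)=\zeta u$ and $\phi_\omega(h_{1,i})=\zeta^{2^i}h_{1,i}$ for $i=0,1$. -/

import Mathlib

noncomputable section

namespace V1BSS

section Cohomology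
open DirectSum

/-! ## Group cohomology and cup products -/

/-- Inhomogeneous `n`-cochains of `G` with values in `A`. -/
def CochDeg (G A : Type) (n : ℕ) : Type := (Fin n → G) → A

instance (G A : Type) [AddCommGroup A] (n : ℕ) : AddCommGroup (CochDeg G A n) :=
  inferInstanceAs (AddCommGroup ((Fin n → G) → A))

instance (k G A : Type) [Semiring k] [AddCommGroup A] [Module k A] (n : ℕ) :
    Module k (CochDeg G A n) :=
  inferInstanceAs (Module k ((Fin n → G) → A))

/-- The cochain of degree zero given by an element of `A`. -/
def constDeg (G : Type) {A : Type} (a : A) : CochDeg G A 0 := fun _ => a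

/-- The graded module of inhomogeneous cochains of all degrees. -/
abbrev Coch (G A : Type) [AddCommGroup A] : Type := ⨁ n, CochDeg G A n

section Differential
variable {k G A : Type} [CommRing k] [Group G] [AddCommGroup A] [Module k A]

/-- The differential of the inhomogeneous cochain complex (Mathlib's) in degree `n`. -/
def dDeg (ρ : Representation k G A) (n : ℕ) : CochDeg G A n →ₗ[k] CochDeg G A (n + 1) :=
  (inhomogeneousCochains.d (Rep.of ρ) n).hom

theorem dDeg_apply (ρ : Representation k G A) (n : ℕ) (f : CochDeg G A n) (g : Fin (n + 1) → G) :
    dDeg ρ n f g = ρ (g 0) (f fun i => g i.succ) +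
      Finset.univ.sum fun j : Fin (n + 1) =>
        (-1 : k) ^ ((j : ℕ) + 1) • f (Fin.contractNth j (· * ·) g) := rfl

theorem dDeg_dDeg (ρ : Representation k G A) (n : ℕ) (f : CochDeg G A n) :
    dDeg ρ (n + 1) (dDeg ρ n f) = 0 := by
  have h := groupCohomology.inhomogeneousCochains.d_comp_d (A := Rep.of ρ) n
  exact congrArg (fun φ => φ.hom f) h

/-- The differential on the cochains of all degrees. -/
def d (ρ : Representation k G A) : Coch G A →ₗ[k] Coch G A :=
  DirectSum.toModule k ℕ _ fun n => DirectSum.lof k ℕ (CochDeg G A) (n + 1) ∘ₗ dDeg ρ n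

theorem d_of (ρ : Representation k G A) (n : ℕ) (f : CochDeg G A n) :
    d ρ (of (CochDeg G A) n f) = of (CochDeg G A) (n + 1) (dDeg ρ n f) :=
  DirectSum.toModule_lof k n f

theorem d_d (ρ : Representation k G A) (x : Coch G A) : d ρ (d ρ x) = 0 := by
  induction x using DirectSum.induction_on with
  | zero => simp
  | of n f => rw [d_of, d_of, dDeg_dDeg, map_zero]
  | add x y hx hy => rw [map_add, map_add, hx, hy, add_zero]

end Differential

section Cup
variable {G A : Type} [CommRing A]

/-- The cup product of cochains with values in a ring with trivial action. -/
def cup {p q : ℕ} (f : CochDeg G A p) (g : CochDeg G A q) : CochDeg G A (p + q) :=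
  fun x => f (fun i => x (Fin.castAdd q i)) * g (fun i => x (Fin.natAdd p i))

theorem mk_eq_mk {G A : Type} {m n : ℕ} (h : m = n) {f : CochDeg G A m} {g : CochDeg G A n}
    (hfg : ∀ x : Fin n → G, f (fun i => x (Fin.cast h i)) = g x) :
    GradedMonoid.mk m f = GradedMonoid.mk n g := by
  subst h
  have : f = g := funext hfg
  rw [this]

theorem congr_coch {G A : Type} {n : ℕ} (f : CochDeg G A n) {x y : Fin n → G} (h : ∀ i, x i = y i) :
    f x = f y := congrArg f (funext h)

theorem congr_fin {G : Type} {n : ℕ} (x : Fin n → G) {i j : Fin n} (h : (i : ℕ) = j) : x i = x j :=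
  congrArg x (Fin.ext h)

instance : GradedMonoid.GMul (CochDeg G A) where
  mul f g := cup f g

instance : GradedMonoid.GOne (CochDeg G A) where
  one := fun _ => 1

instance : GradedMonoid.GMonoid (CochDeg G A) where
  one_mul := by
    rintro ⟨n, f⟩
    refine mk_eq_mk (zero_add n) fun x => ?_
    change 1 * f _ = f x
    rw [one_mul]
    exact congr_coch f fun i => congr_fin x (by simp)
  mul_one := by
    rintro ⟨n, f⟩
    refine mk_eq_mk (add_zero n) fun x => ?_
    change f _ * 1 = f x
    rw [mul_one]
    rfl
  mul_assoc := by
    rintro ⟨p, f⟩ ⟨q, g⟩ ⟨r, h⟩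
    refine mk_eq_mk (add_assoc p q r) fun x => ?_
    change (f _ * g _) * h _ = f _ * (g _ * h _)
    rw [mul_assoc]
    refine congrArg₂ _ rfl (congrArg₂ _ rfl ?_)
    exact congr_coch h fun i => congr_fin x (Nat.add_assoc p q i)

instance : DirectSum.GRing (CochDeg G A) where
  mul_zero _ := funext fun _ => mul_zero _
  zero_mul _ := funext fun _ => zero_mul _
  mul_add _ _ _ := funext fun _ => mul_add _ _ _
  add_mul _ _ _ := funext fun _ => add_mul _ _ _
  natCast n := fun _ => n
  natCast_zero := funext fun _ => Nat.cast_zero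
  natCast_succ n := funext fun _ => Nat.cast_succ n
  intCast n := fun _ => n
  intCast_ofNat n := funext fun _ => Int.cast_natCast n
  intCast_negSucc_ofNat n := funext fun _ => Int.cast_negSucc n

theorem of_mul_of' {p q : ℕ} (f : CochDeg G A p) (g : CochDeg G A q) :
    of (CochDeg G A) p f * of (CochDeg G A) q g = of (CochDeg G A) (p + q) (cup f g) :=
  DirectSum.of_mul_of f g

variable {k : Type} [CommRing k] [Algebra k A]

instance : DirectSum.GAlgebra k (CochDeg G A) where
  toFun :=
    { toFun := fun r _ => algebraMap k A r
      map_zero' := funext fun _ => map_zero _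
      map_add' := fun r s => funext fun _ => map_add _ r s }
  map_one := funext fun _ => map_one (algebraMap k A)
  map_mul r s := mk_eq_mk rfl fun x => map_mul (algebraMap k A) r s
  commutes := by
    rintro r ⟨n, f⟩
    refine mk_eq_mk (Nat.add_comm 0 n) fun x => ?_
    change algebraMap k A r * f _ = f _ * algebraMap k A r
    rw [mul_comm]
    exact congrArg₂ _ (congr_coch f fun i => congr_fin x (Nat.zero_add _)) rfl
  smul_def := by
    rintro r ⟨n, f⟩
    refine mk_eq_mk (zero_add n).symm fun x => ?_
    change r • f _ = algebraMap k A r * f _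
    rw [Algebra.smul_def]
    exact congrArg₂ _ rfl (congr_coch f fun i => congr_fin x (Nat.zero_add _).symm)

variable [Group G]

theorem dDeg_cup [CharP k 2] {p q : ℕ} (f : CochDeg G A p) (g : CochDeg G A q)
    (x : Fin (p + q + 1) → G) :
    dDeg (Representation.trivial k G A) (p + q) (cup f g) x =
      cup (dDeg (Representation.trivial k G A) p f) g (fun i => x (Fin.cast (by omega) i)) +
      cup f (dDeg (Representation.trivial k G A) q g) x := by
  have h1 : ∀ n : ℕ, (-1 : k) ^ n = 1 := fun n => by rw [CharTwo.neg_eq, one_pow]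
  have h2 : ∀ a : A, a + a = 0 := fun a => by
    rw [← one_smul k a, ← add_smul, CharTwo.add_self_eq_zero, zero_smul]
  have hd : ∀ (n : ℕ) (u : CochDeg G A n) (y : Fin (n + 1) → G),
      dDeg (Representation.trivial k G A) n u y = u (fun i => y i.succ) +
        ∑ j : Fin (n + 1), u (Fin.contractNth j (· * ·) y) := by
    intro n u y
    rw [dDeg_apply]
    simp only [h1, one_smul]
    rfl
  have hs : ∀ F : Fin (p + q + 1) → A, ∑ j, F j =
      ∑ i : Fin p, F (Fin.castAdd (q + 1) i) + ∑ i : Fin (q + 1), F (Fin.natAdd p i) :=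
    fun F => Fin.sum_univ_add (a := p) (b := q + 1) F
  have hL : dDeg (Representation.trivial k G A) (p + q) (cup f g) x =
      f (fun i => x (Fin.castAdd q i).succ) * g (fun i => x (Fin.natAdd p i).succ) +
      (∑ i : Fin p, f (Fin.contractNth (Fin.castSucc i) (· * ·)
          fun i => x (Fin.cast (by omega) (Fin.castAdd q i))) * g (fun i => x (Fin.natAdd p i).succ) +
        ∑ j : Fin (q + 1), f (fun i => x (Fin.castAdd (q + 1) i)) *
          g (Fin.contractNth j (· * ·) fun i => x (Fin.natAdd p i))) := by
    rw [hd, hs]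
    refine congrArg₂ _ rfl (congrArg₂ _ (Finset.sum_congr rfl fun i _ => ?_)
      (Finset.sum_congr rfl fun j _ => ?_))
    · refine congrArg₂ _ (congr_coch f fun l => ?_) (congr_coch g fun l => ?_)
      · simp only [Fin.contractNth]
        rfl
      · rw [Fin.contractNth_apply_of_gt]
        simp
        omega
    · refine congrArg₂ _ (congr_coch f fun l => ?_) (congr_coch g fun l => ?_)
      · rw [Fin.contractNth_apply_of_lt]
        · rfl
        · simp
          omega
      · simp only [Fin.contractNth, Fin.val_natAdd, Nat.add_lt_add_iff_left, Nat.add_left_cancel_iff]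
        rfl
  have hR1 : cup (dDeg (Representation.trivial k G A) p f) g
        (fun i => x (Fin.cast (by omega) i)) =
      (f (fun i => x (Fin.castAdd q i).succ) +
        (∑ i : Fin p, f (Fin.contractNth (Fin.castSucc i) (· * ·)
          fun i => x (Fin.cast (by omega) (Fin.castAdd q i))) +
          f (fun i => x (Fin.castAdd (q + 1) i)))) * g (fun i => x (Fin.natAdd p i).succ) := by
    change dDeg (Representation.trivial k G A) p f _ * g _ = _
    rw [hd, Fin.sum_univ_castSucc]
    refine congrArg₂ _ (congrArg₂ _ rfl (congrArg₂ _ rfl (congr_coch f fun l => ?_)))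
      (congr_coch g fun l => congr_fin x ?_)
    · rw [Fin.contractNth_apply_of_lt _ _ _ _ (by simp)]
      rfl
    · simp
      omega
  have hR2 : cup f (dDeg (Representation.trivial k G A) q g) x =
      f (fun i => x (Fin.castAdd (q + 1) i)) * (g (fun i => x (Fin.natAdd p i).succ) +
        ∑ j : Fin (q + 1), g (Fin.contractNth j (· * ·) fun i => x (Fin.natAdd p i))) := by
    change f _ * dDeg (Representation.trivial k G A) q g _ = _
    rw [hd]
    rfl
  rw [hL, hR1, hR2, ← Finset.sum_mul, ← Finset.mul_sum]
  generalize f (fun i => x (Fin.castAdd (q + 1) i)) = a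
  generalize g (fun i => x (Fin.natAdd p i).succ) = b
  linear_combination -(h2 (a * b))

theorem d_mul [CharP k 2] (x y : Coch G A) :
    d (Representation.trivial k G A) (x * y) =
      d (Representation.trivial k G A) x * y + x * d (Representation.trivial k G A) y := by
  induction x using DirectSum.induction_on with
  | zero => simp
  | add x x' hx hx' =>
    rw [add_mul, map_add, map_add, hx, hx', add_mul, add_mul]
    abel
  | of p f =>
    induction y using DirectSum.induction_on with
    | zero => simp
    | add y y' hy hy' =>
      rw [mul_add, map_add, map_add, hy, hy', mul_add, mul_add]
      abel
    | of q g =>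
      rw [of_mul_of', d_of, d_of, d_of, of_mul_of', of_mul_of']
      let w : CochDeg G A (p + q + 1) := fun x =>
        cup (dDeg (Representation.trivial k G A) p f) g (fun i => x (Fin.cast (by omega) i))
      let w' : CochDeg G A (p + q + 1) :=
        (cup f (dDeg (Representation.trivial k G A) q g) : CochDeg G A (p + (q + 1)))
      have h : dDeg (Representation.trivial k G A) (p + q) (cup f g) = w + w' :=
        funext fun x => dDeg_cup f g x
      rw [h, map_add]
      refine congrArg₂ _ (DirectSum.of_eq_of_gradedMonoid_eq ?_) rfl
      exact mk_eq_mk (by omega) fun x => rfl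

theorem d_const (a : A) :
    d (Representation.trivial k G A) (of (CochDeg G A) 0 (constDeg G a)) = 0 := by
  rw [d_of]
  have h : dDeg (Representation.trivial k G A) 0 (constDeg G a) = 0 := by
    funext x
    rw [dDeg_apply]
    change a + ∑ j : Fin 1, (-1 : k) ^ ((j : ℕ) + 1) • a = 0
    simp
  rw [h, map_zero]

theorem d_one : d (Representation.trivial k G A) 1 = 0 := d_const 1

end Cup

section Ring
variable (k G A : Type) [CommRing k] [CharP k 2] [Group G] [CommRing A] [Algebra k A]

/-- The algebra of cocycles with values in a ring `A` with trivial action. -/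
def cocycles : Subalgebra k (Coch G A) where
  carrier := {x | d (Representation.trivial k G A) x = 0}
  mul_mem' {x y} hx hy := by
    rw [Set.mem_ofPred_eq] at *
    rw [d_mul, hx, hy, zero_mul, mul_zero, add_zero]
  add_mem' {x y} hx hy := by
    rw [Set.mem_ofPred_eq] at *
    rw [map_add, hx, hy, add_zero]
  algebraMap_mem' r := by
    rw [Set.mem_ofPred_eq, Algebra.algebraMap_eq_smul_one, map_smul, d_one, smul_zero]

/-- The two-sided ideal of coboundaries in the algebra of cocycles. -/
def coboundaries : Ideal (cocycles k G A) where
  carrier := {z | ∃ y, d (Representation.trivial k G A) y = z}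
  add_mem' := by
    rintro _ _ ⟨y, hy⟩ ⟨y', hy'⟩
    exact ⟨y + y', by rw [map_add, hy, hy']; rfl⟩
  zero_mem' := ⟨0, map_zero _⟩
  smul_mem' := by
    rintro ⟨c, hc⟩ _ ⟨y, hy⟩
    have hc : d (Representation.trivial k G A) c = 0 := hc
    refine ⟨c * y, ?_⟩
    rw [d_mul, hc, hy, zero_mul, zero_add]
    rfl

instance : (coboundaries k G A).IsTwoSided where
  mul_mem_of_left := by
    rintro _ ⟨c, hc⟩ ⟨y, hy⟩
    have hc : d (Representation.trivial k G A) c = 0 := hc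
    refine ⟨y * c, ?_⟩
    rw [d_mul, hc, hy, mul_zero, add_zero]
    rfl

/-- The cohomology ring `H^*(G; A) = ⨁ₙ H^n(G; A)` with its cup product, for a commutative
`k`-algebra `A` (`k` of characteristic two) on which `G` acts trivially. -/
abbrev HRing : Type := cocycles k G A ⧸ coboundaries k G A


variable {k G A}

/-- The cohomology class of a cocycle. -/
def cls : cocycles k G A →ₐ[k] HRing k G A := Ideal.Quotient.mkₐ k (coboundaries k G A)

variable (k G A) in
/-- The part `H^n(G; A)` of the cohomology ring. -/
def Hdeg (n : ℕ) : Submodule k (HRing k G A) :=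
  ((LinearMap.range (DirectSum.lof k ℕ (CochDeg G A) n)).comap
    (cocycles k G A).val.toLinearMap).map (cls (k := k) (G := G) (A := A)).toLinearMap

end Ring

section Functoriality
variable {k G H A B : Type} [CommRing k] [Group G] [Group H]

/-- The map on cochains `f ↦ θ ∘ f ∘ α` induced by a group homomorphism `α` and an additive
map `θ` of coefficients, in degree `n`. -/
def mapDeg [AddCommGroup A] [AddCommGroup B] (α : H →* G) (θ : A →+ B) (n : ℕ) :
    CochDeg G A n →+ CochDeg H B n where
  toFun f := fun x => θ (f fun i => α (x i))
  map_zero' := funext fun _ => map_zero θ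
  map_add' _ _ := funext fun _ => map_add θ _ _

/-- The map on cochains of all degrees induced by a group homomorphism `α` and an additive
map `θ` of coefficients. -/
def cochMap [AddCommGroup A] [AddCommGroup B] (α : H →* G) (θ : A →+ B) : Coch G A →+ Coch H B :=
  DirectSum.map fun n => mapDeg α θ n

theorem cochMap_of [AddCommGroup A] [AddCommGroup B] (α : H →* G) (θ : A →+ B) (n : ℕ)
    (f : CochDeg G A n) :
    cochMap α θ (of (CochDeg G A) n f) = of (CochDeg H B) n (mapDeg α θ n f) :=
  DirectSum.map_of _ _ _

variable [CommRing A] [CommRing B] [Algebra k A] [Algebra k B]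

theorem d_cochMap (α : H →* G) (θ : A →ₐ[k] B) (x : Coch G A) :
    d (Representation.trivial k H B) (cochMap α (θ : A →+ B) x) =
      cochMap α (θ : A →+ B) (d (Representation.trivial k G A) x) := by
  induction x using DirectSum.induction_on with
  | zero => simp
  | add x y hx hy => simp only [map_add, hx, hy]
  | of n f =>
    rw [cochMap_of, d_of, d_of, cochMap_of]
    refine congrArg _ (funext fun x => ?_)
    change dDeg _ n (mapDeg α (θ : A →+ B) n f) x = θ (dDeg _ n f fun i => α (x i))
    rw [dDeg_apply, dDeg_apply]
    have h : ∀ j : Fin (n + 1), (fun i => α (Fin.contractNth j (· * ·) x i)) =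
        Fin.contractNth j (· * ·) (fun i => α (x i)) := fun j =>
      Fin.comp_contractNth (f := α) _ _ (map_mul α) j x
    change θ _ + ∑ j : Fin (n + 1), _ • θ (f fun i => α (Fin.contractNth j (· * ·) x i)) =
      θ (f _ + ∑ j : Fin (n + 1), _ • f _)
    simp only [map_add, map_sum, map_smul, h]

/-- The ring homomorphism on cochains induced by a group homomorphism and a homomorphism of
coefficient algebras. -/
def cochAlgHom (α : H →* G) (θ : A →ₐ[k] B) : Coch G A →ₐ[k] Coch H B where
  __ := cochMap α (θ : A →+ B)
  map_one' := by
    change cochMap α (θ : A →+ B) (of (CochDeg G A) 0 GradedMonoid.GOne.one) =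
      of (CochDeg H B) 0 GradedMonoid.GOne.one
    rw [cochMap_of]
    exact congrArg _ (funext fun _ => map_one θ)
  map_mul' x y := by
    change cochMap α (θ : A →+ B) (x * y) = cochMap α (θ : A →+ B) x * cochMap α (θ : A →+ B) y
    induction x using DirectSum.induction_on with
    | zero => simp
    | add x x' hx hx' => simp only [add_mul, map_add, hx, hx']
    | of p f =>
      induction y using DirectSum.induction_on with
      | zero => simp
      | add y y' hy hy' => simp only [mul_add, map_add, hy, hy']
      | of q g =>
        rw [of_mul_of', cochMap_of, cochMap_of, cochMap_of, of_mul_of']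
        exact congrArg _ (funext fun _ => map_mul θ _ _)
  commutes' r := by
    change cochMap α (θ : A →+ B) (of (CochDeg G A) 0 (constDeg G (algebraMap k A r))) =
      of (CochDeg H B) 0 (constDeg H (algebraMap k B r))
    rw [cochMap_of]
    exact congrArg _ (funext fun _ => θ.commutes r)

variable [CharP k 2]

/-- The ring homomorphism `H^*(G; A) → H^*(H; B)` induced by `α : H → G` and `θ : A → B`. -/
def HRing.map (α : H →* G) (θ : A →ₐ[k] B) : HRing k G A →ₐ[k] HRing k H B :=
  Ideal.Quotient.liftₐ (coboundaries k G A)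
    (cls.comp (((cochAlgHom α θ).comp (cocycles k G A).val).codRestrict (cocycles k H B)
      fun x => by
        have hx : d (Representation.trivial k G A) x = 0 := x.2
        change d (Representation.trivial k H B) (cochMap α (θ : A →+ B) x) = 0
        rw [d_cochMap, hx, map_zero]))
    (by
      rintro z ⟨y, hy⟩
      refine Ideal.Quotient.eq_zero_iff_mem.2 ⟨cochMap α (θ : A →+ B) y, ?_⟩
      rw [d_cochMap, hy]
      rfl)

variable (k G A) in
/-- The identification of `A` with `H^0(G; A)`, as a map to the cohomology ring. -/
def HRing.const (a : A) : HRing k G A :=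
  cls ⟨of (CochDeg G A) 0 (constDeg G a), d_const a⟩

end Functoriality

end Cohomology

section Curves
open PowerSeries LaurentPolynomial WeierstrassCurve

/-! ## The supersingular curve and its automorphisms -/

/-- The field with four elements. -/
abbrev F4 : Type := GaloisField 2 2

instance : Fintype F4 := Fintype.ofFinite F4

theorem F4_pow_four (x : F4) : x ^ 4 = x := by
  have h : Nat.card F4 = 2 ^ 2 := GaloisField.card 2 2 two_ne_zero
  have h' := FiniteField.pow_card x
  rw [← Nat.card_eq_fintype_card, h] at h'
  exact h'

/-- The supersingular curve `C : y² - y = x³` over `F₄`. -/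
def curveC : WeierstrassCurve F4 := ⟨0, 0, -1, 0, 0⟩
/-- The reduction modulo two of the curve `C_U : y² + 3 u₁ x y + (u₁³ - 1) y = x³` over `W⟦u₁⟧`, whose
formal group is a universal deformation of that of `C`; the variable `X` is `u₁`. -/
def curveU : WeierstrassCurve F4⟦X⟧ := ⟨3 * X, 0, X ^ 3 - 1, 0, 0⟩

/-- The automorphism group of `C`, of order 24: the changes of variables
`γ = (l, r, s, t) : (x, y) ↦ (l² x + r, l³ y + l² s x + t)` that fix the Weierstrass equation. -/
abbrev AutC : Subgroup (VariableChange F4) := MulAction.stabilizer (VariableChange F4) curveC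

theorem two_F4 : (2 : F4) = 0 := CharTwo.two_eq_zero
theorem neg_F4 (x : F4) : -x = x := CharTwo.neg_eq x

theorem AutC_iff (g : VariableChange F4) : g ∈ AutC ↔
    (g.u : F4) ^ 3 = 1 ∧ g.r = g.s ^ 2 ∧ g.s = g.r ^ 2 ∧ g.t ^ 2 + g.t = g.r ^ 3 := by
  have h2 := two_F4
  have hu := g.u.ne_zero
  rw [MulAction.mem_stabilizer_iff, variableChange_def, curveC, WeierstrassCurve.mk.injEq]
  simp only [Units.val_inv_eq_inv_val]
  constructor
  · rintro ⟨-, b, c, e, f⟩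
    have b' := (mul_eq_zero.1 b).resolve_left (by positivity)
    have e' := (mul_eq_zero.1 e).resolve_left (by positivity)
    have f' := (mul_eq_zero.1 f).resolve_left (by positivity)
    field_simp at c
    refine ⟨?_, ?_, ?_, ?_⟩ <;> grind
  · rintro ⟨a, b, c, e⟩
    refine ⟨?_, ?_, ?_, ?_, ?_⟩
    · grind
    · rw [mul_eq_zero]; right; grind
    · field_simp
      grind
    · rw [mul_eq_zero]; right; grind
    · rw [mul_eq_zero]; right; grind

theorem AutC.spec (g : AutC) : (g.1.u : F4) ^ 3 = 1 ∧ g.1.r = g.1.s ^ 2 ∧ g.1.s = g.1.r ^ 2 ∧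
    g.1.t ^ 2 + g.1.t = g.1.r ^ 3 := (AutC_iff g.1).1 g.2

/-- The inverse `l⁻¹ + r u₁` of the unit `t₀(γ)`, for `γ = (l, r, s, t)`. -/
def t0inv (g : AutC) : F4⟦X⟧ := PowerSeries.C ((g.1.u⁻¹ : F4ˣ) : F4) + PowerSeries.C g.1.r * X

theorem isUnit_t0inv (g : AutC) : IsUnit (t0inv g) := by
  rw [PowerSeries.isUnit_iff_constantCoeff]
  simp [t0inv]

/-- The unit `t₀(γ)` of `F₄⟦u₁⟧`. -/
def t0 (g : AutC) : F4⟦X⟧ˣ := (isUnit_t0inv g).unit⁻¹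

theorem t0_inv (g : AutC) : ((t0 g)⁻¹ : F4⟦X⟧ˣ) = t0inv g := by
  rw [t0, inv_inv]
  rfl

theorem t0_mul (g : AutC) : (t0 g : F4⟦X⟧) * t0inv g = 1 := by
  rw [← t0_inv]
  exact (t0 g).mul_inv

theorem hasSubst_t0 (g : AutC) : HasSubst ((t0 g : F4⟦X⟧) * X) :=
  HasSubst.of_constantCoeff_zero' (by simp)

/-- The action of `γ` on `F₄⟦u₁⟧`: substitute `t₀(γ) u₁` for `u₁`. -/
def actS (g : AutC) : F4⟦X⟧ →ₐ[F4] F4⟦X⟧ := PowerSeries.substAlgHom (hasSubst_t0 g)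

theorem actS_apply (g : AutC) (f : F4⟦X⟧) :
    actS g f = PowerSeries.subst ((t0 g : F4⟦X⟧) * X) f := by
  rw [actS, PowerSeries.coe_substAlgHom]

theorem actS_X (g : AutC) : actS g X = (t0 g : F4⟦X⟧) * X := PowerSeries.substAlgHom_X (hasSubst_t0 g)

theorem actS_C (g : AutC) (a : F4) : actS g (PowerSeries.C a) = PowerSeries.C a := by
  exact (actS g).commutes a

theorem t0inv_mul (g h : AutC) : t0inv (g * h) = t0inv g * actS g (t0inv h) := by
  have hh := (AutC.spec h).1
  have hu := h.1.u.ne_zero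
  have e : (h.1.u : F4) ^ 2 = ((h.1.u⁻¹ : F4ˣ) : F4) := by
    rw [Units.val_inv_eq_inv_val]
    field_simp
    exact hh
  have h0 : actS g (t0inv h) = PowerSeries.C ((h.1.u⁻¹ : F4ˣ) : F4) +
      PowerSeries.C h.1.r * ((t0 g : F4⟦X⟧) * X) := by
    rw [t0inv, map_add, map_mul, actS_C, actS_C, actS_X]
  have h1 := t0_mul g
  have eu : (((g * h).1.u⁻¹ : F4ˣ) : F4) = ((g.1.u⁻¹ : F4ˣ) : F4) * ((h.1.u⁻¹ : F4ˣ) : F4) := by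
    change (((g.1.u * h.1.u)⁻¹ : F4ˣ) : F4) = _
    rw [mul_inv, Units.val_mul]
  have er : (g * h).1.r = g.1.r * (h.1.u : F4) ^ 2 + h.1.r := rfl
  rw [h0, t0inv, eu, er, e]
  rw [t0inv] at h1 ⊢
  simp only [map_add, map_mul] at *
  linear_combination (-PowerSeries.C h.1.r * X) * h1

theorem t0_cocycle (g h : AutC) : (t0 (g * h) : F4⟦X⟧) = t0 g * actS g (t0 h) := by
  have h1 := t0_mul (g * h)
  have h2 := t0_mul g
  have h3 := congrArg (actS g) (t0_mul h)
  rw [map_mul, map_one] at h3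
  rw [t0inv_mul] at h1
  linear_combination (t0 g * actS g (t0 h)) * h1 - t0 (g * h) * h2
    - (t0 (g*h) * t0 g * t0inv g) * h3

theorem actS_mul (g h : AutC) : actS (g * h) = (actS g).comp (actS h) := by
  ext1 f
  have h1 := PowerSeries.subst_comp_subst_apply (R := F4) (hasSubst_t0 h) (hasSubst_t0 g) f
  have h2 : PowerSeries.subst ((t0 g : F4⟦X⟧) * X) ((t0 h : F4⟦X⟧) * X) = (t0 (g * h) : F4⟦X⟧) * X := by
    rw [← actS_apply, map_mul, actS_X, t0_cocycle]
    ring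
  rw [h2, ← actS_apply, ← actS_apply, ← actS_apply] at h1
  exact h1.symm

theorem actS_one : actS 1 = AlgHom.id F4 F4⟦X⟧ := by
  ext1 f
  have h : (t0 1 : F4⟦X⟧) * X = X := by
    have h1 := t0_mul 1
    have h2 : t0inv 1 = 1 := by
      change PowerSeries.C ((1⁻¹ : F4ˣ) : F4) + PowerSeries.C 0 * X = 1
      simp
    rw [h2, mul_one] at h1
    rw [h1, one_mul]
  rw [actS_apply, h, PowerSeries.X_subst]
  rfl

/-- `(E_C)_* V(0) = F₄⟦u₁⟧[u^{±1}]`; the variable of the power series is `u₁`, the variable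
`T 1` of the Laurent polynomials is `u`. -/
abbrev EV0 : Type := F4⟦X⟧[T;T⁻¹]

/-- The quotient `F₄[u^{±1}]` of `F₄⟦u₁⟧[u^{±1}]` by `u₁`. -/
abbrev EV0bar : Type := F4[T;T⁻¹]

/-- The variable of the Laurent polynomials as a unit. -/
def unitT (R : Type) [CommRing R] : R[T;T⁻¹]ˣ :=
  ⟨T 1, T (-1), by rw [← T_add]; exact T_zero, by rw [← T_add]; exact T_zero⟩

theorem alg_EV0 (a : F4) : algebraMap F4 EV0 a = LaurentPolynomial.C (PowerSeries.C a) := rfl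

/-- The action `φ_γ` of `γ` on `(E_C)_* V(0) = F₄⟦u₁⟧[u^{±1}]`: it is given by `u₁ ↦ t₀(γ) u₁` and
`u ↦ t₀(γ) u`, where `t₀(γ)⁻¹ = l⁻¹ + r u₁`. This is the action by deformations: by `liftVC_smul`,
`liftVC_map` and `lift_unique`, there is a unique pair of an endomorphism `φ` of `F₄⟦u₁⟧` over `F₄`
and an isomorphism `f : φ^* C_U → C_U` that reduces to `γ : C → C` modulo `u₁`, namely `φ = actS γ` and
`f = liftVC γ`, and the leading coefficient of `f` is `t₀(γ)`. -/
def act (g : AutC) : EV0 →ₐ[F4] EV0 where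
  __ := LaurentPolynomial.eval₂ ((LaurentPolynomial.C : F4⟦X⟧ →+* EV0).comp (actS g : F4⟦X⟧ →+* F4⟦X⟧))
    (Units.map (LaurentPolynomial.C : F4⟦X⟧ →+* EV0).toMonoidHom (t0 g) * unitT F4⟦X⟧)
  commutes' a := by
    change LaurentPolynomial.eval₂ _ _ (LaurentPolynomial.C (PowerSeries.C a)) = LaurentPolynomial.C (PowerSeries.C a)
    rw [LaurentPolynomial.eval₂_C]
    change LaurentPolynomial.C (actS g (PowerSeries.C a)) = _
    rw [actS_C]

theorem act_C (g : AutC) (f : F4⟦X⟧) : act g (LaurentPolynomial.C f) = LaurentPolynomial.C (actS g f) :=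
  LaurentPolynomial.eval₂_C _ _ _

theorem act_u (g : AutC) : act g (T 1) = LaurentPolynomial.C (t0 g : F4⟦X⟧) * T 1 := by
  change LaurentPolynomial.eval₂ _ _ (T 1) = _
  rw [LaurentPolynomial.eval₂_T]
  rw [zpow_one]
  rfl

theorem hom_ext {S : Type} [CommRing S] {R : Type} [CommRing R] (f g : R[T;T⁻¹] →+* S)
    (hC : ∀ a, f (LaurentPolynomial.C a) = g (LaurentPolynomial.C a)) (hT : f (T 1) = g (T 1)) : f = g := by
  have hT' : f (T (-1)) = g (T (-1)) := by
    have e : (T 1 * T (-1) : R[T;T⁻¹]) = 1 := by rw [← T_add]; exact T_zero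
    have hf := congrArg f e
    have hg := congrArg g e
    rw [map_mul, map_one] at hf hg
    rw [← hT] at hg
    linear_combination g (T (-1)) * hf - f (T (-1)) * hg
  refine RingHom.ext fun p => ?_
  induction p using LaurentPolynomial.induction_on with
  | h_C a => exact hC a
  | h_add hp hq => rw [map_add, map_add, hp, hq]
  | h_C_mul_T n _ h =>
    have e : (T (n + 1 : ℤ) : R[T;T⁻¹]) = T n * T 1 := T_add _ _
    rw [e, ← mul_assoc, map_mul f (_ * _), map_mul g (_ * _), h, hT]
  | h_C_mul_T_Z n _ h =>
    have e : (T (-n - 1 : ℤ) : R[T;T⁻¹]) = T (-n) * T (-1) := by rw [← T_add]; rfl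
    rw [e, ← mul_assoc, map_mul f (_ * _), map_mul g (_ * _), h, hT']

theorem act_mul (g h : AutC) : act (g * h) = (act g).comp (act h) := by
  refine AlgHom.coe_ringHom_injective (hom_ext _ _ (fun a => ?_) ?_)
  · change act (g * h) _ = act g (act h _)
    rw [act_C, act_C, act_C, actS_mul]
    rfl
  · change act (g * h) _ = act g (act h _)
    rw [act_u, act_u, map_mul, act_C, act_u, t0_cocycle, map_mul]
    ring

theorem t0_one : (t0 1 : F4⟦X⟧) = 1 := by
  have h1 := t0_mul 1
  have h2 : t0inv 1 = 1 := by
    change PowerSeries.C ((1⁻¹ : F4ˣ) : F4) + PowerSeries.C 0 * X = 1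
    simp
  rwa [h2, mul_one] at h1

theorem act_one : act 1 = AlgHom.id F4 EV0 := by
  refine AlgHom.coe_ringHom_injective (hom_ext _ _ (fun a => ?_) ?_)
  · change act 1 _ = _
    rw [act_C, actS_one]
    rfl
  · change act 1 _ = T 1
    rw [act_u, t0_one, map_one, one_mul]

/-- `Aut(C)` acts on `F₄⟦u₁⟧[u^{±1}]` by `F₄`-algebra homomorphisms. -/
def rho : Representation F4 AutC EV0 where
  toFun g := (act g).toLinearMap
  map_one' := by rw [act_one]; rfl
  map_mul' g h := by rw [act_mul]; rfl

/-- The action of `γ` on `F₄[u^{±1}]`: `u ↦ l u`. -/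
def actBar (g : AutC) : EV0bar →ₐ[F4] EV0bar where
  __ := LaurentPolynomial.eval₂ (LaurentPolynomial.C : F4 →+* EV0bar)
    (Units.map (LaurentPolynomial.C : F4 →+* EV0bar).toMonoidHom g.1.u * unitT F4)
  commutes' a := LaurentPolynomial.eval₂_C _ _ _

/-- Reduction modulo `u₁`. -/
def red : EV0 →ₐ[F4] EV0bar where
  __ := LaurentPolynomial.eval₂ ((LaurentPolynomial.C : F4 →+* EV0bar).comp (PowerSeries.constantCoeff (R := F4))) (unitT F4)
  commutes' a := by
    change LaurentPolynomial.eval₂ _ _ (LaurentPolynomial.C (PowerSeries.C a)) = LaurentPolynomial.C a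
    rw [LaurentPolynomial.eval₂_C]
    rfl

theorem red_C (f : F4⟦X⟧) : red (LaurentPolynomial.C f) = LaurentPolynomial.C (PowerSeries.constantCoeff f) :=
  LaurentPolynomial.eval₂_C _ _ _
theorem red_u : red (T 1) = T 1 := by
  change LaurentPolynomial.eval₂ _ _ (T 1) = _
  rw [LaurentPolynomial.eval₂_T, zpow_one]
  rfl

theorem cc_t0 (g : AutC) : PowerSeries.constantCoeff (t0 g : F4⟦X⟧) = g.1.u := by
  have h := congrArg (PowerSeries.constantCoeff (R := F4)) (t0_mul g)
  have hu := g.1.u.ne_zero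
  rw [t0inv] at h
  simp at h
  field_simp at h
  exact h

theorem red_act (g : AutC) (m : EV0) : red (act g m) = actBar g (red m) := by
  have : (red : EV0 →+* EV0bar).comp (act g : EV0 →+* EV0) = (actBar g : EV0bar →+* EV0bar).comp red := by
    refine hom_ext _ _ (fun a => ?_) ?_
    · change red (act g _) = actBar g (red _)
      rw [act_C, red_C, red_C]
      have h1 : PowerSeries.constantCoeff (actS g a) = PowerSeries.constantCoeff a := by
        obtain ⟨b, hb⟩ : (X : F4⟦X⟧) ∣ a - PowerSeries.C (PowerSeries.constantCoeff a) := by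
          rw [PowerSeries.X_dvd_iff]; simp
        have := congrArg (fun z => PowerSeries.constantCoeff (actS g z)) hb
        simp only [map_sub, map_mul, actS_X, actS_C] at this
        simpa [sub_eq_zero] using this
      rw [h1]
      exact (LaurentPolynomial.eval₂_C _ _ _).symm
    · change red (act g _) = actBar g (red _)
      rw [act_u, red_u, map_mul, red_C, red_u, cc_t0]
      change _ = LaurentPolynomial.eval₂ _ _ (T 1)
      rw [LaurentPolynomial.eval₂_T, zpow_one]
      rfl
  exact congrArg (fun f => f m) this

/-- The invariant element `v₁ = u₁ u⁻¹`. -/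
def v1 : EV0 := LaurentPolynomial.C X * T (-1)

theorem act_v1 (g : AutC) : act g v1 = v1 := by
  have h : v1 * T 1 = LaurentPolynomial.C X := by rw [v1, mul_assoc, ← T_add]; simp
  have h2 := congrArg (act g) h
  rw [map_mul, act_u, act_C, actS_X, map_mul, ← h] at h2
  have h3 := congrArg (LaurentPolynomial.C : F4⟦X⟧ →+* EV0) (t0_mul g)
  rw [map_mul, map_one] at h3
  have h4 : (T 1 * T (-1) : EV0) = 1 := by rw [← T_add]; exact T_zero
  linear_combination (LaurentPolynomial.C (t0inv g) * T (-1)) * h2 + (v1 - act g v1) * h4 + (v1 - act g v1) * T 1 * T (-1) * h3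

theorem two_S : (2 : F4⟦X⟧) = 0 := by
  have h := congrArg (PowerSeries.C (R := F4)) two_F4
  rwa [map_ofNat, map_zero] at h

instance : CharP F4⟦X⟧ 2 := charP_of_injective_algebraMap (algebraMap F4 F4⟦X⟧).injective 2

theorem cc_actS (g : AutC) (a : F4⟦X⟧) :
    PowerSeries.constantCoeff (actS g a) = PowerSeries.constantCoeff a := by
  obtain ⟨b, hb⟩ : (X : F4⟦X⟧) ∣ a - PowerSeries.C (PowerSeries.constantCoeff a) := by
    rw [PowerSeries.X_dvd_iff]; simp
  have := congrArg (fun z => PowerSeries.constantCoeff (actS g z)) hb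
  simp only [map_sub, map_mul, actS_X, actS_C] at this
  simpa [sub_eq_zero] using this

/-- The coefficient `s` of the isomorphism `liftVC γ`. -/
def liftS (g : AutC) : F4⟦X⟧ :=
  PowerSeries.C g.1.s + PowerSeries.C (g.1.t + g.1.r ^ 3) * actS g X

/-- The isomorphism `(actS γ)^* C_U → C_U` that lifts `γ`. -/
def liftVC (g : AutC) : VariableChange F4⟦X⟧ where
  u := t0 g
  r := liftS g * actS g X + liftS g ^ 2
  s := liftS g
  t := PowerSeries.C (g.1.t + g.1.r ^ 3) * (actS g X ^ 3 + 1) + liftS g ^ 3 + liftS g * actS g X ^ 2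

theorem liftVC_map (g : AutC) : (liftVC g).map (PowerSeries.constantCoeff (R := F4)) = g.1 := by
  obtain ⟨h1, h2, h3, h4⟩ := AutC.spec g
  have two := two_F4
  have h5 := F4_pow_four g.1.r
  ext
  · exact cc_t0 g
  · simp [VariableChange.map, liftVC, liftS, cc_actS]
    exact h2.symm
  · simp [VariableChange.map, liftVC, liftS, cc_actS]
  · simp [VariableChange.map, liftVC, liftS, cc_actS]
    grind

theorem ring_iff {R : Type} [CommRing R] [CharP R 2] (l v x r s t : R) :
    (v + 2 * s = l * x ∧ (0 - s * v + 3 * r - s ^ 2) = 0 ∧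
      v ^ 3 - 1 + r * v + 2 * t = l ^ 3 * (x ^ 3 - 1) ∧
      (0 - s * (v ^ 3 - 1) + 2 * r * 0 - (t + r * s) * v + 3 * r ^ 2 - 2 * s * t) = 0 ∧
      (0 + r * 0 + r ^ 2 * 0 + r ^ 3 - t * (v ^ 3 - 1) - t ^ 2 - r * t * v) = 0) ↔
    (v = l * x ∧ r = s * v + s ^ 2 ∧ l ^ 3 * (x ^ 3 + 1) = v ^ 3 + 1 + r * v ∧
      s * (v ^ 3 + 1) + (t + r * s) * v + r ^ 2 = 0 ∧
      r ^ 3 + t * (v ^ 3 + 1) + t ^ 2 + r * t * v = 0) := by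
  have two : (2 : R) = 0 := CharTwo.two_eq_zero
  refine and_congr ?_ (and_congr ?_ (and_congr ?_ (and_congr ?_ ?_)))
  · rw [two, zero_mul, add_zero]
  · constructor <;> intro h
    · linear_combination -h + two * (2 * r - s * v - s ^ 2)
    · linear_combination -h + two * (2 * r - s * v - s ^ 2)
  · constructor <;> intro h
    · linear_combination -h + two * (-1 + l ^ 3 + t) * 1
    · linear_combination -h + two * (-1 + l ^ 3 + t) * 1
  · constructor <;> intro h
    · linear_combination h + two * (s * v * r + s * v ^ 3 + s * t + v * t - r ^ 2)
    · linear_combination h - two * (s * v * r + s * v ^ 3 + s * t + v * t - r ^ 2)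
  · constructor <;> intro h
    · linear_combination h + two * (r * t * v + t * v ^ 3 + t ^ 2)
    · linear_combination h - two * (r * t * v + t * v ^ 3 + t ^ 2)

theorem smul_eq_curveU_iff (σ : F4⟦X⟧ →ₐ[F4] F4⟦X⟧) (f : VariableChange F4⟦X⟧) :
    f • curveU.map (σ : F4⟦X⟧ →+* F4⟦X⟧) = curveU ↔
      σ X = (f.u : F4⟦X⟧) * X ∧ f.r = f.s * σ X + f.s ^ 2 ∧
      (f.u : F4⟦X⟧) ^ 3 * (X ^ 3 + 1) = σ X ^ 3 + 1 + f.r * σ X ∧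
      f.s * (σ X ^ 3 + 1) + (f.t + f.r * f.s) * σ X + f.r ^ 2 = 0 ∧
      f.r ^ 3 + f.t * (σ X ^ 3 + 1) + f.t ^ 2 + f.r * f.t * σ X = 0 := by
  have two := two_S
  have hli : ∀ (n : ℕ) (x : F4⟦X⟧), ((f.u⁻¹ : F4⟦X⟧ˣ) : F4⟦X⟧) ^ n * x = 0 ↔ x = 0 := fun n x => by
    rw [← Units.val_pow_eq_pow_val, Units.mul_right_eq_zero]
  have e3 : (3 : F4⟦X⟧) = 1 := by linear_combination two
  have ea : ∀ x y : F4⟦X⟧, ((f.u⁻¹ : F4⟦X⟧ˣ) : F4⟦X⟧) * x = y ↔ x = f.u * y := fun x y => by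
    rw [Units.inv_mul_eq_iff_eq_mul]
  have ea3 : ∀ x y : F4⟦X⟧, ((f.u⁻¹ : F4⟦X⟧ˣ) : F4⟦X⟧) ^ 3 * x = y ↔ x = (f.u : F4⟦X⟧) ^ 3 * y :=
    fun x y => by
      rw [← Units.val_pow_eq_pow_val, inv_pow, Units.inv_mul_eq_iff_eq_mul, Units.val_pow_eq_pow_val]
  rw [← ring_iff, variableChange_def, curveU, WeierstrassCurve.mk.injEq]
  simp only [WeierstrassCurve.map, map_mul, map_sub, map_pow, map_zero, map_one, RingHom.coe_coe,
    map_ofNat, hli, ea, ea3]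
  rw [e3, one_mul, one_mul]

theorem ring_lift {R : Type} [CommRing R] [CharP R 2] {v x l l0 l1 r0 s0 s1 s : R}
    (hv : v = l * x) (ht : l * (l1 + r0 * x) = 1) (hl : l0 * l1 = 1) (h1 : l0 ^ 3 = 1)
    (hr : r0 = s0 ^ 2) (p4 : s0 ^ 4 = s0) (q4 : s1 ^ 2 = s1 + s0 ^ 3) (hS : s = s0 + s1 * v) :
    l ^ 3 * (x ^ 3 + 1) = v ^ 3 + 1 + (s * v + s ^ 2) * v ∧
      s * (v ^ 3 + 1) + (s1 * (v ^ 3 + 1) + s ^ 3 + s * v ^ 2 + (s * v + s ^ 2) * s) * v +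
        (s * v + s ^ 2) ^ 2 = 0 ∧
      (s * v + s ^ 2) ^ 3 + (s1 * (v ^ 3 + 1) + s ^ 3 + s * v ^ 2) * (v ^ 3 + 1) +
        (s1 * (v ^ 3 + 1) + s ^ 3 + s * v ^ 2) ^ 2 +
        (s * v + s ^ 2) * (s1 * (v ^ 3 + 1) + s ^ 3 + s * v ^ 2) * v = 0 := by
  have k1 : l = l0 * (1 + r0 * v) := by
    subst hv
    have : l = l0 * (l * (l1 + r0 * x)) + l0 * r0 * (l * x) := by clear ht h1 hr p4 q4 hS; grind
    linear_combination this + l0 * ht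
  have k2 : l ^ 3 = (1 + r0 * v) ^ 3 := by rw [k1, mul_pow, h1, one_mul]
  have k3 : (1 + r0 * v) ^ 3 = 1 + (s * v + s ^ 2) * v := by
    subst hS hr; clear k1 k2 ht hl h1 hv; grind
  refine ⟨?_, ?_, ?_⟩
  · have : l ^ 3 * x ^ 3 = v ^ 3 := by rw [hv]; ring
    linear_combination this + k2 + k3
  · clear k1 k2 k3 ht hl h1 hv hr; grind
  · clear k1 k2 k3 ht hl h1 hv hr; grind

theorem liftVC_smul (g : AutC) :
    liftVC g • curveU.map (actS g : F4⟦X⟧ →+* F4⟦X⟧) = curveU := by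
  rw [smul_eq_curveU_iff]
  obtain ⟨h1, h2, h3, h4⟩ := AutC.spec g
  have two' := two_F4
  have ht := t0_mul g
  rw [t0inv] at ht
  have p4 := congrArg (PowerSeries.C (R := F4)) (F4_pow_four g.1.s)
  have q4 : (g.1.t + g.1.r ^ 3) ^ 2 = (g.1.t + g.1.r ^ 3) + g.1.s ^ 3 := by
    have := F4_pow_four g.1.s
    grind
  have q4' : PowerSeries.C (g.1.t + g.1.r ^ 3) ^ 2 =
      PowerSeries.C (g.1.t + g.1.r ^ 3) + PowerSeries.C g.1.s ^ 3 := by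
    rw [← map_pow, ← map_pow, ← map_add, q4]
  have h2' := congrArg (PowerSeries.C (R := F4)) h2
  have hl : PowerSeries.C (g.1.u : F4) * PowerSeries.C ((g.1.u⁻¹ : F4ˣ) : F4) = 1 := by
    rw [← map_mul, ← Units.val_mul, mul_inv_cancel, Units.val_one, map_one]
  have h1' := congrArg (PowerSeries.C (R := F4)) h1
  rw [map_pow] at p4
  rw [map_pow] at h2'
  rw [map_pow, map_one] at h1'
  exact ⟨actS_X g, rfl, ring_lift (actS_X g) ht hl h1' h2' p4 q4' rfl⟩

theorem algHom_eq_id (τ : F4⟦X⟧ →ₐ[F4] F4⟦X⟧) (h : τ X = X) : τ = AlgHom.id F4 F4⟦X⟧ := by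
  ext f n
  have hd : (X : F4⟦X⟧) ^ (n + 1) ∣ f - (PowerSeries.trunc (n + 1) f : F4⟦X⟧) := by
    rw [PowerSeries.X_pow_dvd_iff]
    intro m hm
    simp [PowerSeries.coeff_trunc, hm]
  obtain ⟨b, hb⟩ := hd
  have hp : ∀ p : Polynomial F4, τ (p : F4⟦X⟧) = p := by
    intro p
    have : (τ.comp (Polynomial.coeToPowerSeries.algHom F4)) = Polynomial.coeToPowerSeries.algHom F4 := by
      ext1
      simp [h]
    have := congrArg (fun φ => φ p) this
    simpa using this
  have e : τ f = f + X ^ (n + 1) * (τ b - b) := by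
    have := congrArg τ hb
    rw [map_sub, hp, map_mul, map_pow, h] at this
    linear_combination this - hb
  change PowerSeries.coeff n (τ f) = PowerSeries.coeff n f
  rw [e, map_add, PowerSeries.coeff_X_pow_mul']
  simp

theorem ring_unique {R : Type} [CommRing R] [CharP R 2] {r s t v : R}
    (b : r = s * v + s ^ 2) (e : s * (v ^ 3 + 1) + (t + r * s) * v + r ^ 2 = 0)
    (g : r ^ 3 + t * (v ^ 3 + 1) + t ^ 2 + r * t * v = 0) :
    s * ((1 + v ^ 3 + s ^ 2 * v + s ^ 3) * (1 + v ^ 3 + t + r * v) - s ^ 2 * (v + s) ^ 3 * v) = 0 := by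
  subst b
  grind

theorem ring_cube {R : Type} [CommRing R] [CharP R 2] {v x l : R}
    (a : v = l * x) (c : l ^ 3 * (x ^ 3 + 1) = v ^ 3 + 1 + 0 * v) : (l - 1) * (l ^ 2 + l + 1) = 0 := by
  subst a
  grind

theorem lift_unique_one (σ : F4⟦X⟧ →ₐ[F4] F4⟦X⟧) (f : VariableChange F4⟦X⟧)
    (hf : f • curveU.map (σ : F4⟦X⟧ →+* F4⟦X⟧) = curveU)
    (h1 : f.map (PowerSeries.constantCoeff (R := F4)) = 1) :
    σ = AlgHom.id F4 F4⟦X⟧ ∧ f = 1 := by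
  rw [smul_eq_curveU_iff] at hf
  obtain ⟨a, b, c, e, g⟩ := hf
  have two := two_S
  have cu : PowerSeries.constantCoeff (f.u : F4⟦X⟧) = 1 := congrArg (fun z => (z.u : F4)) h1
  have cr : PowerSeries.constantCoeff f.r = 0 := congrArg VariableChange.r h1
  have cs : PowerSeries.constantCoeff f.s = 0 := congrArg VariableChange.s h1
  have ct : PowerSeries.constantCoeff f.t = 0 := congrArg VariableChange.t h1
  have cv : PowerSeries.constantCoeff (σ X) = 0 := by rw [a]; simp
  have key : ∀ x y : F4⟦X⟧, PowerSeries.constantCoeff y = 1 → x * y = 0 → x = 0 := by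
    intro x y hy h
    refine (mul_eq_zero.1 h).resolve_right ?_
    rintro rfl
    simp at hy
  have s0 : f.s = 0 := by
    refine key _ ((1 + σ X ^ 3 + f.s ^ 2 * σ X + f.s ^ 3) * (1 + σ X ^ 3 + f.t + f.r * σ X) -
      f.s ^ 2 * (σ X + f.s) ^ 3 * σ X) (by simp [cv, cs, cr, ct]) ?_
    exact ring_unique b e g
  have r0 : f.r = 0 := by rw [b, s0]; ring
  have t00 : f.t = 0 := by
    refine key _ (1 + σ X ^ 3 + f.t) (by simp [cv, ct]) ?_
    rw [r0] at g
    linear_combination g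
  have u0 : (f.u : F4⟦X⟧) = 1 := by
    rw [← sub_eq_zero]
    refine key _ ((f.u : F4⟦X⟧) ^ 2 + f.u + 1) ?_ ?_
    · have := two_F4
      simp only [map_add, map_pow, cu, map_one]
      linear_combination this
    · rw [r0] at c
      exact ring_cube a c
  refine ⟨algHom_eq_id σ (by rw [a, u0, one_mul]), ?_⟩
  ext
  · rw [u0]; rfl
  · rw [r0]; rfl
  · rw [s0]; rfl
  · rw [t00]; rfl

theorem lift_unique (g : AutC) (σ : F4⟦X⟧ →ₐ[F4] F4⟦X⟧) (f : VariableChange F4⟦X⟧)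
    (hf : f • curveU.map (σ : F4⟦X⟧ →+* F4⟦X⟧) = curveU)
    (h1 : f.map (PowerSeries.constantCoeff (R := F4)) = g.1) : σ = actS g ∧ f = liftVC g := by
  have i1 : (actS g).comp (actS g⁻¹) = AlgHom.id F4 F4⟦X⟧ := by
    rw [← actS_mul, mul_inv_cancel, actS_one]
  have i2 : (actS g⁻¹).comp (actS g) = AlgHom.id F4 F4⟦X⟧ := by
    rw [← actS_mul, inv_mul_cancel, actS_one]
  have hfg : ((liftVC g)⁻¹ * f) • curveU.map (σ : F4⟦X⟧ →+* F4⟦X⟧) =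
      curveU.map (actS g : F4⟦X⟧ →+* F4⟦X⟧) := by
    rw [mul_smul, hf, inv_smul_eq_iff, liftVC_smul]
  have h := lift_unique_one ((actS g⁻¹).comp σ)
    (((liftVC g)⁻¹ * f).map (actS g⁻¹ : F4⟦X⟧ →+* F4⟦X⟧)) (by
      have := congrArg (fun W => W.map (actS g⁻¹ : F4⟦X⟧ →+* F4⟦X⟧)) hfg
      simp only [← map_variableChange] at this
      have e : (curveU.map (actS g : F4⟦X⟧ →+* F4⟦X⟧)).map (actS g⁻¹ : F4⟦X⟧ →+* F4⟦X⟧) =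
          curveU.map ((actS g⁻¹).comp (actS g) : F4⟦X⟧ →+* F4⟦X⟧) := rfl
      rw [e, i2] at this
      exact this) (by
      have e : (PowerSeries.constantCoeff (R := F4)).comp (actS g⁻¹ : F4⟦X⟧ →+* F4⟦X⟧) =
          PowerSeries.constantCoeff := RingHom.ext (cc_actS g⁻¹)
      rw [VariableChange.map_map, e]
      have := (VariableChange.mapHom (PowerSeries.constantCoeff (R := F4))).map_mul (liftVC g)⁻¹ f
      rw [map_inv] at this
      change _ = (VariableChange.map _ _)⁻¹ * VariableChange.map _ _ at this
      rw [liftVC_map, h1, inv_mul_cancel] at this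
      exact this)
  constructor
  · calc σ = ((actS g).comp (actS g⁻¹)).comp σ := by rw [i1]; rfl
      _ = (actS g).comp ((actS g⁻¹).comp σ) := rfl
      _ = actS g := by rw [h.1]; rfl
  · have := congrArg (fun z => z.map (actS g : F4⟦X⟧ →+* F4⟦X⟧)) h.2
    simp only [VariableChange.map_map] at this
    have e : ((actS g : F4⟦X⟧ →+* F4⟦X⟧).comp (actS g⁻¹ : F4⟦X⟧ →+* F4⟦X⟧)) = RingHom.id _ :=
      congrArg (fun z : F4⟦X⟧ →ₐ[F4] F4⟦X⟧ => (z : F4⟦X⟧ →+* F4⟦X⟧)) i1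
    rw [e, VariableChange.map_id] at this
    have e1 := (VariableChange.mapHom (actS g : F4⟦X⟧ →+* F4⟦X⟧)).map_one
    exact (inv_mul_eq_one.1 (this.trans e1)).symm

end Curves

/-! ## The groups `Q₈` and `V` -/

section Groups
open WeierstrassCurve

theorem AutC.mul_u (g h : AutC) : (g * h).1.u = g.1.u * h.1.u := rfl

theorem AutC.mul_r (g h : AutC) : (g * h).1.r = g.1.r * (h.1.u : F4) ^ 2 + h.1.r := rfl

theorem AutC.mul_s (g h : AutC) : (g * h).1.s = (h.1.u : F4) * g.1.s + h.1.s := rfl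

theorem AutC.mul_t (g h : AutC) :
    (g * h).1.t = g.1.t * (h.1.u : F4) ^ 3 + g.1.r * h.1.s * (h.1.u : F4) ^ 2 + h.1.t := rfl

theorem AutC.ext' {g h : AutC} (hu : g.1.u = h.1.u) (hr : g.1.r = h.1.r) (ht : g.1.t = h.1.t) :
    g = h := by
  obtain ⟨-, -, h3, -⟩ := AutC.spec g
  obtain ⟨-, -, h3', -⟩ := AutC.spec h
  refine Subtype.ext (VariableChange.ext hu hr ?_ ht)
  rw [h3, h3', hr]

/-- The homomorphism `(l, r, s, t) ↦ l` on `Aut(C)`. -/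
def leading : AutC →* F4ˣ where
  toFun g := g.1.u
  map_one' := rfl
  map_mul' _ _ := rfl

/-- The quaternion subgroup `Q₈` of `Aut(C)`: the strict automorphisms of `C`, with `l = 1`. It is
the subgroup generated by `i` and `j = ω i ω⁻¹`, see `Q8_eq_closure`. -/
def Q8 : Subgroup AutC := leading.ker

instance : Q8.Normal := inferInstanceAs leading.ker.Normal

theorem mem_Q8 (g : AutC) : g ∈ Q8 ↔ g.1.u = 1 := MonoidHom.mem_ker

theorem pow_three (ζ : F4ˣ) : (ζ : F4) ^ 3 = 1 := by
  have h := F4_pow_four (ζ : F4)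
  have h0 := ζ.ne_zero
  refine mul_left_cancel₀ h0 ?_
  rw [mul_one]
  linear_combination h

/-- The automorphism `ω = (ζ, 0, 0, 0)` of `C`, acting by `ω(x) = ζ x` on the formal group. -/
def omega (ζ : F4ˣ) : AutC :=
  ⟨⟨ζ, 0, 0, 0⟩, (AutC_iff _).2 ⟨pow_three ζ, by simp, by simp, by simp⟩⟩

/-- The central automorphism `-1 = (1, 0, 0, 1)` of `C`. -/
def negOne : Q8 :=
  ⟨⟨⟨1, 0, 0, 1⟩, (AutC_iff _).2 ⟨by simp, by simp, by simp, by
    have := two_F4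
    linear_combination this⟩⟩, rfl⟩

theorem negOne_comm (g : AutC) : (negOne : AutC) * g = g * negOne := by
  obtain ⟨h1, -, -, -⟩ := AutC.spec g
  refine AutC.ext' ?_ ?_ ?_
  · change (1 : F4ˣ) * g.1.u = g.1.u * 1
    rw [one_mul, mul_one]
  · change (0 : F4) * _ + g.1.r = g.1.r * ((1 : F4ˣ) : F4) ^ 2 + 0
    simp
  · change (1 : F4) * (g.1.u : F4) ^ 3 + 0 * g.1.s * (g.1.u : F4) ^ 2 + g.1.t =
      g.1.t * ((1 : F4ˣ) : F4) ^ 3 + g.1.r * 0 * ((1 : F4ˣ) : F4) ^ 2 + 1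
    rw [h1]
    simp [add_comm]

/-- The central subgroup `C₂ = {±1}` of `Q₈`. -/
def C2 : Subgroup Q8 := Subgroup.zpowers negOne

instance : C2.Normal := by
  refine ⟨fun n hn g => ?_⟩
  obtain ⟨k, rfl⟩ := hn
  have h : Commute g negOne := (Subtype.ext (negOne_comm g)).symm
  have h' : g * negOne ^ k * g⁻¹ = negOne ^ k := by
    rw [(h.zpow_right k).eq, mul_inv_cancel_right]
  change g * negOne ^ k * g⁻¹ ∈ C2
  rw [h']
  exact ⟨k, rfl⟩

/-- The quotient `V = Q₈ / C₂`. -/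
abbrev V : Type := Q8 ⧸ C2

/-- The element `i = (1, 1, 1, ζ)` of `Q₈`. -/
def elemI (ζ : F4ˣ) (hζ : IsPrimitiveRoot ζ 3) : AutC :=
  ⟨⟨1, 1, 1, ζ⟩, (AutC_iff _).2 ⟨by simp, by simp, by simp, by
    have h1 : (ζ : F4) ≠ 1 := fun h => hζ.ne_one (by norm_num) (Units.ext h)
    have h3 := pow_three ζ
    have h2 := two_F4
    have h : ((ζ : F4) - 1) * ((ζ : F4) ^ 2 + ζ + 1) = 0 := by linear_combination h3
    have h' := (mul_eq_zero.1 h).resolve_left (sub_ne_zero.2 h1)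
    change (ζ : F4) ^ 2 + ζ = 1 ^ 3
    linear_combination h' - h2⟩⟩

theorem Q8_eq_closure (ζ : F4ˣ) (hζ : IsPrimitiveRoot ζ 3) :
    Q8 = Subgroup.closure {elemI ζ hζ, omega ζ * elemI ζ hζ * (omega ζ)⁻¹} := by
  have two := two_F4
  have h1 : (ζ : F4) ≠ 1 := fun h => hζ.ne_one (by norm_num) (Units.ext h)
  have h3 := pow_three ζ
  have hz : (ζ : F4) ^ 2 + ζ + 1 = 0 := by
    have h : ((ζ : F4) - 1) * ((ζ : F4) ^ 2 + ζ + 1) = 0 := by linear_combination h3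
    exact (mul_eq_zero.1 h).resolve_left (sub_ne_zero.2 h1)
  have hj : (omega ζ * elemI ζ hζ * (omega ζ)⁻¹).1.r = ζ := by
    have e : omega ζ * elemI ζ hζ * (omega ζ)⁻¹ * omega ζ = omega ζ * elemI ζ hζ :=
      inv_mul_cancel_right _ _
    have e' := congrArg (fun g : AutC => g.1.r) e
    simp only [AutC.mul_r (_ * _ * _)] at e'
    have e1 : (omega ζ * elemI ζ hζ).1.r = (0 : F4) * ((1 : F4ˣ) : F4) ^ 2 + 1 := rfl
    have e2 : (omega ζ).1.r = 0 := rfl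
    have e3 : (omega ζ).1.u = ζ := rfl
    rw [e1, e2, e3] at e'
    simp only [zero_mul, zero_add, add_zero] at e'
    generalize (omega ζ * elemI ζ hζ * (omega ζ)⁻¹).1.r = a at *
    linear_combination (ζ : F4) * e' - a * h3
  have hui : (elemI ζ hζ).1.u = 1 := rfl
  have hri : (elemI ζ hζ).1.r = 1 := rfl
  have hi : elemI ζ hζ ∈ Q8 := (mem_Q8 _).2 rfl
  have hjQ : omega ζ * elemI ζ hζ * (omega ζ)⁻¹ ∈ Q8 :=
    Subgroup.Normal.conj_mem inferInstance _ hi _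
  generalize omega ζ * elemI ζ hζ * (omega ζ)⁻¹ = j at *
  refine le_antisymm (fun g hg => ?_) ?_
  · have mi : elemI ζ hζ ∈ Subgroup.closure {elemI ζ hζ, j} :=
      Subgroup.subset_closure (Set.mem_insert _ _)
    have mj : j ∈ Subgroup.closure {elemI ζ hζ, j} :=
      Subgroup.subset_closure (Set.mem_insert_of_mem _ rfl)
    have hju := (mem_Q8 _).1 hjQ
    have hle : Subgroup.closure {elemI ζ hζ, j} ≤ Q8 := by
      rw [Subgroup.closure_le]
      rintro _ (rfl | rfl)
      exacts [hi, hjQ]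
    have key : ∀ h ∈ Subgroup.closure {elemI ζ hζ, j}, g.1.r = h.1.r →
        g ∈ Subgroup.closure {elemI ζ hζ, j} := by
      intro h hh hr
      have hq : g * h⁻¹ ∈ Q8 := Q8.mul_mem hg (Q8.inv_mem (hle hh))
      have hr0 : (g * h⁻¹).1.r = 0 := by
        have e' := congrArg (fun g : AutC => g.1.r) (inv_mul_cancel_right g h)
        simp only [AutC.mul_r (_ * _)] at e'
        rw [(mem_Q8 _).1 (hle hh)] at e'
        simpa [hr] using e'
      obtain ⟨-, -, -, ht⟩ := AutC.spec (g * h⁻¹)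
      rw [hr0] at ht
      have ht' : (g * h⁻¹).1.t * ((g * h⁻¹).1.t + 1) = 0 := by linear_combination ht
      have hm : g * h⁻¹ ∈ Subgroup.closure {elemI ζ hζ, j} := by
        rcases mul_eq_zero.1 ht' with h0 | h0
        · have : g * h⁻¹ = 1 := AutC.ext' ((mem_Q8 _).1 hq) hr0 h0
          rw [this]
          exact Subgroup.one_mem _
        · have : g * h⁻¹ = elemI ζ hζ * elemI ζ hζ := by
            refine AutC.ext' ?_ ?_ ?_
            · rw [(mem_Q8 _).1 hq]
              change (1 : F4ˣ) = 1 * 1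
              rw [one_mul]
            · rw [hr0]
              change (0 : F4) = 1 * ((1 : F4ˣ) : F4) ^ 2 + 1
              rw [Units.val_one]
              linear_combination -two
            · change _ = (ζ : F4) * ((1 : F4ˣ) : F4) ^ 3 + 1 * 1 * ((1 : F4ˣ) : F4) ^ 2 + ζ
              rw [Units.val_one]
              linear_combination h0 - two - ζ * two
          rw [this]
          exact Subgroup.mul_mem _ mi mi
      have := Subgroup.mul_mem _ hm hh
      rwa [inv_mul_cancel_right] at this
    have hg4 := F4_pow_four g.1.r
    have hp : g.1.r * ((g.1.r - 1) * ((g.1.r - ζ) * (g.1.r - ζ ^ 2))) = 0 := by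
      have : (g.1.r - ζ) * (g.1.r - ζ ^ 2) = g.1.r ^ 2 + g.1.r + 1 := by
        linear_combination h3 - g.1.r * hz
      rw [this]
      linear_combination hg4
    rcases mul_eq_zero.1 hp with h | h
    · exact key 1 (Subgroup.one_mem _) h
    rcases mul_eq_zero.1 h with h | h
    · exact key _ mi (sub_eq_zero.1 h)
    rcases mul_eq_zero.1 h with h | h
    · exact key _ mj ((sub_eq_zero.1 h).trans hj.symm)
    · refine key _ (Subgroup.mul_mem _ mi mj) ((sub_eq_zero.1 h).trans ?_)
      rw [AutC.mul_r, hju, hri, hj, Units.val_one]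
      linear_combination hz - two - ζ * two
  · rw [Subgroup.closure_le]
    rintro _ (rfl | rfl)
    exacts [hi, hjQ]

/-- Conjugation `x ↦ g⁻¹ x g` on `Q₈`. -/
def conjQ8 (g : AutC) : Q8 →* Q8 := (MulAut.conjNormal g⁻¹ : MulAut Q8).toMonoidHom

theorem coe_conjQ8 (g : AutC) (x : Q8) : (conjQ8 g x : AutC) = g⁻¹ * x * g := by
  change ((MulAut.conjNormal g⁻¹ : MulAut Q8) x : AutC) = _
  rw [MulAut.conjNormal_apply, inv_inv]

/-- The map induced on `V` by conjugation `x ↦ g⁻¹ x g`. -/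
def conjV (g : AutC) : V →* V :=
  QuotientGroup.map C2 C2 (conjQ8 g) (by
    rw [C2, Subgroup.zpowers_le, Subgroup.mem_comap]
    have h : conjQ8 g negOne = negOne := by
      refine Subtype.ext ?_
      rw [coe_conjQ8, mul_assoc, negOne_comm, inv_mul_cancel_left]
    rw [h]
    exact Subgroup.mem_zpowers negOne)

/-- The action of `Q₈` on `F₄⟦u₁⟧[u^{±1}]`. -/
def rhoQ8 : Representation F4 Q8 EV0 := rho.comp Q8.subtype

theorem act_eq_one (g : AutC) (hu : g.1.u = 1) (hr : g.1.r = 0) : act g = AlgHom.id F4 EV0 := by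
  have h0 : t0inv g = t0inv 1 := by
    rw [t0inv, t0inv, hu, hr]
    rfl
  have h : (t0 g : PowerSeries F4) = t0 1 := by
    have e : (t0 g)⁻¹ = (t0 1)⁻¹ := Units.ext (by rw [t0_inv, t0_inv, h0])
    rw [inv_injective e]
  have hs : actS g = actS 1 := by
    refine AlgHom.ext fun f => ?_
    rw [actS_apply, actS_apply, h]
  rw [← act_one]
  refine AlgHom.coe_ringHom_injective (hom_ext _ _ (fun a => ?_) ?_)
  · change act g _ = act 1 _
    rw [act_C, act_C, hs]
  · change act g _ = act 1 _
    rw [act_u, act_u, h]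

/-- The action of `V = Q₈ / C₂` on `F₄⟦u₁⟧[u^{±1}]`, on which `C₂` acts trivially. -/
def rhoV : Representation F4 V EV0 :=
  QuotientGroup.lift C2 rhoQ8 (by
    intro x hx
    have h : C2 ≤ MonoidHom.ker rhoQ8 := by
      rw [C2, Subgroup.zpowers_le, MonoidHom.mem_ker]
      change (act negOne).toLinearMap = 1
      rw [act_eq_one _ rfl rfl]
      rfl
    exact h hx)

theorem red_rhoQ8 (g : Q8) (m : EV0) : red (rhoQ8 g m) = red m := by
  have h : actBar g = AlgHom.id F4 EV0bar := by
    have hu := (mem_Q8 _).1 g.2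
    refine AlgHom.coe_ringHom_injective (hom_ext _ _ (fun a => ?_) ?_)
    · exact LaurentPolynomial.eval₂_C _ _ _
    · change LaurentPolynomial.eval₂ _ _ (LaurentPolynomial.T 1) = LaurentPolynomial.T 1
      rw [LaurentPolynomial.eval₂_T, zpow_one, hu, map_one, one_mul]
      rfl
  change red (act g m) = red m
  rw [red_act, h]
  rfl

theorem red_rhoV (g : V) (m : EV0) : red (rhoV g m) = red m := by
  obtain ⟨x, rfl⟩ := QuotientGroup.mk_surjective g
  exact red_rhoQ8 x m

end Groups

/-! ## The `v₁`-Bockstein spectral sequence -/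

section Bockstein

variable {G : Type} [Group G]

/-- The first page `H^*(G; F₄[u^{±1}])` of the `v₁`-Bockstein spectral sequence, for a group `G`
acting on `F₄⟦u₁⟧[u^{±1}]` trivially modulo `u₁`. -/
abbrev E1 (G : Type) [Group G] : Type := HRing F4 G EV0bar

/-- Reduction of cochains modulo `u₁` (equivalently, modulo `v₁ = u₁ u⁻¹`). -/
def redCoch : Coch G EV0 →ₐ[F4] Coch G EV0bar := cochAlgHom (MonoidHom.id G) red

instance (n : ℕ) : SMulCommClass F4 EV0 (CochDeg G EV0 n) :=
  inferInstanceAs (SMulCommClass F4 EV0 ((Fin n → G) → EV0))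

instance : SMulCommClass F4 EV0 (Coch G EV0) :=
  inferInstanceAs (SMulCommClass F4 EV0 (Π₀ n, CochDeg G EV0 n))

variable (ρ : Representation F4 G EV0)

/-- The classes on the first page that survive to the `r`-th page, i.e. on which
`d_1, …, d_{r-1}` vanish: those represented by a cocycle that lifts to a cochain `x` with
`dx = v₁^r y`. The differential `d_r` sends the class of `x` modulo `v₁` to the class of `y`
modulo `v₁`. -/
def Zpage (r : ℕ) : Submodule F4 (E1 G) where
  carrier := {c | ∃ (z : cocycles F4 G EV0bar) (x y : Coch G EV0),
    d ρ x = v1 ^ r • y ∧ redCoch x = z ∧ cls z = c}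
  zero_mem' := ⟨0, 0, 0, by rw [map_zero, smul_zero], map_zero _, map_zero _⟩
  add_mem' := by
    rintro _ _ ⟨z, x, y, h1, h2, rfl⟩ ⟨z', x', y', h1', h2', rfl⟩
    exact ⟨z + z', x + x', y + y', by rw [map_add, h1, h1', smul_add],
      by rw [map_add, h2, h2']; rfl, map_add _ _ _⟩
  smul_mem' := by
    rintro a _ ⟨z, x, y, h1, h2, rfl⟩
    exact ⟨a • z, a • x, a • y, by rw [map_smul, h1, smul_comm],
      by rw [map_smul, h2]; rfl, map_smul _ _ _⟩

/-- The classes `c` on the first page such that `v₁ⁿ c`, in filtration `n`, is zero on the `r`-th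
page, `r ≥ 1`, i.e. is hit by `d_1, …, d_{r-1}`: the reductions modulo `v₁` of cochains `y` such that
`v₁^m y = dw` for some cochain `w`, where `m` is the smaller one of `r - 1` and `n` (a differential
`d_m` that ends in filtration `n` starts in filtration `n - m ≥ 0`). -/
def Bpage (r n : ℕ) : Submodule F4 (E1 G) where
  carrier := {c | ∃ (z : cocycles F4 G EV0bar) (w y : Coch G EV0),
    d ρ w = v1 ^ min (r - 1) n • y ∧ redCoch y = z ∧ cls z = c}
  zero_mem' := ⟨0, 0, 0, by rw [map_zero, smul_zero], map_zero _, map_zero _⟩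
  add_mem' := by
    rintro _ _ ⟨z, w, y, h1, h2, rfl⟩ ⟨z', w', y', h1', h2', rfl⟩
    exact ⟨z + z', w + w', y + y', by rw [map_add, h1, h1', smul_add],
      by rw [map_add, h2, h2']; rfl, map_add _ _ _⟩
  smul_mem' := by
    rintro a _ ⟨z, w, y, h1, h2, rfl⟩
    exact ⟨a • z, a • w, a • y, by rw [map_smul, h1, smul_comm],
      by rw [map_smul, h2]; rfl, map_smul _ _ _⟩

/-- The permanent cycles: the classes on which all differentials vanish. -/
def Zinf : Submodule F4 (E1 G) := ⨅ r, Zpage ρ r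

/-- The classes `c` on the first page such that `v₁ⁿ c`, in filtration `n`, is a boundary. -/
def Binf (n : ℕ) : Submodule F4 (E1 G) := ⨆ r, Bpage ρ r n

/-- The part of the `E_∞`-term in cohomological degree `s` and `v₁`-filtration `n` (all internal
degrees together): the permanent cycles of degree `s` modulo those `c` for which `v₁ⁿ c` is a
boundary. The class of `c` stands for `v₁ⁿ c`. -/
abbrev Einf (s n : ℕ) : Type :=
  ↥(Zinf ρ ⊓ Hdeg F4 G EV0bar s) ⧸ (Binf ρ n).comap (Zinf ρ ⊓ Hdeg F4 G EV0bar s).subtype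

/-- The element `v₁ⁿ c` of the `E_∞`-term, for a permanent cycle `c` of degree `s`. -/
def Einf.mk (s n : ℕ) (c : E1 G) (hc : c ∈ Zinf ρ ⊓ Hdeg F4 G EV0bar s) : Einf ρ s n :=
  Submodule.Quotient.mk ⟨c, hc⟩

/-- For classes `x i` of cohomological degree `deg i` on the first page, the statement that, in
cohomological degrees `s` with `P s`, the `E_∞`-term is the direct sum over `i` of the modules
`F₄[v₁] {x i}` (if `ord i = ⊤`) or `F₄[v₁]/(v₁^(ord i)) {x i}` (if `ord i` is finite): all these
`x i` are permanent cycles, the `v₁ⁿ x i` with `n < ord i` form a basis, and the `v₁ⁿ x i` with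
`n ≥ ord i` are zero. -/
def EinfIsDirectSum (P : ℕ → Prop) {ι : Type} (x : ι → E1 G) (deg : ι → ℕ) (ord : ι → ℕ∞) :
    Prop :=
  (∀ i, P (deg i) → x i ∈ Zinf ρ ⊓ Hdeg F4 G EV0bar (deg i)) ∧
  (∀ s, P s → ∀ n : ℕ, ∃ b : Module.Basis {i // deg i = s ∧ (n : ℕ∞) < ord i} F4 (Einf ρ s n),
    ∀ i : {i // deg i = s ∧ (n : ℕ∞) < ord i},
      ∃ h : x i ∈ Zinf ρ ⊓ Hdeg F4 G EV0bar s, b i = Einf.mk ρ s n (x i) h) ∧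
  ∀ i, P (deg i) → ∀ n : ℕ, ord i ≤ n → x i ∈ Binf ρ n

/-- An endomorphism of the first page induces one of the `E_∞`-term: it preserves the permanent
cycles and, in each filtration, the boundaries. -/
def ActsOnEinf (f : E1 G →ₗ[F4] E1 G) : Prop :=
  (∀ x ∈ Zinf ρ, f x ∈ Zinf ρ) ∧ ∀ n, ∀ x ∈ Binf ρ n, f x ∈ Binf ρ n

/-- The power `u^m` on the first page. -/
def uPow (G : Type) [Group G] (m : ℤ) : E1 G := HRing.const F4 G EV0bar (LaurentPolynomial.T m)

/-- The map `H^*(G; F₄) → H^*(G; F₄[u^{±1}])` to the first page. -/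
def toE1 (G : Type) [Group G] : HRing F4 G F4 →ₐ[F4] E1 G := HRing.map (MonoidHom.id G) (Algebra.ofId F4 EV0bar)

/-- Multiplication by a class on the first page. -/
def mulE1 (c : E1 G) : E1 G →ₗ[F4] E1 G := LinearMap.mulLeft F4 c

/-- A generator `h_{1,0}^p h_{1,1}^q u^m` of the `E_∞`-term, generating a copy of `F₄[v₁]` if `ord`
is `⊤`, and of `F₄[v₁]/(v₁^ord)` otherwise. -/
structure Gen where
  p : ℕ
  q : ℕ
  m : ℤ
  ord : ℕ∞

/-- The cohomological degree of a generator. -/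
def Gen.deg (x : Gen) : ℕ := x.p + x.q

/-- The class `h_{1,0}^p h_{1,1}^q u^m` on the first page. -/
def Gen.toE1 (x : Gen) (h10 h11 : HRing F4 G F4) : E1 G :=
  V1BSS.toE1 G (h10 ^ x.p * h11 ^ x.q) * uPow G x.m

end Bockstein

/-- The action of `ω` on the first page for `Q₈`: it sends the class of a cocycle `f` to the class
of `x ↦ φ_ω (f (ω⁻¹ x ω))`. -/
def omegaQ8 (ζ : F4ˣ) : E1 Q8 →ₐ[F4] E1 Q8 := HRing.map (conjQ8 (omega ζ)) (actBar (omega ζ))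

/-- The action of `ω` on the first page for `V`: it sends the class of a cocycle `f` to the class
of `x ↦ φ_ω (f (ω⁻¹ x ω))`. -/
def omegaV (ζ : F4ˣ) : E1 V →ₐ[F4] E1 V := HRing.map (conjV (omega ζ)) (actBar (omega ζ))

open MvPolynomial in
/-- The ring `F₄[g₀, h_{1,0}, h_{1,1}]/(h_{1,0} h_{1,1}, h_{1,0}³ + h_{1,1}³)`, in the variables
`X 0 = g₀`, `X 1 = h_{1,0}` and `X 2 = h_{1,1}`. -/
abbrev RingQ8 : Type :=
  MvPolynomial (Fin 3) F4 ⧸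
    Ideal.span ({X 1 * X 2, X 1 ^ 3 + X 2 ^ 3} : Set (MvPolynomial (Fin 3) F4))

/-- The generators of the `E_∞`-term for `Q₈` over `F₄[g₀, u^{±4}]`. -/
def gensQ8 : Fin 14 → Gen := ![
  ⟨0, 0, 0, ⊤⟩, ⟨1, 0, -1, ⊤⟩, ⟨2, 0, -2, ⊤⟩, ⟨3, 0, -3, ⊤⟩,
  ⟨1, 0, 0, 2⟩, ⟨2, 0, 0, 2⟩, ⟨2, 0, -1, 2⟩, ⟨3, 0, -1, 2⟩,
  ⟨0, 1, 0, 1⟩, ⟨0, 2, 0, 1⟩, ⟨0, 3, 0, 1⟩, ⟨0, 1, -2, 1⟩, ⟨0, 2, -2, 1⟩, ⟨0, 3, -2, 1⟩]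

/-- The generators of the `E_∞`-term for `V` over `F₄[u^{±4}]` in degrees at most three. -/
def gensV : Fin 16 → Gen := ![
  ⟨0, 0, 0, ⊤⟩,
  ⟨1, 0, 0, 2⟩, ⟨2, 0, 0, 2⟩, ⟨3, 0, 0, 2⟩,
  ⟨0, 1, 0, 1⟩, ⟨0, 2, 0, 1⟩, ⟨1, 1, 0, 1⟩, ⟨2, 1, 0, 1⟩, ⟨1, 2, 0, 1⟩, ⟨0, 3, 0, 1⟩,
  ⟨0, 1, -2, 1⟩, ⟨0, 2, -2, 1⟩, ⟨1, 1, -2, 1⟩, ⟨2, 1, -2, 1⟩, ⟨0, 3, -2, 1⟩, ⟨1, 2, -2, 1⟩]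

end V1BSS

end

/-!
The automorphisms in `Q₈` are `(1, r, r², t)` with `t² + t = r³`. The coordinate `r` is a homomorphism
to the additive group of `F₄`, with kernel `C₂`, and `dt = r ∪ r²`. The classes `h_{1,1}` and `h_{1,0}`
are those of `r` and `r²`. The action on the coefficients is `u⁻¹ ↦ u⁻¹ + r v₁`, which looks like the
translation `w ↦ w + r` of the variable `w` of the functions on `V ≅ F₄`. Both the cohomology of the
groups and the differentials of the spectral sequence come from this.

*Cohomology of the groups.* The functions on `V` are the polynomials of degree at most three in `w`, and
the functions on `Q₈` are two copies of them, glued by the cocycle `τ = w r² + t` with values in the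
functions on `V`. So the cochains with values in functions are iterated mapping cones: `X1` is the cone
of `h_{1,1}` on the cochains with values in `F₄`, `X2` the cone of an operator on `X1` that has `h_{1,0}`
as its leading part, and `X3` the cone of `τ` on `X2`. The functions on a group are acyclic
coefficients (`FunBasis.acyclic_deg`), so `X2` has no cohomology in positive degrees for the group `V`,
and neither has `X3` for `Q₈`. For `V`, the exact sequences of the cones say that every class of
positive degree is uniquely a multiple of a power of `h_{1,0}` plus a multiple of `h_{1,1}`
(`exists_cl_eq_of_X2`, `eq_zero_of_X2`), which gives the polynomial ring (`exists_basis_V`). For `Q₈`,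
the powers of `τ` span the cohomology of `X2`. Going down from `X2` to `X1` and to the trivial
coefficients shows that over a class `y` of degree `n` that becomes `τⁿ` there are exactly the classes
`y, h_{1,0} y, h_{1,1} y, h_{1,0}² y, h_{1,1}² y, h_{1,1}³ y` in degrees `n` to `n + 3`, and that `τⁿ⁺⁴`
again comes from a class with trivial coefficients (`IsStage.exists_next`). The class that becomes `τ⁴`
is `g₀`, and so the cohomology ring is free over `F₄[g₀]` on six elements (`exists_basis_Q`). The
relations hold because `t` bounds `h_{1,1} h_{1,0}`, and an explicit cochain bounds
`h_{1,0}³ + h_{1,1}³`.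

*The spectral sequence.* Suppose that a basis of the first page has lifts to cochains such that the
differential of each lift is zero or a power of `v₁` times the lift of another basis element, its target,
where different elements have different targets and all targets are cocycles. Then these are all
differentials, and the `E_∞`-term can be read off (`BocksteinBasis.einfIsDirectSum`). Such lifts are
written down explicitly. The element `u⁻⁴ + v₁³ u⁻¹` is invariant, as `r⁴ = r`, so that only the powers
`u⁰, u⁻¹, u⁻², u⁻³` have to be considered. The formula for the action gives `d(u⁻¹) = v₁ h_{1,1}`,
`d(u⁻²) = v₁² h_{1,0}` and `d(u⁻³) ≡ v₁ u⁻² h_{1,1}` modulo `v₁²`. For `V` the multiples of these by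
monomials account for the whole first page. For `Q₈`, where `h_{1,1} h_{1,0} = 0`, the first
differential on `h_{1,0} u⁻³` vanishes and the second is `h_{1,0}² u⁻¹`, similarly for `h_{1,0}² u⁻³`.
The `v₁`-towers on `h_{1,0}ᵉ u⁻ᵉ` consist of permanent cycles because these are the leading terms of the
powers `τᵉ`, made homogeneous with `v₁` (`IsTwist.d_tower`).

*The action of `ω`.* Conjugation multiplies `r` by `ζ²`, which gives the action on `h_{1,0}` and
`h_{1,1}`. The class `g₀` is invariant because it spans the cohomology in degree four and conjugation
commutes with the Frobenius map of the coefficients, which forces the eigenvalue to be in `F₂`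
(`map_eq_self_of_span`).
-/

noncomputable section

namespace V1BSS

open DirectSum
open scoped LaurentPolynomial

/-! ### Cochains -/

section Cochains
variable {k G A : Type} [CommRing k]

/-- The homogeneous cochains of degree `n` inside the graded module of all cochains. -/
def cdeg (k G A : Type) [CommRing k] [AddCommGroup A] [Module k A] (n : ℕ) :
    Submodule k (Coch G A) :=
  LinearMap.range (DirectSum.lof k ℕ (CochDeg G A) n)

section Module
variable [AddCommGroup A] [Module k A]

theorem of_mem_cdeg (n : ℕ) (f : CochDeg G A n) : of (CochDeg G A) n f ∈ cdeg k G A n := ⟨f, rfl⟩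

theorem exists_of_mem_cdeg {n : ℕ} {x : Coch G A} (hx : x ∈ cdeg k G A n) :
    ∃ f : CochDeg G A n, of (CochDeg G A) n f = x := hx

theorem d_mem_cdeg [Group G] (ρ : Representation k G A) {n : ℕ} {x : Coch G A} (hx : x ∈ cdeg k G A n) :
    d ρ x ∈ cdeg k G A (n + 1) := by
  obtain ⟨f, rfl⟩ := exists_of_mem_cdeg hx
  rw [d_of]
  exact of_mem_cdeg _ _

theorem of_injective (n : ℕ) : Function.Injective (of (CochDeg G A) n) :=
  DirectSum.of_injective n

end Module

section Ring
variable [CommRing A] [Algebra k A]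

theorem mul_mem_cdeg {p q : ℕ} {x y : Coch G A} (hx : x ∈ cdeg k G A p) (hy : y ∈ cdeg k G A q) :
    x * y ∈ cdeg k G A (p + q) := by
  obtain ⟨f, rfl⟩ := exists_of_mem_cdeg hx
  obtain ⟨g, rfl⟩ := exists_of_mem_cdeg hy
  rw [of_mul_of']
  exact of_mem_cdeg _ _

theorem one_mem_cdeg : (1 : Coch G A) ∈ cdeg k G A 0 := of_mem_cdeg 0 _

theorem pow_mem_cdeg {p : ℕ} {x : Coch G A} (hx : x ∈ cdeg k G A p) (n : ℕ) :
    x ^ n ∈ cdeg k G A (p * n) := by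
  induction n with
  | zero => exact one_mem_cdeg
  | succ n ih =>
    rw [pow_succ]
    exact mul_mem_cdeg ih hx

end Ring

theorem add_self_coch [CharP k 2] [AddCommGroup A] [Module k A] (x : Coch G A) : x + x = 0 := by
  rw [← one_smul k x, ← add_smul, CharTwo.add_self_eq_zero, zero_smul]

theorem eq_of_add_eq_zero_coch [CharP k 2] [AddCommGroup A] [Module k A] {x y : Coch G A}
    (h : x + y = 0) : x = y := by
  rw [← add_zero x, ← add_self_coch (k := k) y, ← add_assoc, h, zero_add]

end Cochains

section Scalar
variable {G : Type}

/-- The differential of cochains with values in `F₄`. -/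
abbrev dF [Group G] : Coch G F4 →ₗ[F4] Coch G F4 := d (Representation.trivial F4 G F4)

theorem add_self_C (x : Coch G F4) : x + x = 0 := add_self_coch (k := F4) x

theorem add_self_F4 (x : F4) : x + x = 0 := CharTwo.add_self_eq_zero x

/-- A function on the group as an element of `CochDeg G F4 1`. -/
def fun1 (a : G → F4) : CochDeg G F4 1 := fun x => a (x 0)

/-- A function of two variables as an element of `CochDeg G F4 2`. -/
def fun2 (a : G → G → F4) : CochDeg G F4 2 := fun x => a (x 0) (x 1)

/-- The `1`-cochain given by a function on the group. -/
def c1 (a : G → F4) : Coch G F4 := of (CochDeg G F4) 1 (fun1 a)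

/-- The `2`-cochain given by a function of two variables. -/
def c2 (a : G → G → F4) : Coch G F4 := of (CochDeg G F4) 2 (fun2 a)

theorem c1_mem (a : G → F4) : c1 a ∈ cdeg F4 G F4 1 := of_mem_cdeg _ _

theorem c1_mul_c1 (a b : G → F4) : c1 a * c1 b = c2 fun g h => a g * b h := of_mul_of' _ _

theorem c2_add (a b : G → G → F4) : c2 a + c2 b = c2 fun g h => a g h + b g h :=
  (map_add (of (CochDeg G F4) 2) _ _).symm

theorem c1_add (a b : G → F4) : c1 a + c1 b = c1 fun g => a g + b g :=
  (map_add (of (CochDeg G F4) 1) _ _).symm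

theorem c2_zero : (c2 fun _ _ => 0 : Coch G F4) = 0 := map_zero (of (CochDeg G F4) 2)

variable [Group G]

theorem neg_one_pow_F4 (n : ℕ) : (-1 : F4) ^ n = 1 := by rw [CharTwo.neg_eq, one_pow]

/-- The differential of cochains with trivial coefficients, with the signs dropped. -/
theorem dDeg_trivial_apply (n : ℕ) (f : CochDeg G F4 n) (x : Fin (n + 1) → G) :
    dDeg (Representation.trivial F4 G F4) n f x = f (fun i => x i.succ) +
      ∑ j : Fin (n + 1), f (Fin.contractNth j (· * ·) x) := by
  rw [dDeg_apply]
  simp only [neg_one_pow_F4, one_smul]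
  rfl

theorem d_c1 (a : G → F4) : dF (c1 a) = c2 fun g h => a g + a h + a (g * h) := by
  rw [c1, dF, d_of]
  refine congrArg _ (funext fun x => ?_)
  rw [dDeg_trivial_apply, Fin.sum_univ_two]
  have h0 : Fin.contractNth (0 : Fin 2) (· * ·) x 0 = x 0 * x 1 := by
    simp [Fin.contractNth]
  have h1 : Fin.contractNth (1 : Fin 2) (· * ·) x 0 = x 0 := by
    simp [Fin.contractNth]
  change a (x 1) + (a (Fin.contractNth (0 : Fin 2) (· * ·) x 0) +
    a (Fin.contractNth (1 : Fin 2) (· * ·) x 0)) = a (x 0) + a (x 1) + a (x 0 * x 1)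
  rw [h0, h1]
  ring

/-- A function on the group that is a homomorphism to the additive group of `F₄`. -/
def IsAdd (r : G → F4) : Prop := ∀ g h, r (g * h) = r g + r h

/-- An additive function is a cocycle. -/
theorem d_c1_hom {r : G → F4} (hr : IsAdd r) : dF (c1 r) = 0 := by
  rw [d_c1, ← c2_zero]
  refine congrArg c2 (funext fun g => funext fun h => ?_)
  rw [hr, add_self_F4]

theorem hom_prod {r : G → F4} (hr : IsAdd r) (l : List G) :
    r l.prod = (l.map r).sum := by
  induction l with
  | nil =>
    have := hr 1 1
    rw [mul_one] at this
    simpa using this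
  | cons a l ih => rw [List.prod_cons, hr, ih, List.map_cons, List.sum_cons]

/-- Multiplication by the cochain `x ↦ r (x₁ ⋯ xₙ) z (x₁, …, xₙ)` (the cup-1 product of `z` and `r`)
shows that a homomorphism `r` commutes with every cocycle `z` up to coboundaries. -/
theorem hom_comm {r : G → F4} (hr : IsAdd r) {n : ℕ} {z : Coch G F4}
    (hz : z ∈ cdeg F4 G F4 n) (hd : dF z = 0) :
    ∃ y ∈ cdeg F4 G F4 n, dF y = c1 r * z + z * c1 r := by
  obtain ⟨f, rfl⟩ := exists_of_mem_cdeg hz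
  let θ : CochDeg G F4 n := fun x => (∑ i, r (x i)) * f x
  refine ⟨of _ n θ, of_mem_cdeg _ _, ?_⟩
  rw [dF, d_of] at hd
  have hd' := of_injective (n + 1) (hd.trans (map_zero (of (CochDeg G F4) (n + 1))).symm)
  let w : CochDeg G F4 (n + 1) := fun x => r (x 0) * f fun i => x i.succ
  let w' : CochDeg G F4 (n + 1) := fun x => f (fun i => x i.castSucc) * r (x (Fin.last n))
  have e1 : c1 r * of _ n f = of _ (n + 1) w := by
    rw [c1, of_mul_of']
    refine DirectSum.of_eq_of_gradedMonoid_eq (mk_eq_mk (Nat.add_comm 1 n) fun x => ?_)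
    refine congrArg₂ _ (congrArg r (congr_fin x (by simp)))
      (congr_coch f fun i => congr_fin x (by simp))
  have e2 : of _ n f * c1 r = of _ (n + 1) w' := by
    rw [c1, of_mul_of']
    rfl
  rw [e1, e2, dF, d_of, ← map_add]
  refine congrArg _ (funext fun x => ?_)
  have hx := congrFun hd' x
  rw [dDeg_trivial_apply, Fin.sum_univ_castSucc] at hx
  rw [dDeg_trivial_apply, Fin.sum_univ_castSucc]
  have hlast : ∀ i, Fin.contractNth (Fin.last n) (· * ·) x i = x i.castSucc := fun i =>
    Fin.contractNth_apply_of_lt _ _ _ _ (by simp)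
  have hl : (Fin.contractNth (Fin.last n) (· * ·) x) = fun i : Fin n => x i.castSucc := funext hlast
  -- Merging two adjacent arguments does not change the sum of the values of `r`.
  have hmid : ∀ j : Fin n, ∑ i, r (Fin.contractNth j.castSucc (· * ·) x i) = ∑ i, r (x i) := by
    intro j
    have hp : ∀ (m : ℕ) (y : Fin m → G), ∑ i, r (y i) = r (List.ofFn y).prod := fun m y => by
      rw [hom_prod hr, List.map_ofFn, List.sum_ofFn]
      rfl
    cases n with
    | zero => exact j.elim0
    | succ n =>
      rw [Fin.sum_univ_succAbove _ j, Fin.sum_univ_succAbove _ j.castSucc,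
        Fin.sum_univ_succAbove _ j, ← add_assoc]
      have h1 : Fin.contractNth j.castSucc (· * ·) x j = x j.castSucc * x j.succ :=
        Fin.contractNth_apply_of_eq _ _ _ _ (by simp)
      have h2 : j.castSucc.succAbove j = j.succ := by simp
      rw [h1, hr, h2]
      refine congrArg₂ _ rfl (Finset.sum_congr rfl fun i _ => congrArg r ?_)
      by_cases h : i.castSucc < j
      · have h4 : ((j.succAbove i : Fin (n + 1)) : ℕ) = i := by
          rw [Fin.succAbove_of_castSucc_lt _ _ h]; rfl
        rw [Fin.contractNth_apply_of_lt _ _ _ _ (by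
          rw [h4]; simpa [Fin.lt_def] using h)]
        refine congr_fin x ?_
        rw [Fin.val_castSucc, h4, Fin.succAbove_of_castSucc_lt]
        · simp [Fin.val_castSucc, h4]
        · rw [Fin.lt_def, Fin.val_castSucc, h4]
          simpa [Fin.lt_def] using h
      · have h' : j ≤ i.castSucc := not_lt.1 h
        have h4 : ((j.succAbove i : Fin (n + 1)) : ℕ) = i + 1 := by
          rw [Fin.succAbove_of_le_castSucc _ _ h']; rfl
        rw [Fin.contractNth_apply_of_gt _ _ _ _ (by
          rw [h4]
          have := Fin.le_def.1 h'
          simp at this ⊢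
          omega)]
        refine congr_fin x ?_
        rw [Fin.val_succ, h4, Fin.succAbove_of_le_castSucc]
        · simp [h4]
        · rw [Fin.le_def, Fin.val_castSucc, Fin.val_castSucc, h4]
          have := Fin.le_def.1 h'
          simp at this ⊢
          omega
  change (∑ i : Fin n, r (x i.succ)) * f (fun i => x i.succ) +
    (∑ j : Fin n, (∑ i, r (Fin.contractNth j.castSucc (· * ·) x i)) *
      f (Fin.contractNth j.castSucc (· * ·) x) +
      (∑ i, r (Fin.contractNth (Fin.last n) (· * ·) x i)) *
        f (Fin.contractNth (Fin.last n) (· * ·) x)) =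
    r (x 0) * f (fun i => x i.succ) + f (fun i => x i.castSucc) * r (x (Fin.last n))
  simp only [hmid, hlast, ← Finset.mul_sum]
  rw [hl] at hx ⊢
  change _ + (_ + _) = (0 : F4) at hx
  have s1 := Fin.sum_univ_succ fun i => r (x i)
  have s2 := Fin.sum_univ_castSucc fun i => r (x i)
  have two := two_F4
  generalize (∑ j : Fin n, f (Fin.contractNth j.castSucc (· * ·) x)) = m at *
  generalize f (fun i => x i.succ) = p at *
  generalize f (fun i => x i.castSucc) = q at *
  generalize (∑ i : Fin n, r (x i.succ)) = σ1 at *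
  generalize (∑ i : Fin n, r (x i.castSucc)) = σ2 at *
  generalize (∑ i, r (x i)) = σ at hx s1 s2 ⊢
  linear_combination σ * hx - p * s1 - q * s2 - (p * r (x 0) + q * r (x (Fin.last n))) * two

end Scalar

/-! ### Graded complexes and mapping cones -/

/-- A cochain complex of vector spaces over `F₄` in nonnegative degrees, given as one vector space
with a differential and a family of homogeneous parts. -/
structure GC (M : Type) [AddCommGroup M] [Module F4 M] where
  /-- The differential. -/
  d : M →ₗ[F4] M
  /-- The homogeneous elements of a given degree. -/
  deg : ℕ → Submodule F4 M
  d_mem : ∀ n, ∀ x ∈ deg n, d x ∈ deg (n + 1)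

namespace GC
variable {M N : Type} [AddCommGroup M] [Module F4 M] [AddCommGroup N] [Module F4 N]

/-- The elements of degree `n - 1`; in degree `0` only zero. -/
def prev (X : GC M) : ℕ → Submodule F4 M
  | 0 => ⊥
  | n + 1 => X.deg n

/-- The coboundaries of degree `n`. -/
def B (X : GC M) (n : ℕ) : Submodule F4 M := (X.prev n).map X.d

/-- The cocycles of degree `n`. -/
def Z (X : GC M) (n : ℕ) : Submodule F4 M := X.deg n ⊓ LinearMap.ker X.d

/-- The class of an element modulo the coboundaries of degree `n`. On cocycles of degree `n` this is
the cohomology class. -/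
def cl (X : GC M) (n : ℕ) : M →ₗ[F4] M ⧸ X.B n := (X.B n).mkQ

theorem mem_Z {X : GC M} {n : ℕ} {x : M} : x ∈ X.Z n ↔ x ∈ X.deg n ∧ X.d x = 0 := Iff.rfl

theorem cl_eq_zero {X : GC M} {n : ℕ} {x : M} : X.cl n x = 0 ↔ ∃ z ∈ X.prev n, X.d z = x :=
  Submodule.Quotient.mk_eq_zero _

theorem cl_zero_eq_zero {X : GC M} {x : M} : X.cl 0 x = 0 ↔ x = 0 := by
  rw [cl_eq_zero]
  constructor
  · rintro ⟨z, hz, rfl⟩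
    rw [(Submodule.mem_bot F4).1 hz, map_zero]
  · rintro rfl
    exact ⟨0, Submodule.zero_mem _, map_zero _⟩

theorem cl_d {X : GC M} {n : ℕ} {x : M} (hx : x ∈ X.deg n) : X.cl (n + 1) (X.d x) = 0 :=
  cl_eq_zero.2 ⟨x, hx, rfl⟩

/-- Chain maps that raise the degree by `k`. -/
structure Hom (X : GC M) (Y : GC N) (k : ℕ) where
  /-- The underlying linear map. -/
  f : M →ₗ[F4] N
  deg_mem : ∀ n, ∀ x ∈ X.deg n, f x ∈ Y.deg (n + k)
  comm : ∀ x, Y.d (f x) = f (X.d x)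

namespace Hom
variable {X : GC M} {Y : GC N} {k : ℕ}

theorem prev_mem (φ : Hom X Y k) {n : ℕ} {x : M} (hx : x ∈ X.prev n) : φ.f x ∈ Y.prev (n + k) := by
  cases n with
  | zero =>
    rw [(Submodule.mem_bot F4).1 hx, map_zero]
    exact Submodule.zero_mem _
  | succ n =>
    rw [Nat.succ_add]
    exact φ.deg_mem n x hx

/-- The map induced on cohomology. -/
def H (φ : Hom X Y k) (n : ℕ) : M ⧸ X.B n →ₗ[F4] N ⧸ Y.B (n + k) :=
  Submodule.mapQ _ _ φ.f (by
    rintro _ ⟨z, hz, rfl⟩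
    exact ⟨φ.f z, φ.prev_mem hz, φ.comm z⟩)

theorem H_cl (φ : Hom X Y k) (n : ℕ) (x : M) : φ.H n (X.cl n x) = Y.cl (n + k) (φ.f x) := rfl

theorem cl_smul (φ : Hom X Y k) {n : ℕ} {x z : M} {a : F4} (h : X.cl n x = a • X.cl n z) :
    Y.cl (n + k) (φ.f x) = a • Y.cl (n + k) (φ.f z) := by
  rw [← H_cl, h, map_smul, H_cl]

theorem cl_congr (φ : Hom X Y k) {n : ℕ} {x z : M} (h : X.cl n x = X.cl n z) :
    Y.cl (n + k) (φ.f x) = Y.cl (n + k) (φ.f z) := by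
  rw [← H_cl, h, H_cl]

theorem cl_smul_add (φ : Hom X Y k) {n : ℕ} {x z z' : M} {a b : F4}
    (h : X.cl n x = a • X.cl n z + b • X.cl n z') :
    Y.cl (n + k) (φ.f x) = a • Y.cl (n + k) (φ.f z) + b • Y.cl (n + k) (φ.f z') := by
  rw [← H_cl, h, map_add, map_smul, map_smul, H_cl, H_cl]

theorem cl_smul_add_eq_zero (φ : Hom X Y k) {n : ℕ} {z z' : M} {a b : F4}
    (h : a • X.cl n z + b • X.cl n z' = 0) :
    a • Y.cl (n + k) (φ.f z) + b • Y.cl (n + k) (φ.f z') = 0 := by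
  rw [← H_cl, ← H_cl, ← LinearMap.map_smul (φ.H n), ← LinearMap.map_smul (φ.H n), ← map_add, h,
    map_zero]

theorem mem_Z (φ : Hom X Y k) {n : ℕ} {x : M} (hx : x ∈ X.Z n) : φ.f x ∈ Y.Z (n + k) :=
  GC.mem_Z.2 ⟨φ.deg_mem n x hx.1, by rw [φ.comm, (GC.mem_Z.1 hx).2, map_zero]⟩

theorem cl_map_eq_zero (φ : Hom X Y k) {n : ℕ} {x : M} (h : X.cl n x = 0) :
    Y.cl (n + k) (φ.f x) = 0 := by
  rw [← H_cl, h, map_zero]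

end Hom

variable (X : GC M)

/-- The mapping cone of a chain map `φ` of degree one: pairs with `d (a, b) = (d a + φ b, d b)`.
With coefficients of characteristic two no signs are needed. -/
def cone (φ : Hom X X 1) : GC (M × M) where
  d := LinearMap.prod (X.d ∘ₗ LinearMap.fst F4 M M + φ.f ∘ₗ LinearMap.snd F4 M M)
    (X.d ∘ₗ LinearMap.snd F4 M M)
  deg n := (X.deg n).prod (X.deg n)
  d_mem n _ hx := ⟨Submodule.add_mem _ (X.d_mem n _ hx.1) (φ.deg_mem n _ hx.2), X.d_mem n _ hx.2⟩

variable {X}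
variable (φ : Hom X X 1)

theorem cone_d (x : M × M) : (X.cone φ).d x = (X.d x.1 + φ.f x.2, X.d x.2) := rfl

/-- The inclusion of a complex in a cone. -/
def incl : Hom X (X.cone φ) 0 where
  f := LinearMap.inl F4 M M
  deg_mem _ _ hx := ⟨hx, Submodule.zero_mem _⟩
  comm x := by
    rw [cone_d]
    simp

/-- The projection of a cone. -/
def proj : Hom (X.cone φ) X 0 where
  f := LinearMap.snd F4 M M
  deg_mem _ _ hx := hx.2
  comm _ := rfl

/-- The extension of a chain map that commutes with `φ` to the cone of `φ`. -/
def coneMap {k : ℕ} (ψ : Hom X X k) (h : ∀ x, ψ.f (φ.f x) = φ.f (ψ.f x)) :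
    Hom (X.cone φ) (X.cone φ) k where
  f := LinearMap.prodMap ψ.f ψ.f
  deg_mem n _ hx := ⟨ψ.deg_mem n _ hx.1, ψ.deg_mem n _ hx.2⟩
  comm x := by
    simp only [cone_d, LinearMap.prodMap_apply, ψ.comm, map_add, h]

variable {φ}

theorem proj_cl_smul {n : ℕ} {x z : M × M} {a : F4}
    (h : (X.cone φ).cl n x = a • (X.cone φ).cl n z) : X.cl n x.2 = a • X.cl n z.2 :=
  (proj φ).cl_smul h

theorem proj_cl_smul_add {n : ℕ} {x z z' : M × M} {a b : F4}
    (h : (X.cone φ).cl n x = a • (X.cone φ).cl n z + b • (X.cone φ).cl n z') :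
    X.cl n x.2 = a • X.cl n z.2 + b • X.cl n z'.2 := (proj φ).cl_smul_add h

theorem incl_cl {n : ℕ} {x : M} (h : X.cl n x = 0) : (X.cone φ).cl n (x, 0) = 0 :=
  (incl φ).cl_map_eq_zero h

theorem proj_cl {n : ℕ} {x : M × M} (h : (X.cone φ).cl n x = 0) : X.cl n x.2 = 0 :=
  (proj φ).cl_map_eq_zero h

theorem incl_mem_Z {n : ℕ} {x : M} (h : x ∈ X.Z n) : (x, 0) ∈ (X.cone φ).Z n :=
  (incl φ).mem_Z h

theorem proj_mem_Z {n : ℕ} {x : M × M} (h : x ∈ (X.cone φ).Z n) : x.2 ∈ X.Z n :=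
  (proj φ).mem_Z h

/-- Exactness of the cohomology sequence of a cone at the source of the inclusion. -/
theorem exists_of_incl {n : ℕ} {x : M} (h : (X.cone φ).cl (n + 1) (x, 0) = 0) :
    ∃ m ∈ X.Z n, X.cl (n + 1) x = X.cl (n + 1) (φ.f m) := by
  obtain ⟨z, hz, e⟩ := cl_eq_zero.1 h
  rw [cone_d, Prod.mk.injEq] at e
  refine ⟨z.2, ⟨hz.2, e.2⟩, ?_⟩
  rw [← e.1, map_add, cl_d hz.1, zero_add]

theorem exists_of_incl_eq {n : ℕ} {x z : M} {a : F4}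
    (h : (X.cone φ).cl (n + 1) (x, 0) = a • (X.cone φ).cl (n + 1) (z, 0)) :
    ∃ m ∈ X.Z n, X.cl (n + 1) x = a • X.cl (n + 1) z + X.cl (n + 1) (φ.f m) := by
  rw [← map_smul, ← sub_eq_zero, ← map_sub, Prod.smul_mk, smul_zero, Prod.mk_sub_mk,
    sub_zero] at h
  obtain ⟨m, hm, e⟩ := exists_of_incl h
  refine ⟨m, hm, ?_⟩
  rw [map_sub, map_smul, sub_eq_iff_eq_add'] at e
  exact e

theorem mem_Z_of_incl {n : ℕ} {x : M} (h : (x, 0) ∈ (X.cone φ).Z n) : x ∈ X.Z n := by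
  refine mem_Z.2 ⟨h.1.1, ?_⟩
  have e := (Prod.mk.inj ((cone_d φ (x, 0)).symm.trans (mem_Z.1 h).2)).1
  simpa using e

/-- Exactness of the cohomology sequence of a cone at the source of `φ`. -/
theorem exists_of_map {n : ℕ} {m : M} (hm : m ∈ X.Z n) (h : X.cl (n + 1) (φ.f m) = 0) :
    ∃ m' ∈ X.deg n, (m', m) ∈ (X.cone φ).Z n := by
  obtain ⟨z, hz, e⟩ := cl_eq_zero.1 h
  refine ⟨-z, Submodule.neg_mem _ hz, mem_Z.2 ⟨⟨Submodule.neg_mem _ hz, hm.1⟩, ?_⟩⟩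
  rw [cone_d, map_neg, e, (mem_Z.1 hm).2, neg_add_cancel]
  rfl

/-- Exactness of the cohomology sequence of a cone at the target of the projection. -/
theorem cl_map_proj {n : ℕ} {x : M × M} (h : x ∈ (X.cone φ).Z n) :
    X.cl (n + 1) (φ.f x.2) = 0 := by
  have e := (mem_Z.1 h).2
  rw [cone_d] at e
  refine cl_eq_zero.2 ⟨-x.1, Submodule.neg_mem _ h.1.1, ?_⟩
  rw [map_neg]
  exact neg_eq_of_add_eq_zero_right (Prod.mk.inj e).1

/-- Exactness of the cohomology sequence of a cone at the target of the inclusion. -/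
theorem exists_of_proj {n : ℕ} {x : M × M} (hx : x ∈ (X.cone φ).Z (n + 1))
    (h : X.cl (n + 1) x.2 = 0) :
    ∃ m ∈ X.Z (n + 1), (X.cone φ).cl (n + 1) (m, 0) = (X.cone φ).cl (n + 1) x := by
  obtain ⟨z, hz, e⟩ := cl_eq_zero.1 h
  have e1 := (Prod.mk.inj ((cone_d φ x).symm.trans (mem_Z.1 hx).2)).1
  have e2 : φ.f x.2 + φ.f x.2 = 0 := by
    rw [← one_smul F4 (φ.f x.2), ← add_smul, CharTwo.add_self_eq_zero, zero_smul]
  refine ⟨x.1 - φ.f z, mem_Z.2 ⟨sub_mem hx.1.1 (φ.deg_mem n z hz), ?_⟩, ?_⟩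
  · rw [map_sub, φ.comm, e, eq_neg_of_add_eq_zero_left e1, ← neg_add', e2, neg_zero]
  · rw [← sub_eq_zero, ← map_sub, cl_eq_zero]
    refine ⟨-(0, z), ⟨by simp, neg_mem hz⟩, ?_⟩
    rw [map_neg, cone_d, map_zero, zero_add, e]
    exact Prod.ext (by simp) (by simp)

/-- In a cone the image of `φ` becomes zero in cohomology. -/
theorem incl_map {n : ℕ} {m : M} (hm : m ∈ X.Z n) : (X.cone φ).cl (n + 1) (φ.f m, 0) = 0 := by
  refine cl_eq_zero.2 ⟨(0, m), ⟨Submodule.zero_mem _, hm.1⟩, ?_⟩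
  rw [cone_d, map_zero, zero_add]
  exact Prod.ext rfl hm.2

theorem iterate_mem_Z {e : M} (he : e ∈ X.Z 0) (n : ℕ) : (φ.f ^ n) e ∈ X.Z n := by
  induction n with
  | zero => exact he
  | succ n ih =>
    rw [pow_succ', Module.End.mul_apply]
    exact φ.mem_Z ih

/-- A complex is acyclic up to a line in degree zero spanned by `e`. -/
structure IsResolution (Y : GC N) (e : N) : Prop where
  zero : ∀ x ∈ Y.Z 0, ∃ a : F4, x = a • e
  succ : ∀ n, ∀ x ∈ Y.Z (n + 1), Y.cl (n + 1) x = 0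

/-- If the cone of `φ` has no cohomology except for a line in degree zero, spanned by a class of the
complex, then the powers of `φ` applied to this class span the cohomology of the complex. -/
theorem exists_cl_eq_iterate {e : M} (h : (X.cone φ).IsResolution (e, 0)) :
    ∀ n, ∀ x ∈ X.Z n, ∃ a : F4, X.cl n x = a • X.cl n ((φ.f ^ n) e) := by
  intro n
  induction n with
  | zero =>
    intro x hx
    obtain ⟨a, ha⟩ := h.zero _ (incl_mem_Z hx)
    refine ⟨a, ?_⟩
    rw [← map_smul]
    exact congrArg _ (Prod.mk.inj ha).1
  | succ n ih =>
    intro x hx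
    -- The class of `x` dies in the cone, so it is the image under `φ` of a class of degree `n`.
    obtain ⟨m, hm, e1⟩ := exists_of_incl (h.succ n _ (incl_mem_Z hx))
    obtain ⟨a, ha⟩ := ih m hm
    refine ⟨a, ?_⟩
    have := congrArg (φ.H n) ha
    rw [map_smul, Hom.H_cl, Hom.H_cl] at this
    rw [e1, this, pow_succ', Module.End.mul_apply]

/-- If the cone of `φ` has no cohomology except for a line in degree zero, spanned by a class of the
complex, then the powers of `φ` applied to this class are not coboundaries. -/
theorem cl_iterate_ne_zero {e : M} (h : (X.cone φ).IsResolution (e, 0)) (he : e ∈ X.Z 0)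
    (h0 : e ≠ 0) : ∀ n, X.cl n ((φ.f ^ n) e) ≠ 0 := by
  intro n
  induction n with
  | zero => exact fun hn => h0 (cl_zero_eq_zero.1 hn)
  | succ n ih =>
    intro hn
    rw [pow_succ', Module.End.mul_apply] at hn
    -- If `φⁿ⁺¹ e` is a coboundary, then `φⁿ e` is the second component of a cocycle of the cone.
    obtain ⟨m', -, hm⟩ := exists_of_map (iterate_mem_Z he n) hn
    cases n with
    | zero =>
      obtain ⟨a, ha⟩ := h.zero _ hm
      exact h0 ((Prod.mk.inj ha).2.trans (smul_zero a))
    | succ n => exact ih (proj_cl (h.succ n _ hm))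

end GC

/-! ### Acyclicity of the functions on a finite group -/

section Acyclic
variable {G : Type}

/-- The product `c1 a * f` in degree `n + 1`. -/
def lmul {n : ℕ} (a : G → F4) (f : CochDeg G F4 n) : CochDeg G F4 (n + 1) :=
  fun x => a (x 0) * f fun i => x i.succ

theorem c1_mul_of {n : ℕ} (a : G → F4) (f : CochDeg G F4 n) :
    c1 a * of (CochDeg G F4) n f = of (CochDeg G F4) (n + 1) (lmul a f) := by
  rw [c1, of_mul_of']
  refine DirectSum.of_eq_of_gradedMonoid_eq (mk_eq_mk (Nat.add_comm 1 n) fun x => ?_)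
  exact congrArg₂ _ (congrArg a (congr_fin x (by simp)))
    (congr_coch f fun i => congr_fin x (by simp))

theorem exists_smul_one_of_mem_cdeg_zero {x : Coch G F4} (hx : x ∈ cdeg F4 G F4 0) :
    ∃ a : F4, x = a • 1 := by
  obtain ⟨f, rfl⟩ := exists_of_mem_cdeg hx
  refine ⟨f Fin.elim0, ?_⟩
  rw [← Algebra.algebraMap_eq_smul_one]
  refine congrArg (of (CochDeg G F4) 0) (funext fun y => ?_)
  rw [Subsingleton.elim y Fin.elim0]
  rfl

variable [Group G]

theorem d_smul_one (a : F4) : dF (a • 1 : Coch G F4) = 0 := by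
  rw [map_smul, dF, d_one, smul_zero]

theorem contractNth_zero_cons {n : ℕ} (x : G) (g : Fin (n + 1) → G) :
    Fin.contractNth (0 : Fin (n + 2)) (· * ·) (Fin.cons x g : Fin (n + 2) → G) =
      Fin.cons (x * g 0) fun i => g i.succ := by
  funext i
  refine Fin.cases ?_ (fun i => ?_) i
  · rw [Fin.contractNth_apply_of_eq _ _ _ _ (by simp)]
    rfl
  · rw [Fin.contractNth_apply_of_gt _ _ _ _ (by simp)]
    rfl

theorem contractNth_succ_cons {n : ℕ} (x : G) (g : Fin (n + 1) → G) (k : Fin (n + 1)) :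
    Fin.contractNth k.succ (· * ·) (Fin.cons x g : Fin (n + 2) → G) =
      Fin.cons x (Fin.contractNth k (· * ·) g) := by
  funext i
  refine Fin.cases ?_ (fun i => ?_) i
  · rw [Fin.contractNth_apply_of_lt _ _ _ _ (by simp)]
    rfl
  · rw [Fin.cons_succ]
    simp only [Fin.contractNth, Fin.val_succ, Nat.add_lt_add_iff_right, Nat.add_right_cancel_iff]
    rfl

/-- A basis `β` of the space of functions on a finite group `G`, which is triangular in the sense
that right translation by `g` sends `β i` to `β i + ∑ j, c i j g • β j`. The basis vector with index
`i₀` is the constant function one, the others vanish at the neutral element, and `γ` gives the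
coordinates of the delta functions. -/
structure FunBasis (G : Type) [Group G] (ι : Type) [Fintype ι] [DecidableEq ι]
    (i₀ : ι) where
  /-- The functions. -/
  β : ι → G → F4
  /-- The matrix of the right translations. -/
  c : ι → ι → G → F4
  /-- The coordinates of the delta functions. -/
  γ : ι → G → F4
  β_mul : ∀ i x g, β i (x * g) = β i x + ∑ j, β j x * c i j g
  β_one : ∀ i, β i 1 = if i = i₀ then 1 else 0
  β_zero : ∀ x, β i₀ x = 1
  sum_γ_self : ∀ x, ∑ i, β i x * γ i x = 1
  sum_γ_ne : ∀ x y, x ≠ y → ∑ i, β i x * γ i y = 0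
  inj : ∀ a : ι → F4, (∀ x, ∑ i, β i x * a i = 0) → ∀ i, a i = 0

variable {ι : Type} [Fintype ι] [DecidableEq ι] {i₀ : ι} (b : FunBasis G ι i₀)

theorem FunBasis.β_eq (i : ι) (x : G) : b.β i x = (if i = i₀ then 1 else 0) + b.c i i₀ x := by
  have h := b.β_mul i 1 x
  simpa [b.β_one] using h

/-- A cocycle of positive degree with values in the functions on `G`, given by its coordinates `f`,
is a coboundary. The homotopy sends a cochain `F` with values in functions to
`(g₁, …, gₙ) ↦ (x ↦ F (x, g₁, …, gₙ) (1))`. -/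
theorem FunBasis.acyclic_deg [Fintype G] {n : ℕ} (f : ι → CochDeg G F4 (n + 1))
    (hf : ∀ j, dDeg (Representation.trivial F4 G F4) (n + 1) (f j) +
      ∑ i, lmul (b.c i j) (f i) = 0) :
    ∃ h : ι → CochDeg G F4 n, ∀ j, f j = dDeg (Representation.trivial F4 G F4) n (h j) +
      ∑ i, lmul (b.c i j) (h i) := by
  have sum_ap : ∀ (m : ℕ) (u : ι → CochDeg G F4 m) (g : Fin m → G),
      (∑ i, u i) g = ∑ i, u i g := fun m u g => Finset.sum_apply g _ _
  -- The component `f i₀` is the value at the neutral element; `γ` recovers the coordinates of the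
  -- homotopy from its values.
  let h : ι → CochDeg G F4 n := fun j y => ∑ x, b.γ j x * f i₀ (Fin.cons x y)
  have key : ∀ x y, ∑ j, b.β j x * h j y = f i₀ (Fin.cons x y) := by
    intro x y
    simp only [h, Finset.mul_sum]
    rw [Finset.sum_comm]
    simp only [← mul_assoc, ← Finset.sum_mul]
    rw [Finset.sum_eq_single x (fun z _ hz => by rw [b.sum_γ_ne x z hz.symm, zero_mul]) (by simp),
      b.sum_γ_self, one_mul]
  refine ⟨h, fun j => ?_⟩
  funext g
  rw [← sub_eq_zero]
  refine b.inj (fun j => f j g - (dDeg (Representation.trivial F4 G F4) n (h j) +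
    ∑ i, lmul (b.c i j) (h i) : CochDeg G F4 (n + 1)) g) (fun x => ?_) j
  -- The cocycle condition at the neutral element, with `x` as additional first argument.
  have e0 := congrFun (hf i₀) (Fin.cons x g)
  change dDeg _ (n + 1) (f i₀) _ + (∑ i, lmul (b.c i i₀) (f i)) _ = (0 : F4) at e0
  rw [sum_ap, dDeg_trivial_apply, Fin.sum_univ_succ, contractNth_zero_cons] at e0
  simp only [contractNth_succ_cons] at e0
  have e1 : ∑ i, lmul (b.c i i₀) (f i) (Fin.cons x g) = ∑ i, b.β i x * f i g - f i₀ g := by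
    have : ∀ i, b.β i x * f i g = (if i = i₀ then f i g else 0) +
        lmul (b.c i i₀) (f i) (Fin.cons x g) := fun i => by
      rw [b.β_eq, add_mul, ite_mul, one_mul, zero_mul]
      rfl
    simp only [this, Finset.sum_add_distrib, Finset.sum_ite_eq', Finset.mem_univ, if_true]
    ring
  have e2 : ∑ j, b.β j x * (dDeg (Representation.trivial F4 G F4) n (h j) +
        ∑ i, lmul (b.c i j) (h i) : CochDeg G F4 (n + 1)) g =
      f i₀ (Fin.cons (x * g 0) fun i => g i.succ) +
        ∑ k, f i₀ (Fin.cons x (Fin.contractNth k (· * ·) g)) := by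
    have a1 : ∀ j, (dDeg (Representation.trivial F4 G F4) n (h j) +
        ∑ i, lmul (b.c i j) (h i) : CochDeg G F4 (n + 1)) g =
        h j (fun i => g i.succ) + ∑ k, h j (Fin.contractNth k (· * ·) g) +
          ∑ i, b.c i j (g 0) * h i fun i => g i.succ := by
      intro j
      change dDeg _ n (h j) g + (∑ i, lmul (b.c i j) (h i)) g = _
      rw [sum_ap, dDeg_trivial_apply]
      rfl
    simp only [a1, mul_add, Finset.sum_add_distrib, key]
    have a2 : ∑ j, b.β j x * ∑ k, h j (Fin.contractNth k (· * ·) g) =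
        ∑ k, f i₀ (Fin.cons x (Fin.contractNth k (· * ·) g)) := by
      simp only [Finset.mul_sum]
      rw [Finset.sum_comm]
      simp only [key]
    have a3 : ∑ j, b.β j x * ∑ i, b.c i j (g 0) * h i (fun i => g i.succ) =
        f i₀ (Fin.cons (x * g 0) fun i => g i.succ) - f i₀ (Fin.cons x fun i => g i.succ) := by
      simp only [Finset.mul_sum]
      rw [Finset.sum_comm, ← key, ← key, ← Finset.sum_sub_distrib]
      refine Finset.sum_congr rfl fun i _ => ?_
      rw [b.β_mul, add_mul, add_sub_cancel_left, Finset.sum_mul]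
      exact Finset.sum_congr rfl fun j _ => by ring
    rw [a2, a3]
    ring
  have e3 : (fun i => (Fin.cons x g : Fin (n + 2) → G) i.succ) = g := funext fun i => rfl
  simp only [mul_sub, Finset.sum_sub_distrib]
  rw [e2]
  rw [e1, e3] at e0
  have two := two_F4
  linear_combination e0 - (f i₀ (Fin.cons (x * g 0) fun i => g i.succ) +
        ∑ k, f i₀ (Fin.cons x (Fin.contractNth k (· * ·) g))) * two

/-- The statement of `acyclic_deg` for homogeneous elements of the graded module of cochains. -/
theorem FunBasis.acyclic [Fintype G] {n : ℕ} (f : ι → Coch G F4)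
    (hf : ∀ j, f j ∈ cdeg F4 G F4 (n + 1))
    (hd : ∀ j, dF (f j) + ∑ i, c1 (b.c i j) * f i = 0) :
    ∃ h : ι → Coch G F4, (∀ j, h j ∈ cdeg F4 G F4 n) ∧
      ∀ j, dF (h j) + ∑ i, c1 (b.c i j) * h i = f j := by
  choose f' hf' using fun j => exists_of_mem_cdeg (hf j)
  obtain ⟨h, hh⟩ := b.acyclic_deg f' (fun j => by
    have := hd j
    simp only [← hf', dF, d_of, c1_mul_of] at this
    rw [← map_sum, ← map_add] at this
    exact of_injective (n + 2) (this.trans (map_zero _).symm))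
  refine ⟨fun j => of _ n (h j), fun j => of_mem_cdeg _ _, fun j => ?_⟩
  simp only [dF, d_of, c1_mul_of]
  rw [← map_sum, ← map_add, ← hh, hf']

/-- The cocycles of degree zero with values in the functions on `G` are the constant functions. -/
theorem FunBasis.acyclic_zero (f : ι → Coch G F4) (hf : ∀ j, f j ∈ cdeg F4 G F4 0)
    (hd : ∀ j, dF (f j) + ∑ i, c1 (b.c i j) * f i = 0) :
    ∃ a : F4, ∀ j, f j = if j = i₀ then a • 1 else 0 := by
  choose a ha using fun j => exists_smul_one_of_mem_cdeg_zero (hf j)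
  refine ⟨a i₀, fun j => ?_⟩
  have h : ∀ x, ∑ i, b.c i i₀ x * a i = 0 := by
    intro x
    have := hd i₀
    simp only [ha, d_smul_one, zero_add, mul_smul_comm, mul_one] at this
    have e : ∀ i, a i • c1 (b.c i i₀) = of (CochDeg G F4) 1 (fun1 fun x => b.c i i₀ x * a i) := by
      intro i
      refine (DirectSum.of_smul F4 1 (a i) _).symm.trans (congrArg _ (funext fun x => ?_))
      exact mul_comm _ _
    simp only [e, ← map_sum] at this
    have := congrFun (of_injective 1 (this.trans (map_zero _).symm)) fun _ => x
    exact (Finset.sum_apply _ _ _).symm.trans this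
  have h2 := b.inj (fun i => a i - if i = i₀ then a i₀ else 0) (fun x => by
    have h3 := h x
    simp only [mul_sub, Finset.sum_sub_distrib, b.β_eq, add_mul, Finset.sum_add_distrib, h3]
    have h4 : b.c i₀ i₀ x = 0 := by
      have := b.β_eq i₀ x
      rw [b.β_zero, if_pos rfl] at this
      simpa using this
    simp [h4]) j
  rw [ha j, sub_eq_zero.1 h2]
  split <;> simp

end Acyclic

/-! ### The cohomology of the Klein four-group -/

section Tower
variable {G : Type}

theorem two_zsmul_C (x : Coch G F4) : (2 : ℤ) • x = 0 := by rw [two_smul, add_self_C]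

theorem c1_mul_mem {n : ℕ} (a : G → F4) {x : Coch G F4} (hx : x ∈ cdeg F4 G F4 n) :
    c1 a * x ∈ cdeg F4 G F4 (n + 1) := by
  rw [Nat.add_comm]
  exact mul_mem_cdeg (c1_mem a) hx

theorem smul_one_eq_zero {a : F4} (h : a • (1 : Coch G F4) = 0) : a = 0 := by
  have h1 : of (CochDeg G F4) 0 (constDeg G a) = 0 := by
    rw [← h, ← Algebra.algebraMap_eq_smul_one]
    rfl
  exact congrFun (of_injective 0 (h1.trans (map_zero _).symm)) Fin.elim0

theorem one_ne_zero_C : (1 : Coch G F4) ≠ 0 := fun h =>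
  one_ne_zero (smul_one_eq_zero (G := G) (a := 1) (by rw [h, smul_zero]))

variable [Group G]

/-- The complex of cochains with values in `F₄`. -/
def X0 (G : Type) [Group G] : GC (Coch G F4) where
  d := dF
  deg := cdeg F4 G F4
  d_mem _ _ hx := d_mem_cdeg _ hx

theorem mem_Z0 {n : ℕ} {x : Coch G F4} : x ∈ (X0 G).Z n ↔ x ∈ cdeg F4 G F4 n ∧ dF x = 0 := Iff.rfl

theorem d_mul_C (x y : Coch G F4) : dF (x * y) = dF x * y + x * dF y := d_mul x y

/-- Right multiplication by a cocycle. -/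
def mulR {p : ℕ} (c : Coch G F4) (hc : c ∈ (X0 G).Z p) : GC.Hom (X0 G) (X0 G) p where
  f := LinearMap.mulRight F4 c
  deg_mem _ _ hx := mul_mem_cdeg hx hc.1
  comm x := by
    change dF (x * c) = dF x * c
    rw [d_mul_C, (mem_Z0.1 hc).2, mul_zero, add_zero]

/-- Left multiplication by a homomorphism. -/
def mulL (r : G → F4) (hr : IsAdd r) : GC.Hom (X0 G) (X0 G) 1 where
  f := LinearMap.mulLeft F4 (c1 r)
  deg_mem _ _ hx := c1_mul_mem r hx
  comm x := by
    change dF (c1 r * x) = c1 r * dF x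
    rw [d_mul_C, d_c1_hom hr, zero_mul, zero_add]

variable {r : G → F4}

theorem IsAdd.sq (hr : IsAdd r) : IsAdd fun g => r g ^ 2 := fun g h => by
  change r (g * h) ^ 2 = r g ^ 2 + r h ^ 2
  rw [hr, add_pow_char]

/-- The `1`-cochain of `r²`. -/
abbrev cS (r : G → F4) : Coch G F4 := c1 fun g => r g ^ 2

/-- The `1`-cochain of `r³`. -/
abbrev cK (r : G → F4) : Coch G F4 := c1 fun g => r g ^ 3

theorem d_cS (hr : IsAdd r) : dF (cS r) = 0 := d_c1_hom (hr.sq)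

theorem d_cR (hr : IsAdd r) : dF (c1 r) = 0 := d_c1_hom hr

theorem d_cK (hr : IsAdd r) : dF (cK r) = c1 r * cS r + cS r * c1 r := by
  rw [d_c1, c1_mul_c1, c1_mul_c1, c2_add]
  refine congrArg c2 (funext fun g => funext fun h => ?_)
  rw [hr]
  have two := two_F4
  linear_combination (r g ^ 3 + r h ^ 3 + r g ^ 2 * r h + r g * r h ^ 2) * two

variable (hr : IsAdd r)

/-- The cochains `f₀ + w f₁` with values in `F₄ ⊕ F₄ w`, where `g` acts by `w ↦ w + r g`. -/
abbrev X1 : GC (Coch G F4 × Coch G F4) := (X0 G).cone (mulL r hr)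

theorem X1_d (x : Coch G F4 × Coch G F4) : (X1 hr).d x = (dF x.1 + c1 r * x.2, dF x.2) := rfl

/-- The chain map whose cone is the complex of cochains with values in the polynomials of degree at
most three in `w`: on `w² f` the differential is `w² df + r² f`, and on `w³ f` it is
`w² r f + w r² f + r³ f + w³ df`. -/
def phi2 : GC.Hom (X1 hr) (X1 hr) 1 where
  f := LinearMap.prod
    (LinearMap.mulLeft F4 (cS r) ∘ₗ LinearMap.fst F4 (Coch G F4) (Coch G F4) +
      LinearMap.mulLeft F4 (cK r) ∘ₗ LinearMap.snd F4 (Coch G F4) (Coch G F4))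
    (LinearMap.mulLeft F4 (cS r) ∘ₗ LinearMap.snd F4 (Coch G F4) (Coch G F4))
  deg_mem _ _ hx := ⟨Submodule.add_mem _ (c1_mul_mem (fun g => r g ^ 2) hx.1)
    (c1_mul_mem (fun g => r g ^ 3) hx.2), c1_mul_mem (fun g => r g ^ 2) hx.2⟩
  comm x := by
    change (dF (cS r * x.1 + cK r * x.2) + c1 r * (cS r * x.2), dF (cS r * x.2)) =
      (cS r * (dF x.1 + c1 r * x.2) + cK r * dF x.2, cS r * dF x.2)
    refine Prod.ext ?_ ?_
    · refine eq_of_add_eq_zero_coch (k := F4) ?_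
      simp only [map_add, d_mul_C, d_cS hr, d_cK hr, mul_add, add_mul, mul_assoc, zero_mul]
      abel_nf
      simp only [two_zsmul_C, add_zero]
    · change dF (cS r * x.2) = cS r * dF x.2
      rw [d_mul_C, d_cS hr, zero_mul, zero_add]

theorem phi2_apply (x : Coch G F4 × Coch G F4) :
    (phi2 hr).f x = (cS r * x.1 + cK r * x.2, cS r * x.2) := rfl

/-- The cochains with values in the polynomials of degree at most three in `w`, a tower with four
steps. If `r` is a bijection
to `F₄`, then these are all functions on the group. -/
abbrev X2 : GC ((Coch G F4 × Coch G F4) × (Coch G F4 × Coch G F4)) := (X1 hr).cone (phi2 hr)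

theorem X2_d (x : (Coch G F4 × Coch G F4) × (Coch G F4 × Coch G F4)) : (X2 hr).d x =
    ((dF x.1.1 + c1 r * x.1.2 + (cS r * x.2.1 + cK r * x.2.2), dF x.1.2 + cS r * x.2.2),
      (dF x.2.1 + c1 r * x.2.2, dF x.2.2)) := rfl

theorem phi2_pow_one (n : ℕ) : ((phi2 hr).f ^ n) (1, 0) = (cS r ^ n, 0) := by
  induction n with
  | zero => rfl
  | succ n ih =>
    rw [pow_succ', Module.End.mul_apply, ih, phi2_apply, mul_zero, mul_zero, add_zero, pow_succ']

theorem one_mem_Z0 : (1 : Coch G F4) ∈ (X0 G).Z 0 := mem_Z0.2 ⟨one_mem_cdeg, d_one⟩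

theorem exists_smul_one_of_mem_Z0 {x : Coch G F4} (hx : x ∈ (X0 G).Z 0) : ∃ a : F4, x = a • 1 :=
  exists_smul_one_of_mem_cdeg_zero hx.1

/-- If the four-step tower is acyclic, every class is a multiple of `h_{1,0}ⁿ` plus a multiple
of `h_{1,1}`. -/
theorem exists_cl_eq_of_X2 (h : (X2 hr).IsResolution ((1, 0), 0)) {n : ℕ} {x : Coch G F4}
    (hx : x ∈ (X0 G).Z (n + 1)) : ∃ a : F4, ∃ c ∈ (X0 G).Z n,
      (X0 G).cl (n + 1) x = a • (X0 G).cl (n + 1) (cS r ^ (n + 1)) +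
        (X0 G).cl (n + 1) (c1 r * c) := by
  obtain ⟨a, ha⟩ := GC.exists_cl_eq_iterate h (n + 1) _ (GC.incl_mem_Z hx)
  rw [phi2_pow_one, ← map_smul, ← sub_eq_zero, ← map_sub, Prod.smul_mk, smul_zero, Prod.mk_sub_mk,
    sub_zero] at ha
  obtain ⟨c, hc, e⟩ := GC.exists_of_incl ha
  refine ⟨a, c, hc, ?_⟩
  rw [map_sub, sub_eq_iff_eq_add, map_smul] at e
  exact e.trans (add_comm _ _)

theorem cS_pow_mem (hr : IsAdd r) (n : ℕ) : cS r ^ n ∈ (X0 G).Z n := by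
  have := GC.iterate_mem_Z (φ := mulL _ (hr.sq)) one_mem_Z0 n
  have e : ((mulL _ (hr.sq)).f ^ n) 1 = cS r ^ n := by
    change ((LinearMap.mulLeft F4 (cS r)) ^ n) 1 = _
    rw [LinearMap.pow_mulLeft]
    exact mul_one _
  rwa [e] at this

/-- If the four-step tower is acyclic, the presentation of `exists_cl_eq_of_X2` is unique. -/
theorem eq_zero_of_X2 (h : (X2 hr).IsResolution ((1, 0), 0)) {n : ℕ} {a : F4} {c : Coch G F4}
    (hc : c ∈ (X0 G).Z n)
    (e : a • (X0 G).cl (n + 1) (cS r ^ (n + 1)) + (X0 G).cl (n + 1) (c1 r * c) = 0) :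
    a = 0 ∧ (X0 G).cl n c = 0 := by
  have h1 : ((1, 0) : Coch G F4 × Coch G F4) ≠ 0 := fun h => one_ne_zero_C (Prod.mk.inj h).1
  have hne : ∀ m, (X1 hr).cl m (cS r ^ m, 0) ≠ 0 := fun m => by
    rw [← phi2_pow_one hr]
    exact GC.cl_iterate_ne_zero h (GC.incl_mem_Z one_mem_Z0) h1 m
  have ha : a = 0 := by
    by_contra ha
    refine hne (n + 1) ?_
    have h2 := congrArg ((GC.incl (mulL r hr)).H (n + 1)) e
    -- With coefficients in `F₄ ⊕ F₄ w` only the term with `h_{1,0}ⁿ⁺¹` remains.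
    have h3 : (X1 hr).cl (n + 1) (c1 r * c, 0) = 0 := GC.incl_map hc
    rw [map_add, map_smul, GC.Hom.H_cl, GC.Hom.H_cl, map_zero] at h2
    have h4 : a • (X1 hr).cl (n + 1) (cS r ^ (n + 1), 0) + (X1 hr).cl (n + 1) (c1 r * c, 0) = 0 := h2
    rw [h3, add_zero] at h4
    exact (smul_eq_zero.1 h4).resolve_left ha
  refine ⟨ha, ?_⟩
  rw [ha, zero_smul, zero_add] at e
  -- Now `c` is the second component of a cocycle, but the cohomology with coefficients in
  -- `F₄ ⊕ F₄ w` is spanned by classes whose second component is zero.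
  obtain ⟨m', -, hm⟩ := GC.exists_of_map (φ := mulL r hr) hc e
  obtain ⟨b, hb⟩ := GC.exists_cl_eq_iterate h n _ hm
  rw [phi2_pow_one, ← map_smul, ← sub_eq_zero, ← map_sub, Prod.smul_mk, smul_zero, Prod.mk_sub_mk,
    sub_zero] at hb
  exact GC.proj_cl hb

end Tower

/-! ### Bases of the functions on `V` and `Q₈` -/

section Bases

theorem card_F4 : Fintype.card F4 = 4 := by
  rw [← Nat.card_eq_fintype_card, GaloisField.card 2 2 two_ne_zero]
  norm_num

/-- A polynomial of degree at most three that vanishes on `F₄` is zero. -/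
theorem F4_cubic_eq_zero {a b c e : F4} (h : ∀ w : F4, a + w * b + w ^ 2 * c + w ^ 3 * e = 0) :
    a = 0 ∧ b = 0 ∧ c = 0 ∧ e = 0 := by
  let p : Polynomial F4 := Polynomial.C e * Polynomial.X ^ 3 + Polynomial.C c * Polynomial.X ^ 2 +
    Polynomial.C b * Polynomial.X + Polynomial.C a
  have hp : p = 0 := by
    refine Polynomial.eq_zero_of_natDegree_lt_card_of_eval_eq_zero p (f := fun w : F4 => w)
      Function.injective_id (fun w => ?_) ?_
    · simp only [p, Polynomial.eval_add, Polynomial.eval_mul, Polynomial.eval_C,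
        Polynomial.eval_pow, Polynomial.eval_X]
      linear_combination h w
    · rw [card_F4]
      exact Nat.lt_succ_of_le Polynomial.natDegree_cubic_le
  have h0 := congrArg (fun q => Polynomial.coeff q 0) hp
  have h1 := congrArg (fun q => Polynomial.coeff q 1) hp
  have h2 := congrArg (fun q => Polynomial.coeff q 2) hp
  have h3 := congrArg (fun q => Polynomial.coeff q 3) hp
  simp [p, Polynomial.coeff_X, Polynomial.coeff_C] at h0 h1 h2 h3
  exact ⟨h0, h1, h2, h3⟩

theorem one_add_cube_self (a : F4) : 1 + (a ^ 3 + a * a ^ 2 + a ^ 2 * a + a ^ 3) = 1 := by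
  have two := two_F4
  linear_combination 2 * a ^ 3 * two

theorem one_add_cube_ne {a b : F4} (h : a ≠ b) :
    1 + (b ^ 3 + a * b ^ 2 + a ^ 2 * b + a ^ 3) = 0 := by
  have two := two_F4
  have ha := F4_pow_four a
  have hb := F4_pow_four b
  refine mul_left_cancel₀ (sub_ne_zero.2 h) ?_
  linear_combination ha - hb + (a - b) * two

variable {G : Type} [Group G] {r : G → F4}

theorem IsAdd.one (hr : IsAdd r) : r 1 = 0 := by
  have := hr 1 1
  rw [mul_one] at this
  simpa using this

/-- If `r` is a bijection from the group to `F₄`, then `1, r, r², r³` is a basis of the functions. -/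
def basisV (hr : IsAdd r) (hi : Function.Injective r) (hs : Function.Surjective r) :
    FunBasis G (Fin 4) 0 where
  β i x := ![1, r x, r x ^ 2, r x ^ 3] i
  c i j g := !![0, 0, 0, 0; r g, 0, 0, 0; r g ^ 2, 0, 0, 0; r g ^ 3, r g ^ 2, r g, 0] i j
  γ i y := ![1 + r y ^ 3, r y ^ 2, r y, 1] i
  β_mul i x g := by
    have two := two_F4
    fin_cases i <;> simp [Fin.sum_univ_four, hr x g]
    · linear_combination (r x * r g) * two
    · linear_combination (r x * r g ^ 2 + r x ^ 2 * r g) * two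
  β_one i := by fin_cases i <;> simp [hr.one]
  β_zero x := rfl
  sum_γ_self x := by
    rw [Fin.sum_univ_four]
    simp
    linear_combination one_add_cube_self (r x)
  sum_γ_ne x y h := by
    rw [Fin.sum_univ_four]
    simp
    linear_combination one_add_cube_ne fun h' => h (hi h')
  inj a h := by
    obtain ⟨h0, h1, h2, h3⟩ := F4_cubic_eq_zero (a := a 0) (b := a 1) (c := a 2) (e := a 3) (by
      intro w
      obtain ⟨x, rfl⟩ := hs w
      have := h x
      rw [Fin.sum_univ_four] at this
      simpa using this)
    intro i
    fin_cases i <;> assumption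

/-- Functions `r`, `t` on a group with the properties of the coordinates of the automorphisms
`(1, r, r², t)` in `Q₈`. -/
structure QCoord (r t : G → F4) : Prop where
  r_mul : IsAdd r
  t_mul : ∀ g h, t (g * h) = t g + t h + r g * r h ^ 2
  t_sq : ∀ g, t g ^ 2 + t g = r g ^ 3
  ext : ∀ g h, r g = r h → t g = t h → g = h
  surj : Function.Surjective r
  neg : ∃ c, r c = 0 ∧ t c = 1

variable {t : G → F4}

/-- The functions `rᵃ tᵇ` with `a ≤ 3`, `b ≤ 1` are a basis of the functions on `Q₈`. -/
def basisQ (q : QCoord r t) : FunBasis G (Fin 8) 0 where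
  β i x := ![1, r x, r x ^ 2, r x ^ 3, t x, r x * t x, r x ^ 2 * t x, r x ^ 3 * t x] i
  c i j g := !![0, 0, 0, 0, 0, 0, 0, 0;
    r g, 0, 0, 0, 0, 0, 0, 0;
    r g ^ 2, 0, 0, 0, 0, 0, 0, 0;
    r g ^ 3, r g ^ 2, r g, 0, 0, 0, 0, 0;
    t g, r g ^ 2, 0, 0, 0, 0, 0, 0;
    t g * r g, r g ^ 3 + t g, r g ^ 2, 0, r g, 0, 0, 0;
    t g * r g ^ 2, r g, t g, r g ^ 2, r g ^ 2, 0, 0, 0;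
    t g * r g ^ 3, t g * r g ^ 2, r g + t g * r g, r g ^ 3 + t g, r g ^ 3, r g ^ 2, r g, 0] i j
  γ i y := ![(1 + r y ^ 3) * (1 + t y), r y ^ 2 * (1 + t y), r y * (1 + t y), 1 + t y,
    1 + r y ^ 3, r y ^ 2, r y, 1] i
  β_mul i x g := by
    have two := two_F4
    have h4 := F4_pow_four (r g)
    have k4 := F4_pow_four (r x)
    fin_cases i <;> simp [Fin.sum_univ_eight, q.r_mul x g, q.t_mul x g]
    · linear_combination (r x * r g) * two
    · linear_combination (r x * r g ^ 2 + r x ^ 2 * r g) * two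
    · ring
    · ring
    · linear_combination r x * h4 + r x * r g * (t x + t g + r x * r g ^ 2) * two
    · linear_combination r g ^ 2 * k4 + r x ^ 2 * h4 + r x * r g * h4 + r x * r g ^ 2 * two +
        (r x ^ 2 * r g + r x * r g ^ 2) * (t x + t g + r x * r g ^ 2) * two
  β_one i := by
    have := q.t_mul 1 1
    have h1 := q.r_mul.one
    rw [mul_one, h1] at this
    have h2 : t 1 = 0 := by linear_combination -this
    fin_cases i <;> simp [h1, h2]
  β_zero x := rfl
  sum_γ_self x := by
    have two := two_F4
    rw [Fin.sum_univ_eight]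
    simp
    linear_combination (1 + 2 * t x) * one_add_cube_self (r x) + t x * two
  sum_γ_ne x y h := by
    have e : ∑ i, ![1, r x, r x ^ 2, r x ^ 3, t x, r x * t x, r x ^ 2 * t x, r x ^ 3 * t x] i *
        ![(1 + r y ^ 3) * (1 + t y), r y ^ 2 * (1 + t y), r y * (1 + t y), 1 + t y,
          1 + r y ^ 3, r y ^ 2, r y, 1] i =
        (1 + (r y ^ 3 + r x * r y ^ 2 + r x ^ 2 * r y + r x ^ 3)) * (1 + t y + t x) := by
      rw [Fin.sum_univ_eight]
      simp
      ring
    refine e.trans ?_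
    by_cases h1 : r x = r y
    · have h2 : t x - t y ≠ 0 := sub_ne_zero.2 fun h2 => h (q.ext x y h1 h2)
      have h3 : 1 + t y + t x = 0 := by
        refine mul_left_cancel₀ h2 ?_
        have hx := q.t_sq x
        have hy := q.t_sq y
        rw [h1] at hx
        linear_combination hx - hy
      rw [h3, mul_zero]
    · rw [one_add_cube_ne h1, zero_mul]
  inj a h := by
    obtain ⟨c, hc, hc'⟩ := q.neg
    have h' : ∀ w, ∃ z : F4, (a 0 + w * a 1 + w ^ 2 * a 2 + w ^ 3 * a 3 +
        z * (a 4 + w * a 5 + w ^ 2 * a 6 + w ^ 3 * a 7) = 0) ∧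
        (a 4 + w * a 5 + w ^ 2 * a 6 + w ^ 3 * a 7) = 0 := by
      intro w
      obtain ⟨x, rfl⟩ := q.surj w
      refine ⟨t x, ?_⟩
      -- Comparing the values at `x` and `x c`, where `c` is the central element with `t c = 1`,
      -- separates the part that involves `t`.
      have h1 := h x
      have h2 := h (x * c)
      rw [Fin.sum_univ_eight] at h1 h2
      simp [q.r_mul x c, q.t_mul x c, hc, hc'] at h1 h2
      exact ⟨by linear_combination h1, by linear_combination h2 - h1⟩
    choose z hz hz' using h'
    obtain ⟨h4, h5, h6, h7⟩ := F4_cubic_eq_zero hz'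
    obtain ⟨h0, h1, h2, h3⟩ := F4_cubic_eq_zero (a := a 0) (b := a 1) (c := a 2) (e := a 3)
      (fun w => by have := hz w; rw [hz' w, mul_zero, add_zero] at this; exact this)
    intro i
    fin_cases i <;> assumption

/-- For a bijection `r` to `F₄` the four-step tower consists of the cochains with values in the
functions on the group, so it is acyclic. -/
theorem X2_isResolution [Finite G] (hr : IsAdd r) (hi : Function.Injective r)
    (hs : Function.Surjective r) : (X2 hr).IsResolution ((1, 0), 0) := by
  have := Fintype.ofFinite G
  let b := basisV hr hi hs
  have h0 : ∀ y : Coch G F4, c1 (fun _ => 0) * y = 0 := fun y => by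
    have : c1 (fun _ : G => (0 : F4)) = 0 := map_zero (of (CochDeg G F4) 1)
    rw [this, zero_mul]
  have eq : ∀ x : (Coch G F4 × Coch G F4) × (Coch G F4 × Coch G F4), ∀ j,
      dF (![x.1.1, x.1.2, x.2.1, x.2.2] j) +
        ∑ i, c1 (b.c i j) * ![x.1.1, x.1.2, x.2.1, x.2.2] i =
      ![((X2 hr).d x).1.1, ((X2 hr).d x).1.2, ((X2 hr).d x).2.1, ((X2 hr).d x).2.2] j := by
    intro x j
    rw [Fin.sum_univ_four, X2_d]
    fin_cases j <;> simp [b, basisV, h0]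
    abel
  have hdeg : ∀ n, ∀ x ∈ (X2 hr).deg n, ∀ j, ![x.1.1, x.1.2, x.2.1, x.2.2] j ∈ cdeg F4 G F4 n := by
    intro n x hx j
    fin_cases j
    exacts [hx.1.1, hx.1.2, hx.2.1, hx.2.2]
  refine ⟨fun x hx => ?_, fun n x hx => ?_⟩
  · have hd := (GC.mem_Z.1 hx).2
    obtain ⟨a, ha⟩ := b.acyclic_zero _ (hdeg 0 x hx.1) fun j => by
      rw [eq, hd]
      fin_cases j <;> rfl
    refine ⟨a, Prod.ext (Prod.ext (ha 0) ?_) (Prod.ext ?_ ?_)⟩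
    · exact (ha 1).trans (smul_zero a).symm
    · exact (ha 2).trans (smul_zero a).symm
    · exact (ha 3).trans (smul_zero a).symm
  · have hd := (GC.mem_Z.1 hx).2
    obtain ⟨h, hh, e⟩ := b.acyclic _ (hdeg _ x hx.1) fun j => by
      rw [eq, hd]
      fin_cases j <;> rfl
    refine GC.cl_eq_zero.2 ⟨((h 0, h 1), (h 2, h 3)), ⟨⟨hh 0, hh 1⟩, ⟨hh 2, hh 3⟩⟩, ?_⟩
    have hv : h = ![h 0, h 1, h 2, h 3] := by
      funext i
      fin_cases i <;> rfl
    have e' := fun j => (eq ((h 0, h 1), (h 2, h 3)) j).symm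
    simp only [← hv, e] at e'
    exact Prod.ext (Prod.ext (e' 0) (e' 1)) (Prod.ext (e' 2) (e' 3))

end Bases

/-! ### The cohomology of the quaternion group -/

section Quaternion
variable {G : Type} {r t : G → F4}

/-- The `1`-cochain of `t r`. -/
abbrev cTR (r t : G → F4) : Coch G F4 := c1 fun g => t g * r g

/-- The `1`-cochain of `t r²`. -/
abbrev cTS (r t : G → F4) : Coch G F4 := c1 fun g => t g * r g ^ 2

/-- The `1`-cochain of `t r³`. -/
abbrev cTK (r t : G → F4) : Coch G F4 := c1 fun g => t g * r g ^ 3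

variable [Group G]

theorem d_cT (q : QCoord r t) : dF (c1 t) = c1 r * cS r := by
  rw [d_c1, c1_mul_c1]
  refine congrArg c2 (funext fun g => funext fun h => ?_)
  rw [q.t_mul]
  have two := two_F4
  linear_combination (t g + t h) * two

theorem d_cTR (q : QCoord r t) :
    dF (cTR r t) = c1 t * c1 r + c1 r * c1 t + cS r * cS r + c1 r * cK r := by
  rw [d_c1]
  simp only [c1_mul_c1, c2_add]
  refine congrArg c2 (funext fun g => funext fun h => ?_)
  rw [q.t_mul, q.r_mul]
  have two := two_F4
  linear_combination (t g * r g + t h * r h) * two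

theorem d_cTS (q : QCoord r t) :
    dF (cTS r t) = c1 t * cS r + cS r * c1 t + cK r * cS r + c1 r * c1 r := by
  rw [d_c1]
  simp only [c1_mul_c1, c2_add]
  refine congrArg c2 (funext fun g => funext fun h => ?_)
  rw [q.t_mul, q.r_mul]
  have two := two_F4
  have h4 := F4_pow_four (r h)
  linear_combination r g * h4 + (t g * r g ^ 2 + t h * r h ^ 2 + r g * r h * (t g + t h + r g * r h ^ 2)) * two

theorem d_cTK (q : QCoord r t) :
    dF (cTK r t) = c1 t * cK r + cTS r t * c1 r + cTR r t * cS r + cK r * c1 t + cS r * cTR r t +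
      c1 r * cTS r t + cK r * cK r + cS r * c1 r := by
  rw [d_c1]
  simp only [c1_mul_c1, c2_add]
  refine congrArg c2 (funext fun g => funext fun h => ?_)
  rw [q.t_mul, q.r_mul]
  have two := two_F4
  have h4 := F4_pow_four (r h)
  have k4 := F4_pow_four (r g)
  linear_combination r h ^ 2 * k4 + (3 * r g ^ 2 + r g * r h) * h4 +
    (t g * r g ^ 3 + t h * r h ^ 3 + (t g + t h) * (r g ^ 2 * r h + r g * r h ^ 2) +
      r g * r h ^ 2 + r g ^ 3 * r h ^ 3 + r g ^ 2 * r h) * two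

variable (q : QCoord r t)

/-- Left multiplication by the cocycle `w r² + t` with values in the functions on `V`, in the
coordinates with respect to `1, w, w², w³`; note that `w⁴ = w` as functions. -/
def phi3 : GC.Hom (X2 q.r_mul) (X2 q.r_mul) 1 where
  f :=
    { toFun := fun x =>
        ((c1 t * x.1.1 + cTR r t * x.1.2 + cTS r t * x.2.1 + cTK r t * x.2.2,
          cS r * x.1.1 + (cK r + c1 t) * x.1.2 + c1 r * x.2.1 + cTS r t * x.2.2),
         (cS r * x.1.2 + c1 t * x.2.1 + (c1 r + cTR r t) * x.2.2,
          cS r * x.2.1 + (cK r + c1 t) * x.2.2))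
      map_add' := fun x y => by
        simp only [Prod.fst_add, Prod.snd_add, mul_add, Prod.mk_add_mk]
        refine Prod.ext (Prod.ext ?_ ?_) (Prod.ext ?_ ?_) <;> dsimp only <;> abel
      map_smul' := fun a x => by
        simp [smul_add] }
  deg_mem n x hx := by
    obtain ⟨⟨h0, h1⟩, ⟨h2, h3⟩⟩ := hx
    have hm : ∀ (a : G → F4) {y : Coch G F4}, y ∈ cdeg F4 G F4 n → c1 a * y ∈ cdeg F4 G F4 (n + 1) :=
      fun a _ hy => c1_mul_mem a hy
    have hm' : ∀ (a b : G → F4) {y : Coch G F4}, y ∈ cdeg F4 G F4 n →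
        (c1 a + c1 b) * y ∈ cdeg F4 G F4 (n + 1) := fun a b y hy => by
      rw [add_mul]
      exact add_mem (hm _ hy) (hm _ hy)
    refine ⟨⟨?_, ?_⟩, ⟨?_, ?_⟩⟩
    · exact add_mem (add_mem (add_mem (hm _ h0) (hm _ h1)) (hm _ h2)) (hm _ h3)
    · exact add_mem (add_mem (add_mem (hm _ h0) (hm' _ _ h1)) (hm _ h2)) (hm _ h3)
    · exact add_mem (add_mem (hm _ h1) (hm _ h2)) (hm' _ _ h3)
    · exact add_mem (hm _ h2) (hm' _ _ h3)
  comm x := by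
    obtain ⟨⟨x0, x1⟩, ⟨x2, x3⟩⟩ := x
    rw [X2_d, X2_d]
    dsimp only [LinearMap.coe_mk, AddHom.coe_mk]
    refine Prod.ext (Prod.ext ?_ ?_) (Prod.ext ?_ ?_) <;>
    · refine eq_of_add_eq_zero_coch (k := F4) ?_
      simp only [map_add, d_mul_C, d_cR q.r_mul, d_cS q.r_mul, d_cK q.r_mul, d_cT q, d_cTR q, d_cTS q,
        d_cTK q, mul_add, add_mul, mul_assoc, zero_mul]
      abel_nf
      simp only [two_zsmul_C, add_zero]

theorem phi3_apply (x : (Coch G F4 × Coch G F4) × (Coch G F4 × Coch G F4)) :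
    (phi3 q).f x = ((c1 t * x.1.1 + cTR r t * x.1.2 + cTS r t * x.2.1 + cTK r t * x.2.2,
          cS r * x.1.1 + (cK r + c1 t) * x.1.2 + c1 r * x.2.1 + cTS r t * x.2.2),
         (cS r * x.1.2 + c1 t * x.2.1 + (c1 r + cTR r t) * x.2.2,
          cS r * x.2.1 + (cK r + c1 t) * x.2.2)) := rfl

/-- The cochains with values in the functions on `Q₈`. -/
abbrev X3 := (X2 q.r_mul).cone (phi3 q)

/-- The complex `X3` consists of the cochains with values in the functions on `Q₈`, so it is acyclic. -/
theorem X3_isResolution [Finite G] : (X3 q).IsResolution (((1, 0), 0), 0) := by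
  have := Fintype.ofFinite G
  let b := basisQ q
  let co (x : ((Coch G F4 × Coch G F4) × (Coch G F4 × Coch G F4)) ×
      ((Coch G F4 × Coch G F4) × (Coch G F4 × Coch G F4))) : Fin 8 → Coch G F4 :=
    ![x.1.1.1, x.1.1.2, x.1.2.1, x.1.2.2, x.2.1.1, x.2.1.2, x.2.2.1, x.2.2.2]
  have h0 : ∀ y : Coch G F4, c1 (fun _ => 0) * y = 0 := fun y => by
    have : c1 (fun _ : G => (0 : F4)) = 0 := map_zero (of (CochDeg G F4) 1)
    rw [this, zero_mul]
  have ext8 : ∀ x y, (∀ j, co x j = co y j) → x = y := fun x y h =>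
    Prod.ext (Prod.ext (Prod.ext (h 0) (h 1)) (Prod.ext (h 2) (h 3)))
      (Prod.ext (Prod.ext (h 4) (h 5)) (Prod.ext (h 6) (h 7)))
  have eq : ∀ x j, dF (co x j) + ∑ i, c1 (b.c i j) * co x i = co ((X3 q).d x) j := by
    intro x j
    rw [Fin.sum_univ_eight, GC.cone_d, X2_d, X2_d, phi3_apply]
    fin_cases j <;> simp [co, b, basisQ, h0, ← c1_add, add_mul] <;> abel
  have hdeg : ∀ n, ∀ x ∈ (X3 q).deg n, ∀ j, co x j ∈ cdeg F4 G F4 n := by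
    intro n x hx j
    fin_cases j
    exacts [hx.1.1.1, hx.1.1.2, hx.1.2.1, hx.1.2.2, hx.2.1.1, hx.2.1.2, hx.2.2.1, hx.2.2.2]
  have co0 : ∀ j, co 0 j = 0 := fun j => by fin_cases j <;> rfl
  refine ⟨fun x hx => ?_, fun n x hx => ?_⟩
  · obtain ⟨a, ha⟩ := b.acyclic_zero _ (hdeg 0 x hx.1) fun j => by
      rw [eq, (GC.mem_Z.1 hx).2, co0]
    refine ⟨a, ext8 _ _ fun j => ?_⟩
    rw [ha]
    fin_cases j <;> simp [co]
  · obtain ⟨h, hh, e⟩ := b.acyclic _ (hdeg _ x hx.1) fun j => by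
      rw [eq, (GC.mem_Z.1 hx).2, co0]
    refine GC.cl_eq_zero.2 ⟨(((h 0, h 1), (h 2, h 3)), ((h 4, h 5), (h 6, h 7))),
      ⟨⟨⟨hh 0, hh 1⟩, ⟨hh 2, hh 3⟩⟩, ⟨⟨hh 4, hh 5⟩, ⟨hh 6, hh 7⟩⟩⟩, ext8 _ _ fun j => ?_⟩
    have hv : h = co (((h 0, h 1), (h 2, h 3)), ((h 4, h 5), (h 6, h 7))) := by
      funext i
      fin_cases i <;> rfl
    rw [← eq, ← hv, e]

end Quaternion

/-! ### One period of the cohomology of `Q₈` -/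

section Stage
variable {G : Type} {r t : G → F4} [Group G] (q : QCoord r t)

/-- The powers of the cocycle `τ = w r² + t`, which generates the cohomology with coefficients in the
functions on `V`. -/
def tau (n : ℕ) : (Coch G F4 × Coch G F4) × (Coch G F4 × Coch G F4) :=
  ((phi3 q).f ^ n) ((1, 0), 0)

theorem tau_succ (n : ℕ) : tau q (n + 1) = (phi3 q).f (tau q n) := by
  rw [tau, tau, pow_succ', Module.End.mul_apply]

theorem tau_mem (n : ℕ) : tau q n ∈ (X2 q.r_mul).Z n :=
  GC.iterate_mem_Z (GC.incl_mem_Z (GC.incl_mem_Z one_mem_Z0)) n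

/-- The cohomology of `Q₈` with coefficients in the functions on `V`, which is that of `C₂`, is spanned
by `τⁿ` in degree `n`. -/
theorem exists_cl_eq_tau [Finite G] {n : ℕ} {x : (Coch G F4 × Coch G F4) × (Coch G F4 × Coch G F4)}
    (hx : x ∈ (X2 q.r_mul).Z n) : ∃ a : F4, (X2 q.r_mul).cl n x = a • (X2 q.r_mul).cl n (tau q n) :=
  GC.exists_cl_eq_iterate (X3_isResolution q) n x hx

theorem cl_tau_ne_zero [Finite G] (n : ℕ) : (X2 q.r_mul).cl n (tau q n) ≠ 0 :=
  GC.cl_iterate_ne_zero (X3_isResolution q) (GC.incl_mem_Z (GC.incl_mem_Z one_mem_Z0))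
    (fun h => one_ne_zero_C (Prod.mk.inj (Prod.mk.inj h).1).1) n

theorem phi2_e (hr : IsAdd r) (y : Coch G F4) : (phi2 hr).f (y, 0) = (cS r * y, 0) := by
  rw [phi2_apply]
  simp

/-- The stages of the computation of the cohomology of `Q₈`: a class `y` of degree `n` spans the
cohomology in this degree, also with coefficients in `F₄ ⊕ F₄ w`, and with coefficients in the
functions on `V` it is the power `τⁿ`. -/
structure IsStage (n : ℕ) (y : Coch G F4) : Prop where
  mem : y ∈ (X0 G).Z n
  cl_tau : (X2 q.r_mul).cl n ((y, 0), 0) = (X2 q.r_mul).cl n (tau q n)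
  span1 : ∀ m ∈ (X1 q.r_mul).Z n, ∃ a : F4, (X1 q.r_mul).cl n m = a • (X1 q.r_mul).cl n (y, 0)
  span0 : ∀ c ∈ (X0 G).Z n, ∃ a : F4, (X0 G).cl n c = a • (X0 G).cl n y

namespace IsStage
variable {q} {n : ℕ} {y : Coch G F4}

/-- The class `τ y` with coefficients in `F₄ ⊕ F₄ w`. -/
abbrev ty (r t : G → F4) (y : Coch G F4) : Coch G F4 × Coch G F4 := (c1 t * y, cS r * y)

theorem dy (s : IsStage q n y) : dF y = 0 := (mem_Z0.1 s.mem).2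

theorem S_mem (s : IsStage q n y) : cS r * y ∈ (X0 G).Z (n + 1) := (mulL _ q.r_mul.sq).mem_Z s.mem
theorem R_mem (s : IsStage q n y) : c1 r * y ∈ (X0 G).Z (n + 1) := (mulL _ q.r_mul).mem_Z s.mem
theorem SS_mem (s : IsStage q n y) : cS r * (cS r * y) ∈ (X0 G).Z (n + 2) := (mulL _ q.r_mul.sq).mem_Z s.S_mem
theorem RR_mem (s : IsStage q n y) : c1 r * (c1 r * y) ∈ (X0 G).Z (n + 2) := (mulL _ q.r_mul).mem_Z s.R_mem
theorem RRR_mem (s : IsStage q n y) : c1 r * (c1 r * (c1 r * y)) ∈ (X0 G).Z (n + 3) := (mulL _ q.r_mul).mem_Z s.RR_mem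
theorem e_mem (s : IsStage q n y) : (y, 0) ∈ (X1 q.r_mul).Z n := GC.incl_mem_Z s.mem
theorem e2_mem (s : IsStage q n y) : ((y, 0), 0) ∈ (X2 q.r_mul).Z n := GC.incl_mem_Z s.e_mem

theorem phi3_y : (phi3 q).f ((y, 0), 0) = (ty r t y, 0) := by
  rw [phi3_apply]
  simp

theorem phi3_phi3_y : (phi3 q).f ((phi3 q).f ((y, 0), 0)) =
    ((c1 t * (c1 t * y) + cTR r t * (cS r * y), cS r * (c1 t * y) + (cK r + c1 t) * (cS r * y)),
      (cS r * (cS r * y), 0)) := by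
  rw [phi3_y, phi3_apply]
  simp

theorem cl_tau1 (s : IsStage q n y) : (X2 q.r_mul).cl (n + 1) (ty r t y, 0) = (X2 q.r_mul).cl (n + 1) (tau q (n + 1)) := by
  rw [tau_succ, ← phi3_y]
  exact (phi3 q).cl_congr s.cl_tau

theorem cl_tau2 (s : IsStage q n y) : (X2 q.r_mul).cl (n + 2) ((phi3 q).f ((phi3 q).f ((y, 0), 0))) =
    (X2 q.r_mul).cl (n + 2) (tau q (n + 2)) := by
  rw [tau_succ, tau_succ]
  exact (phi3 q).cl_congr ((phi3 q).cl_congr s.cl_tau)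

theorem cl_tau3 (s : IsStage q n y) : (X2 q.r_mul).cl (n + 3) ((phi3 q).f ((phi3 q).f ((phi3 q).f ((y, 0), 0)))) =
    (X2 q.r_mul).cl (n + 3) (tau q (n + 3)) := by
  rw [tau_succ, tau_succ, tau_succ]
  exact (phi3 q).cl_congr ((phi3 q).cl_congr ((phi3 q).cl_congr s.cl_tau))

theorem ty_mem (s : IsStage q n y) : ty r t y ∈ (X1 q.r_mul).Z (n + 1) := by
  have := (phi3 q).mem_Z s.e2_mem
  rw [phi3_y] at this
  exact GC.mem_Z_of_incl this

theorem phi3_phi3_mem (s : IsStage q n y) : (phi3 q).f ((phi3 q).f ((y, 0), 0)) ∈ (X2 q.r_mul).Z (n + 2) :=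
  (phi3 q).mem_Z ((phi3 q).mem_Z s.e2_mem)

/-- The component of `τ³ y` that maps to the quotient is cohomologous to `h_{1,0}² τ y`. -/
theorem cl_tau3_snd (s : IsStage q n y) :
    (X1 q.r_mul).cl (n + 3) ((phi3 q).f ((phi3 q).f ((phi3 q).f ((y, 0), 0)))).2 =
      (X1 q.r_mul).cl (n + 3) ((phi2 q.r_mul).f ((phi2 q.r_mul).f (ty r t y))) := by
  -- This cochain bounds the difference.
  have hz : (cTS r t * (cS r * y) + c1 r * (c1 t * y), 0) ∈ (X1 q.r_mul).deg (n + 2) :=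
    ⟨add_mem (c1_mul_mem _ (c1_mul_mem _ s.mem.1)) (c1_mul_mem _ (c1_mul_mem _ s.mem.1)),
      zero_mem _⟩
  have e : ((phi3 q).f ((phi3 q).f ((phi3 q).f ((y, 0), 0)))).2 =
      (phi2 q.r_mul).f ((phi2 q.r_mul).f (ty r t y)) +
      (X1 q.r_mul).d (cTS r t * (cS r * y) + c1 r * (c1 t * y), 0) := by
    rw [phi3_phi3_y, phi3_apply, phi2_apply, phi2_apply, X1_d]
    refine Prod.ext ?_ ?_
    · refine eq_of_add_eq_zero_coch (k := F4) ?_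
      simp only [map_add, d_mul_C, d_cR q.r_mul, d_cS q.r_mul, d_cT q, d_cTS q, s.dy, mul_add,
        add_mul, mul_assoc, zero_mul, mul_zero, Prod.fst_add]
      abel_nf
      simp only [two_zsmul_C, add_zero]
    · simp
  rw [e, map_add, GC.cl_d hz, add_zero]

theorem cl_phi2_SS (s : IsStage q n y) : (X1 q.r_mul).cl (n + 3) ((phi2 q.r_mul).f (cS r * (cS r * y), 0)) = 0 := by
  have := GC.cl_map_proj s.phi3_phi3_mem
  rwa [phi3_phi3_y] at this

variable [Finite G]

theorem cl_y_ne_zero (s : IsStage q n y) : (X1 q.r_mul).cl n (y, 0) ≠ 0 := fun h =>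
  cl_tau_ne_zero q n (by rw [← s.cl_tau]; exact GC.incl_cl h)

theorem cl_y_ne_zero' (s : IsStage q n y) : (X0 G).cl n y ≠ 0 := fun h => s.cl_y_ne_zero (GC.incl_cl h)

/-- The kernel of `h_{1,0}` with coefficients in `F₄ ⊕ F₄ w` is spanned by a component of a power
of `τ`. -/
theorem ker_phi2 {k : ℕ} {m : Coch G F4 × Coch G F4} (hm : m ∈ (X1 q.r_mul).Z k)
    (h : (X1 q.r_mul).cl (k + 1) ((phi2 q.r_mul).f m) = 0) :
    ∃ a : F4, (X1 q.r_mul).cl k m = a • (X1 q.r_mul).cl k (tau q k).2 := by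
  obtain ⟨m', -, hm'⟩ := GC.exists_of_map hm h
  obtain ⟨a, ha⟩ := exists_cl_eq_tau q hm'
  exact ⟨a, GC.proj_cl_smul ha⟩

/-- The classes `τ y` and `h_{1,0} y` with coefficients in `F₄ ⊕ F₄ w` are independent. In the
functions on `V` only `τ y` survives. -/
theorem indep1 (s : IsStage q n y) {a b : F4} (h : a • (X1 q.r_mul).cl (n + 1) (ty r t y) +
    b • (X1 q.r_mul).cl (n + 1) (cS r * y, 0) = 0) : a = 0 ∧ b = 0 := by
  have h1 : (X2 q.r_mul).cl (n + 1) ((cS r * y, 0), 0) = 0 := by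
    rw [← phi2_e q.r_mul]
    exact GC.incl_map s.e_mem
  have h2 : a • (X2 q.r_mul).cl (n + 1) (ty r t y, 0) +
      b • (X2 q.r_mul).cl (n + 1) ((cS r * y, 0), 0) = 0 :=
    (GC.incl (phi2 q.r_mul)).cl_smul_add_eq_zero h
  rw [h1, smul_zero, add_zero, s.cl_tau1] at h2
  have ha := (smul_eq_zero.1 h2).resolve_right (cl_tau_ne_zero q _)
  refine ⟨ha, ?_⟩
  rw [ha, zero_smul, zero_add] at h
  by_contra hb
  have h3 := (smul_eq_zero.1 h).resolve_left hb
  rw [← phi2_e q.r_mul] at h3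
  obtain ⟨c, hc⟩ := ker_phi2 s.e_mem h3
  have h4 : (X1 q.r_mul).cl n (0 : Coch G F4 × Coch G F4) = (X1 q.r_mul).cl n (tau q n).2 :=
    (GC.proj _).cl_congr s.cl_tau
  rw [← h4, map_zero, smul_zero] at hc
  exact s.cl_y_ne_zero hc

/-- The classes `τ y` and `h_{1,0} y` span the cohomology with coefficients in `F₄ ⊕ F₄ w` in
degree `n + 1`. -/
theorem span1_1 (s : IsStage q n y) {m : Coch G F4 × Coch G F4} (hm : m ∈ (X1 q.r_mul).Z (n + 1)) :
    ∃ a b : F4, (X1 q.r_mul).cl (n + 1) m = a • (X1 q.r_mul).cl (n + 1) (ty r t y) +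
      b • (X1 q.r_mul).cl (n + 1) (cS r * y, 0) := by
  obtain ⟨a, ha⟩ := exists_cl_eq_tau q (GC.incl_mem_Z hm)
  rw [← s.cl_tau1] at ha
  obtain ⟨m', hm', e⟩ := GC.exists_of_incl_eq ha
  obtain ⟨b, hb⟩ := s.span1 m' hm'
  have := (phi2 q.r_mul).cl_smul hb
  rw [phi2_e] at this
  exact ⟨a, b, by rw [e, this]⟩

/-- The classes `h_{1,0} τ y` and `h_{1,0}² y` with coefficients in `F₄ ⊕ F₄ w` are independent, as
the component of `τⁿ⁺¹` that controls the kernel of `h_{1,0}` is zero. -/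
theorem indep2 (s : IsStage q n y) {a b : F4}
    (h : a • (X1 q.r_mul).cl (n + 2) ((phi2 q.r_mul).f (ty r t y)) +
      b • (X1 q.r_mul).cl (n + 2) (cS r * (cS r * y), 0) = 0) : a = 0 ∧ b = 0 := by
  have h' : (X1 q.r_mul).cl (n + 2)
      ((phi2 q.r_mul).f (a • ty r t y + b • (cS r * y, 0))) = 0 := by
    rw [map_add, map_smul, map_smul, map_add, map_smul, map_smul, phi2_e]
    exact h
  obtain ⟨c, hc⟩ := ker_phi2 (add_mem (Submodule.smul_mem _ a s.ty_mem)
    (Submodule.smul_mem _ b (GC.incl_mem_Z s.S_mem))) h'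
  have h4 : (X1 q.r_mul).cl (n + 1) (0 : Coch G F4 × Coch G F4) =
      (X1 q.r_mul).cl (n + 1) (tau q (n + 1)).2 := (GC.proj _).cl_congr s.cl_tau1
  rw [← h4, map_zero, smul_zero, map_add, map_smul, map_smul] at hc
  exact s.indep1 hc

/-- The classes `h_{1,0} τ y` and `h_{1,0}² y` span the cohomology with coefficients in `F₄ ⊕ F₄ w` in
degree `n + 2`. The class `τⁿ⁺²` does not contribute: it maps to the nonzero class `h_{1,0}² y`. -/
theorem span1_2 (s : IsStage q n y) {m : Coch G F4 × Coch G F4} (hm : m ∈ (X1 q.r_mul).Z (n + 2)) :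
    ∃ a b : F4, (X1 q.r_mul).cl (n + 2) m =
      a • (X1 q.r_mul).cl (n + 2) ((phi2 q.r_mul).f (ty r t y)) +
      b • (X1 q.r_mul).cl (n + 2) (cS r * (cS r * y), 0) := by
  obtain ⟨a, ha⟩ := exists_cl_eq_tau q (GC.incl_mem_Z hm)
  rw [← s.cl_tau2, phi3_phi3_y] at ha
  have h0 := GC.proj_cl_smul ha
  have ha0 : a = 0 := by
    refine (s.indep2 (a := 0) (b := a) ?_).2
    rw [← h0, map_zero, zero_smul, add_zero]
  rw [ha0, zero_smul] at ha
  obtain ⟨m', hm', e⟩ := GC.exists_of_incl ha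
  obtain ⟨a, b, hab⟩ := s.span1_1 hm'
  have := (phi2 q.r_mul).cl_smul_add hab
  rw [phi2_e] at this
  exact ⟨a, b, by rw [e, this]⟩

/-- The class `h_{1,0}² τ y` with coefficients in `F₄ ⊕ F₄ w` is not zero, because the kernel of
`h_{1,0}` in degree `n + 2` is spanned by `h_{1,0}² y`. -/
theorem cl_ne_zero3 (s : IsStage q n y) :
    (X1 q.r_mul).cl (n + 3) ((phi2 q.r_mul).f ((phi2 q.r_mul).f (ty r t y))) ≠ 0 := fun h => by
  obtain ⟨a, ha⟩ := ker_phi2 ((phi2 q.r_mul).mem_Z s.ty_mem) h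
  have h4 : (X1 q.r_mul).cl (n + 2) (cS r * (cS r * y), 0) =
      (X1 q.r_mul).cl (n + 2) (tau q (n + 2)).2 := by
    have h5 := s.cl_tau2
    rw [phi3_phi3_y] at h5
    exact (GC.proj _).cl_congr h5
  rw [← h4, ← sub_eq_zero, sub_eq_add_neg, ← neg_smul] at ha
  have := (s.indep2 (a := 1) (b := -a) (by rw [one_smul]; exact ha)).1
  exact one_ne_zero this

/-- The class `h_{1,0}² τ y` spans the cohomology with coefficients in `F₄ ⊕ F₄ w` in degree `n + 3`.
The class `τⁿ⁺³` does not contribute: it maps to `h_{1,0}² τ y`. -/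
theorem span1_3 (s : IsStage q n y) {m : Coch G F4 × Coch G F4} (hm : m ∈ (X1 q.r_mul).Z (n + 3)) :
    ∃ a : F4, (X1 q.r_mul).cl (n + 3) m =
      a • (X1 q.r_mul).cl (n + 3) ((phi2 q.r_mul).f ((phi2 q.r_mul).f (ty r t y))) := by
  obtain ⟨a, ha⟩ := exists_cl_eq_tau q (GC.incl_mem_Z hm)
  rw [← s.cl_tau3] at ha
  have h0 : (X1 q.r_mul).cl (n + 3) (0 : Coch G F4 × Coch G F4) = _ := GC.proj_cl_smul ha
  rw [s.cl_tau3_snd, map_zero] at h0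
  have ha0 : a = 0 := (smul_eq_zero.1 h0.symm).resolve_right s.cl_ne_zero3
  rw [ha0, zero_smul] at ha
  obtain ⟨m', hm', e⟩ := GC.exists_of_incl ha
  obtain ⟨a, b, hab⟩ := s.span1_2 hm'
  have := (phi2 q.r_mul).cl_smul_add hab
  rw [s.cl_phi2_SS, smul_zero, add_zero] at this
  exact ⟨a, by rw [e, this]⟩

/-- In degree `n + 4` the cohomology with coefficients in `F₄ ⊕ F₄ w` injects into that with coefficients
in the functions on `V`, because `h_{1,0}` annihilates the degree `n + 3`. -/
theorem inj1_4 (s : IsStage q n y) {m : Coch G F4 × Coch G F4}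
    (h : (X2 q.r_mul).cl (n + 4) (m, 0) = 0) : (X1 q.r_mul).cl (n + 4) m = 0 := by
  obtain ⟨m', hm', e⟩ := GC.exists_of_incl h
  obtain ⟨a, ha⟩ := s.span1_3 hm'
  have h1 := (phi2 q.r_mul).cl_smul ha
  have h2 := GC.cl_map_proj ((phi3 q).mem_Z s.phi3_phi3_mem)
  have h3 := (phi2 q.r_mul).cl_congr s.cl_tau3_snd
  rw [← h3, h2, smul_zero] at h1
  rw [e, h1]

/-- The class `τⁿ⁺⁴` comes from the cohomology with coefficients in `F₄ ⊕ F₄ w`. -/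
theorem exists1_4 (s : IsStage q n y) : ∃ m ∈ (X1 q.r_mul).Z (n + 4),
    (X2 q.r_mul).cl (n + 4) (m, 0) = (X2 q.r_mul).cl (n + 4) (tau q (n + 4)) := by
  have hx : (tau q (n + 4)).2 ∈ (X1 q.r_mul).Z (n + 4) := GC.proj_mem_Z (tau_mem q (n + 4))
  -- The second component of `τⁿ⁺⁴`, as a class with coefficients in the functions on `V`, is a multiple
  -- of `τⁿ⁺⁴`. Either the multiple is zero and exactness applies, or the component itself can be scaled.
  obtain ⟨a, ha⟩ := exists_cl_eq_tau q (GC.incl_mem_Z hx)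
  by_cases h : a = 0
  · rw [h, zero_smul] at ha
    exact GC.exists_of_proj (tau_mem q (n + 4)) (s.inj1_4 ha)
  · refine ⟨a⁻¹ • (tau q (n + 4)).2, Submodule.smul_mem _ _ hx, ?_⟩
    have := congrArg (fun z => a⁻¹ • z) ha
    simp only [smul_smul, inv_mul_cancel₀ h, one_smul] at this
    rw [← this, ← map_smul]
    exact congrArg _ (Prod.ext rfl (smul_zero _).symm)

end IsStage
end Stage

section StageClasses
variable {G : Type} {r t : G → F4} [Group G] {q : QCoord r t}

namespace IsStage
variable {n : ℕ} {y : Coch G F4}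

/-- The relation `h_{1,0} h_{1,1} = 0`. -/
theorem cl_RS (q : QCoord r t) {n : ℕ} {z : Coch G F4} (hz : z ∈ (X0 G).Z n) :
    (X0 G).cl (n + 2) (c1 r * (cS r * z)) = 0 := by
  refine GC.cl_eq_zero.2 ⟨c1 t * z, c1_mul_mem _ hz.1, ?_⟩
  change dF _ = _
  rw [d_mul_C, d_cT q, (mem_Z0.1 hz).2, mul_zero, add_zero, mul_assoc]

/-- The relation `h_{1,0}³ = h_{1,1}³`. -/
theorem cl_SSS (q : QCoord r t) {n : ℕ} {z : Coch G F4} (hz : z ∈ (X0 G).Z n) :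
    (X0 G).cl (n + 3) (cS r * (cS r * (cS r * z))) =
      (X0 G).cl (n + 3) (c1 r * (c1 r * (c1 r * z))) := by
  rw [← sub_eq_zero, ← map_sub, GC.cl_eq_zero]
  refine ⟨cTR r t * (cS r * z) + c1 t * (c1 t * z) + c1 r * (cTS r t * z),
    add_mem (add_mem (c1_mul_mem _ (c1_mul_mem _ hz.1)) (c1_mul_mem _ (c1_mul_mem _ hz.1)))
      (c1_mul_mem _ (c1_mul_mem _ hz.1)), ?_⟩
  change dF _ = _
  refine eq_of_add_eq_zero_coch (k := F4) ?_
  simp only [map_add, d_mul_C, d_cR q.r_mul, d_cS q.r_mul, d_cT q, d_cTR q, d_cTS q,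
    (mem_Z0.1 hz).2, mul_add, add_mul, mul_assoc, zero_mul, mul_zero]
  abel_nf
  simp only [two_zsmul_C, add_zero]

theorem mem_X1_Z_of {k : ℕ} {c : Coch G F4} (hr : IsAdd r) (hc : c ∈ (X0 G).Z k)
    (h : (X0 G).cl (k + 1) (c1 r * c) = 0) : ∃ m', (m', c) ∈ (X1 hr).Z k := by
  obtain ⟨m', -, h⟩ := GC.exists_of_map (φ := mulL r hr) hc h
  exact ⟨m', h⟩

variable [Finite G] (s : IsStage q n y)
include s

theorem cl_S_ne_zero : (X0 G).cl (n + 1) (cS r * y) ≠ 0 := fun h =>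
  one_ne_zero (s.indep1 (a := 0) (b := 1) (by rw [zero_smul, one_smul, GC.incl_cl h, zero_add])).2

theorem cl_SS_ne_zero : (X0 G).cl (n + 2) (cS r * (cS r * y)) ≠ 0 := fun h =>
  one_ne_zero (s.indep2 (a := 0) (b := 1) (by rw [zero_smul, one_smul, GC.incl_cl h, zero_add])).2

/-- The classes `h_{1,0} y` and `h_{1,1} y` span the cohomology in degree `n + 1`. The class `τ y` does
not contribute: its component along `w` is the nonzero class `h_{1,0} y`. -/
theorem span0_1 {c : Coch G F4} (hc : c ∈ (X0 G).Z (n + 1)) : ∃ a b : F4,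
    (X0 G).cl (n + 1) c = a • (X0 G).cl (n + 1) (cS r * y) + b • (X0 G).cl (n + 1) (c1 r * y) := by
  obtain ⟨a, b, e⟩ := s.span1_1 (GC.incl_mem_Z hc)
  have e1 := GC.proj_cl_smul_add e
  have ha : a = 0 := by
    refine (smul_eq_zero.1 (?_ : a • (X0 G).cl (n + 1) (cS r * y) = 0)).resolve_right s.cl_S_ne_zero
    rw [map_zero, smul_zero, add_zero] at e1
    exact e1.symm
  rw [ha, zero_smul, zero_add] at e
  obtain ⟨c', hc', e2⟩ := GC.exists_of_incl_eq e
  obtain ⟨a', ha'⟩ := s.span0 c' hc'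
  have := (mulL r q.r_mul).cl_smul ha'
  exact ⟨b, a', by rw [e2, this]; rfl⟩

/-- The classes `h_{1,0} y` and `h_{1,1} y` are independent. With coefficients in `F₄ ⊕ F₄ w` only
`h_{1,0} y` survives, and `h_{1,1}` is injective in degree `n`. -/
theorem indep0_1 {a b : F4} (h : a • (X0 G).cl (n + 1) (cS r * y) +
    b • (X0 G).cl (n + 1) (c1 r * y) = 0) : a = 0 ∧ b = 0 := by
  have h1 : a • (X1 q.r_mul).cl (n + 1) (cS r * y, 0) +
    b • (X1 q.r_mul).cl (n + 1) (c1 r * y, 0) = 0 := (GC.incl (mulL r q.r_mul)).cl_smul_add_eq_zero h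
  have h2 : (X1 q.r_mul).cl (n + 1) (c1 r * y, 0) = 0 := GC.incl_map (φ := mulL r q.r_mul) s.mem
  rw [h2, smul_zero, add_zero] at h1
  have ha : a = 0 := (s.indep1 (a := 0) (b := a) (by rw [zero_smul, zero_add, h1])).2
  refine ⟨ha, ?_⟩
  rw [ha, zero_smul, zero_add] at h
  by_contra hb
  obtain ⟨m', hm'⟩ := mem_X1_Z_of q.r_mul s.mem ((smul_eq_zero.1 h).resolve_left hb)
  obtain ⟨c, hc⟩ := s.span1 _ hm'
  have := GC.proj_cl_smul hc
  rw [map_zero, smul_zero] at this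
  exact s.cl_y_ne_zero' this

/-- The classes `h_{1,0}² y` and `h_{1,1}² y` span the cohomology in degree `n + 2`. -/
theorem span0_2 {c : Coch G F4} (hc : c ∈ (X0 G).Z (n + 2)) : ∃ a b : F4,
    (X0 G).cl (n + 2) c = a • (X0 G).cl (n + 2) (cS r * (cS r * y)) +
      b • (X0 G).cl (n + 2) (c1 r * (c1 r * y)) := by
  obtain ⟨a, b, e⟩ := s.span1_2 (GC.incl_mem_Z hc)
  have e1 := GC.proj_cl_smul_add e
  have ha : a = 0 := by
    refine (smul_eq_zero.1 (?_ : a • (X0 G).cl (n + 2) (cS r * (cS r * y)) = 0)).resolve_right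
      s.cl_SS_ne_zero
    rw [map_zero, smul_zero, add_zero] at e1
    exact e1.symm
  rw [ha, zero_smul, zero_add] at e
  obtain ⟨c', hc', e2⟩ := GC.exists_of_incl_eq e
  obtain ⟨a', b', hab⟩ := s.span0_1 hc'
  have := (mulL r q.r_mul).cl_smul_add hab
  have h0 : (X0 G).cl (n + 2) ((mulL r q.r_mul).f (cS r * y)) = 0 := cl_RS q s.mem
  rw [h0, smul_zero, zero_add] at this
  exact ⟨b, b', by rw [e2, this]; rfl⟩

/-- The classes `h_{1,0}² y` and `h_{1,1}² y` are independent. The kernel of `h_{1,1}` in degree `n + 1`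
is spanned by `h_{1,0} y`. -/
theorem indep0_2 {a b : F4} (h : a • (X0 G).cl (n + 2) (cS r * (cS r * y)) +
    b • (X0 G).cl (n + 2) (c1 r * (c1 r * y)) = 0) : a = 0 ∧ b = 0 := by
  have h1 : a • (X1 q.r_mul).cl (n + 2) (cS r * (cS r * y), 0) +
    b • (X1 q.r_mul).cl (n + 2) (c1 r * (c1 r * y), 0) = 0 :=
    (GC.incl (mulL r q.r_mul)).cl_smul_add_eq_zero h
  have h2 : (X1 q.r_mul).cl (n + 2) (c1 r * (c1 r * y), 0) = 0 :=
    GC.incl_map (φ := mulL r q.r_mul) s.R_mem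
  rw [h2, smul_zero, add_zero] at h1
  have ha : a = 0 := (s.indep2 (a := 0) (b := a) (by rw [zero_smul, zero_add, h1])).2
  refine ⟨ha, ?_⟩
  rw [ha, zero_smul, zero_add] at h
  by_contra hb
  obtain ⟨m', hm'⟩ := mem_X1_Z_of q.r_mul s.R_mem ((smul_eq_zero.1 h).resolve_left hb)
  obtain ⟨c, c', hc⟩ := s.span1_1 hm'
  have := GC.proj_cl_smul_add hc
  rw [map_zero, smul_zero, add_zero, ← sub_eq_zero, sub_eq_add_neg, ← neg_smul] at this
  exact one_ne_zero (s.indep0_1 (a := -c) (b := 1) (by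
    rw [one_smul]; exact (add_comm _ _).trans this)).2

/-- The class `h_{1,1}³ y` is not zero, because the kernel of `h_{1,1}` in degree `n + 2` is spanned by
`h_{1,0}² y`. -/
theorem cl_RRR_ne_zero : (X0 G).cl (n + 3) (c1 r * (c1 r * (c1 r * y))) ≠ 0 := fun h => by
  obtain ⟨m', hm'⟩ := mem_X1_Z_of q.r_mul s.RR_mem h
  obtain ⟨c, c', hc⟩ := s.span1_2 hm'
  have := GC.proj_cl_smul_add hc
  rw [map_zero, smul_zero, add_zero, ← sub_eq_zero, sub_eq_add_neg, ← neg_smul] at this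
  exact one_ne_zero (s.indep0_2 (a := -c) (b := 1) (by
    rw [one_smul]; exact (add_comm _ _).trans this)).2

/-- The class `h_{1,1}³ y` spans the cohomology in degree `n + 3`. -/
theorem span0_3 {c : Coch G F4} (hc : c ∈ (X0 G).Z (n + 3)) : ∃ a : F4,
    (X0 G).cl (n + 3) c = a • (X0 G).cl (n + 3) (c1 r * (c1 r * (c1 r * y))) := by
  obtain ⟨a, e⟩ := s.span1_3 (GC.incl_mem_Z hc)
  have e1 := GC.proj_cl_smul e
  have ha : a = 0 := by
    refine (smul_eq_zero.1 (?_ : a • (X0 G).cl (n + 3) (cS r * (cS r * (cS r * y))) = 0)).resolve_right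
      (by rw [cl_SSS q s.mem]; exact s.cl_RRR_ne_zero)
    rw [map_zero] at e1
    exact e1.symm
  rw [ha, zero_smul] at e
  obtain ⟨c', hc', e2⟩ := GC.exists_of_incl e
  obtain ⟨a', b', hab⟩ := s.span0_2 hc'
  have := (mulL r q.r_mul).cl_smul_add hab
  have h0 : (X0 G).cl (n + 3) ((mulL r q.r_mul).f (cS r * (cS r * y))) = 0 := cl_RS q s.S_mem
  rw [h0, smul_zero, zero_add] at this
  exact ⟨b', by rw [e2, this]; rfl⟩

/-- In degree `n + 4` the cohomology injects into that with coefficients in `F₄ ⊕ F₄ w`, because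
`h_{1,1}⁴ y = h_{1,1} h_{1,0}³ y = 0`. -/
theorem inj0_4 {c : Coch G F4} (h : (X1 q.r_mul).cl (n + 4) (c, 0) = 0) :
    (X0 G).cl (n + 4) c = 0 := by
  obtain ⟨c', hc', e2⟩ := GC.exists_of_incl h
  obtain ⟨a', ha'⟩ := s.span0_3 hc'
  rw [← cl_SSS q s.mem] at ha'
  have := (mulL r q.r_mul).cl_smul ha'
  have h0 : (X0 G).cl (n + 4) ((mulL r q.r_mul).f (cS r * (cS r * (cS r * y)))) = 0 :=
    cl_RS q s.SS_mem
  rw [h0, smul_zero] at this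
  rw [e2, this]

/-- A class of degree `n + 4` that becomes `τ^(n + 4)` is a stage of the computation. -/
theorem next_of_cl {y' : Coch G F4} (hy : y' ∈ (X0 G).Z (n + 4))
    (h : (X2 q.r_mul).cl (n + 4) ((y', 0), 0) = (X2 q.r_mul).cl (n + 4) (tau q (n + 4))) :
    IsStage q (n + 4) y' := by
  have h1 : ∀ m ∈ (X1 q.r_mul).Z (n + 4), ∃ a : F4,
      (X1 q.r_mul).cl (n + 4) m = a • (X1 q.r_mul).cl (n + 4) (y', 0) := by
    intro m hm
    obtain ⟨a, ha⟩ := exists_cl_eq_tau q (GC.incl_mem_Z hm)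
    rw [← h] at ha
    refine ⟨a, ?_⟩
    rw [← sub_eq_zero, ← map_smul, ← map_sub]
    refine s.inj1_4 ?_
    rw [← sub_eq_zero, ← map_smul, ← map_sub] at ha
    convert ha using 2
    exact Prod.ext rfl (by simp)
  refine ⟨hy, h, h1, fun c hc => ?_⟩
  obtain ⟨a, ha⟩ := h1 _ (GC.incl_mem_Z hc)
  refine ⟨a, ?_⟩
  rw [← sub_eq_zero, ← map_smul, ← map_sub]
  refine s.inj0_4 ?_
  rw [← sub_eq_zero, ← map_smul, ← map_sub] at ha
  convert ha using 2
  exact Prod.ext rfl (by simp)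

/-- The computation is periodic with period four: `τⁿ⁺⁴` comes from a class with trivial coefficients. -/
theorem exists_next : ∃ y', IsStage q (n + 4) y' := by
  obtain ⟨m, hm, e⟩ := s.exists1_4
  -- Let `m` with coefficients in `F₄ ⊕ F₄ w` become `τⁿ⁺⁴`. Its component along `w` is, with
  -- coefficients in `F₄ ⊕ F₄ w`, a multiple of `m` but has no component along `w` itself.
  have hm2 : (X0 G).cl (n + 4) m.2 = 0 := by
    have h2 : m.2 ∈ (X0 G).Z (n + 4) := GC.proj_mem_Z hm
    obtain ⟨a, ha⟩ := exists_cl_eq_tau q (GC.incl_mem_Z (φ := phi2 q.r_mul)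
      (GC.incl_mem_Z (φ := mulL r q.r_mul) h2))
    have ha' : (X1 q.r_mul).cl (n + 4) (m.2, 0) = a • (X1 q.r_mul).cl (n + 4) m := by
      rw [← e] at ha
      rw [← sub_eq_zero, ← map_smul, ← map_sub]
      refine s.inj1_4 ?_
      rw [← sub_eq_zero, ← map_smul, ← map_sub] at ha
      convert ha using 2
      exact Prod.ext rfl (by simp)
    have h3 := GC.proj_cl_smul ha'
    rw [map_zero] at h3
    rcases smul_eq_zero.1 h3.symm with h | h
    · rw [h, zero_smul] at ha'
      exact s.inj0_4 ha'
    · exact h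
  obtain ⟨y', hy', e'⟩ := GC.exists_of_proj hm hm2
  refine ⟨y', s.next_of_cl hy' ?_⟩
  rw [← e]
  exact (GC.incl (phi2 q.r_mul)).cl_congr e'

end IsStage

/-- Right multiplication by a cocycle on the cochains with values in the functions on `V`. -/
def mulR2 (hr : IsAdd r) {p : ℕ} (c : Coch G F4) (hc : c ∈ (X0 G).Z p) : GC.Hom (X2 hr) (X2 hr) p :=
  GC.coneMap (phi2 hr) (GC.coneMap (mulL r hr) (mulR c hc) fun x => mul_assoc (c1 r) x c) fun x => by
    refine Prod.ext ?_ ?_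
    · change (cS r * x.1 + cK r * x.2) * c = cS r * (x.1 * c) + cK r * (x.2 * c)
      rw [add_mul, mul_assoc, mul_assoc]
    · exact mul_assoc (cS r) x.2 c

theorem mulR2_apply (hr : IsAdd r) {p : ℕ} (c : Coch G F4) (hc : c ∈ (X0 G).Z p)
    (x : (Coch G F4 × Coch G F4) × (Coch G F4 × Coch G F4)) : (mulR2 hr c hc).f x =
      ((x.1.1 * c, x.1.2 * c), (x.2.1 * c, x.2.2 * c)) := rfl

theorem mulR2_phi3 (q : QCoord r t) {p : ℕ} (c : Coch G F4) (hc : c ∈ (X0 G).Z p)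
    (x : (Coch G F4 × Coch G F4) × (Coch G F4 × Coch G F4)) :
    (mulR2 q.r_mul c hc).f ((phi3 q).f x) = (phi3 q).f ((mulR2 q.r_mul c hc).f x) := by
  simp only [mulR2_apply, phi3_apply, add_mul, mul_assoc]

variable [Finite G]

theorem isStage_one (q : QCoord r t) : IsStage q 0 1 where
  mem := one_mem_Z0
  cl_tau := rfl
  span1 m hm := by
    obtain ⟨a, ha⟩ := exists_cl_eq_tau q (GC.incl_mem_Z hm)
    refine ⟨a, ?_⟩
    rw [← map_smul, ← sub_eq_zero, ← map_sub, GC.cl_zero_eq_zero] at ha ⊢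
    exact (Prod.mk.inj ha).1
  span0 c hc := by
    obtain ⟨a, ha⟩ := exists_smul_one_of_mem_Z0 hc
    exact ⟨a, by rw [ha, map_smul]⟩

/-- The powers of a class of degree four that becomes `τ⁴`. -/
theorem isStage_pow {g : Coch G F4} (hg : IsStage q 4 g) (k : ℕ) : IsStage q (4 * k) (g ^ k) := by
  induction k with
  | zero => exact isStage_one q
  | succ k ih =>
    rw [pow_succ]
    refine ih.next_of_cl ((mulR g hg.mem).mem_Z ih.mem) ?_
    have h1 := (mulR2 q.r_mul g hg.mem).cl_congr ih.cl_tau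
    -- Right multiplication by `g` commutes with left multiplication by `τ`, and sends `1` to `τ⁴`.
    have h2 : ∀ m : ℕ, (X2 q.r_mul).cl (m + 4) ((mulR2 q.r_mul g hg.mem).f (tau q m)) =
        (X2 q.r_mul).cl (m + 4) (tau q (m + 4)) := by
      intro m
      induction m with
      | zero =>
        rw [← hg.cl_tau]
        refine congrArg _ ?_
        rw [mulR2_apply, tau]
        simp
      | succ m ihm =>
        have e : m + 1 + 4 = m + 4 + 1 := by omega
        rw [e, tau_succ, tau_succ, mulR2_phi3]
        exact (phi3 q).cl_congr ihm
    rw [← h2, ← h1, mulR2_apply]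
    simp only [zero_mul]
    rfl

end StageClasses

/-! ### The cohomology ring -/

section Components
variable {k G A : Type} [CommRing k] [AddCommGroup A] [Module k A]

/-- The homogeneous component of degree `n` of a cochain. -/
def cproj (k G A : Type) [CommRing k] [AddCommGroup A] [Module k A] (n : ℕ) :
    Coch G A →ₗ[k] Coch G A :=
  DirectSum.lof k ℕ (CochDeg G A) n ∘ₗ DirectSum.component k ℕ (CochDeg G A) n

theorem cproj_of_self (n : ℕ) (f : CochDeg G A n) :
    cproj k G A n (of (CochDeg G A) n f) = of (CochDeg G A) n f := by
  change of (CochDeg G A) n (of (CochDeg G A) n f n) = _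
  rw [DirectSum.of_eq_same]

theorem cproj_of_of_ne {m n : ℕ} (h : m ≠ n) (f : CochDeg G A m) :
    cproj k G A n (of (CochDeg G A) m f) = 0 := by
  change of (CochDeg G A) n (of (CochDeg G A) m f n) = _
  rw [DirectSum.of_eq_of_ne _ _ _ (Ne.symm h), map_zero]

theorem cproj_mem (n : ℕ) (x : Coch G A) : cproj k G A n x ∈ cdeg k G A n := of_mem_cdeg _ _

theorem cproj_of_mem {n : ℕ} {x : Coch G A} (hx : x ∈ cdeg k G A n) : cproj k G A n x = x := by
  obtain ⟨f, rfl⟩ := exists_of_mem_cdeg hx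
  exact cproj_of_self n f

theorem cproj_of_mem_ne {m n : ℕ} (h : m ≠ n) {x : Coch G A} (hx : x ∈ cdeg k G A m) :
    cproj k G A n x = 0 := by
  obtain ⟨f, rfl⟩ := exists_of_mem_cdeg hx
  exact cproj_of_of_ne h f

variable [Group G]

theorem cproj_succ_d (ρ : Representation k G A) (n : ℕ) (x : Coch G A) :
    cproj k G A (n + 1) (d ρ x) = d ρ (cproj k G A n x) := by
  induction x using DirectSum.induction_on with
  | zero => simp
  | add x y hx hy => simp only [map_add, hx, hy]
  | of m f =>
    by_cases h : m = n
    · subst h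
      rw [cproj_of_self, d_of, cproj_of_self]
    · rw [cproj_of_of_ne h, d_of, cproj_of_of_ne (fun h' => h (Nat.succ.inj h')), map_zero]

theorem cproj_zero_d (ρ : Representation k G A) (x : Coch G A) :
    cproj k G A 0 (d ρ x) = 0 := by
  induction x using DirectSum.induction_on with
  | zero => simp
  | add x y hx hy => simp only [map_add, hx, hy, add_zero]
  | of m f => rw [d_of, cproj_of_of_ne (Nat.succ_ne_zero m)]

theorem d_cproj_eq_zero {ρ : Representation k G A} {x : Coch G A} (h : d ρ x = 0) (n : ℕ) :
    d ρ (cproj k G A n x) = 0 := by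
  rw [← cproj_succ_d, h, map_zero]

end Components

/-- A linear map factors through a surjection if it is constant on the fibres. -/
theorem exists_factor {k M N P : Type} [Semiring k] [AddCommMonoid M] [Module k M]
    [AddCommMonoid N] [Module k N] [AddCommMonoid P] [Module k P] (p : M →ₗ[k] N)
    (hp : Function.Surjective p) (f : M →ₗ[k] P) (h : ∀ x y, p x = p y → f x = f y) :
    ∃ L : N →ₗ[k] P, ∀ x, L (p x) = f x := by
  obtain ⟨out, hout⟩ := hp.hasRightInverse
  refine ⟨{ toFun := fun x => f (out x), map_add' := fun x y => ?_, map_smul' := fun a x => ?_ },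
    fun z => h _ _ (hout _)⟩
  · rw [← map_add]
    exact h _ _ (by rw [map_add, hout, hout, hout])
  · rw [RingHom.id_apply, ← map_smul]
    exact h _ _ (by rw [map_smul, hout, hout])

section Classes
variable {k G A H B : Type} [CommRing k] [CharP k 2] [Group G] [CommRing A] [Algebra k A]
  [Group H] [CommRing B] [Algebra k B]

-- This instance spares the elaborator the search for a `FunLike` instance each time `cls` is applied.
instance : CoeFun (cocycles k G A →ₐ[k] HRing k G A) fun _ => cocycles k G A → HRing k G A :=
  ⟨fun f => f⟩

theorem mem_cocycles {x : Coch G A} :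
    x ∈ cocycles k G A ↔ d (Representation.trivial k G A) x = 0 := Iff.rfl

theorem cls_surjective : Function.Surjective (cls : cocycles k G A → HRing k G A) :=
  Ideal.Quotient.mkₐ_surjective k _

theorem cls_eq_zero {z : cocycles k G A} :
    cls z = 0 ↔ ∃ y, d (Representation.trivial k G A) y = z :=
  Ideal.Quotient.eq_zero_iff_mem

theorem cls_eq_cls {z z' : cocycles k G A} :
    cls z = cls z' ↔ ∃ y, d (Representation.trivial k G A) y = (z : Coch G A) - z' := by
  rw [← sub_eq_zero, ← map_sub, cls_eq_zero]
  rfl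

/-- The map that a linear map of cochains induces from cocycles to cohomology. -/
def linCls (F : Coch G A →ₗ[k] Coch H B) (h1 : ∀ z ∈ cocycles k G A, F z ∈ cocycles k H B) :
    cocycles k G A →ₗ[k] HRing k H B :=
  (cls (k := k) (G := H) (A := B)).toLinearMap ∘ₗ
    { toFun := fun z => ⟨F z, h1 z z.2⟩
      map_add' := fun _ _ => Subtype.ext (map_add F _ _)
      map_smul' := fun a _ => Subtype.ext (map_smul F a _) }

theorem HRing.exists_lin (F : Coch G A →ₗ[k] Coch H B)
    (h1 : ∀ z ∈ cocycles k G A, F z ∈ cocycles k H B)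
    (h2 : ∀ y, ∃ y', d (Representation.trivial k H B) y' =
      F (d (Representation.trivial k G A) y)) :
    ∃ L : HRing k G A →ₗ[k] HRing k H B,
      ∀ z : cocycles k G A, L (cls z) = cls ⟨F z, h1 z z.2⟩ := by
  obtain ⟨L, hL⟩ := exists_factor (cls (k := k) (G := G) (A := A)).toLinearMap cls_surjective
    (linCls F h1) fun z z' h => by
      obtain ⟨y, hy⟩ := cls_eq_cls.1 h
      obtain ⟨y', hy'⟩ := h2 y
      exact cls_eq_cls.2 ⟨y', by rw [hy', hy, map_sub]; rfl⟩
  exact ⟨L, hL⟩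

/-- The map on cohomology induced by a linear map of cochains that preserves cocycles and
coboundaries. -/
def HRing.lin (F : Coch G A →ₗ[k] Coch H B)
    (h1 : ∀ z ∈ cocycles k G A, F z ∈ cocycles k H B)
    (h2 : ∀ y, ∃ y', d (Representation.trivial k H B) y' =
      F (d (Representation.trivial k G A) y)) : HRing k G A →ₗ[k] HRing k H B :=
  (HRing.exists_lin F h1 h2).choose

theorem HRing.lin_cls {F : Coch G A →ₗ[k] Coch H B}
    {h1 : ∀ z ∈ cocycles k G A, F z ∈ cocycles k H B}
    {h2 : ∀ y, ∃ y', d (Representation.trivial k H B) y' =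
      F (d (Representation.trivial k G A) y)} (z : cocycles k G A) :
    HRing.lin F h1 h2 (cls z) = cls ⟨F z, h1 z z.2⟩ := (HRing.exists_lin F h1 h2).choose_spec z

theorem mem_Hdeg {n : ℕ} {x : HRing k G A} :
    x ∈ Hdeg k G A n ↔ ∃ z : cocycles k G A, (z : Coch G A) ∈ cdeg k G A n ∧ cls z = x := Iff.rfl

/-- The component of degree `n` of a cohomology class. -/
def HRing.proj (k G A : Type) [CommRing k] [CharP k 2] [Group G] [CommRing A] [Algebra k A]
    (n : ℕ) : HRing k G A →ₗ[k] HRing k G A :=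
  HRing.lin (cproj k G A n) (fun z hz => mem_cocycles.2 (d_cproj_eq_zero (mem_cocycles.1 hz) n))
    fun y => by
      cases n with
      | zero => exact ⟨0, by rw [cproj_zero_d, map_zero]⟩
      | succ n => exact ⟨cproj k G A n y, (cproj_succ_d _ n y).symm⟩

theorem HRing.proj_of_mem {n : ℕ} {x : HRing k G A} (hx : x ∈ Hdeg k G A n) :
    HRing.proj k G A n x = x := by
  obtain ⟨z, hz, rfl⟩ := mem_Hdeg.1 hx
  exact (HRing.lin_cls z).trans (congrArg _ (Subtype.ext (cproj_of_mem hz)))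

theorem HRing.proj_of_mem_ne {m n : ℕ} (h : m ≠ n) {x : HRing k G A} (hx : x ∈ Hdeg k G A m) :
    HRing.proj k G A n x = 0 := by
  obtain ⟨z, hz, rfl⟩ := mem_Hdeg.1 hx
  refine (HRing.lin_cls (k := k) z).trans (cls_eq_zero.2 ⟨0, ?_⟩)
  rw [map_zero]
  exact (cproj_of_mem_ne h hz).symm

theorem HRing.mul_mem_Hdeg {m n : ℕ} {x y : HRing k G A} (hx : x ∈ Hdeg k G A m)
    (hy : y ∈ Hdeg k G A n) : x * y ∈ Hdeg k G A (m + n) := by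
  obtain ⟨z, hz, rfl⟩ := mem_Hdeg.1 hx
  obtain ⟨z', hz', rfl⟩ := mem_Hdeg.1 hy
  exact mem_Hdeg.2 ⟨z * z', mul_mem_cdeg hz hz', map_mul _ _ _⟩

theorem HRing.one_mem_Hdeg : (1 : HRing k G A) ∈ Hdeg k G A 0 :=
  mem_Hdeg.2 ⟨1, one_mem_cdeg, map_one _⟩

theorem HRing.pow_mem_Hdeg {m : ℕ} {x : HRing k G A} (hx : x ∈ Hdeg k G A m) (n : ℕ) :
    x ^ n ∈ Hdeg k G A (m * n) := by
  obtain ⟨z, hz, rfl⟩ := mem_Hdeg.1 hx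
  exact mem_Hdeg.2 ⟨z ^ n, pow_mem_cdeg hz n, map_pow _ _ _⟩

/-- Every cohomology class is a sum of homogeneous ones. -/
theorem HRing.mem_of_Hdeg (p : Submodule k (HRing k G A)) (h : ∀ n, Hdeg k G A n ≤ p)
    (x : HRing k G A) : x ∈ p := by
  classical
  obtain ⟨z, rfl⟩ := cls_surjective x
  have e : (z : Coch G A) = ∑ n ∈ DFinsupp.support (z : Coch G A), cproj k G A n z :=
    (DirectSum.sum_support_of (z : Coch G A)).symm
  let c : ℕ → cocycles k G A := fun n => ⟨cproj k G A n z, mem_cocycles.2 (d_cproj_eq_zero z.2 n)⟩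
  have e' : z = ∑ n ∈ DFinsupp.support (z : Coch G A), c n :=
    Subtype.ext (by rw [AddSubmonoidClass.coe_finsetSum]; exact e)
  rw [e', map_sum]
  exact Submodule.sum_mem _ fun n _ => h n (mem_Hdeg.2 ⟨c n, cproj_mem n _, rfl⟩)

section Basis
variable {K : Type} {v : K → HRing k G A} {deg : K → ℕ}

/-- A family of homogeneous classes is linearly independent if it is so in every degree. -/
theorem HRing.linearIndependent_of_degreewise (hv : ∀ i, v i ∈ Hdeg k G A (deg i))
    (F : ℕ → Finset K) (hF : ∀ n i, i ∈ F n ↔ deg i = n)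
    (h : ∀ n (a : K → k), ∑ i ∈ F n, a i • v i = 0 → ∀ i ∈ F n, a i = 0) :
    LinearIndependent k v := by
  classical
  rw [linearIndependent_iff]
  intro l hl
  ext i
  refine h (deg i) l ?_ i ((hF _ _).2 rfl)
  have := congrArg (HRing.proj k G A (deg i)) hl
  rw [Finsupp.linearCombination_apply, map_zero, Finsupp.sum, map_sum] at this
  rw [← this]
  have e : ∀ j, HRing.proj k G A (deg i) (l j • v j) = if j ∈ F (deg i) then l j • v j else 0 := by
    intro j
    rw [map_smul]
    split_ifs with hj
    · rw [← (hF _ _).1 hj, HRing.proj_of_mem (hv j)]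
    · rw [HRing.proj_of_mem_ne (fun h => hj ((hF _ _).2 h)) (hv j), smul_zero]
  rw [Finset.sum_congr rfl fun j _ => e j, ← Finset.sum_filter]
  refine (Finset.sum_subset (fun j hj => (Finset.mem_filter.1 hj).2) fun j hj hj' => ?_).symm
  rw [Finset.mem_filter, not_and, not_imp_not.symm, not_not] at hj'
  have : l j = 0 := by
    by_contra h0
    exact (hj' hj) (Finsupp.mem_support_iff.2 h0)
  rw [this, zero_smul]

/-- The coordinates of a homogeneous class in a homogeneous basis are concentrated in its degree. -/
theorem HRing.repr_eq_zero (b : Module.Basis K k (HRing k G A))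
    (hv : ∀ i, b i ∈ Hdeg k G A (deg i)) {n : ℕ} {x : HRing k G A} (hx : x ∈ Hdeg k G A n) {i : K}
    (hi : deg i ≠ n) : b.repr x i = 0 := by
  -- The `i`-th coordinate of the component of degree `n` is zero on every basis element.
  have key : b.coord i ∘ₗ HRing.proj k G A n = 0 := b.ext fun j => by
    rw [LinearMap.comp_apply]
    by_cases h : deg j = n
    · rw [← h, HRing.proj_of_mem (hv j), Module.Basis.coord_apply, b.repr_self,
        Finsupp.single_eq_of_ne]
      · rfl
      · rintro rfl
        exact hi h
    · rw [HRing.proj_of_mem_ne h (hv j), map_zero]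
      rfl
  have := congrArg (fun f => f x) key
  rw [LinearMap.comp_apply, HRing.proj_of_mem hx] at this
  exact this

end Basis

end Classes

section Rep
variable {k G A : Type} [CommRing k] [CharP k 2] [Group G] [CommRing A] [Algebra k A]
  {z z' : Coch G A} {c c' : HRing k G A}

/-- The cochain `z` is a cocycle that represents the cohomology class `c`. -/
def IsRep (z : Coch G A) (c : HRing k G A) : Prop :=
  ∃ hz : z ∈ cocycles k G A, cls ⟨z, hz⟩ = c

theorem IsRep.unique (h : IsRep z c) (h' : IsRep z c') : c = c' := by
  obtain ⟨hz, rfl⟩ := h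
  obtain ⟨hz', rfl⟩ := h'
  rfl

theorem IsRep.d_eq_zero (h : IsRep z c) : d (Representation.trivial k G A) z = 0 := h.1

theorem exists_isRep (c : HRing k G A) : ∃ z, IsRep z c := by
  obtain ⟨z, rfl⟩ := cls_surjective c
  exact ⟨z, z.2, rfl⟩

theorem isRep_cls (z : cocycles k G A) : IsRep (z : Coch G A) (cls z) := ⟨z.2, rfl⟩

theorem IsRep.add (h : IsRep z c) (h' : IsRep z' c') : IsRep (z + z') (c + c') := by
  obtain ⟨hz, rfl⟩ := h
  obtain ⟨hz', rfl⟩ := h'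
  exact ⟨add_mem hz hz', map_add cls (⟨z, hz⟩ : cocycles k G A) ⟨z', hz'⟩⟩

theorem IsRep.sub (h : IsRep z c) (h' : IsRep z' c') : IsRep (z - z') (c - c') := by
  obtain ⟨hz, rfl⟩ := h
  obtain ⟨hz', rfl⟩ := h'
  exact ⟨sub_mem hz hz', map_sub cls (⟨z, hz⟩ : cocycles k G A) ⟨z', hz'⟩⟩

theorem IsRep.mul (h : IsRep z c) (h' : IsRep z' c') : IsRep (z * z') (c * c') := by
  obtain ⟨hz, rfl⟩ := h
  obtain ⟨hz', rfl⟩ := h'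
  exact ⟨mul_mem hz hz', map_mul cls (⟨z, hz⟩ : cocycles k G A) ⟨z', hz'⟩⟩

theorem IsRep.smul (a : k) (h : IsRep z c) : IsRep (a • z) (a • c) := by
  obtain ⟨hz, rfl⟩ := h
  exact ⟨(cocycles k G A).smul_mem hz a, map_smul cls a (⟨z, hz⟩ : cocycles k G A)⟩

theorem isRep_one : IsRep (1 : Coch G A) (1 : HRing k G A) := ⟨one_mem _, map_one _⟩

theorem IsRep.pow (h : IsRep z c) (n : ℕ) : IsRep (z ^ n) (c ^ n) := by
  induction n with
  | zero =>
    rw [pow_zero, pow_zero]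
    exact isRep_one
  | succ n ih =>
    rw [pow_succ, pow_succ]
    exact ih.mul h

theorem isRep_d (y : Coch G A) :
    IsRep (d (Representation.trivial k G A) y) (0 : HRing k G A) :=
  ⟨d_d _ y, cls_eq_zero.2 ⟨y, rfl⟩⟩

theorem isRep_zero : IsRep (0 : Coch G A) (0 : HRing k G A) := by
  have := isRep_d (k := k) (0 : Coch G A)
  rwa [map_zero] at this

theorem isRep_zero_iff : IsRep z (0 : HRing k G A) ↔
    ∃ y, d (Representation.trivial k G A) y = z := by
  constructor
  · rintro ⟨hz, h⟩
    exact cls_eq_zero.1 h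
  · rintro ⟨y, rfl⟩
    exact isRep_d y

theorem IsRep.mem_Hdeg (h : IsRep z c) {n : ℕ} (hz : z ∈ cdeg k G A n) : c ∈ Hdeg k G A n := by
  obtain ⟨hz', rfl⟩ := h
  exact V1BSS.mem_Hdeg.2 ⟨_, hz, rfl⟩

theorem exists_isRep_of_mem_Hdeg {n : ℕ} (hc : c ∈ Hdeg k G A n) :
    ∃ z ∈ cdeg k G A n, IsRep z c := by
  obtain ⟨z, hz, rfl⟩ := V1BSS.mem_Hdeg.1 hc
  exact ⟨z, hz, isRep_cls z⟩

end Rep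

section Scalars
variable {G : Type} [Group G]

theorem IsRep.mem_Z {n : ℕ} {z : Coch G F4} {c : HRing F4 G F4} (h : IsRep z c)
    (hz : z ∈ cdeg F4 G F4 n) : z ∈ (X0 G).Z n := mem_Z0.2 ⟨hz, h.d_eq_zero⟩

theorem exists_isRep_of_mem_Z {n : ℕ} {z : Coch G F4} (hz : z ∈ (X0 G).Z n) :
    ∃ c ∈ Hdeg F4 G F4 n, IsRep z c :=
  have h : IsRep z (cls ⟨z, (mem_Z0.1 hz).2⟩ : HRing F4 G F4) := ⟨(mem_Z0.1 hz).2, rfl⟩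
  ⟨_, h.mem_Hdeg (mem_Z0.1 hz).1, h⟩

/-- The cohomology ring is the quotient of all cocycles by all coboundaries. For homogeneous elements
this agrees with the cohomology of the graded complex `X0`. -/
theorem IsRep.cl_eq_zero_iff {n : ℕ} {z : Coch G F4} {c : HRing F4 G F4} (h : IsRep z c)
    (hz : z ∈ cdeg F4 G F4 n) : (X0 G).cl n z = 0 ↔ c = 0 := by
  rw [GC.cl_eq_zero]
  constructor
  · rintro ⟨y, -, hy⟩
    exact h.unique (isRep_zero_iff.2 ⟨y, hy⟩)
  · rintro rfl
    obtain ⟨y, hy⟩ := isRep_zero_iff.1 h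
    change dF y = z at hy
    cases n with
    | zero =>
      refine ⟨0, Submodule.zero_mem _, ?_⟩
      rw [map_zero, ← cproj_of_mem hz, ← hy, cproj_zero_d]
    | succ n =>
      refine ⟨cproj F4 G F4 n y, cproj_mem n y, ?_⟩
      change dF _ = z
      rw [← cproj_succ_d, hy, cproj_of_mem hz]

theorem IsRep.cl_eq_cl_iff {n : ℕ} {z z' : Coch G F4} {c c' : HRing F4 G F4} (h : IsRep z c)
    (h' : IsRep z' c') (hz : z ∈ cdeg F4 G F4 n) (hz' : z' ∈ cdeg F4 G F4 n) :
    (X0 G).cl n z = (X0 G).cl n z' ↔ c = c' := by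
  rw [← sub_eq_zero, ← map_sub, (h.sub h').cl_eq_zero_iff (sub_mem hz hz'), sub_eq_zero]

/-- The class of a homomorphism to the additive group of `F₄`. -/
def homCls {r : G → F4} (hr : IsAdd r) : HRing F4 G F4 := cls ⟨c1 r, d_c1_hom hr⟩

theorem isRep_homCls {r : G → F4} (hr : IsAdd r) : IsRep (c1 r) (homCls hr) := ⟨_, rfl⟩

theorem homCls_mem {r : G → F4} (hr : IsAdd r) : homCls hr ∈ Hdeg F4 G F4 1 :=
  (isRep_homCls hr).mem_Hdeg (c1_mem r)

/-- Classes of homomorphisms are central in the cohomology ring. -/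
theorem homCls_comm {r : G → F4} (hr : IsAdd r) (x : HRing F4 G F4) : Commute (homCls hr) x := by
  refine sub_eq_zero.1 (?_ : x ∈ LinearMap.ker
    (LinearMap.mulLeft F4 (homCls hr) - LinearMap.mulRight F4 (homCls hr)))
  refine HRing.mem_of_Hdeg _ (fun n y hy => ?_) x
  obtain ⟨z, hz, hzy⟩ := exists_isRep_of_mem_Hdeg hy
  -- The ring of cochains is not commutative; the commutator is the coboundary of a cup-1 product.
  obtain ⟨w, -, hw⟩ := hom_comm hr hz hzy.d_eq_zero
  refine (((isRep_homCls hr).mul hzy).sub (hzy.mul (isRep_homCls hr))).unique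
    (isRep_zero_iff.2 ⟨w, hw.trans ?_⟩)
  rw [sub_eq_add_neg]
  refine congrArg _ ?_
  rw [eq_neg_iff_add_eq_zero]
  exact add_self_C _

end Scalars

/-- A homomorphism from a polynomial ring to an algebra that happens to be commutative. -/
theorem exists_algHom_of_comm {B σ : Type} [Ring B] [Algebra F4 B] (h : ∀ x y : B, x * y = y * x)
    (a : σ → B) : ∃ f : MvPolynomial σ F4 →ₐ[F4] B, ∀ i, f (MvPolynomial.X i) = a i := by
  let : CommRing B := { ‹Ring B› with mul_comm := h }
  exact ⟨MvPolynomial.aeval a, fun i => MvPolynomial.aeval_X a i⟩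

/-- A linear map is bijective if it sends a spanning family to a basis. -/
theorem bijective_of_basis {k M N K : Type} [Ring k] [AddCommGroup M] [Module k M] [AddCommGroup N]
    [Module k N] (f : M →ₗ[k] N) (v : K → M) (hv : ⊤ ≤ Submodule.span k (Set.range v))
    (b : Module.Basis K k N) (h : ∀ i, f (v i) = b i) : Function.Bijective f := by
  constructor
  · rw [← LinearMap.ker_eq_bot, LinearMap.ker_eq_bot']
    intro x hx
    obtain ⟨l, rfl⟩ := Finsupp.mem_span_range_iff_exists_finsupp.1 (hv (Submodule.mem_top (x := x)))
    have e : Finsupp.linearCombination k b l = 0 := by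
      rw [Finsupp.linearCombination_apply, ← hx, map_finsuppSum]
      simp only [map_smul, h]
    rw [linearIndependent_iff.1 b.linearIndependent l e, Finsupp.sum_zero_index]
  · rw [← LinearMap.range_eq_top, eq_top_iff, ← b.span_eq, Submodule.span_le]
    rintro _ ⟨i, rfl⟩
    exact ⟨v i, h i⟩

/-- An algebra spanned by pairwise commuting elements is commutative. -/
theorem mul_comm_of_span {B K : Type} [Ring B] [Algebra F4 B] (v : K → B)
    (hv : ⊤ ≤ Submodule.span F4 (Set.range v)) (h : ∀ i j, v i * v j = v j * v i) (x y : B) :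
    x * y = y * x := by
  have h1 : ∀ i, ∀ y : B, v i * y = y * v i := fun i y => by
    refine sub_eq_zero.1 (?_ : y ∈ LinearMap.ker
      (LinearMap.mulLeft F4 (v i) - LinearMap.mulRight F4 (v i)))
    refine (hv.trans (Submodule.span_le.2 ?_)) Submodule.mem_top
    rintro _ ⟨j, rfl⟩
    exact sub_eq_zero.2 (h i j)
  refine sub_eq_zero.1 (?_ : x ∈ LinearMap.ker
    (LinearMap.mulRight F4 y - LinearMap.mulLeft F4 y))
  refine (hv.trans (Submodule.span_le.2 ?_)) Submodule.mem_top
  rintro _ ⟨j, rfl⟩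
  exact sub_eq_zero.2 (h1 j y)

/-! ### The cohomology rings of `V` and `Q₈` -/

theorem eq_zero_of_smul {M : Type} [AddCommGroup M] [Module F4 M] {a : F4} {x : M} (e : a • x = 0)
    (h : x ≠ 0) : a = 0 := (smul_eq_zero.1 e).resolve_right h

section Klein
variable {G : Type} [Group G] {r : G → F4} (hr : IsAdd r)

/-- The class `h_{1,1}` of the homomorphism `r`. -/
abbrev h11 : HRing F4 G F4 := homCls hr

/-- The class `h_{1,0}` of the homomorphism `r²`. -/
abbrev h10 : HRing F4 G F4 := homCls hr.sq

/-- The cohomology in positive degrees is spanned by the power of `h_{1,0}` and the multiples of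
`h_{1,1}`. -/
theorem exists_eq_of_X2 (h : (X2 hr).IsResolution ((1, 0), 0)) {n : ℕ} {x : HRing F4 G F4}
    (hx : x ∈ Hdeg F4 G F4 (n + 1)) : ∃ a : F4, ∃ c ∈ Hdeg F4 G F4 n,
      x = a • h10 hr ^ (n + 1) + h11 hr * c := by
  obtain ⟨z, hz, hzx⟩ := exists_isRep_of_mem_Hdeg hx
  obtain ⟨a, y, hy, e⟩ := exists_cl_eq_of_X2 hr h (hzx.mem_Z hz)
  obtain ⟨c, hc, hyc⟩ := exists_isRep_of_mem_Z hy
  refine ⟨a, c, hc, ?_⟩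
  rw [← map_smul, ← map_add] at e
  exact (hzx.cl_eq_cl_iff ((((isRep_homCls hr.sq).pow _).smul a).add ((isRep_homCls hr).mul hyc)) hz
    (add_mem (Submodule.smul_mem _ _ (mem_Z0.1 (cS_pow_mem hr _)).1)
      (c1_mul_mem _ (mem_Z0.1 hy).1))).1 e

/-- The class `h_{1,1}` is not a zero divisor, and its multiples do not contain a power of `h_{1,0}`. -/
theorem eq_zero_of_eq_X2 (h : (X2 hr).IsResolution ((1, 0), 0)) {n : ℕ} {a : F4}
    {c : HRing F4 G F4} (hc : c ∈ Hdeg F4 G F4 n) (e : a • h10 hr ^ (n + 1) + h11 hr * c = 0) :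
    a = 0 ∧ c = 0 := by
  obtain ⟨y, hy, hyc⟩ := exists_isRep_of_mem_Hdeg hc
  have := eq_zero_of_X2 hr h (a := a) (hyc.mem_Z hy) (by
    rw [← map_smul, ← map_add]
    exact (((((isRep_homCls hr.sq).pow _).smul a).add ((isRep_homCls hr).mul hyc)).cl_eq_zero_iff
      (add_mem (Submodule.smul_mem _ _ (mem_Z0.1 (cS_pow_mem hr _)).1) (c1_mul_mem _ hy))).2 e)
  exact ⟨this.1, (hyc.cl_eq_zero_iff hy).1 this.2⟩

/-- The monomials in `h_{1,0}` and `h_{1,1}`. -/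
def monV (i : ℕ × ℕ) : HRing F4 G F4 := h10 hr ^ i.1 * h11 hr ^ i.2

theorem monV_mem (i : ℕ × ℕ) : monV hr i ∈ Hdeg F4 G F4 (i.1 + i.2) := by
  have := HRing.mul_mem_Hdeg (HRing.pow_mem_Hdeg (homCls_mem hr.sq) i.1)
    (HRing.pow_mem_Hdeg (homCls_mem hr) i.2)
  rwa [one_mul, one_mul] at this

theorem monV_succ (i : ℕ × ℕ) : monV hr (i.1, i.2 + 1) = h11 hr * monV hr i := by
  rw [monV, monV, pow_succ, ← mul_assoc]
  exact ((homCls_comm hr _).eq).symm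

theorem exists_eq_sum_monV (h : (X2 hr).IsResolution ((1, 0), 0)) (n : ℕ) {x : HRing F4 G F4}
    (hx : x ∈ Hdeg F4 G F4 n) :
    ∃ a : ℕ × ℕ → F4, x = ∑ i ∈ Finset.HasAntidiagonal.antidiagonal n, a i • monV hr i := by
  induction n generalizing x with
  | zero =>
    obtain ⟨z, hz, hzx⟩ := exists_isRep_of_mem_Hdeg hx
    obtain ⟨a, rfl⟩ := exists_smul_one_of_mem_Z0 (hzx.mem_Z hz)
    refine ⟨fun _ => a, ?_⟩
    rw [Finset.Nat.antidiagonal_zero, Finset.sum_singleton]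
    have : monV hr (0, 0) = 1 := by rw [monV, pow_zero, pow_zero, one_mul]
    rw [this]
    exact hzx.unique (isRep_one.smul a)
  | succ n ih =>
    obtain ⟨a, c, hc, rfl⟩ := exists_eq_of_X2 hr h hx
    obtain ⟨f, rfl⟩ := ih hc
    refine ⟨fun i => if i.2 = 0 then a else f (i.1, i.2 - 1), ?_⟩
    rw [Finset.Nat.sum_antidiagonal_succ']
    refine congrArg₂ _ ?_ ?_
    · change _ = a • _
      rw [monV, pow_zero, mul_one]
    · rw [Finset.mul_sum]
      refine Finset.sum_congr rfl fun i _ => ?_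
      rw [monV_succ, mul_smul_comm]
      rfl

theorem monV_independent (h : (X2 hr).IsResolution ((1, 0), 0)) (n : ℕ) (a : ℕ × ℕ → F4)
    (e : ∑ i ∈ Finset.HasAntidiagonal.antidiagonal n, a i • monV hr i = 0) :
    ∀ i ∈ Finset.HasAntidiagonal.antidiagonal n, a i = 0 := by
  induction n generalizing a with
  | zero =>
    rw [Finset.Nat.antidiagonal_zero, Finset.sum_singleton, monV, pow_zero, pow_zero, one_mul] at e
    intro i hi
    rw [Finset.Nat.antidiagonal_zero, Finset.mem_singleton] at hi
    rw [hi]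
    refine smul_one_eq_zero (G := G) ?_
    rw [← GC.cl_zero_eq_zero (X := X0 G)]
    exact ((isRep_one.smul _).cl_eq_zero_iff (Submodule.smul_mem _ _ one_mem_cdeg)).2 e
  | succ n ih =>
    rw [Finset.Nat.sum_antidiagonal_succ'] at e
    have e1 : ∑ i ∈ Finset.HasAntidiagonal.antidiagonal n, a (i.1, i.2 + 1) • monV hr (i.1, i.2 + 1) =
        h11 hr * ∑ i ∈ Finset.HasAntidiagonal.antidiagonal n, a (i.1, i.2 + 1) • monV hr i := by
      rw [Finset.mul_sum]
      refine Finset.sum_congr rfl fun i _ => ?_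
      rw [monV_succ, mul_smul_comm]
    have e2 : monV hr (n + 1, 0) = h10 hr ^ (n + 1) := by rw [monV, pow_zero, mul_one]
    rw [e1, e2] at e
    have hm : ∑ i ∈ Finset.HasAntidiagonal.antidiagonal n, a (i.1, i.2 + 1) • monV hr i ∈ Hdeg F4 G F4 n := by
      refine Submodule.sum_mem _ fun i hi => Submodule.smul_mem _ _ ?_
      have := monV_mem hr i
      rwa [Finset.HasAntidiagonal.mem_antidiagonal.1 hi] at this
    obtain ⟨h1, h2⟩ := eq_zero_of_eq_X2 hr h hm e
    have h3 := ih (fun i => a (i.1, i.2 + 1)) h2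
    rintro ⟨p, q⟩ hi
    rw [Finset.HasAntidiagonal.mem_antidiagonal] at hi
    cases q with
    | zero =>
      obtain rfl : p = n + 1 := hi
      exact h1
    | succ q => exact h3 (p, q) (Finset.HasAntidiagonal.mem_antidiagonal.2 (Nat.succ.inj hi))

/-- The monomials in `h_{1,0}` and `h_{1,1}` are a basis of the cohomology ring. -/
theorem exists_basis_V (h : (X2 hr).IsResolution ((1, 0), 0)) :
    ∃ b : Module.Basis (ℕ × ℕ) F4 (HRing F4 G F4), ∀ i, b i = monV hr i :=
  ⟨.mk (HRing.linearIndependent_of_degreewise (monV_mem hr) Finset.HasAntidiagonal.antidiagonal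
    (fun _ _ => Finset.HasAntidiagonal.mem_antidiagonal) (monV_independent hr h)) fun x _ =>
      HRing.mem_of_Hdeg _ (fun n y hy => by
        obtain ⟨a, rfl⟩ := exists_eq_sum_monV hr h n hy
        exact Submodule.sum_mem _ fun i _ => Submodule.smul_mem _ _ (Submodule.subset_span ⟨i, rfl⟩)) x,
    fun i => Module.Basis.mk_apply _ _ i⟩

theorem comm_of_X2 (h : (X2 hr).IsResolution ((1, 0), 0)) (x y : HRing F4 G F4) : x * y = y * x := by
  obtain ⟨b, hb⟩ := exists_basis_V hr h
  refine mul_comm_of_span b b.span_eq.ge (fun i j => ?_) x y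
  rw [hb i, monV]
  exact Commute.mul_left ((homCls_comm hr.sq _).pow_left _) ((homCls_comm hr _).pow_left _)

/-- The cohomology ring is the polynomial ring on `h_{1,0}` and `h_{1,1}`. -/
theorem exists_algEquiv_V (h : (X2 hr).IsResolution ((1, 0), 0)) :
    ∃ φ : MvPolynomial (Fin 2) F4 ≃ₐ[F4] HRing F4 G F4,
      φ (MvPolynomial.X 0) = h10 hr ∧ φ (MvPolynomial.X 1) = h11 hr := by
  obtain ⟨b, hb⟩ := exists_basis_V hr h
  obtain ⟨f, hf⟩ := exists_algHom_of_comm (B := HRing F4 G F4) (comm_of_X2 hr h) ![h10 hr, h11 hr]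
  have hbij : Function.Bijective f := by
    refine bijective_of_basis f.toLinearMap
      (fun i : ℕ × ℕ => MvPolynomial.X 0 ^ i.1 * MvPolynomial.X 1 ^ i.2) ?_ b fun i => ?_
    · rintro p -
      induction p using MvPolynomial.induction_on' with
      | add p q hp hq => exact add_mem hp hq
      | monomial u a =>
        have : MvPolynomial.monomial u a =
            a • (MvPolynomial.X 0 ^ u 0 * MvPolynomial.X 1 ^ u 1 : MvPolynomial (Fin 2) F4) := by
          rw [MvPolynomial.monomial_eq, MvPolynomial.smul_eq_C_mul, Finsupp.prod_fintype _ _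
            (fun _ => pow_zero _), Fin.prod_univ_two]
        rw [this]
        exact Submodule.smul_mem _ _ (Submodule.subset_span ⟨(u 0, u 1), rfl⟩)
    · change f _ = _
      rw [map_mul, map_pow, map_pow, hf, hf, hb]
      rfl
  exact ⟨AlgEquiv.ofBijective f hbij, hf 0, hf 1⟩

end Klein

section Quaternion
variable {G : Type} [Group G] {r t : G → F4}

theorem h11_mul_h10 (q : QCoord r t) : h11 q.r_mul * h10 q.r_mul = 0 := by
  have h := IsStage.cl_RS q (one_mem_Z0 (G := G))
  rw [mul_one] at h
  exact (((isRep_homCls q.r_mul).mul (isRep_homCls q.r_mul.sq)).cl_eq_zero_iff (n := 2)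
    (c1_mul_mem _ (c1_mem _))).1 h

theorem h10_mul_h11 (q : QCoord r t) : h10 q.r_mul * h11 q.r_mul = 0 :=
  ((homCls_comm q.r_mul.sq _).eq).trans (h11_mul_h10 q)

theorem h10_pow_three (q : QCoord r t) : h10 q.r_mul ^ 3 = h11 q.r_mul ^ 3 := by
  have h := IsStage.cl_SSS q (one_mem_Z0 (G := G))
  have e : ∀ {x : G → F4} (hx : IsAdd x),
      IsRep (c1 x * (c1 x * (c1 x * 1))) (homCls hx ^ 3) := fun hx => by
    have := (isRep_homCls hx).mul ((isRep_homCls hx).mul ((isRep_homCls hx).mul isRep_one))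
    rwa [mul_one (homCls hx), ← pow_two, ← pow_succ'] at this
  have m : ∀ x : G → F4, c1 x * (c1 x * (c1 x * 1)) ∈ cdeg F4 G F4 (0 + 3) := fun x =>
    c1_mul_mem _ (c1_mul_mem _ (c1_mul_mem _ one_mem_cdeg))
  exact ((e q.r_mul.sq).cl_eq_cl_iff (e q.r_mul) (m _) (m _)).1 h

section Stages
variable {q : QCoord r t} {n : ℕ} {y : Coch G F4} (s : IsStage q n y)
  {c : HRing F4 G F4} (hc : IsRep y c)
include s hc

theorem IsStage.exists_eq0 {x : HRing F4 G F4} (hx : x ∈ Hdeg F4 G F4 n) : ∃ a : F4, x = a • c := by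
  obtain ⟨z, hz, hzx⟩ := exists_isRep_of_mem_Hdeg hx
  obtain ⟨a, e⟩ := s.span0 _ (hzx.mem_Z hz)
  rw [← map_smul] at e
  exact ⟨a, (hzx.cl_eq_cl_iff (hc.smul a) hz (Submodule.smul_mem _ _ (mem_Z0.1 s.mem).1)).1 e⟩

variable [Finite G]

theorem IsStage.exists_eq1 {x : HRing F4 G F4} (hx : x ∈ Hdeg F4 G F4 (n + 1)) :
    ∃ a b : F4, x = a • (h10 q.r_mul * c) + b • (h11 q.r_mul * c) := by
  obtain ⟨z, hz, hzx⟩ := exists_isRep_of_mem_Hdeg hx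
  obtain ⟨a, b, e⟩ := s.span0_1 (hzx.mem_Z hz)
  rw [← map_smul, ← map_smul, ← map_add] at e
  refine ⟨a, b, (hzx.cl_eq_cl_iff ((((isRep_homCls q.r_mul.sq).mul hc).smul a).add
    (((isRep_homCls q.r_mul).mul hc).smul b)) hz ?_).1 e⟩
  exact add_mem (Submodule.smul_mem _ _ (mem_Z0.1 s.S_mem).1)
    (Submodule.smul_mem _ _ (mem_Z0.1 s.R_mem).1)

theorem IsStage.exists_eq2 {x : HRing F4 G F4} (hx : x ∈ Hdeg F4 G F4 (n + 2)) :
    ∃ a b : F4, x = a • (h10 q.r_mul * (h10 q.r_mul * c)) +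
      b • (h11 q.r_mul * (h11 q.r_mul * c)) := by
  obtain ⟨z, hz, hzx⟩ := exists_isRep_of_mem_Hdeg hx
  obtain ⟨a, b, e⟩ := s.span0_2 (hzx.mem_Z hz)
  rw [← map_smul, ← map_smul, ← map_add] at e
  refine ⟨a, b, (hzx.cl_eq_cl_iff
    ((((isRep_homCls q.r_mul.sq).mul ((isRep_homCls q.r_mul.sq).mul hc)).smul a).add
      (((isRep_homCls q.r_mul).mul ((isRep_homCls q.r_mul).mul hc)).smul b)) hz ?_).1 e⟩
  exact add_mem (Submodule.smul_mem _ _ (mem_Z0.1 s.SS_mem).1)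
    (Submodule.smul_mem _ _ (mem_Z0.1 s.RR_mem).1)

theorem IsStage.exists_eq3 {x : HRing F4 G F4} (hx : x ∈ Hdeg F4 G F4 (n + 3)) :
    ∃ a : F4, x = a • (h11 q.r_mul * (h11 q.r_mul * (h11 q.r_mul * c))) := by
  obtain ⟨z, hz, hzx⟩ := exists_isRep_of_mem_Hdeg hx
  obtain ⟨a, e⟩ := s.span0_3 (hzx.mem_Z hz)
  rw [← map_smul] at e
  have h := isRep_homCls q.r_mul
  exact ⟨a, (hzx.cl_eq_cl_iff ((h.mul (h.mul (h.mul hc))).smul a) hz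
    (Submodule.smul_mem _ _ (mem_Z0.1 s.RRR_mem).1)).1 e⟩

theorem IsStage.ne_zero : c ≠ 0 := fun h =>
  s.cl_y_ne_zero' ((hc.cl_eq_zero_iff (mem_Z0.1 s.mem).1).2 h)

theorem IsStage.independent1 {a b : F4}
    (e : a • (h10 q.r_mul * c) + b • (h11 q.r_mul * c) = 0) : a = 0 ∧ b = 0 := by
  refine s.indep0_1 ?_
  rw [← map_smul, ← map_smul, ← map_add]
  exact (((((isRep_homCls q.r_mul.sq).mul hc).smul a).add
    (((isRep_homCls q.r_mul).mul hc).smul b)).cl_eq_zero_iff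
      (add_mem (Submodule.smul_mem _ _ (mem_Z0.1 s.S_mem).1)
        (Submodule.smul_mem _ _ (mem_Z0.1 s.R_mem).1))).2 e

theorem IsStage.independent2 {a b : F4} (e : a • (h10 q.r_mul * (h10 q.r_mul * c)) +
      b • (h11 q.r_mul * (h11 q.r_mul * c)) = 0) : a = 0 ∧ b = 0 := by
  refine s.indep0_2 ?_
  rw [← map_smul, ← map_smul, ← map_add]
  exact (((((isRep_homCls q.r_mul.sq).mul ((isRep_homCls q.r_mul.sq).mul hc)).smul a).add
      (((isRep_homCls q.r_mul).mul ((isRep_homCls q.r_mul).mul hc)).smul b)).cl_eq_zero_iff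
      (add_mem (Submodule.smul_mem _ _ (mem_Z0.1 s.SS_mem).1)
        (Submodule.smul_mem _ _ (mem_Z0.1 s.RR_mem).1))).2 e

theorem IsStage.ne_zero3 : h11 q.r_mul * (h11 q.r_mul * (h11 q.r_mul * c)) ≠ 0 := fun e =>
  have h := isRep_homCls q.r_mul
  s.cl_RRR_ne_zero (((h.mul (h.mul (h.mul hc))).cl_eq_zero_iff (mem_Z0.1 s.RRR_mem).1).2 e)

end Stages

/-- The basis `1, h_{1,0}, h_{1,0}², h_{1,1}, h_{1,1}², h_{1,1}³` of the cohomology of `Q₈` over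
`F₄[g₀]`. -/
def monQ (hr : IsAdd r) : Fin 6 → HRing F4 G F4 :=
  ![1, h10 hr, h10 hr ^ 2, h11 hr, h11 hr ^ 2, h11 hr ^ 3]

/-- The degrees of the classes `monQ`. -/
def degQ : Fin 6 → ℕ := ![0, 1, 2, 1, 2, 3]

theorem monQ_mem (hr : IsAdd r) (i : Fin 6) : monQ hr i ∈ Hdeg F4 G F4 (degQ i) := by
  have h1 := HRing.pow_mem_Hdeg (homCls_mem hr.sq)
  have h2 := HRing.pow_mem_Hdeg (homCls_mem hr)
  fin_cases i
  exacts [HRing.one_mem_Hdeg, homCls_mem hr.sq, h1 2, homCls_mem hr, h2 2, h2 3]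

/-- The elements of the basis of the cohomology of `Q₈` of a given degree. -/
def fibreQ (n : ℕ) : Finset (Fin 6 × ℕ) := ({i : Fin 6 | degQ i = n % 4} : Finset (Fin 6)) ×ˢ {n / 4}

theorem mem_fibreQ (n : ℕ) (i : Fin 6 × ℕ) : i ∈ fibreQ n ↔ degQ i.1 + 4 * i.2 = n := by
  have h : degQ i.1 < 4 := by
    generalize i.1 = j
    fin_cases j <;> decide
  rw [fibreQ, Finset.mem_product, Finset.mem_filter, Finset.mem_singleton]
  simp only [Finset.mem_univ, true_and]
  omega

/-- The cohomology of `Q₈` is free over the polynomial ring on a class `g₀` of degree four. -/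
theorem exists_basis_Q [Finite G] (q : QCoord r t) : ∃ g0 ∈ Hdeg F4 G F4 4,
    ∃ b : Module.Basis (Fin 6 × ℕ) F4 (HRing F4 G F4), ∀ i, b i = monQ q.r_mul i.1 * g0 ^ i.2 := by
  -- The class `g₀` becomes `τ⁴`, so its powers start the periods of the computation.
  obtain ⟨g, s⟩ := (isStage_one q).exists_next
  obtain ⟨g0, hg0, hg⟩ := exists_isRep_of_mem_Z s.mem
  have hst := isStage_pow s
  have hmem : ∀ i : Fin 6 × ℕ, monQ q.r_mul i.1 * g0 ^ i.2 ∈ Hdeg F4 G F4 (degQ i.1 + 4 * i.2) :=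
    fun i => HRing.mul_mem_Hdeg (monQ_mem _ _) (HRing.pow_mem_Hdeg hg0 _)
  let p : Submodule F4 (HRing F4 G F4) :=
    Submodule.span F4 (Set.range fun i : Fin 6 × ℕ => monQ q.r_mul i.1 * g0 ^ i.2)
  have hp : ∀ (a : F4) (i : Fin 6) (k : ℕ) (x : HRing F4 G F4), monQ q.r_mul i * g0 ^ k = x →
      a • x ∈ p := by
    rintro a i k _ rfl
    exact Submodule.smul_mem _ _ (Submodule.subset_span ⟨(i, k), rfl⟩)
  have e0 : ∀ k, monQ q.r_mul 0 * g0 ^ k = g0 ^ k := fun k => one_mul _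
  have e1 : ∀ k, monQ q.r_mul 1 * g0 ^ k = h10 q.r_mul * g0 ^ k := fun k => rfl
  have e2 : ∀ k, monQ q.r_mul 2 * g0 ^ k = h10 q.r_mul * (h10 q.r_mul * g0 ^ k) := fun k => by
    rw [← mul_assoc, ← pow_two]
    rfl
  have e3 : ∀ k, monQ q.r_mul 3 * g0 ^ k = h11 q.r_mul * g0 ^ k := fun k => rfl
  have e4 : ∀ k, monQ q.r_mul 4 * g0 ^ k = h11 q.r_mul * (h11 q.r_mul * g0 ^ k) := fun k => by
    rw [← mul_assoc, ← pow_two]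
    rfl
  have e5 : ∀ k, monQ q.r_mul 5 * g0 ^ k =
      h11 q.r_mul * (h11 q.r_mul * (h11 q.r_mul * g0 ^ k)) := fun k => by
    rw [← mul_assoc, ← mul_assoc, ← pow_two, ← pow_succ]
    rfl
  have hli := HRing.linearIndependent_of_degreewise hmem fibreQ mem_fibreQ fun n a e => by
    rw [fibreQ, Finset.sum_product] at e
    simp only [Finset.sum_singleton] at e
    have hn : n % 4 < 4 := Nat.mod_lt _ (by norm_num)
    rw [fibreQ]
    rintro ⟨i, k⟩ hi
    obtain ⟨hi, hk⟩ := Finset.mem_product.1 hi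
    obtain rfl := Finset.mem_singleton.1 hk
    generalize n / 4 = k at *
    generalize n % 4 = m at *
    have f0 : ({i : Fin 6 | degQ i = 0} : Finset (Fin 6)) = {0} := by decide
    have f1 : ({i : Fin 6 | degQ i = 1} : Finset (Fin 6)) = {1, 3} := by decide
    have f2 : ({i : Fin 6 | degQ i = 2} : Finset (Fin 6)) = {2, 4} := by decide
    have f3 : ({i : Fin 6 | degQ i = 3} : Finset (Fin 6)) = {5} := by decide
    interval_cases m
    · rw [f0] at e hi
      rw [Finset.sum_singleton, e0] at e
      obtain rfl := Finset.mem_singleton.1 hi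
      exact eq_zero_of_smul e ((hst k).ne_zero (hg.pow k))
    · rw [f1] at e hi
      rw [Finset.sum_pair (by decide), e1, e3] at e
      obtain ⟨h1, h2⟩ := (hst k).independent1 (hg.pow k) e
      rcases Finset.mem_insert.1 hi with rfl | hi
      · exact h1
      · obtain rfl := Finset.mem_singleton.1 hi
        exact h2
    · rw [f2] at e hi
      rw [Finset.sum_pair (by decide), e2, e4] at e
      obtain ⟨h1, h2⟩ := (hst k).independent2 (hg.pow k) e
      rcases Finset.mem_insert.1 hi with rfl | hi
      · exact h1
      · obtain rfl := Finset.mem_singleton.1 hi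
        exact h2
    · rw [f3] at e hi
      rw [Finset.sum_singleton, e5] at e
      obtain rfl := Finset.mem_singleton.1 hi
      exact eq_zero_of_smul e ((hst k).ne_zero3 (hg.pow k))
  refine ⟨g0, hg0, .mk hli fun x _ => HRing.mem_of_Hdeg p (fun n y hy => ?_) x,
    fun i => Module.Basis.mk_apply _ _ i⟩
  have hn : n % 4 < 4 := Nat.mod_lt _ (by norm_num)
  rw [← Nat.div_add_mod n 4] at hy
  generalize n / 4 = k at *
  generalize n % 4 = m at *
  interval_cases m
  · obtain ⟨a, rfl⟩ := (hst k).exists_eq0 (hg.pow k) hy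
    exact hp a 0 k _ (e0 k)
  · obtain ⟨a, b, rfl⟩ := (hst k).exists_eq1 (hg.pow k) hy
    exact add_mem (hp a 1 k _ (e1 k)) (hp b 3 k _ (e3 k))
  · obtain ⟨a, b, rfl⟩ := (hst k).exists_eq2 (hg.pow k) hy
    exact add_mem (hp a 2 k _ (e2 k)) (hp b 4 k _ (e4 k))
  · obtain ⟨a, rfl⟩ := (hst k).exists_eq3 (hg.pow k) hy
    exact hp a 5 k _ (e5 k)

section Presentation
variable {q : QCoord r t} {g0 : HRing F4 G F4} {b : Module.Basis (Fin 6 × ℕ) F4 (HRing F4 G F4)}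
  (hb : ∀ i, b i = monQ q.r_mul i.1 * g0 ^ i.2)
include hb

/-- The cohomology ring of `Q₈` is commutative, as it is generated by `g₀` and classes of homomorphisms. -/
theorem comm_of_basis_Q (x y : HRing F4 G F4) : x * y = y * x := by
  refine mul_comm_of_span b b.span_eq.ge (fun i j => ?_) x y
  rw [hb i, hb j]
  have hm : ∀ i x, Commute (monQ q.r_mul i) x := fun i x => by
    have h0 := homCls_comm q.r_mul.sq x
    have h1 := homCls_comm q.r_mul x
    fin_cases i
    exacts [Commute.one_left x, h0, h0.pow_left 2, h1, h1.pow_left 2, h1.pow_left 3]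
  refine Commute.mul_left (hm _ _) (Commute.mul_right (hm _ _).symm ?_)
  exact (Commute.refl g0).pow_pow _ _

/-- The presentation of the cohomology ring of `Q₈`. -/
theorem exists_algEquiv_Q : ∃ φ : RingQ8 ≃ₐ[F4] HRing F4 G F4,
    φ (Ideal.Quotient.mk _ (MvPolynomial.X 0)) = g0 ∧
    φ (Ideal.Quotient.mk _ (MvPolynomial.X 1)) = h10 q.r_mul ∧
    φ (Ideal.Quotient.mk _ (MvPolynomial.X 2)) = h11 q.r_mul := by
  obtain ⟨f, hf⟩ := exists_algHom_of_comm (B := HRing F4 G F4) (comm_of_basis_Q (q := q) hb)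
    ![g0, h10 q.r_mul, h11 q.r_mul]
  let I : Ideal (MvPolynomial (Fin 3) F4) := Ideal.span {MvPolynomial.X 1 * MvPolynomial.X 2,
    MvPolynomial.X 1 ^ 3 + MvPolynomial.X 2 ^ 3}
  have hI : ∀ a ∈ I, f a = 0 := by
    intro a ha
    refine (Ideal.span_le.2 ?_ : I ≤ RingHom.ker f) ha
    rintro _ (rfl | rfl)
    · refine (RingHom.mem_ker).2 ?_
      rw [map_mul, hf, hf]
      exact h10_mul_h11 q
    · refine (RingHom.mem_ker).2 ?_
      rw [map_add, map_pow, map_pow, hf, hf]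
      change h10 q.r_mul ^ 3 + h11 q.r_mul ^ 3 = 0
      rw [h10_pow_three q, ← two_smul F4, two_F4, zero_smul]
  let φ : RingQ8 →ₐ[F4] HRing F4 G F4 := Ideal.Quotient.liftₐ I f hI
  let x : Fin 3 → RingQ8 := fun i => Ideal.Quotient.mk _ (MvPolynomial.X i)
  have hφ : ∀ i, φ (x i) = ![g0, h10 q.r_mul, h11 q.r_mul] i := hf
  have r1 : x 1 * x 2 = 0 := by
    refine (map_mul (Ideal.Quotient.mk I) _ _).symm.trans ?_
    exact Ideal.Quotient.eq_zero_iff_mem.2 (Ideal.subset_span (Or.inl rfl))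
  have r2 : x 1 ^ 3 = x 2 ^ 3 := by
    have h : x 1 ^ 3 + x 2 ^ 3 = 0 := by
      have : x 1 ^ 3 + x 2 ^ 3 = Ideal.Quotient.mk I (MvPolynomial.X 1 ^ 3 + MvPolynomial.X 2 ^ 3) := by
        rw [map_add, map_pow, map_pow]
      rw [this]
      exact Ideal.Quotient.eq_zero_iff_mem.2 (Ideal.subset_span (Or.inr rfl))
    have h2 : x 2 ^ 3 + x 2 ^ 3 = 0 := by rw [← two_smul F4, two_F4, zero_smul]
    linear_combination h - h2
  let m : Fin 6 → RingQ8 := ![1, x 1, x 1 ^ 2, x 2, x 2 ^ 2, x 2 ^ 3]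
  let p : Submodule F4 RingQ8 := Submodule.span F4 (Set.range fun i : Fin 6 × ℕ => m i.1 * x 0 ^ i.2)
  have hp : ∀ (i : Fin 6) (k : ℕ) (z : RingQ8), z = m i * x 0 ^ k → z ∈ p := by
    rintro i k _ rfl
    exact Submodule.subset_span ⟨(i, k), rfl⟩
  have hp0 : ∀ (z : RingQ8), z = 0 → z ∈ p := by
    rintro _ rfl
    exact zero_mem _
  -- The six monomials span the presented ring over `F₄[g₀]`: their span `p` is stable under the
  -- generators.
  have hmul : ∀ j, ∀ z ∈ p, z * x j ∈ p := by
    intro j z hz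
    refine (Submodule.span_le.2 ?_ : p ≤ p.comap (LinearMap.mulRight F4 (x j))) hz
    rintro _ ⟨⟨i, k⟩, rfl⟩
    change m i * x 0 ^ k * x j ∈ p
    fin_cases j
    · refine hp i (k + 1) _ ?_
      change m i * x 0 ^ k * x 0 = _
      ring
    · change m i * x 0 ^ k * x 1 ∈ p
      fin_cases i
      · refine hp 1 k _ ?_
        change 1 * x 0 ^ k * x 1 = x 1 * x 0 ^ k
        ring
      · refine hp 2 k _ ?_
        change x 1 * x 0 ^ k * x 1 = x 1 ^ 2 * x 0 ^ k
        ring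
      · refine hp 5 k _ ?_
        change x 1 ^ 2 * x 0 ^ k * x 1 = x 2 ^ 3 * x 0 ^ k
        linear_combination x 0 ^ k * r2
      · refine hp0 _ ?_
        change x 2 * x 0 ^ k * x 1 = 0
        linear_combination x 0 ^ k * r1
      · refine hp0 _ ?_
        change x 2 ^ 2 * x 0 ^ k * x 1 = 0
        linear_combination x 2 * x 0 ^ k * r1
      · refine hp0 _ ?_
        change x 2 ^ 3 * x 0 ^ k * x 1 = 0
        linear_combination x 2 ^ 2 * x 0 ^ k * r1
    · change m i * x 0 ^ k * x 2 ∈ p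
      fin_cases i
      · refine hp 3 k _ ?_
        change 1 * x 0 ^ k * x 2 = x 2 * x 0 ^ k
        ring
      · refine hp0 _ ?_
        change x 1 * x 0 ^ k * x 2 = 0
        linear_combination x 0 ^ k * r1
      · refine hp0 _ ?_
        change x 1 ^ 2 * x 0 ^ k * x 2 = 0
        linear_combination x 1 * x 0 ^ k * r1
      · refine hp 4 k _ ?_
        change x 2 * x 0 ^ k * x 2 = x 2 ^ 2 * x 0 ^ k
        ring
      · refine hp 5 k _ ?_
        change x 2 ^ 2 * x 0 ^ k * x 2 = x 2 ^ 3 * x 0 ^ k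
        ring
      · refine hp0 _ ?_
        change x 2 ^ 3 * x 0 ^ k * x 2 = 0
        linear_combination (- x 2 * x 0 ^ k) * r2 + x 1 ^ 2 * x 0 ^ k * r1
  have hspan : ⊤ ≤ p := by
    rintro z -
    obtain ⟨z, rfl⟩ := Ideal.Quotient.mk_surjective z
    induction z using MvPolynomial.induction_on with
    | C a =>
      have : Ideal.Quotient.mk I (MvPolynomial.C a) = a • (1 : RingQ8) :=
        (Algebra.algebraMap_eq_smul_one (A := RingQ8) a)
      refine this ▸ Submodule.smul_mem _ _ (hp 0 0 _ ?_)
      change (1 : RingQ8) = 1 * x 0 ^ 0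
      ring
    | add z w hz hw =>
      rw [map_add]
      exact add_mem hz hw
    | mul_X z i hz =>
      rw [map_mul]
      exact hmul i _ hz
  have hbij : Function.Bijective φ := by
    refine bijective_of_basis φ.toLinearMap _ hspan b fun i => ?_
    obtain ⟨i, k⟩ := i
    change φ (m i * x 0 ^ k) = _
    rw [map_mul, map_pow, hφ 0, hb]
    refine congrArg (· * g0 ^ k) ?_
    fin_cases i
    · exact map_one φ
    · exact hφ 1
    · exact (map_pow φ _ _).trans (congrArg (· ^ 2) (hφ 1))
    · exact hφ 2
    · exact (map_pow φ _ _).trans (congrArg (· ^ 2) (hφ 2))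
    · exact (map_pow φ _ _).trans (congrArg (· ^ 3) (hφ 2))
  exact ⟨AlgEquiv.ofBijective φ hbij, hφ 0, hφ 1, hφ 2⟩

end Presentation

end Quaternion

/-! ### The first page -/

section Coefficients
variable {k G A B : Type} [CommRing k]

/-- The map on cochains induced by a linear map of coefficients. -/
def cochLin (G : Type) [AddCommGroup A] [Module k A] [AddCommGroup B] [Module k B] (θ : A →ₗ[k] B) :
    Coch G A →ₗ[k] Coch G B :=
  DirectSum.toModule k ℕ _ fun n => DirectSum.lof k ℕ (CochDeg G B) n ∘ₗ
    ({ toFun := fun f x => θ (f x)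
       map_add' := fun _ _ => funext fun _ => map_add θ _ _
       map_smul' := fun _ _ => funext fun _ => map_smul θ _ _ } : CochDeg G A n →ₗ[k] CochDeg G B n)

/-- The map `cochLin` in degree `n`. -/
def linDeg [AddCommGroup A] [Module k A] [AddCommGroup B] [Module k B] (θ : A →ₗ[k] B) {n : ℕ}
    (f : CochDeg G A n) : CochDeg G B n := fun x => θ (f x)

theorem cochLin_of [AddCommGroup A] [Module k A] [AddCommGroup B] [Module k B] (θ : A →ₗ[k] B)
    (n : ℕ) (f : CochDeg G A n) :
    cochLin G θ (of (CochDeg G A) n f) = of (CochDeg G B) n (linDeg θ f) :=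
  DirectSum.toModule_lof k n f

theorem const_mul [CommRing A] (a : A) (x : Coch G A) : of (CochDeg G A) 0 (constDeg G a) * x = a • x :=
  (Algebra.smul_def (A := Coch G A) a x).symm

theorem mul_const [CommRing A] (a : A) (x : Coch G A) : x * of (CochDeg G A) 0 (constDeg G a) = a • x :=
  (Algebra.commutes (A := Coch G A) a x).symm.trans (const_mul a x)

variable [Group G]

theorem d_cochLin [AddCommGroup A] [Module k A] [AddCommGroup B] [Module k B] (θ : A →ₗ[k] B)
    (x : Coch G A) : d (Representation.trivial k G B) (cochLin G θ x) =
      cochLin G θ (d (Representation.trivial k G A) x) := by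
  induction x using DirectSum.induction_on with
  | zero => simp
  | add x y hx hy => simp only [map_add, hx, hy]
  | of n f =>
    rw [cochLin_of, d_of, d_of, cochLin_of]
    refine congrArg _ (funext fun x => ?_)
    change dDeg _ n (linDeg θ f) x = θ (dDeg _ n f x)
    rw [dDeg_apply, dDeg_apply, map_add, map_sum]
    simp only [map_smul]
    rfl

/-- The map on cohomology induced by a linear map of coefficients. -/
def HRing.coeffMap (G : Type) [Group G] [CharP k 2] [CommRing A] [Algebra k A] [CommRing B] [Algebra k B]
    (θ : A →ₗ[k] B) : HRing k G A →ₗ[k] HRing k G B :=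
  HRing.lin (cochLin G θ)
    (fun z hz => by rw [mem_cocycles, d_cochLin, mem_cocycles.1 hz, map_zero])
    fun y => ⟨cochLin G θ y, d_cochLin θ y⟩

theorem IsRep.coeffMap [CharP k 2] [CommRing A] [Algebra k A] [CommRing B] [Algebra k B]
    (θ : A →ₗ[k] B) {z : Coch G A} {c : HRing k G A} (h : IsRep z c) :
    IsRep (cochLin G θ z) (HRing.coeffMap G θ c) := by
  obtain ⟨hz, rfl⟩ := h
  rw [HRing.coeffMap, HRing.lin_cls]
  exact ⟨_, rfl⟩

theorem IsRep.map [CharP k 2] [CommRing A] [Algebra k A] [CommRing B] [Algebra k B]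
    {H : Type} [Group H] (α : H →* G) (θ : A →ₐ[k] B) {z : Coch G A} {c : HRing k G A}
    (h : IsRep z c) : IsRep (cochAlgHom α θ z) (HRing.map α θ c) := by
  obtain ⟨hz, rfl⟩ := h
  exact ⟨_, rfl⟩

section Constants
variable [CommRing A] [Algebra k A]

variable [CharP k 2]

theorem isRep_const (a : A) : IsRep (of (CochDeg G A) 0 (constDeg G a)) (HRing.const k G A a) :=
  ⟨_, rfl⟩

theorem HRing.const_comm (a : A) (x : HRing k G A) :
    HRing.const k G A a * x = x * HRing.const k G A a := by
  obtain ⟨z, hz⟩ := exists_isRep x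
  have h1 := (isRep_const (k := k) (G := G) a).mul hz
  have h2 := hz.mul (isRep_const (k := k) (G := G) a)
  rw [const_mul] at h1
  rw [mul_const] at h2
  exact h1.unique h2

theorem IsRep.const_smul (a : A) {z : Coch G A} {c : HRing k G A} (h : IsRep z c) :
    IsRep (a • z) (c * HRing.const k G A a) := by
  have := h.mul (isRep_const (k := k) (G := G) a)
  rwa [mul_const] at this

end Constants

end Coefficients

section FirstPage
variable {G : Type} [Group G]

theorem uPow_comm (m : ℤ) (x : E1 G) : uPow G m * x = x * uPow G m := HRing.const_comm _ x

theorem uPow_add (m n : ℤ) : uPow G (m + n) = uPow G m * uPow G n := by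
  have h := (isRep_const (k := F4) (G := G) (LaurentPolynomial.T m : EV0bar)).mul
    (isRep_const (k := F4) (G := G) (LaurentPolynomial.T n : EV0bar))
  rw [of_mul_of'] at h
  refine (IsRep.unique (z := _) ?_ h)
  have : cup (constDeg G (LaurentPolynomial.T m : EV0bar)) (constDeg G (LaurentPolynomial.T n)) =
      constDeg G (LaurentPolynomial.T (m + n) : EV0bar) :=
    funext fun _ => (LaurentPolynomial.T_add m n).symm
  rw [this]
  exact isRep_const _

theorem uPow_zero : uPow G 0 = 1 := (isRep_const (k := F4) (G := G) (1 : EV0bar)).unique isRep_one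

/-- The inclusion of the cochains with values in `F₄`. -/
abbrev scal (G : Type) [Group G] (A : Type) [CommRing A] [Algebra F4 A] :
    Coch G F4 →ₐ[F4] Coch G A :=
  cochAlgHom (MonoidHom.id G) (Algebra.ofId F4 A)

theorem IsRep.toE1 {z : Coch G F4} {c : HRing F4 G F4} (h : IsRep z c) :
    IsRep (scal G EV0bar z) (toE1 G c) := h.map (MonoidHom.id G) (Algebra.ofId F4 EV0bar)

/-- The coefficient of `uᵐ`. -/
def coeffT (m : ℤ) : EV0bar →ₗ[F4] F4 where
  toFun f := f.coeff m
  map_add' _ _ := rfl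
  map_smul' _ _ := rfl

theorem coeffT_T_mul (n m : ℤ) (a : F4) :
    coeffT n (LaurentPolynomial.T m * algebraMap F4 EV0bar a) = if m = n then a else 0 := by
  change (LaurentPolynomial.T m * LaurentPolynomial.C a : EV0bar).coeff n = _
  rw [mul_comm, ← LaurentPolynomial.single_eq_C_mul_T]
  exact Finsupp.single_apply

theorem sum_coeffT (f : EV0bar) (S : Finset ℤ) (h : f.coeff.support ⊆ S) :
    ∑ m ∈ S, LaurentPolynomial.T m * algebraMap F4 EV0bar (coeffT m f) = f := by
  refine LaurentPolynomial.ext fun n => ?_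
  have : (coeffT n) (∑ m ∈ S, LaurentPolynomial.T m * algebraMap F4 EV0bar (coeffT m f)) =
      coeffT n f := by
    rw [map_sum, Finset.sum_congr rfl fun m _ => coeffT_T_mul n m _, Finset.sum_ite_eq' S n]
    split_ifs with hn
    · rfl
    · exact (Finsupp.notMem_support_iff.1 fun h' => hn (h h')).symm
  exact this

/-- The cochain of degree `n` with values `uᵐ f`. -/
def powDeg {n : ℕ} (m : ℤ) (f : CochDeg G F4 n) : CochDeg G EV0bar n :=
  fun x => LaurentPolynomial.T m * algebraMap F4 EV0bar (f x)

theorem T_smul_scal_of (m : ℤ) (n : ℕ) (f : CochDeg G F4 n) :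
    (LaurentPolynomial.T m : EV0bar) • scal G EV0bar (of _ n f) = of _ n (powDeg m f) := by
  have : scal G EV0bar (of _ n f) = of _ n (mapDeg (MonoidHom.id G)
    ((Algebra.ofId F4 EV0bar : F4 →+* EV0bar) : F4 →+ EV0bar) n f) := cochMap_of _ _ n f
  rw [this]
  exact (DirectSum.of_smul EV0bar n _ _).symm

theorem cochLin_T_smul (n m : ℤ) (z : Coch G F4) :
    cochLin G (coeffT n) ((LaurentPolynomial.T m : EV0bar) • scal G EV0bar z) =
      if m = n then z else 0 := by
  induction z using DirectSum.induction_on with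
  | zero => simp
  | add x y hx hy =>
    rw [map_add, smul_add, map_add, hx, hy]
    split_ifs
    · rfl
    · rw [add_zero]
  | of j f =>
    rw [T_smul_scal_of, cochLin_of]
    have : linDeg (coeffT n) (powDeg m f) = if m = n then f else 0 := funext fun x => by
      refine (coeffT_T_mul n m (f x)).trans ?_
      split_ifs <;> rfl
    rw [this]
    split_ifs
    · rfl
    · exact map_zero _

/-- A cochain with values in the Laurent polynomials is the sum of its parts in the single powers of
`u`. As the group is finite, finitely many of them suffice. -/
theorem exists_sum_eq [Finite G] (z : Coch G EV0bar) : ∃ S : Finset ℤ, ∀ S', S ⊆ S' →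
    ∑ m ∈ S', (LaurentPolynomial.T m : EV0bar) • scal G EV0bar (cochLin G (coeffT m) z) = z := by
  classical
  induction z using DirectSum.induction_on with
  | zero => exact ⟨∅, fun S' _ => Finset.sum_eq_zero fun m _ => by rw [map_zero, map_zero, smul_zero]⟩
  | add x y hx hy =>
    obtain ⟨S, hS⟩ := hx
    obtain ⟨T, hT⟩ := hy
    refine ⟨S ∪ T, fun S' h => ?_⟩
    conv_rhs => rw [← hS S' (Finset.union_subset_left h), ← hT S' (Finset.union_subset_right h)]
    rw [← Finset.sum_add_distrib]
    refine Finset.sum_congr rfl fun m _ => ?_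
    rw [map_add, map_add, smul_add]
  | of j f =>
    have := Fintype.ofFinite (Fin j → G)
    refine ⟨Finset.univ.biUnion fun x : Fin j → G => (f x).coeff.support, fun S' h => ?_⟩
    simp only [cochLin_of, T_smul_scal_of]
    rw [← map_sum]
    refine congrArg _ (funext fun x => ?_)
    have e : (∑ m ∈ S', powDeg m (linDeg (coeffT m) f)) x =
        ∑ m ∈ S', powDeg m (linDeg (coeffT m) f) x :=
      Finset.sum_apply (M := fun _ : Fin j → G => EV0bar) x S'
        (fun m => powDeg m (linDeg (coeffT m) f))
    rw [e]
    exact sum_coeffT (f x) S' ((Finset.subset_biUnion_of_mem (fun x : Fin j → G => (f x).coeff.support)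
      (Finset.mem_univ x)).trans h)

theorem coeffMap_toE1_mul (n m : ℤ) (c : HRing F4 G F4) :
    HRing.coeffMap G (coeffT n) (toE1 G c * uPow G m) = if m = n then c else 0 := by
  obtain ⟨z, hz⟩ := exists_isRep c
  have h := (hz.toE1.const_smul (LaurentPolynomial.T m)).coeffMap (coeffT n)
  rw [cochLin_T_smul] at h
  refine h.unique ?_
  split_ifs
  · exact hz
  · exact isRep_zero

theorem IsRep.sum {k A I : Type} [CommRing k] [CharP k 2] [CommRing A] [Algebra k A]
    (S : Finset I) {z : I → Coch G A} {c : I → HRing k G A} (h : ∀ i, IsRep (z i) (c i)) :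
    IsRep (∑ i ∈ S, z i) (∑ i ∈ S, c i) := by
  classical
  induction S using Finset.induction_on with
  | empty =>
    rw [Finset.sum_empty, Finset.sum_empty]
    exact isRep_zero
  | insert i S hi ih =>
    rw [Finset.sum_insert hi, Finset.sum_insert hi]
    exact (h i).add ih

/-- A basis of the cohomology with coefficients in `F₄` gives one of the first page. -/
theorem exists_basis_E1 [Finite G] {K : Type} (b : Module.Basis K F4 (HRing F4 G F4)) :
    ∃ b' : Module.Basis (K × ℤ) F4 (E1 G), ∀ i, b' i = toE1 G (b i.1) * uPow G i.2 := by
  classical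
  -- The coordinates in `b` of the coefficients of `uᵐ` are the dual basis.
  have hdual : ∀ i j : K × ℤ, (b.coord i.1 ∘ₗ HRing.coeffMap G (coeffT i.2))
      (toE1 G (b j.1) * uPow G j.2) = if j = i then 1 else 0 := by
    intro i j
    rw [LinearMap.comp_apply, coeffMap_toE1_mul]
    by_cases h2 : j.2 = i.2
    · rw [if_pos h2, Module.Basis.coord_apply, b.repr_self, Finsupp.single_apply]
      by_cases h1 : j.1 = i.1
      · rw [if_pos h1, if_pos (Prod.ext h1 h2)]
      · rw [if_neg h1, if_neg fun h => h1 (congrArg Prod.fst h)]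
    · rw [if_neg h2, map_zero, if_neg fun h => h2 (congrArg Prod.snd h)]
  have hli : LinearIndependent F4 fun i : K × ℤ => toE1 G (b i.1) * uPow G i.2 :=
    LinearIndependent.of_pairwise_dual_eq_zero_one _
      (fun i => b.coord i.1 ∘ₗ HRing.coeffMap G (coeffT i.2))
      (fun i j h => (hdual i j).trans (if_neg (Ne.symm h))) fun i => (hdual i i).trans (if_pos rfl)
  refine ⟨.mk hli fun x _ => ?_, fun i => Module.Basis.mk_apply _ _ i⟩
  obtain ⟨z, hz⟩ := exists_isRep x
  obtain ⟨S, hS⟩ := exists_sum_eq z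
  have h := IsRep.sum S fun m => ((hz.coeffMap (coeffT m)).toE1.const_smul (LaurentPolynomial.T m))
  rw [hS S subset_rfl] at h
  rw [hz.unique h]
  refine Submodule.sum_mem _ fun m _ => ?_
  have hc : HRing.coeffMap G (coeffT m) x ∈ Submodule.span F4 (Set.range b) := b.span_eq ▸ Submodule.mem_top
  refine (Submodule.span_le.2 ?_ : Submodule.span F4 (Set.range b) ≤ (Submodule.span F4 (Set.range
    fun i : K × ℤ => toE1 G (b i.1) * uPow G i.2)).comap
      (LinearMap.mulRight F4 (uPow G m) ∘ₗ (toE1 G).toLinearMap)) hc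
  rintro _ ⟨i, rfl⟩
  exact Submodule.subset_span ⟨(i, m), rfl⟩

/-- The first page is commutative if the cohomology with coefficients in `F₄` is. -/
theorem comm_E1 [Finite G] {K : Type} (b : Module.Basis K F4 (HRing F4 G F4))
    (hc : ∀ x y : HRing F4 G F4, x * y = y * x) (x y : E1 G) : x * y = y * x := by
  obtain ⟨b', hb'⟩ := exists_basis_E1 b
  refine mul_comm_of_span b' b'.span_eq.ge (fun i j => ?_) x y
  have h : ∀ x y, Commute (toE1 G x) (toE1 G y) := fun x y => by
    rw [commute_iff_eq, ← map_mul, hc, map_mul]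
  have hu : ∀ m (x : E1 G), Commute (uPow G m) x := uPow_comm
  rw [hb', hb']
  exact Commute.mul_left (Commute.mul_right (h _ _) (hu _ _).symm) (hu _ _)

end FirstPage

/-! ### The Bockstein spectral sequence of a basis of cochains -/

section Reduction

/-- The section of the reduction modulo `u₁` that includes the Laurent polynomials over `F₄`. -/
def sec : EV0bar →+* EV0 :=
  LaurentPolynomial.eval₂ ((LaurentPolynomial.C : PowerSeries F4 →+* EV0).comp PowerSeries.C)
    (unitT (PowerSeries F4))

theorem unitT_zpow (R : Type) [CommRing R] (n : ℤ) :
    ((unitT R ^ n : R[T;T⁻¹]ˣ) : R[T;T⁻¹]) = LaurentPolynomial.T n := by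
  have h : ∀ k : ℕ, ((unitT R ^ k : R[T;T⁻¹]ˣ) : R[T;T⁻¹]) = LaurentPolynomial.T k := fun k => by
    rw [Units.val_pow_eq_pow_val]
    change LaurentPolynomial.T 1 ^ k = _
    rw [LaurentPolynomial.T_pow, mul_one]
  have h' : ∀ k : ℕ, (((unitT R)⁻¹ ^ k : R[T;T⁻¹]ˣ) : R[T;T⁻¹]) = LaurentPolynomial.T (-k) :=
    fun k => by
      rw [Units.val_pow_eq_pow_val]
      change LaurentPolynomial.T (-1) ^ k = _
      rw [LaurentPolynomial.T_pow, mul_neg_one]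
  cases n with
  | ofNat k => exact h k
  | negSucc k =>
    rw [zpow_negSucc, ← inv_pow]
    exact h' (k + 1)

theorem red_T (n : ℤ) : red (LaurentPolynomial.T n) = LaurentPolynomial.T n :=
  (LaurentPolynomial.eval₂_T _ _ n).trans (unitT_zpow F4 n)

theorem sec_T (n : ℤ) : sec (LaurentPolynomial.T n) = LaurentPolynomial.T n :=
  (LaurentPolynomial.eval₂_T _ _ n).trans (unitT_zpow (PowerSeries F4) n)

theorem exists_eq_sec_add (m : EV0) : ∃ m', m = sec (red m) + v1 * m' := by
  induction m using LaurentPolynomial.induction_on' with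
  | add p q hp hq =>
    obtain ⟨p', hp⟩ := hp
    obtain ⟨q', hq⟩ := hq
    refine ⟨p' + q', ?_⟩
    rw [map_add, map_add]
    linear_combination hp + hq
  | C_mul_T n a =>
    obtain ⟨c, hc⟩ : (PowerSeries.X : PowerSeries F4) ∣
        a - PowerSeries.C (PowerSeries.constantCoeff a) := by
      rw [PowerSeries.X_dvd_iff]
      simp
    refine ⟨LaurentPolynomial.C c * LaurentPolynomial.T (n + 1), ?_⟩
    have e := congrArg (LaurentPolynomial.C : PowerSeries F4 →+* EV0) hc
    rw [map_sub, map_mul] at e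
    have e1 : sec (LaurentPolynomial.C (PowerSeries.constantCoeff a)) =
      LaurentPolynomial.C (PowerSeries.C (PowerSeries.constantCoeff a)) :=
      LaurentPolynomial.eval₂_C _ _ _
    have e2 : (LaurentPolynomial.T n : EV0) = LaurentPolynomial.T (-1) * LaurentPolynomial.T (n + 1) := by
      rw [← LaurentPolynomial.T_add]
      congr 1
      ring
    rw [map_mul, red_C, red_T, map_mul, e1, sec_T, v1]
    linear_combination LaurentPolynomial.T n * e +
      LaurentPolynomial.C PowerSeries.X * LaurentPolynomial.C c * e2

theorem exists_eq_v1_mul {m : EV0} (h : red m = 0) : ∃ m', m = v1 * m' := by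
  obtain ⟨m', hm'⟩ := exists_eq_sec_add m
  rw [h, map_zero, zero_add] at hm'
  exact ⟨m', hm'⟩

theorem red_surjective : Function.Surjective red := by
  intro f
  induction f using LaurentPolynomial.induction_on' with
  | add p q hp hq =>
    obtain ⟨p', rfl⟩ := hp
    obtain ⟨q', rfl⟩ := hq
    exact ⟨p' + q', map_add _ _ _⟩
  | C_mul_T n a =>
    refine ⟨LaurentPolynomial.C (PowerSeries.C a) * LaurentPolynomial.T n, ?_⟩
    rw [map_mul, red_T, red_C, PowerSeries.constantCoeff_C]

theorem red_v1 : red v1 = 0 := by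
  rw [v1, map_mul, red_C, PowerSeries.constantCoeff_X, map_zero, zero_mul]

theorem v1_mul_eq_zero {m : EV0} (h : v1 * m = 0) : m = 0 := by
  have hX : (LaurentPolynomial.C (PowerSeries.X : PowerSeries F4) : EV0) ≠ 0 := fun h0 => by
    rw [← LaurentPolynomial.single_eq_C, AddMonoidAlgebra.single_eq_zero] at h0
    exact PowerSeries.X_ne_zero h0
  have h1 : v1 * LaurentPolynomial.T 1 = LaurentPolynomial.C PowerSeries.X := by
    rw [v1, mul_assoc, ← LaurentPolynomial.T_add]
    simp
  have h2 : LaurentPolynomial.C PowerSeries.X * m = 0 := by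
    rw [← h1]
    linear_combination LaurentPolynomial.T 1 * h
  exact (mul_eq_zero.1 h2).resolve_left hX

variable {G : Type} [Group G]

theorem redCoch_of (n : ℕ) (f : CochDeg G EV0 n) :
    redCoch (of (CochDeg G EV0) n f) = of (CochDeg G EV0bar) n
      (mapDeg (MonoidHom.id G) ((red : EV0 →+* EV0bar) : EV0 →+ EV0bar) n f) := cochMap_of _ _ n f

theorem redCoch_smul (a : EV0) (x : Coch G EV0) : redCoch (a • x) = red a • redCoch x := by
  rw [← const_mul, ← const_mul, map_mul, redCoch_of]
  rfl

theorem redCoch_v1_smul (x : Coch G EV0) : redCoch (v1 • x) = 0 := by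
  rw [redCoch_smul, red_v1, zero_smul]

theorem redCoch_surjective : Function.Surjective (redCoch (G := G)) := by
  intro z
  induction z using DirectSum.induction_on with
  | zero => exact ⟨0, map_zero _⟩
  | add x y hx hy =>
    obtain ⟨x', rfl⟩ := hx
    obtain ⟨y', rfl⟩ := hy
    exact ⟨x' + y', map_add _ _ _⟩
  | of n f =>
    let f' : CochDeg G EV0 n := fun x => (red_surjective (f x)).choose
    refine ⟨of _ n f', ?_⟩
    rw [redCoch_of]
    exact congrArg _ (funext fun x => (red_surjective (f x)).choose_spec)

theorem exists_eq_v1_smul {x : Coch G EV0} (h : redCoch x = 0) : ∃ y, x = v1 • y := by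
  classical
  have h1 : ∀ n, ∃ f : CochDeg G EV0 n, x n = v1 • f := fun n => by
    have h2 : redCoch x n = mapDeg (MonoidHom.id G) ((red : EV0 →+* EV0bar) : EV0 →+ EV0bar) n (x n) :=
      DirectSum.map_apply _ _ _
    rw [h] at h2
    have h3 : ∀ y, ∃ m', x n y = v1 * m' := fun y => exists_eq_v1_mul (congrFun h2.symm y)
    choose f hf using h3
    exact ⟨f, funext hf⟩
  choose f hf using h1
  refine ⟨∑ n ∈ DFinsupp.support x, of _ n (f n), ?_⟩
  rw [Finset.smul_sum]
  conv_lhs => rw [← DirectSum.sum_support_of x]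
  refine Finset.sum_congr rfl fun n _ => ?_
  rw [hf n]
  exact DirectSum.of_smul EV0 n v1 (f n)

theorem v1_smul_eq_zero {G : Type} {x : Coch G EV0} (h : v1 • x = 0) : x = 0 := by
  refine DFinsupp.ext fun n => funext fun y => v1_mul_eq_zero ?_
  have h1 : (v1 • x) n = v1 • x n := DirectSum.smul_apply v1 x n
  rw [h] at h1
  exact (congrFun h1 y).symm

theorem v1_smul_cancel {G : Type} {x y : Coch G EV0} (h : v1 • x = v1 • y) : x = y := by
  rw [← sub_eq_zero] at h ⊢
  rw [← smul_sub] at h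
  exact v1_smul_eq_zero h

theorem v1_pow_smul_eq_zero {G : Type} {n : ℕ} {x : Coch G EV0} (h : v1 ^ n • x = 0) : x = 0 := by
  induction n with
  | zero => rwa [pow_zero, one_smul] at h
  | succ n ih =>
    rw [pow_succ', mul_smul] at h
    exact ih (v1_smul_eq_zero h)

/-- Multiplication by an invariant element commutes with the differential. -/
theorem d_smul_of_invariant {A : Type} [CommRing A] [Algebra F4 A] {ρ : Representation F4 G A}
    (hmul : ∀ g a b, ρ g (a * b) = ρ g a * ρ g b) {a : A} (ha : ∀ g, ρ g a = a) (x : Coch G A) :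
    d ρ (a • x) = a • d ρ x := by
  induction x using DirectSum.induction_on with
  | zero => simp
  | add x y hx hy => simp only [smul_add, map_add, hx, hy]
  | of n f =>
    have e : ∀ (m : ℕ) (f : CochDeg G A m), a • of _ m f = of (CochDeg G A) m (a • f) :=
      fun m f => (DirectSum.of_smul A m a f).symm
    rw [e, d_of, d_of, e]
    refine congrArg _ (funext fun x => ?_)
    change dDeg ρ n (a • f) x = a • dDeg ρ n f x
    rw [dDeg_apply, dDeg_apply]
    change ρ (x 0) (a * f _) + ∑ j : Fin (n + 1), _ • (a * f _) = a * (_ + _)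
    rw [hmul, ha, mul_add, Finset.mul_sum]
    simp only [mul_smul_comm]

/-- The properties of the action of a group on `F₄⟦u₁⟧[u^{±1}]` used below: it is by ring
homomorphisms that fix `v₁` and are trivial modulo `v₁`, and `u⁻¹ ↦ u⁻¹ + r(g) v₁`. -/
structure IsBockstein (ρ : Representation F4 G EV0) (r : G → F4) : Prop where
  map_mul : ∀ g a b, ρ g (a * b) = ρ g a * ρ g b
  map_one : ∀ g, ρ g 1 = 1
  map_v1 : ∀ g, ρ g v1 = v1
  red_map : ∀ g m, red (ρ g m) = red m
  map_T : ∀ g, ρ g (LaurentPolynomial.T (-1)) = LaurentPolynomial.T (-1) + r g • v1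

variable {ρ : Representation F4 G EV0} {r : G → F4}

theorem IsBockstein.redCoch_d (h : IsBockstein ρ r) (x : Coch G EV0) :
    redCoch (d ρ x) = d (Representation.trivial F4 G EV0bar) (redCoch x) := by
  induction x using DirectSum.induction_on with
  | zero => simp
  | add x y hx hy => simp only [map_add, hx, hy]
  | of n f =>
    rw [d_of, redCoch_of, redCoch_of, d_of]
    refine congrArg _ (funext fun x => ?_)
    change red (dDeg ρ n f x) = dDeg _ n _ x
    rw [dDeg_apply, dDeg_apply, map_add, map_sum, h.red_map]
    simp only [map_smul]
    rfl

/-- Multiplication by an invariant element commutes with the differential. -/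
theorem IsBockstein.d_smul (h : IsBockstein ρ r) {a : EV0} (ha : ∀ g, ρ g a = a) (x : Coch G EV0) :
    d ρ (a • x) = a • d ρ x := d_smul_of_invariant h.map_mul ha x

theorem IsBockstein.d_v1_pow_smul (h : IsBockstein ρ r) (n : ℕ) (x : Coch G EV0) :
    d ρ (v1 ^ n • x) = v1 ^ n • d ρ x := by
  refine h.d_smul (fun g => ?_) x
  induction n with
  | zero => rw [pow_zero, h.map_one]
  | succ n ih => rw [pow_succ, h.map_mul, ih, h.map_v1]

end Reduction

section Abstract
variable {G : Type} [Group G] {ρ : Representation F4 G EV0} {r : G → F4}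

/-- A basis of the first page of the `v₁`-Bockstein spectral sequence, indexed by `ι ⊕ σ`, with
cochains that lift it: the lifts of the elements of `ι` are cocycles, and for the elements of `σ`
the differential of the lift is a power of `v₁` times the lift of an element of `ι`, its target. -/
structure BocksteinBasis (ρ : Representation F4 G EV0) (ι σ : Type) where
  /-- The basis of the first page. -/
  b : Module.Basis (ι ⊕ σ) F4 (E1 G)
  /-- The lifts. -/
  X : ι ⊕ σ → Coch G EV0
  /-- The target of the differential. -/
  tgt : σ → ι
  /-- The length of the differential. -/
  o : σ → ℕ
  isRep : ∀ i, IsRep (redCoch (X i)) (b i)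
  tgt_injective : Function.Injective tgt
  o_ne_zero : ∀ s, o s ≠ 0
  d_inl : ∀ i, d ρ (X (.inl i)) = 0
  d_inr : ∀ s, d ρ (X (.inr s)) = v1 ^ o s • X (.inl (tgt s))

namespace BocksteinBasis
variable {ι σ : Type} (D : BocksteinBasis ρ ι σ)

theorem isRep_linear (L : E1 G →ₗ[F4] Coch G EV0) (δ : E1 G →ₗ[F4] E1 G)
    (h : ∀ i, IsRep (redCoch (L (D.b i))) (δ (D.b i))) (c : E1 G) :
    IsRep (redCoch (L c)) (δ c) := by
  have hc : c ∈ Submodule.span F4 (Set.range D.b) := D.b.span_eq ▸ Submodule.mem_top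
  induction hc using Submodule.span_induction with
  | mem x hx =>
    obtain ⟨i, rfl⟩ := hx
    exact h i
  | zero =>
    rw [map_zero, map_zero, map_zero]
    exact isRep_zero
  | add x y _ _ hx hy =>
    rw [map_add, map_add, map_add]
    exact hx.add hy
  | smul a x _ hx =>
    rw [map_smul, map_smul, map_smul]
    exact hx.smul a

/-- The linear extension of the lifts. -/
def lift : E1 G →ₗ[F4] Coch G EV0 := D.b.constr F4 D.X

theorem isRep_lift (c : E1 G) : IsRep (redCoch (D.lift c)) c :=
  D.isRep_linear D.lift LinearMap.id (fun i => by
    rw [lift, Module.Basis.constr_basis]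
    exact D.isRep i) c

/-- The differential of the lift, divided by `v₁ʲ`. The basis elements whose differential is not
divisible by `v₁ʲ` are sent to zero. -/
def dLift (j : ℕ) : E1 G →ₗ[F4] Coch G EV0 :=
  D.b.constr F4 (Sum.elim (fun _ => 0) fun s =>
    if D.o s < j then 0 else v1 ^ (D.o s - j) • D.X (.inl (D.tgt s)))

/-- The differential of length `j`. -/
def diff (j : ℕ) : E1 G →ₗ[F4] E1 G :=
  D.b.constr F4 (Sum.elim (fun _ => 0) fun s => if D.o s = j then D.b (.inl (D.tgt s)) else 0)

theorem dLift_inl (j : ℕ) (i : ι) : D.dLift j (D.b (.inl i)) = 0 := by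
  rw [dLift, Module.Basis.constr_basis]
  rfl

theorem dLift_inr (j : ℕ) (s : σ) : D.dLift j (D.b (.inr s)) =
    if D.o s < j then 0 else v1 ^ (D.o s - j) • D.X (.inl (D.tgt s)) := by
  rw [dLift, Module.Basis.constr_basis]
  rfl

theorem diff_inl (j : ℕ) (i : ι) : D.diff j (D.b (.inl i)) = 0 := by
  rw [diff, Module.Basis.constr_basis]
  rfl

theorem diff_inr (j : ℕ) (s : σ) : D.diff j (D.b (.inr s)) =
    if D.o s = j then D.b (.inl (D.tgt s)) else 0 := by
  rw [diff, Module.Basis.constr_basis]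
  rfl

theorem isRep_dLift (j : ℕ) (c : E1 G) : IsRep (redCoch (D.dLift j c)) (D.diff j c) := by
  refine D.isRep_linear _ _ (fun i => ?_) c
  have h0 : IsRep (redCoch (0 : Coch G EV0)) (0 : E1 G) := by
    rw [map_zero]
    exact isRep_zero
  rcases i with i | s
  · rw [dLift_inl, diff_inl]
    exact h0
  · rw [dLift_inr, diff_inr]
    split_ifs with h1 h2 h2
    · omega
    · exact h0
    · rw [h2, Nat.sub_self, pow_zero, one_smul]
      exact D.isRep _
    · obtain ⟨k, hk⟩ : ∃ k, D.o s - j = k + 1 := ⟨D.o s - j - 1, by omega⟩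
      rw [hk, pow_succ', mul_smul, redCoch_v1_smul]
      exact isRep_zero

theorem d_lift {j : ℕ} {c : E1 G} (hc : ∀ s, D.o s < j → D.b.repr c (.inr s) = 0) :
    d ρ (D.lift c) = v1 ^ j • D.dLift j c := by
  rw [lift, dLift, Module.Basis.constr_apply, Module.Basis.constr_apply, map_finsuppSum,
    Finsupp.smul_sum]
  refine Finsupp.sum_congr fun i hi => ?_
  rw [map_smul, ← smul_comm (D.b.repr c i) (v1 ^ j)]
  refine congrArg _ ?_
  rcases i with i | s
  · rw [D.d_inl]
    exact (smul_zero _).symm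
  · have h : ¬ D.o s < j := fun h => (Finsupp.mem_support_iff.1 hi) (hc s h)
    rw [D.d_inr]
    change _ = v1 ^ j • (if _ then _ else _)
    rw [if_neg h, smul_smul, ← pow_add]
    congr 2
    omega

/-- The span of the targets of differentials of length at most `j`. -/
def bd (j : ℕ) : Submodule F4 (E1 G) :=
  Submodule.span F4 ((fun s => D.b (.inl (D.tgt s))) '' {s | D.o s ≤ j})

theorem bd_mono {i j : ℕ} (h : i ≤ j) : D.bd i ≤ D.bd j :=
  Submodule.span_mono (Set.image_mono fun _ hs => le_trans hs h)

theorem repr_eq_zero_of_mem_bd {j : ℕ} {c : E1 G} (hc : c ∈ D.bd j) {i : ι ⊕ σ}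
    (hi : ∀ s, D.o s ≤ j → i ≠ .inl (D.tgt s)) : D.b.repr c i = 0 := by
  refine (Submodule.span_le.2 ?_ : D.bd j ≤ LinearMap.ker (D.b.coord i)) hc
  rintro _ ⟨s, hs, rfl⟩
  change D.b.repr (D.b (.inl (D.tgt s))) i = 0
  rw [D.b.repr_self, Finsupp.single_eq_of_ne (hi s hs)]

theorem diff_mem_bd (j : ℕ) (c : E1 G) : D.diff j c ∈ D.bd j := by
  rw [diff, Module.Basis.constr_apply]
  refine Submodule.sum_mem _ fun i _ => Submodule.smul_mem _ _ ?_
  rcases i with i | s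
  · exact zero_mem _
  · change (if _ then _ else _) ∈ _
    split_ifs with h
    · exact Submodule.subset_span ⟨s, h.le, rfl⟩
    · exact zero_mem _

theorem repr_diff {j : ℕ} {s : σ} (h : D.o s = j) (c : E1 G) :
    D.b.repr (D.diff j c) (.inl (D.tgt s)) = D.b.repr c (.inr s) := by
  have key : D.b.coord (.inl (D.tgt s)) ∘ₗ D.diff j = D.b.coord (.inr s) := D.b.ext fun i => by
    rw [LinearMap.comp_apply]
    rcases i with i | s'
    · rw [diff_inl, LinearMap.map_zero, Module.Basis.coord_apply, D.b.repr_self,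
        Finsupp.single_eq_of_ne Sum.inr_ne_inl]
    · rw [diff_inr]
      by_cases hs : s = s'
      · subst hs
        rw [if_pos h, Module.Basis.coord_apply, Module.Basis.coord_apply, D.b.repr_self,
          D.b.repr_self, Finsupp.single_eq_same, Finsupp.single_eq_same]
      · rw [D.b.coord_apply (.inr s), D.b.repr_self,
          Finsupp.single_eq_of_ne fun h => hs (Sum.inr_injective h)]
        split_ifs
        · rw [Module.Basis.coord_apply, D.b.repr_self, Finsupp.single_eq_of_ne fun h =>
            hs (D.tgt_injective (Sum.inl_injective h))]
        · exact LinearMap.map_zero _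
  exact congrArg (fun f => f c) key

/-- A cochain that represents `c` modulo `v₁` differs from the lift of `c` by a coboundary and a multiple
of `v₁`. -/
theorem exists_eq_lift_add (hρ : IsBockstein ρ r) {x : Coch G EV0} {c : E1 G}
    (hx : IsRep (redCoch x) c) : ∃ e x', x = D.lift c + d ρ e + v1 • x' := by
  have h := hx.sub (D.isRep_lift c)
  rw [sub_self] at h
  obtain ⟨e', he'⟩ := isRep_zero_iff.1 h
  obtain ⟨e, rfl⟩ := redCoch_surjective e'
  rw [← hρ.redCoch_d, ← sub_eq_zero, ← map_sub, ← map_sub] at he'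
  obtain ⟨x', hx'⟩ := exists_eq_v1_smul he'
  refine ⟨e, -x', ?_⟩
  rw [smul_neg, ← hx']
  abel

/-- If `v₁ʲ y` is a coboundary, then the class of `y` modulo `v₁` is in the span of the targets of the
differentials of length at most `j` of the basis. -/
def Bounded (j : ℕ) : Prop := ∀ (x y : Coch G EV0) (c : E1 G), d ρ x = v1 ^ j • y →
  IsRep (redCoch y) c → c ∈ D.bd j

/-- If the differential of `x` is `v₁^(m + 1) y`, and the class `c` of `x` does not involve the sources of
differentials of length at most `j`, then `x` minus the lift of `c` and a coboundary can be divided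
by `v₁`. The differential of the quotient shows that the differential of length `j + 1` of `c` is a
boundary for shorter differentials. -/
theorem exists_d_eq (hρ : IsBockstein ρ r) {m j : ℕ} (hj : j ≤ m) {x y : Coch G EV0} {c : E1 G}
    (hx : IsRep (redCoch x) c) (hd : d ρ x = v1 ^ (m + 1) • y)
    (hc : ∀ s, D.o s ≤ j → D.b.repr c (.inr s) = 0) :
    ∃ x', d ρ x' = v1 ^ j • (v1 ^ (m - j) • y - D.dLift (j + 1) c) := by
  obtain ⟨e, x', hx'⟩ := D.exists_eq_lift_add hρ hx
  refine ⟨x', v1_smul_cancel ?_⟩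
  have h1 := congrArg (d ρ) hx'
  have h2 := hρ.d_v1_pow_smul 1 x'
  rw [pow_one] at h2
  rw [map_add, map_add, d_d, add_zero, hd, h2, D.d_lift (j := j + 1) fun s hs =>
    hc s (Nat.lt_succ_iff.1 hs)] at h1
  rw [smul_smul, ← pow_succ', smul_sub, smul_smul, ← pow_add]
  have : j + 1 + (m - j) = m + 1 := by omega
  rw [this, h1]
  abel

/-- A class whose lift has a differential divisible by a high power of `v₁` does not involve the
sources of shorter differentials. -/
theorem repr_eq_zero (hρ : IsBockstein ρ r) {m : ℕ} (hb : ∀ j < m, D.Bounded j) {x y : Coch G EV0}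
    {c : E1 G} (hx : IsRep (redCoch x) c) (hd : d ρ x = v1 ^ (m + 1) • y) (j : ℕ) (hj : j ≤ m) :
    ∀ s, D.o s ≤ j → D.b.repr c (.inr s) = 0 := by
  induction j with
  | zero => exact fun s hs => absurd (Nat.le_zero.1 hs) (D.o_ne_zero s)
  | succ j ih =>
    have ih := ih (Nat.le_of_succ_le hj)
    intro s hs
    rcases Nat.lt_or_eq_of_le hs with h | h
    · exact ih s (Nat.lt_succ_iff.1 h)
    obtain ⟨x', hx'⟩ := D.exists_d_eq hρ (Nat.le_of_succ_le hj) hx hd ih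
    obtain ⟨k, hk⟩ : ∃ k, m - j = k + 1 := ⟨m - j - 1, by omega⟩
    have h1 : IsRep (redCoch (v1 ^ (m - j) • y - D.dLift (j + 1) c)) (0 - D.diff (j + 1) c) := by
      rw [map_sub, hk, pow_succ', mul_smul, redCoch_v1_smul]
      exact isRep_zero.sub (D.isRep_dLift _ c)
    -- So the differential of length `j + 1` of `c` is in the span of the targets of shorter
    -- differentials; since different sources have different targets, its coordinates are zero.
    have h2 := hb j hj _ _ _ hx' h1
    rw [zero_sub, neg_mem_iff] at h2
    rw [← D.repr_diff h]
    refine D.repr_eq_zero_of_mem_bd h2 fun s' hs' e => ?_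
    rw [D.tgt_injective (Sum.inl_injective e)] at h
    omega

/-- The differentials of the spectral sequence are no more than those of the basis. The induction
replaces `x` by the quotient by `v₁` of its difference with the lift of its class, which changes the
class of `y` by a differential of the basis. -/
theorem bounded (hρ : IsBockstein ρ r) (m : ℕ) : D.Bounded m := by
  induction m using Nat.strong_induction_on with
  | h m ih =>
    intro x y c hd hy
    cases m with
    | zero =>
      rw [pow_zero, one_smul] at hd
      rw [← hd, hρ.redCoch_d] at hy
      rw [hy.unique (isRep_d _)]
      exact zero_mem _
    | succ m =>
      have h0 : d ρ x = v1 ^ (m + 1) • y := hd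
      -- The differential of `x` is divisible by `v₁`, so `x` represents a class of the first page.
      have hx : d (Representation.trivial F4 G EV0bar) (redCoch x) = 0 := by
        rw [← hρ.redCoch_d, h0, pow_succ', mul_smul, redCoch_v1_smul]
      have hx' : IsRep (redCoch x) (cls ⟨redCoch x, hx⟩) := ⟨hx, rfl⟩
      have h1 := D.repr_eq_zero hρ (fun j hj => ih j (Nat.lt_succ_of_lt hj)) hx' h0 m le_rfl
      obtain ⟨z, hz⟩ := D.exists_d_eq hρ le_rfl hx' h0 h1
      rw [Nat.sub_self, pow_zero, one_smul] at hz
      have h2 : IsRep (redCoch (y - D.dLift (m + 1) (cls ⟨redCoch x, hx⟩)))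
          (c - D.diff (m + 1) (cls ⟨redCoch x, hx⟩)) := by
        rw [map_sub]
        exact hy.sub (D.isRep_dLift _ _)
      have h3 := D.bd_mono (Nat.le_succ m) (ih m (Nat.lt_succ_self m) _ _ _ hz h2)
      have := add_mem h3 (D.diff_mem_bd (m + 1) (cls ⟨redCoch x, hx⟩))
      rwa [sub_add_cancel] at this

theorem inl_mem_Zinf (i : ι) : D.b (.inl i) ∈ Zinf ρ := by
  refine Submodule.mem_iInf _ |>.2 fun n => ?_
  obtain ⟨hz, h⟩ := D.isRep (.inl i)
  exact ⟨⟨_, hz⟩, D.X (.inl i), 0, by rw [D.d_inl, smul_zero], rfl, h⟩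

/-- The permanent cycles are spanned by the elements indexed by `ι`. -/
theorem repr_eq_zero_of_mem_Zinf (hρ : IsBockstein ρ r) {c : E1 G} (hc : c ∈ Zinf ρ) (s : σ) :
    D.b.repr c (.inr s) = 0 := by
  obtain ⟨z, x, y, h1, h2, h3⟩ := (Submodule.mem_iInf _).1 hc (D.o s + 1)
  have hx : IsRep (redCoch x) c := by
    rw [h2, ← h3]
    exact isRep_cls z
  exact D.repr_eq_zero hρ (fun j _ => D.bounded hρ j) hx h1 (D.o s) le_rfl s le_rfl

theorem Binf_eq (hρ : IsBockstein ρ r) (n : ℕ) : Binf ρ n = D.bd n := by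
  refine le_antisymm (iSup_le fun m => ?_) (Submodule.span_le.2 ?_)
  · rintro c ⟨z, w, y, h1, h2, rfl⟩
    refine D.bd_mono (min_le_right _ _) (D.bounded hρ _ w y _ h1 ?_)
    rw [h2]
    exact isRep_cls z
  · rintro _ ⟨s, hs, rfl⟩
    refine Submodule.mem_iSup_of_mem (D.o s + 1) ?_
    obtain ⟨hz, h⟩ := D.isRep (.inl (D.tgt s))
    refine ⟨⟨_, hz⟩, D.X (.inr s), D.X (.inl (D.tgt s)), ?_, rfl, h⟩
    rw [D.d_inr, Nat.add_sub_cancel, min_eq_left hs]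

/-- The `E_∞`-term in terms of a basis of lifts. -/
theorem einfIsDirectSum (hρ : IsBockstein ρ r) (deg : ι ⊕ σ → ℕ)
    (hdeg : ∀ i, D.b i ∈ Hdeg F4 G EV0bar (deg i)) (ord : ι → ℕ∞)
    (hord : ∀ s, ord (D.tgt s) = D.o s) (hord' : ∀ i, ord i ≠ ⊤ → ∃ s, D.tgt s = i) :
    EinfIsDirectSum ρ (fun _ => True) (fun i => D.b (.inl i)) (fun i => deg (.inl i)) ord := by
  have hmem : ∀ i, D.b (.inl i) ∈ Zinf ρ ⊓ Hdeg F4 G EV0bar (deg (.inl i)) := fun i =>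
    ⟨D.inl_mem_Zinf i, hdeg _⟩
  have hB : ∀ i (n : ℕ), ord i ≤ n → D.b (.inl i) ∈ Binf ρ n := fun i n h => by
    obtain ⟨s, rfl⟩ := hord' i fun h' => by
      rw [h', top_le_iff] at h
      exact ENat.natCast_ne_top n h
    rw [D.Binf_eq hρ]
    rw [hord, Nat.cast_le] at h
    exact Submodule.subset_span ⟨s, h, rfl⟩
  refine ⟨fun i _ => hmem i, fun s _ n => ?_, fun i _ n h => hB i n h⟩
  classical
  let J := {i // deg (.inl i) = s ∧ (n : ℕ∞) < ord i}
  have hJ : ∀ j : J, D.b (.inl j) ∈ Zinf ρ ⊓ Hdeg F4 G EV0bar s := fun j => by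
    have := hmem j
    rwa [j.2.1] at this
  let v : J → Einf ρ s n := fun j => Einf.mk ρ s n (D.b (.inl j)) (hJ j)
  -- The coordinates of the basis of the first page pass to the quotient by `Binf ρ n`, where they give
  -- a dual basis.
  let f : J → Module.Dual F4 (Einf ρ s n) := fun j => Submodule.liftQ _
    (D.b.coord (.inl j) ∘ₗ (Zinf ρ ⊓ Hdeg F4 G EV0bar s).subtype) fun c hc => by
      have hc' : (c : E1 G) ∈ Binf ρ n := hc
      rw [D.Binf_eq hρ] at hc'
      refine D.repr_eq_zero_of_mem_bd hc' fun t ht e => ?_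
      have := j.2.2
      rw [Sum.inl_injective e, hord, Nat.cast_lt] at this
      omega
  have hf : ∀ i j, f i (v j) = D.b.repr (D.b (.inl j)) (.inl i) := fun i j => rfl
  have hli : LinearIndependent F4 v := by
    refine LinearIndependent.of_pairwise_dual_eq_zero_one v f (fun i j h => ?_) fun i => ?_
    · refine (hf i j).trans ?_
      rw [D.b.repr_self, Finsupp.single_eq_of_ne fun e => h (Subtype.ext (Sum.inl_injective e))]
    · refine (hf i i).trans ?_
      rw [D.b.repr_self, Finsupp.single_eq_same]
  refine ⟨.mk hli fun x _ => ?_, fun j => ⟨hJ j, Module.Basis.mk_apply _ _ j⟩⟩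
  obtain ⟨⟨c, hc⟩, rfl⟩ := Submodule.Quotient.mk_surjective _ x
  let W := Zinf ρ ⊓ Hdeg F4 G EV0bar s
  let p : Submodule F4 W := (Submodule.span F4 (Set.range v)).comap
    (Submodule.mkQ ((Binf ρ n).comap W.subtype))
  have hp : ∀ i, deg (.inl i) = s → D.b (.inl i) ∈ p.map W.subtype := fun i hi => by
    have hW : D.b (.inl i) ∈ W := by
      have := hmem i
      rwa [hi] at this
    refine ⟨⟨_, hW⟩, ?_, rfl⟩
    by_cases h : (n : ℕ∞) < ord i
    · exact Submodule.subset_span ⟨⟨i, hi, h⟩, rfl⟩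
    · have : Submodule.mkQ ((Binf ρ n).comap W.subtype) ⟨_, hW⟩ = 0 :=
        (Submodule.Quotient.mk_eq_zero _).2 (hB i n (not_lt.1 h))
      rw [SetLike.mem_coe, Submodule.mem_comap, this]
      exact zero_mem _
  have hc' : c ∈ p.map W.subtype := by
    rw [← D.b.linearCombination_repr c]
    refine Submodule.sum_mem _ fun i hi => Submodule.smul_mem _ _ ?_
    have hi := Finsupp.mem_support_iff.1 hi
    rcases i with i | t
    · exact hp i (by_contra fun h => hi (HRing.repr_eq_zero D.b hdeg hc.2 h))
    · exact absurd (D.repr_eq_zero_of_mem_Zinf hρ hc.1 t) hi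
  obtain ⟨w, hw, e⟩ := hc'
  obtain rfl : w = ⟨c, hc⟩ := Subtype.ext e
  exact hw

end BocksteinBasis

/-- Passage to a family of generators that contains all those of the degrees considered. -/
theorem EinfIsDirectSum.reindex {ι κ : Type} {x : ι → E1 G} {deg : ι → ℕ} {ord : ι → ℕ∞}
    (h : EinfIsDirectSum ρ (fun _ => True) x deg ord) (P : ℕ → Prop) (e : κ → ι)
    (he : Function.Injective e) (hP : ∀ i, P (deg i) → ∃ j, e j = i) :
    EinfIsDirectSum ρ P (fun j => x (e j)) (fun j => deg (e j)) fun j => ord (e j) := by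
  obtain ⟨h1, h2, h3⟩ := h
  refine ⟨fun j _ => h1 _ trivial, fun s hs n => ?_, fun j _ => h3 _ trivial⟩
  obtain ⟨b, hb⟩ := h2 s trivial n
  let σ : {j // deg (e j) = s ∧ (n : ℕ∞) < ord (e j)} → {i // deg i = s ∧ (n : ℕ∞) < ord i} :=
    fun j => ⟨e j, j.2⟩
  have hσ : Function.Bijective σ := by
    refine ⟨fun i j h => Subtype.ext (he (congrArg Subtype.val h)), fun i => ?_⟩
    obtain ⟨j, hj⟩ := hP i (by rw [i.2.1]; exact hs)
    exact ⟨⟨j, by rw [hj]; exact i.2⟩, Subtype.ext hj⟩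
  refine ⟨b.reindex (Equiv.ofBijective σ hσ).symm, fun j => ?_⟩
  obtain ⟨h, hj⟩ := hb (σ j)
  refine ⟨h, ?_⟩
  rw [Module.Basis.reindex_apply, Equiv.symm_symm]
  exact hj

end Abstract

/-! ### Lifts of classes and their differentials -/

section Lifts
variable {G A : Type} [Group G] [CommRing A] [Algebra F4 A] {ρ : Representation F4 G A} {r : G → F4}
  {w v : A}

/-- A multiplicative action of `G` on `A`, for which `v` is invariant and `w` is invariant up to
multiples of `v`, with the cocycle `r`. -/
structure IsTwist (ρ : Representation F4 G A) (r : G → F4) (w v : A) : Prop where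
  map_mul : ∀ g a b, ρ g (a * b) = ρ g a * ρ g b
  map_one : ∀ g, ρ g 1 = 1
  map_v : ∀ g, ρ g v = v
  map_w : ∀ g, ρ g w = w + v * algebraMap F4 A (r g)

theorem two_eq_zero_A : (2 : A) = 0 := by
  rw [← map_ofNat (algebraMap F4 A), two_F4, map_zero]

theorem add_self_A (a : A) : a + a = 0 := by rw [← two_mul, two_eq_zero_A, zero_mul]

/-- The Leibniz rule, for a second factor with invariant values. -/
theorem IsTwist.dDeg_cup (h : IsTwist ρ r w v) {p q : ℕ} (f : CochDeg G A p)
    (g : CochDeg G A q) (hg : ∀ γ y, ρ γ (g y) = g y) (x : Fin (p + q + 1) → G) :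
    dDeg ρ (p + q) (cup f g) x =
      cup (dDeg ρ p f) g (fun i => x (Fin.cast (by omega) i)) +
      cup f (dDeg (Representation.trivial F4 G A) q g) x := by
  have h2 : ∀ a : A, a + a = 0 := add_self_A
  have hd : ∀ (ρ' : Representation F4 G A) (n : ℕ) (u : CochDeg G A n) (y : Fin (n + 1) → G),
      dDeg ρ' n u y = ρ' (y 0) (u (fun i => y i.succ)) +
        ∑ j : Fin (n + 1), u (Fin.contractNth j (· * ·) y) := by
    intro ρ' n u y
    rw [dDeg_apply]
    simp only [neg_one_pow_F4, one_smul]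
  have hs : ∀ F : Fin (p + q + 1) → A, ∑ j, F j =
      ∑ i : Fin p, F (Fin.castAdd (q + 1) i) + ∑ i : Fin (q + 1), F (Fin.natAdd p i) :=
    fun F => Fin.sum_univ_add (a := p) (b := q + 1) F
  have hL : dDeg ρ (p + q) (cup f g) x =
      ρ (x 0) (f (fun i => x (Fin.castAdd q i).succ)) * g (fun i => x (Fin.natAdd p i).succ) +
      (∑ i : Fin p, f (Fin.contractNth (Fin.castSucc i) (· * ·)
          fun i => x (Fin.cast (by omega) (Fin.castAdd q i))) * g (fun i => x (Fin.natAdd p i).succ) +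
        ∑ j : Fin (q + 1), f (fun i => x (Fin.castAdd (q + 1) i)) *
          g (Fin.contractNth j (· * ·) fun i => x (Fin.natAdd p i))) := by
    rw [hd, hs]
    refine congrArg₂ _ ?_ (congrArg₂ _ (Finset.sum_congr rfl fun i _ => ?_)
      (Finset.sum_congr rfl fun j _ => ?_))
    · change ρ (x 0) (f _ * g _) = _
      rw [h.map_mul, hg]
    · refine congrArg₂ _ (congr_coch f fun l => ?_) (congr_coch g fun l => ?_)
      · simp only [Fin.contractNth]
        rfl
      · rw [Fin.contractNth_apply_of_gt]
        simp
        omega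
    · refine congrArg₂ _ (congr_coch f fun l => ?_) (congr_coch g fun l => ?_)
      · rw [Fin.contractNth_apply_of_lt]
        · rfl
        · simp
          omega
      · simp only [Fin.contractNth, Fin.val_natAdd, Nat.add_lt_add_iff_left, Nat.add_left_cancel_iff]
        rfl
  have hR1 : cup (dDeg ρ p f) g
        (fun i => x (Fin.cast (by omega) i)) =
      (ρ (x 0) (f (fun i => x (Fin.castAdd q i).succ)) +
        (∑ i : Fin p, f (Fin.contractNth (Fin.castSucc i) (· * ·)
          fun i => x (Fin.cast (by omega) (Fin.castAdd q i))) +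
          f (fun i => x (Fin.castAdd (q + 1) i)))) * g (fun i => x (Fin.natAdd p i).succ) := by
    change dDeg ρ p f _ * g _ = _
    rw [hd, Fin.sum_univ_castSucc]
    refine congrArg₂ _ (congrArg₂ _ rfl (congrArg₂ _ rfl (congr_coch f fun l => ?_)))
      (congr_coch g fun l => congr_fin x ?_)
    · rw [Fin.contractNth_apply_of_lt _ _ _ _ (by simp)]
      rfl
    · simp
      omega
  have hR2 : cup f (dDeg (Representation.trivial F4 G A) q g) x =
      f (fun i => x (Fin.castAdd (q + 1) i)) * (g (fun i => x (Fin.natAdd p i).succ) +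
        ∑ j : Fin (q + 1), g (Fin.contractNth j (· * ·) fun i => x (Fin.natAdd p i))) := by
    change f _ * dDeg (Representation.trivial F4 G A) q g _ = _
    rw [hd]
    rfl
  rw [hL, hR1, hR2, ← Finset.sum_mul, ← Finset.mul_sum]
  generalize f (fun i => x (Fin.castAdd (q + 1) i)) = a
  generalize g (fun i => x (Fin.natAdd p i).succ) = b
  linear_combination -(h2 (a * b))

/-- The inclusion `scal` in degree `n`. -/
def scalDeg {n : ℕ} (f : CochDeg G F4 n) : CochDeg G A n := fun x => algebraMap F4 A (f x)

theorem scal_of (n : ℕ) (f : CochDeg G F4 n) :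
    scal G A (of (CochDeg G F4) n f) = of (CochDeg G A) n (scalDeg f) := cochMap_of _ _ n f

theorem IsTwist.map_algebraMap (h : IsTwist ρ r w v) (g : G) (a : F4) :
    ρ g (algebraMap F4 A a) = algebraMap F4 A a := by
  rw [Algebra.algebraMap_eq_smul_one, map_smul, h.map_one]

/-- The Leibniz rule for right multiplication by a cochain with values in `F₄`. -/
theorem IsTwist.d_mul_scal (h : IsTwist ρ r w v) (x : Coch G A) (z : Coch G F4) :
    d ρ (x * scal G A z) = d ρ x * scal G A z + x * scal G A (dF z) := by
  have hz : scal G A (dF z) = d (Representation.trivial F4 G A) (scal G A z) :=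
    (d_cochMap (MonoidHom.id G) (Algebra.ofId F4 A) z).symm
  rw [hz]
  induction x using DirectSum.induction_on with
  | zero => simp
  | add x x' hx hx' =>
    rw [add_mul, map_add, map_add, hx, hx', add_mul, add_mul]
    abel
  | of p f =>
    induction z using DirectSum.induction_on with
    | zero => simp
    | add y y' hy hy' =>
      have hy := hy (d_cochMap (MonoidHom.id G) (Algebra.ofId F4 A) y).symm
      have hy' := hy' (d_cochMap (MonoidHom.id G) (Algebra.ofId F4 A) y').symm
      rw [map_add, mul_add, map_add, map_add, hy, hy', mul_add, mul_add]
      abel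
    | of q g =>
      rw [scal_of, of_mul_of', d_of, d_of, d_of, of_mul_of', of_mul_of']
      let e : CochDeg G A (p + q + 1) := fun x =>
        cup (dDeg ρ p f) (scalDeg g) (fun i => x (Fin.cast (by omega) i))
      let e' : CochDeg G A (p + q + 1) :=
        (cup f (dDeg (Representation.trivial F4 G A) q (scalDeg g)) : CochDeg G A (p + (q + 1)))
      have h : dDeg ρ (p + q) (cup f (scalDeg g)) = e + e' :=
        funext fun x => h.dDeg_cup f (scalDeg g) (fun γ y => h.map_algebraMap γ _) x
      rw [h, map_add]
      refine congrArg₂ _ (DirectSum.of_eq_of_gradedMonoid_eq ?_) rfl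
      exact mk_eq_mk (by omega) fun x => rfl

theorem IsTwist.d_v_smul (h : IsTwist ρ r w v) (x : Coch G A) : d ρ (v • x) = v • d ρ x :=
  d_smul_of_invariant h.map_mul h.map_v x

/-- The `1`-cochain given by a function. -/
def funA (a : G → A) : CochDeg G A 1 := fun x => a (x 0)

theorem d_constA (ρ : Representation F4 G A) (a : A) :
    d ρ (of (CochDeg G A) 0 (constDeg G a)) = of (CochDeg G A) 1 (funA fun g => ρ g a + a) := by
  rw [d_of]
  refine congrArg _ (funext fun x => ?_)
  rw [dDeg_apply]
  simp only [neg_one_pow_F4, one_smul]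
  rw [Fin.sum_univ_one]
  rfl

theorem IsTwist.d_smul_scal (h : IsTwist ρ r w v) (a : A) (z : Coch G F4) :
    d ρ (a • scal G A z) = of (CochDeg G A) 1 (funA fun g => ρ g a + a) * scal G A z +
      a • scal G A (dF z) := by
  rw [← const_mul, h.d_mul_scal, d_constA, const_mul]

theorem IsTwist.d_scal (h : IsTwist ρ r w v) (z : Coch G F4) :
    d ρ (scal G A z) = scal G A (dF z) := by
  have h1 := h.d_mul_scal 1 z
  have h2 : d ρ (1 : Coch G A) = 0 := by
    refine (d_constA ρ 1).trans ?_
    have : (funA fun g => ρ g 1 + 1 : CochDeg G A 1) = 0 := funext fun x => by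
      change ρ (x 0) 1 + 1 = 0
      rw [h.map_one]
      exact add_self_A 1
    rw [this, map_zero]
  rwa [one_mul, one_mul, h2, zero_mul, zero_add] at h1

theorem of_funA_add {G A : Type} [CommRing A] (a b : G → A) : of (CochDeg G A) 1 (funA fun g => a g + b g) =
    of (CochDeg G A) 1 (funA a) + of (CochDeg G A) 1 (funA b) :=
  map_add (of (CochDeg G A) 1) (funA a) (funA b)

theorem of_funA_smul (a : A) (b : G → F4) :
    of (CochDeg G A) 1 (funA fun g => a * algebraMap F4 A (b g)) = a • scal G A (c1 b) := by
  rw [c1, scal_of]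
  exact DirectSum.of_smul A 1 a (scalDeg (fun1 b))

theorem IsTwist.map_pow (h : IsTwist ρ r w v) (g : G) (a : A) (n : ℕ) :
    ρ g (a ^ n) = ρ g a ^ n := by
  induction n with
  | zero => rw [pow_zero, pow_zero, h.map_one]
  | succ n ih => rw [pow_succ, h.map_mul, ih, pow_succ]

theorem IsTwist.d_w_smul (h : IsTwist ρ r w v) (z : Coch G F4) :
    d ρ (w • scal G A z) = v • scal G A (c1 r * z) + w • scal G A (dF z) := by
  rw [h.d_smul_scal, _root_.map_mul, ← smul_mul_assoc, ← of_funA_smul]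
  congr 4
  funext g
  rw [h.map_w]
  linear_combination w * (two_eq_zero_A : (2 : A) = 0)

theorem IsTwist.d_w2_smul (h : IsTwist ρ r w v) (z : Coch G F4) :
    d ρ (w ^ 2 • scal G A z) = v ^ 2 • scal G A (cS r * z) + w ^ 2 • scal G A (dF z) := by
  rw [h.d_smul_scal, _root_.map_mul, ← smul_mul_assoc, ← of_funA_smul]
  congr 4
  funext g
  rw [h.map_pow, h.map_w, _root_.map_pow]
  generalize algebraMap F4 A (r g) = a
  linear_combination (w ^ 2 + w * v * a) * (two_eq_zero_A : (2 : A) = 0)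

theorem IsTwist.d_w3_smul (h : IsTwist ρ r w v) (z : Coch G F4) :
    d ρ (w ^ 3 • scal G A z) = v • w ^ 2 • scal G A (c1 r * z) +
      v ^ 2 • w • scal G A (cS r * z) + v ^ 3 • scal G A (cK r * z) +
        w ^ 3 • scal G A (dF z) := by
  rw [h.d_smul_scal, _root_.map_mul, _root_.map_mul, _root_.map_mul]
  simp only [← smul_mul_assoc, ← add_mul]
  rw [smul_smul, smul_smul, ← of_funA_smul, ← of_funA_smul, ← of_funA_smul, ← of_funA_add, ← of_funA_add]
  congr 4
  funext g
  rw [h.map_pow, h.map_w, _root_.map_pow, _root_.map_pow]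
  generalize algebraMap F4 A (r g) = a
  linear_combination (w ^ 3 + w ^ 2 * v * a + w * v ^ 2 * a ^ 2) * (two_eq_zero_A : (2 : A) = 0)

section Differentials
variable (h : IsTwist ρ r w v) {y : Coch G F4} (hy : dF y = 0)
include h hy

/-- The differentials `u⁻¹ y ↦ h_{1,1} y`. -/
theorem IsTwist.d1_w : d ρ (w • scal G A y) = v ^ 1 • scal G A (c1 r * y) := by
  rw [h.d_w_smul, hy, map_zero, smul_zero, add_zero, pow_one]

/-- The differentials `u⁻³ y ↦ h_{1,1} u⁻² y`. -/
theorem IsTwist.d1_w3 : d ρ (w ^ 3 • scal G A y) = v ^ 1 • (w ^ 2 • scal G A (c1 r * y) +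
    v • (w • scal G A (cS r * y) + v • scal G A (cK r * y))) := by
  rw [h.d_w3_smul, hy, map_zero, smul_zero, add_zero]
  module

/-- The differentials `u⁻² y ↦ h_{1,0} y`. -/
theorem IsTwist.d2_w2 : d ρ (w ^ 2 • scal G A y) = v ^ 2 • scal G A (cS r * y) := by
  rw [h.d_w2_smul, hy, map_zero, smul_zero, add_zero]

/-- The differentials `h_{1,0} u⁻³ y ↦ h_{1,0}² u⁻¹ y`. -/
theorem IsTwist.d2_w3 {t : G → F4} (q : QCoord r t) :
    d ρ (w ^ 3 • scal G A (cS r * y) + v • w ^ 2 • scal G A (c1 t * y)) =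
      v ^ 2 • (w • scal G A (cS r * (cS r * y)) +
        v • scal G A (cK r * (cS r * y) + cS r * (c1 t * y))) := by
  have h1 := h.d_v_smul (w ^ 2 • scal G A (c1 t * y))
  have e1 : dF (cS r * y) = 0 := by rw [d_mul_C, d_cS q.r_mul, hy, zero_mul, mul_zero, add_zero]
  have e2 : dF (c1 t * y) = c1 r * (cS r * y) := by
    rw [d_mul_C, d_cT q, hy, mul_zero, add_zero, mul_assoc]
  rw [_root_.map_add, h1, h.d_w3_smul, h.d_w2_smul, e1, e2, map_zero, smul_zero, add_zero,
    map_add (scal G A)]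
  -- The term `w² h_{1,1} h_{1,0} y` occurs twice, since `t` bounds `h_{1,1} h_{1,0}`.
  have := add_self_coch (k := F4) (v • w ^ 2 • scal G A (c1 r * (cS r * y)))
  rw [← sub_eq_zero]
  refine Eq.trans ?_ this
  module

/-- The lift of the permanent cycle `h_{1,0} u⁻¹ y`. -/
theorem IsTwist.d_tower_one {t : G → F4} (q : QCoord r t) :
    d ρ (w • scal G A (cS r * y) + v • scal G A (c1 t * y)) = 0 := by
  have e1 : dF (cS r * y) = 0 := by rw [d_mul_C, d_cS q.r_mul, hy, zero_mul, mul_zero, add_zero]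
  have e2 : dF (c1 t * y) = c1 r * (cS r * y) := by
    rw [d_mul_C, d_cT q, hy, mul_zero, add_zero, mul_assoc]
  rw [_root_.map_add, h.d_v_smul, h.d_w_smul, h.d_scal, e1, e2, map_zero, smul_zero, add_zero]
  exact add_self_coch (k := F4) _

end Differentials

section Towers
variable (h : IsTwist ρ r w v) (hr : IsAdd r)
include h

/-- A cocycle with values in the polynomials of degree at most two in `w` gives an invariant
cochain, by homogenizing the polynomials with `v`. -/
theorem IsTwist.d_tower_two {f : (Coch G F4 × Coch G F4) × (Coch G F4 × Coch G F4)}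
    (hf : (X2 hr).d f = 0) (h3 : f.2.2 = 0) :
    d ρ (w ^ 2 • scal G A f.2.1 + v • (w • scal G A f.1.2 + v • scal G A f.1.1)) = 0 := by
  obtain ⟨⟨f0, f1⟩, ⟨f2, f3⟩⟩ := f
  obtain rfl : f3 = 0 := h3
  rw [X2_d] at hf
  simp only [mul_zero, add_zero, map_zero] at hf
  have e0 : dF f0 + c1 r * f1 + cS r * f2 = 0 := congrArg (fun x => x.1.1) hf
  have e1 : dF f1 = 0 := congrArg (fun x => x.1.2) hf
  have e2 : dF f2 = 0 := congrArg (fun x => x.2.1) hf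
  rw [_root_.map_add, h.d_v_smul, _root_.map_add, h.d_v_smul, h.d_w2_smul, h.d_w_smul, h.d_scal, e1, e2]
  have e := congrArg (fun x => v ^ 2 • scal G A x) e0
  simp only [_root_.map_add, map_zero, smul_zero, smul_add, add_zero, smul_smul, ← pow_two] at e ⊢
  rw [← e]
  abel

/-- A cocycle with values in the polynomials of degree at most three in `w` gives an invariant
cochain, by homogenizing the polynomials with `v`. -/
theorem IsTwist.d_tower {f : (Coch G F4 × Coch G F4) × (Coch G F4 × Coch G F4)}
    (hf : (X2 hr).d f = 0) :
    d ρ (w ^ 3 • scal G A f.2.2 + v • (w ^ 2 • scal G A f.2.1 + v • (w • scal G A f.1.2 +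
      v • scal G A f.1.1))) = 0 := by
  obtain ⟨⟨f0, f1⟩, ⟨f2, f3⟩⟩ := f
  rw [X2_d] at hf
  have e0 : dF f0 + c1 r * f1 + (cS r * f2 + cK r * f3) = 0 := congrArg (fun x => x.1.1) hf
  have e1 : dF f1 + cS r * f3 = 0 := congrArg (fun x => x.1.2) hf
  have e2 : dF f2 + c1 r * f3 = 0 := congrArg (fun x => x.2.1) hf
  have e3 : dF f3 = 0 := congrArg (fun x => x.2.2) hf
  rw [_root_.map_add, h.d_v_smul, _root_.map_add, h.d_v_smul, _root_.map_add, h.d_v_smul, h.d_w3_smul,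
    h.d_w2_smul, h.d_w_smul, h.d_scal, e3]
  -- The cocycle condition of `f`, homogenized: the component along `wⁱ` is multiplied by `wⁱ v^(3 - i)`.
  have e : v ^ 3 • scal G A (dF f0 + c1 r * f1 + (cS r * f2 + cK r * f3)) +
      (v ^ 2 * w) • scal G A (dF f1 + cS r * f3) + (v * w ^ 2) • scal G A (dF f2 + c1 r * f3) = 0 := by
    rw [e0, e1, e2, map_zero, smul_zero, smul_zero, smul_zero, add_zero, add_zero]
  simp only [_root_.map_add, map_zero, smul_zero, smul_add, add_zero, smul_smul, ← pow_two] at e ⊢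
  rw [← e]
  have e4 : v * (v * v ^ 1) = v ^ 3 := by ring
  have e5 : v * v ^ 2 = v ^ 3 := by ring
  have e7 : v * (v * w) = v ^ 2 * w := by ring
  simp only [e5, e7]
  abel

end Towers

end Lifts

section BocksteinLifts
variable {G : Type} [Group G] {ρ : Representation F4 G EV0} {r : G → F4}

theorem smul_mul_coch {G A : Type} [CommRing A] (a : A) (x y : Coch G A) : a • x * y = a • (x * y) :=
  smul_mul_assoc a x y

theorem mul_zero_coch {G A : Type} [CommRing A] (x : Coch G A) : x * 0 = 0 := mul_zero x

theorem zero_mul_coch {G A : Type} [CommRing A] (x : Coch G A) : 0 * x = 0 := zero_mul x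

/-- The element `u⁻¹`, on which `G` acts by `u⁻¹ ↦ u⁻¹ + r v₁`. -/
abbrev wE : EV0 := LaurentPolynomial.T (-1)

theorem IsBockstein.isTwist (h : IsBockstein ρ r) : IsTwist ρ r wE v1 :=
  ⟨h.map_mul, h.map_one, h.map_v1, fun g => by rw [h.map_T, Algebra.smul_def, mul_comm]⟩

theorem redCoch_scal (z : Coch G F4) : redCoch (scal G EV0 z) = scal G EV0bar z := by
  induction z using DirectSum.induction_on with
  | zero => rw [map_zero, map_zero, map_zero]
  | add x y hx hy => rw [map_add, map_add, map_add, hx, hy]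
  | of n f =>
    rw [scal_of, redCoch_of]
    refine (congrArg _ (funext fun x => ?_)).trans (cochMap_of _ _ n f).symm
    exact red.commutes (f x)

theorem red_wE_pow (e : ℕ) : red (wE ^ e) = LaurentPolynomial.T (-e : ℤ) := by
  rw [LaurentPolynomial.T_pow, red_T, mul_neg_one]

/-- The class on the first page of a cochain with leading term `u⁻ᵉ z`. -/
theorem isRep_leading {z : Coch G F4} {c : HRing F4 G F4} (h : IsRep z c) (e : ℕ) (x : Coch G EV0) :
    IsRep (redCoch (wE ^ e • scal G EV0 z + v1 • x)) (toE1 G c * uPow G (-e)) := by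
  rw [map_add, redCoch_v1_smul, add_zero, redCoch_smul, red_wE_pow, redCoch_scal]
  exact h.toE1.const_smul _

theorem isUnit_one_add_X_pow : IsUnit (1 + PowerSeries.X ^ 3 : PowerSeries F4) := by
  rw [PowerSeries.isUnit_iff_constantCoeff]
  simp

/-- The invariant unit `u⁻⁴ (1 + u₁³) = u⁻⁴ + v₁³ u⁻¹`. -/
def unitD : EV0ˣ :=
  Units.map (LaurentPolynomial.C : PowerSeries F4 →+* EV0).toMonoidHom isUnit_one_add_X_pow.unit *
    unitT (PowerSeries F4) ^ (-4 : ℤ)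

theorem coe_unitD : (unitD : EV0) = wE ^ 4 + v1 ^ 3 * wE := by
  have h : (unitD : EV0) = LaurentPolynomial.C (1 + PowerSeries.X ^ 3) * LaurentPolynomial.T (-4) := by
    rw [unitD, Units.val_mul, unitT_zpow]
    rfl
  have e : (LaurentPolynomial.T (-4) : EV0) = wE ^ 4 := by
    rw [LaurentPolynomial.T_pow]
    rfl
  rw [h, e, v1, map_add, map_one, map_pow]
  ring

theorem IsBockstein.map_unitD (h : IsBockstein ρ r) (g : G) : ρ g unitD = unitD := by
  -- With `w = u⁻¹` the element is `w⁴ + v₁³ w`, and `w ↦ w + v₁ a` adds `v₁⁴ (a⁴ + a) = 0` to it.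
  have h4 := congrArg (algebraMap F4 EV0) (F4_pow_four (r g))
  have two : (2 : EV0) = 0 := two_eq_zero_A
  rw [coe_unitD, map_add, h.map_mul, h.isTwist.map_pow, h.isTwist.map_pow, h.map_v1, h.isTwist.map_w]
  rw [map_pow] at h4
  generalize algebraMap F4 EV0 (r g) = a at *
  generalize wE = w at *
  linear_combination v1 ^ 4 * h4 + (2 * w ^ 3 * v1 * a + 3 * w ^ 2 * v1 ^ 2 * a ^ 2 + 2 * w * v1 ^ 3 * a ^ 3 +
    v1 ^ 4 * a) * two

theorem IsBockstein.map_unitD_zpow (h : IsBockstein ρ r) (g : G) (j : ℤ) :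
    ρ g (unitD ^ j : EV0ˣ) = (unitD ^ j : EV0ˣ) := by
  let f : EV0 →* EV0 := ⟨⟨ρ g, h.map_one g⟩, h.map_mul g⟩
  have h1 : Units.map f unitD = unitD := Units.ext (h.map_unitD g)
  have h2 := map_zpow (Units.map f) unitD j
  rw [h1] at h2
  exact congrArg Units.val h2

theorem red_unitD_zpow (j : ℤ) : red (unitD ^ j : EV0ˣ) = LaurentPolynomial.T (-4 * j) := by
  have h1 : Units.map (red : EV0 →* EV0bar) unitD = unitT F4 ^ (-4 : ℤ) := by
    refine Units.ext ?_
    change red unitD = _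
    rw [coe_unitD, map_add, map_mul, map_pow red v1, red_v1, red_wE_pow, unitT_zpow]
    simp
  have h2 := map_zpow (Units.map (red : EV0 →* EV0bar)) unitD j
  rw [h1, ← zpow_mul] at h2
  exact (congrArg Units.val h2).trans (unitT_zpow F4 _)

/-- The multiple by `u⁻⁴ʲ` and a cocycle `z` with values in `F₄` of a cochain, where `u⁻⁴` is replaced
by the invariant unit `unitD`. -/
def multiple (j : ℤ) (z : Coch G F4) (x : Coch G EV0) : Coch G EV0 :=
  ((unitD ^ j : EV0ˣ) : EV0) • (x * scal G EV0 z)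

theorem IsBockstein.d_multiple (h : IsBockstein ρ r) (j : ℤ) {z : Coch G F4} (hz : dF z = 0)
    (x : Coch G EV0) : d ρ (multiple j z x) = multiple j z (d ρ x) := by
  rw [multiple, h.d_smul (fun g => h.map_unitD_zpow g j), h.isTwist.d_mul_scal, hz, map_zero, multiple,
    mul_zero_coch, add_zero]

theorem multiple_smul (j : ℤ) (z : Coch G F4) (a : EV0) (x : Coch G EV0) :
    multiple j z (a • x) = a • multiple j z x := by
  rw [multiple, multiple, smul_mul_coch, smul_comm]

theorem multiple_zero (j : ℤ) (z : Coch G F4) : multiple j z 0 = 0 := by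
  rw [multiple, zero_mul_coch, smul_zero]

theorem isRep_multiple (j : ℤ) {z : Coch G F4} {c : HRing F4 G F4} (h : IsRep z c)
    {x : Coch G EV0} {y : E1 G} (hx : IsRep (redCoch x) y) :
    IsRep (redCoch (multiple j z x)) (y * toE1 G c * uPow G (-4 * j)) := by
  rw [multiple, redCoch_smul, red_unitD_zpow, map_mul, redCoch_scal]
  exact (hx.mul h.toE1).const_smul _

end BocksteinLifts

/-! ### Endomorphisms of the `E_∞`-term -/

section Acts
variable {G : Type} [Group G] {ρ : Representation F4 G EV0} {r : G → F4}

theorem mem_Zpage {s : ℕ} {c : E1 G} : c ∈ Zpage ρ s ↔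
    ∃ x y : Coch G EV0, d ρ x = v1 ^ s • y ∧ IsRep (redCoch x) c := by
  constructor
  · rintro ⟨z, x, y, h1, h2, rfl⟩
    exact ⟨x, y, h1, h2 ▸ isRep_cls z⟩
  · rintro ⟨x, y, h1, hz, h2⟩
    exact ⟨⟨_, hz⟩, x, y, h1, rfl, h2⟩

theorem mem_Bpage {s n : ℕ} {c : E1 G} : c ∈ Bpage ρ s n ↔
    ∃ w y : Coch G EV0, d ρ w = v1 ^ min (s - 1) n • y ∧ IsRep (redCoch y) c := by
  constructor
  · rintro ⟨z, x, y, h1, h2, rfl⟩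
    exact ⟨x, y, h1, h2 ▸ isRep_cls z⟩
  · rintro ⟨x, y, h1, hz, h2⟩
    exact ⟨⟨_, hz⟩, x, y, h1, rfl, h2⟩

/-- An endomorphism of the first page that comes from an endomorphism of the cochains with values in
`F₄⟦u₁⟧[u^{±1}]`, compatible with the differential and with `v₁`, acts on the `E_∞`-term. -/
theorem actsOnEinf_of_lift (F : Coch G EV0 → Coch G EV0) (f : E1 G →ₗ[F4] E1 G)
    (hd : ∀ x, d ρ (F x) = F (d ρ x)) (hv : ∀ (n : ℕ) x, F (v1 ^ n • x) = v1 ^ n • F x)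
    (hf : ∀ x c, IsRep (redCoch x) c → IsRep (redCoch (F x)) (f c)) : ActsOnEinf ρ f := by
  refine ⟨fun c hc => ?_, fun n => ?_⟩
  · rw [Zinf, Submodule.mem_iInf] at hc ⊢
    intro s
    obtain ⟨x, y, h1, h2⟩ := mem_Zpage.1 (hc s)
    exact mem_Zpage.2 ⟨F x, F y, by rw [hd, h1, hv], hf _ _ h2⟩
  · have h : Binf ρ n ≤ (Binf ρ n).comap f := by
      refine iSup_le fun s c hc => ?_
      obtain ⟨x, y, h1, h2⟩ := mem_Bpage.1 hc
      exact Submodule.mem_iSup_of_mem s (mem_Bpage.2 ⟨F x, F y, by rw [hd, h1, hv], hf _ _ h2⟩)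
    exact h

theorem IsBockstein.actsOnEinf_mulE1_toE1 (h : IsBockstein ρ r) (hc : ∀ x y : E1 G, x * y = y * x)
    (c : HRing F4 G F4) : ActsOnEinf ρ (mulE1 (toE1 G c)) := by
  obtain ⟨z, hz⟩ := exists_isRep c
  refine actsOnEinf_of_lift (multiple 0 z) _ (h.d_multiple 0 hz.d_eq_zero)
    (fun n x => multiple_smul 0 z _ x) fun x y hx => ?_
  have := isRep_multiple 0 hz hx
  rw [mul_zero, uPow_zero, mul_one, hc] at this
  exact this

theorem IsBockstein.actsOnEinf_mulE1_uPow (h : IsBockstein ρ r) (k : ℤ) :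
    ActsOnEinf ρ (mulE1 (uPow G (-4 * k))) := by
  refine actsOnEinf_of_lift (multiple k 1) _ (h.d_multiple k isRep_one.d_eq_zero)
    (fun n x => multiple_smul k 1 _ x) fun x y hx => ?_
  have := isRep_multiple k isRep_one hx
  rw [_root_.map_one, mul_one, ← uPow_comm] at this
  exact this

/-- A homomorphism `α` of the group and a map of the coefficients that is equivariant along `α` give a
chain map. -/
theorem d_cochMap_of_equivariant {k A : Type} [CommRing k] [AddCommGroup A] [Module k A] {ρ : Representation k G A}
    (α : G →* G) (θ : A →+ A) (hθ : ∀ (j : ℕ) m, θ ((-1 : k) ^ j • m) = (-1 : k) ^ j • θ m)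
    (h : ∀ g m, ρ g (θ m) = θ (ρ (α g) m)) (x : Coch G A) :
    d ρ (cochMap α θ x) = cochMap α θ (d ρ x) := by
  induction x using DirectSum.induction_on with
  | zero => simp
  | add x y hx hy => simp only [map_add, hx, hy]
  | of n f =>
    rw [cochMap_of, d_of, d_of, cochMap_of]
    refine congrArg _ (funext fun x => ?_)
    change dDeg _ n (mapDeg α θ n f) x = θ (dDeg _ n f fun i => α (x i))
    rw [dDeg_apply, dDeg_apply]
    have h' : ∀ j : Fin (n + 1), (fun i => α (Fin.contractNth j (· * ·) x i)) =
        Fin.contractNth j (· * ·) (fun i => α (x i)) := fun j =>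
      Fin.comp_contractNth (f := α) _ _ (map_mul α) j x
    change ρ (x 0) (θ _) + ∑ j : Fin (n + 1), _ • θ (f fun i => α (Fin.contractNth j (· * ·) x i)) =
      θ (ρ (α (x 0)) (f _) + ∑ j : Fin (n + 1), _ • f _)
    simp only [map_add, map_sum, hθ, h, h']

/-- A conjugation of `G` and a compatible action of `γ ∈ Aut(C)` on the coefficients act on the
`E_∞`-term. -/
theorem actsOnEinf_map (α : G →* G) (γ : AutC) (h : ∀ g m, ρ g (act γ m) = act γ (ρ (α g) m)) :
    ActsOnEinf ρ (HRing.map (k := F4) α (actBar γ)).toLinearMap := by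
  refine actsOnEinf_of_lift (cochMap α (act γ : EV0 →+ EV0)) _
    (d_cochMap_of_equivariant α _ (fun j m => map_smul (act γ) _ m) h) (fun n x => ?_) fun x c hx => ?_
  · have hs : act γ (v1 ^ n) = v1 ^ n := by rw [map_pow, act_v1]
    induction x using DirectSum.induction_on with
    | zero => rw [map_zero, smul_zero, map_zero]
    | add x y hx hy => rw [smul_add, map_add, hx, hy, map_add, smul_add]
    | of m f =>
      have e : ∀ f : CochDeg G EV0 m, v1 ^ n • of _ m f = of (CochDeg G EV0) m (v1 ^ n • f) :=
        fun f => (DirectSum.of_smul EV0 m _ f).symm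
      rw [e, cochMap_of, cochMap_of, e]
      refine congrArg _ (funext fun x => ?_)
      change act γ (v1 ^ n * f _) = v1 ^ n * act γ (f _)
      rw [map_mul, hs]
  · have e : redCoch (cochMap α (act γ : EV0 →+ EV0) x) = cochAlgHom α (actBar γ) (redCoch x) := by
      clear hx
      induction x using DirectSum.induction_on with
      | zero => rw [map_zero, map_zero, map_zero]
      | add x y hx hy => rw [map_add, map_add, map_add, map_add, hx, hy]
      | of m f =>
        rw [cochMap_of, redCoch_of, redCoch_of]
        refine (congrArg _ (funext fun x => ?_)).trans (cochMap_of _ _ m _).symm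
        exact red_act γ _
    rw [e]
    exact hx.map α (actBar γ)

end Acts

/-! ### The coordinates of the automorphisms of the curve -/

section Data

/-- The coordinate `r` of an element `(1, r, r², t)` of `Q₈`. -/
def rQ (g : Q8) : F4 := g.1.1.r

/-- The coordinate `t` of an element `(1, r, r², t)` of `Q₈`. -/
def tQ (g : Q8) : F4 := g.1.1.t

theorem u_Q8 (g : Q8) : g.1.1.u = 1 := (mem_Q8 _).1 g.2

/-- The Artin–Schreier equation `t² + t = a³` of the curve has a solution over `F₄` for every `a`. -/
theorem exists_sq_add (a : F4) : ∃ t : F4, t ^ 2 + t = a ^ 3 := by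
  by_cases ha : a = 0
  · exact ⟨0, by rw [ha]; ring⟩
  classical
  -- For `a ≠ 0` the equation is `t² + t = 1`, which holds for every `t ≠ 0, 1`.
  obtain ⟨t, -, ht⟩ := Finset.exists_mem_notMem_of_card_lt_card (s := {(0 : F4), 1})
    (t := Finset.univ) (Finset.card_le_two.trans_lt (by
      rw [Finset.card_univ, card_F4]
      norm_num))
  rw [Finset.mem_insert, Finset.mem_singleton, not_or] at ht
  have h1 : a ^ 3 = 1 := mul_left_cancel₀ ha (by linear_combination F4_pow_four a)
  refine ⟨t, mul_left_cancel₀ (mul_ne_zero ht.1 (sub_ne_zero.2 ht.2)) ?_⟩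
  rw [h1]
  linear_combination F4_pow_four t + (t - t ^ 2) * two_F4

theorem qCoord : QCoord rQ tQ where
  r_mul g h := by
    change (g.1 * h.1).1.r = _
    rw [AutC.mul_r, u_Q8, Units.val_one, one_pow, mul_one]
    rfl
  t_mul g h := by
    change (g.1 * h.1).1.t = g.1.1.t + h.1.1.t + g.1.1.r * h.1.1.r ^ 2
    rw [AutC.mul_t, u_Q8, Units.val_one, (AutC.spec h.1).2.2.1]
    ring
  t_sq g := (AutC.spec g.1).2.2.2
  ext g h hr ht := Subtype.ext (AutC.ext' (by rw [u_Q8, u_Q8]) hr ht)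
  surj a := by
    obtain ⟨t, ht⟩ := exists_sq_add a
    exact ⟨⟨⟨⟨1, a, a ^ 2, t⟩, (AutC_iff _).2 ⟨by simp, by
      change a = (a ^ 2) ^ 2
      linear_combination -F4_pow_four a, rfl, ht⟩⟩, (mem_Q8 _).2 rfl⟩, rfl⟩
  neg := ⟨negOne, rfl, rfl⟩

instance : Finite Q8 := Finite.of_injective (fun g : Q8 => (rQ g, tQ g)) fun _ _ h =>
  qCoord.ext _ _ (congrArg Prod.fst h) (congrArg Prod.snd h)

/-- The coordinate `r` as a homomorphism from `V`. -/
def rVHom : V →* Multiplicative F4 :=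
  QuotientGroup.lift C2
    (MonoidHom.mk' (fun g => Multiplicative.ofAdd (rQ g)) fun g h => congrArg _ (qCoord.r_mul g h)) (by
      intro x hx
      have h : C2 ≤ MonoidHom.ker (MonoidHom.mk' (fun g => Multiplicative.ofAdd (rQ g))
          fun g h => congrArg _ (qCoord.r_mul g h)) := by
        rw [C2, Subgroup.zpowers_le, MonoidHom.mem_ker]
        rfl
      exact h hx)

/-- The coordinate `r` of an element of `V`. -/
def rV (g : V) : F4 := (rVHom g).toAdd

theorem isAdd_rV : IsAdd rV := fun g h => congrArg Multiplicative.toAdd (map_mul rVHom g h)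

theorem rV_surjective : Function.Surjective rV := fun a => by
  obtain ⟨g, rfl⟩ := qCoord.surj a
  exact ⟨g, rfl⟩

theorem rV_injective : Function.Injective rV := by
  have h : Function.Injective rVHom := by
    rw [injective_iff_map_eq_one]
    intro x hx
    obtain ⟨g, rfl⟩ := QuotientGroup.mk_surjective x
    have hr : rQ g = 0 := hx
    have ht := qCoord.t_sq g
    rw [hr] at ht
    have ht' : tQ g * (tQ g + 1) = 0 := by linear_combination ht
    rw [QuotientGroup.eq_one_iff]
    rcases mul_eq_zero.1 ht' with h0 | h0
    · rw [qCoord.ext g 1 hr h0]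
      exact one_mem _
    · rw [qCoord.ext g negOne hr (by
        change tQ g = 1
        linear_combination h0 - two_F4)]
      exact Subgroup.mem_zpowers _
  exact fun x y hxy => h (congrArg Multiplicative.ofAdd hxy)

theorem X2_isResolution_V : (X2 isAdd_rV).IsResolution ((1, 0), 0) :=
  X2_isResolution isAdd_rV rV_injective rV_surjective

theorem act_T_neg_one (g : AutC) : act g (LaurentPolynomial.T (-1)) =
    LaurentPolynomial.C (t0inv g) * LaurentPolynomial.T (-1) := by
  have e : (LaurentPolynomial.T 1 * LaurentPolynomial.T (-1) : EV0) = 1 := by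
    rw [← LaurentPolynomial.T_add]
    exact LaurentPolynomial.T_zero
  have h1 := congrArg (act g) e
  rw [map_mul, map_one, act_u] at h1
  have h2 := congrArg (LaurentPolynomial.C : PowerSeries F4 →+* EV0) (t0_mul g)
  rw [map_mul, map_one] at h2
  linear_combination (LaurentPolynomial.C (t0inv g) * LaurentPolynomial.T (-1)) * h1 -
    act g (LaurentPolynomial.T (-1)) * e -
    act g (LaurentPolynomial.T (-1)) * LaurentPolynomial.T 1 * LaurentPolynomial.T (-1) * h2

theorem isBockstein_Q8 : IsBockstein rhoQ8 rQ where
  map_mul g := map_mul (act g)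
  map_one g := map_one (act g)
  map_v1 g := act_v1 g
  red_map := red_rhoQ8
  map_T g := by
    change act g _ = _
    rw [act_T_neg_one, t0inv, u_Q8, inv_one, Units.val_one, Algebra.smul_def, alg_EV0, v1]
    simp only [map_add, map_mul, map_one]
    change (1 + LaurentPolynomial.C (PowerSeries.C (rQ g)) * _) * _ = _
    ring

theorem isBockstein_V : IsBockstein rhoV rV where
  map_mul g := by
    obtain ⟨g, rfl⟩ := QuotientGroup.mk_surjective g
    exact isBockstein_Q8.map_mul g
  map_one g := by
    obtain ⟨g, rfl⟩ := QuotientGroup.mk_surjective g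
    exact isBockstein_Q8.map_one g
  map_v1 g := by
    obtain ⟨g, rfl⟩ := QuotientGroup.mk_surjective g
    exact isBockstein_Q8.map_v1 g
  red_map := red_rhoV
  map_T g := by
    obtain ⟨g, rfl⟩ := QuotientGroup.mk_surjective g
    exact isBockstein_Q8.map_T g

end Data

/-! ### The action of `ω` -/

section Omega
variable (ζ : F4ˣ)

/-- Conjugation by `ω` multiplies `r`, and hence the class `h_{1,1}`, by `ζ²`. -/
theorem rQ_conj (x : Q8) : rQ (conjQ8 (omega ζ) x) = (ζ : F4) ^ 2 * rQ x := by
  have e : omega ζ * (conjQ8 (omega ζ) x : AutC) = x * omega ζ := by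
    rw [coe_conjQ8, mul_assoc, mul_inv_cancel_left]
  have h := congrArg (fun g : AutC => g.1.r) e
  simp only [AutC.mul_r] at h
  change (0 : F4) * _ + rQ (conjQ8 (omega ζ) x) = rQ x * (ζ : F4) ^ 2 + 0 at h
  linear_combination h

theorem rV_conj (x : V) : rV (conjV (omega ζ) x) = (ζ : F4) ^ 2 * rV x := by
  obtain ⟨g, rfl⟩ := QuotientGroup.mk_surjective x
  exact rQ_conj ζ g

theorem actsOnEinf_omegaQ8 : ActsOnEinf rhoQ8 (omegaQ8 ζ).toLinearMap := by
  refine actsOnEinf_map _ _ fun g m => ?_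
  change act g (act (omega ζ) m) = act (omega ζ) (act (conjQ8 (omega ζ) g : Q8) m)
  rw [coe_conjQ8, ← AlgHom.comp_apply, ← AlgHom.comp_apply, ← act_mul, ← act_mul, ← mul_assoc,
    mul_inv_cancel_left]

theorem actsOnEinf_omegaV : ActsOnEinf rhoV (omegaV ζ).toLinearMap := by
  refine actsOnEinf_map _ _ fun g m => ?_
  obtain ⟨g, rfl⟩ := QuotientGroup.mk_surjective g
  change act g (act (omega ζ) m) = act (omega ζ) (act (conjQ8 (omega ζ) g : Q8) m)
  rw [coe_conjQ8, ← AlgHom.comp_apply, ← AlgHom.comp_apply, ← act_mul, ← act_mul, ← mul_assoc,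
    mul_inv_cancel_left]

theorem act_omega_T : act (omega ζ) (LaurentPolynomial.T 1) = (ζ : F4) • LaurentPolynomial.T 1 := by
  have h : (t0 (omega ζ) : PowerSeries F4) = PowerSeries.C (ζ : F4) := by
    have h1 := t0_mul (omega ζ)
    have h2 : t0inv (omega ζ) = PowerSeries.C ((ζ⁻¹ : F4ˣ) : F4) := by
      change PowerSeries.C ((ζ⁻¹ : F4ˣ) : F4) + PowerSeries.C 0 * PowerSeries.X = _
      rw [map_zero, zero_mul, add_zero]
    have h3 : PowerSeries.C (ζ : F4) * PowerSeries.C ((ζ⁻¹ : F4ˣ) : F4) = 1 := by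
      rw [← map_mul, Units.mul_inv, map_one]
    rw [h2] at h1
    linear_combination PowerSeries.C (ζ : F4) * h1 - (t0 (omega ζ) : PowerSeries F4) * h3
  rw [act_u, h, Algebra.smul_def, alg_EV0]

theorem actBar_omega_T : actBar (omega ζ) (LaurentPolynomial.T 1) = (ζ : F4) • LaurentPolynomial.T 1 := by
  have h := congrArg red (act_omega_T ζ)
  rwa [red_act, red_u, map_smul, red_u] at h

section General
variable {G : Type} [Group G] {r : G → F4} (α : G →* G) (γ : AutC)

theorem map_uPow {γ : AutC} (h : actBar γ (LaurentPolynomial.T 1) = (ζ : F4) • LaurentPolynomial.T 1) :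
    HRing.map (k := F4) α (actBar γ) (uPow G 1) = (ζ : F4) • uPow G 1 := by
  have h1 := (isRep_const (k := F4) (G := G) (LaurentPolynomial.T 1 : EV0bar))
  have h2 := h1.map α (actBar γ)
  have h3 := h1.smul (ζ : F4)
  refine (IsRep.unique (z := _) h2 ?_)
  have e : cochAlgHom α (actBar γ) (of (CochDeg G EV0bar) 0 (constDeg G (LaurentPolynomial.T 1))) =
      (ζ : F4) • of (CochDeg G EV0bar) 0 (constDeg G (LaurentPolynomial.T 1)) := by
    refine (cochMap_of _ _ 0 _).trans ?_
    refine Eq.trans ?_ (DirectSum.of_smul F4 0 (ζ : F4) _)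
    exact congrArg _ (funext fun x => h)
  rw [e]
  exact h3

/-- Conjugations commute with the inclusion of the classes with coefficients in `F₄`. -/
theorem map_toE1 (c : HRing F4 G F4) : HRing.map (k := F4) α (actBar γ) (toE1 G c) =
    toE1 G (HRing.map α (AlgHom.id F4 F4) c) := by
  obtain ⟨z, hz⟩ := exists_isRep c
  refine (hz.toE1.map α (actBar γ)).unique ?_
  have h := (hz.map α (AlgHom.id F4 F4)).toE1
  have e : cochAlgHom α (actBar γ) (scal G EV0bar z) =
      scal G EV0bar (cochAlgHom α (AlgHom.id F4 F4) z) := by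
    clear hz h
    induction z using DirectSum.induction_on with
    | zero => rw [map_zero, map_zero, map_zero, map_zero]
    | add x y hx hy => rw [map_add, map_add, map_add, map_add, hx, hy]
    | of m f =>
      have e1 : scal G EV0bar (of _ m f) = of (CochDeg G EV0bar) m _ := cochMap_of _ _ m f
      have e2 : cochAlgHom α (AlgHom.id F4 F4) (of _ m f) = of (CochDeg G F4) m _ :=
        cochMap_of _ _ m f
      rw [e1, e2]
      refine (cochMap_of _ _ m _).trans (Eq.trans ?_ (cochMap_of _ _ m _).symm)
      exact congrArg _ (funext fun x => (actBar γ).commutes _)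
  rw [e]
  exact h

theorem map_homCls {s : G → F4} (hs : IsAdd s) {a : F4} (h : ∀ g, s (α g) = a * s g) :
    HRing.map α (AlgHom.id F4 F4) (homCls hs) = a • homCls hs := by
  refine ((isRep_homCls hs).map α _).unique ?_
  have h3 := (isRep_homCls hs).smul a
  have e : cochAlgHom α (AlgHom.id F4 F4) (c1 s) = a • c1 s := by
    refine (cochMap_of _ _ 1 _).trans ?_
    refine Eq.trans ?_ (DirectSum.of_smul F4 1 a _)
    exact congrArg _ (funext fun x => h _)
  rw [e]
  exact h3

theorem cochMap_mem_cdeg (θ : F4 →+ F4) {n : ℕ} {z : Coch G F4} (hz : z ∈ cdeg F4 G F4 n) :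
    cochMap α θ z ∈ cdeg F4 G F4 n := by
  obtain ⟨f, rfl⟩ := hz
  exact ⟨_, (cochMap_of α θ n f).symm⟩

/-- The Frobenius map of the coefficients on the cochains. -/
def frobCoch (G : Type) [Group G] : Coch G F4 →+ Coch G F4 :=
  cochMap (MonoidHom.id G) (frobenius F4 2 : F4 →+ F4)

/-- The Frobenius map of the coefficients in degree `n`. -/
def frobDeg {G : Type} {n : ℕ} (f : CochDeg G F4 n) : CochDeg G F4 n := fun x => f x ^ 2

theorem frobCoch_of (n : ℕ) (f : CochDeg G F4 n) :
    frobCoch G (of (CochDeg G F4) n f) = of (CochDeg G F4) n (frobDeg f) := cochMap_of _ _ n f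

theorem d_frobCoch (z : Coch G F4) : dF (frobCoch G z) = frobCoch G (dF z) :=
  d_cochMap_of_equivariant (MonoidHom.id G) (frobenius F4 2 : F4 →+ F4)
    (fun j m => by rw [neg_one_pow_F4, one_smul, one_smul]) (fun _ _ => rfl) z

theorem frobCoch_frobCoch (z : Coch G F4) : frobCoch G (frobCoch G z) = z := by
  induction z using DirectSum.induction_on with
  | zero => rw [map_zero, map_zero]
  | add x y hx hy => rw [map_add, map_add, hx, hy]
  | of n f =>
    rw [frobCoch_of, frobCoch_of]
    refine congrArg _ (funext fun x => ?_)
    change (f x ^ 2) ^ 2 = f x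
    rw [← pow_mul]
    exact F4_pow_four _

theorem frobCoch_smul (a : F4) (z : Coch G F4) : frobCoch G (a • z) = a ^ 2 • frobCoch G z := by
  induction z using DirectSum.induction_on with
  | zero => rw [map_zero, smul_zero, smul_zero, map_zero]
  | add x y hx hy => rw [smul_add, map_add, hx, hy, map_add, smul_add]
  | of n f =>
    have e : ∀ (b : F4) (f : CochDeg G F4 n), b • of _ n f = of (CochDeg G F4) n (b • f) :=
      fun b f => (DirectSum.of_smul F4 n b f).symm
    rw [e, frobCoch_of, frobCoch_of, e]
    refine congrArg _ (funext fun x => ?_)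
    exact mul_pow a (f x) 2

theorem frobCoch_cochMap (z : Coch G F4) : frobCoch G (cochAlgHom α (AlgHom.id F4 F4) z) =
    cochAlgHom α (AlgHom.id F4 F4) (frobCoch G z) := by
  induction z using DirectSum.induction_on with
  | zero => rw [map_zero, map_zero, map_zero]
  | add x y hx hy => rw [map_add, map_add, map_add, map_add, hx, hy]
  | of n f =>
    rw [frobCoch_of]
    exact (congrArg _ (cochMap_of _ _ n f)).trans ((frobCoch_of n _).trans
      (cochMap_of α (AlgHom.id F4 F4 : F4 →+ F4) n (frobDeg f)).symm)

theorem cochMap_cochMap {α β : G →* G} (h : ∀ x, α (β x) = x) (z : Coch G F4) :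
    cochAlgHom β (AlgHom.id F4 F4) (cochAlgHom α (AlgHom.id F4 F4) z) = z := by
  induction z using DirectSum.induction_on with
  | zero => rw [map_zero, map_zero]
  | add x y hx hy => rw [map_add, map_add, hx, hy]
  | of n f =>
    refine (congrArg _ (cochMap_of _ _ n f)).trans ((cochMap_of _ _ n _).trans ?_)
    refine congrArg _ (funext fun x => ?_)
    exact congr_coch f fun i => h _

/-- If the cohomology in a degree is one-dimensional, then an automorphism of the group acts on it
trivially: it commutes with the Frobenius map of the coefficients, so that its eigenvalue is in
`F₂`. -/
theorem map_eq_self_of_span {α β : G →* G} (hαβ : ∀ x, α (β x) = x) {n : ℕ} {g0 : HRing F4 G F4}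
    (hg : g0 ∈ Hdeg F4 G F4 n) (h0 : g0 ≠ 0) (hs : ∀ c ∈ Hdeg F4 G F4 n, ∃ a : F4, c = a • g0) :
    HRing.map α (AlgHom.id F4 F4) g0 = g0 := by
  obtain ⟨z, hz, hzg⟩ := exists_isRep_of_mem_Hdeg hg
  have hm := hzg.map α (AlgHom.id F4 F4)
  obtain ⟨l, hl⟩ := hs _ (hm.mem_Hdeg (cochMap_mem_cdeg α _ hz))
  have hfz : IsRep (frobCoch G z) (cls ⟨frobCoch G z, by
      rw [mem_cocycles, d_frobCoch, hzg.d_eq_zero, map_zero]⟩ : HRing F4 G F4) := ⟨_, rfl⟩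
  obtain ⟨m, hm'⟩ := hs _ (hfz.mem_Hdeg (cochMap_mem_cdeg (MonoidHom.id G) _ hz))
  rw [hm'] at hfz
  -- The Frobenius map `F` of the coefficients is an involution, so its eigenvalue `m` on `g₀` is not zero.
  have hm0 : m ≠ 0 := by
    rintro rfl
    rw [zero_smul, isRep_zero_iff] at hfz
    obtain ⟨y, hy⟩ := hfz
    have h1 := d_frobCoch y
    rw [hy, frobCoch_frobCoch] at h1
    exact h0 (hzg.unique (isRep_zero_iff.2 ⟨_, h1⟩))
  have hl0 : l ≠ 0 := by
    rintro rfl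
    have h1 := hm.map β (AlgHom.id F4 F4)
    rw [cochMap_cochMap hαβ, hl, zero_smul, map_zero] at h1
    exact h0 (hzg.unique h1)
  rw [hl] at hm ⊢
  have h1 := hfz.map α (AlgHom.id F4 F4)
  rw [map_smul, hl, ← frobCoch_cochMap] at h1
  obtain ⟨y, hy⟩ := isRep_zero_iff.1 (by
    have := hm.sub (hzg.smul l)
    rwa [sub_self] at this)
  -- The automorphism acts on `g₀` by `l`. As it commutes with `F` and `F` is semilinear, `l² m = l m`.
  have h2 : frobCoch G (cochAlgHom α (AlgHom.id F4 F4) z) = dF (frobCoch G y) + l ^ 2 • frobCoch G z := by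
    rw [d_frobCoch, hy, ← frobCoch_smul, ← map_add, sub_add_cancel]
  rw [h2] at h1
  have h3 := h1.unique ((isRep_d (frobCoch G y)).add (hfz.smul (l ^ 2)))
  rw [zero_add, smul_smul, smul_smul, ← sub_eq_zero, ← sub_smul] at h3
  have h4 := eq_zero_of_smul h3 h0
  have h5 : l = 1 := by
    refine mul_left_cancel₀ (mul_ne_zero hm0 hl0) ?_
    linear_combination -h4
  rw [h5, one_smul]

end General

end Omega

/-! ### The differentials for `Q₈` -/

section QuaternionLifts
variable {G A : Type} [Group G] [CommRing A] [Algebra F4 A] {ρ : Representation F4 G A} {r t : G → F4}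
  {w v : A}

/-- The basis elements `b u⁻ᵉ` of the first page, up to multiples of `g₀` and `u⁻⁴`: the index of the
class `b` in `monQ`. The elements of `Fin 14` are those that survive to the `E_∞`-term, in the order of
`gensQ8`, and the differential of the element `s` of `Fin 10` is the element `s + 4` of `Fin 14`. -/
def monIdxQ : Fin 14 ⊕ Fin 10 → Fin 6 :=
  Sum.elim ![0, 1, 2, 5, 1, 2, 2, 5, 3, 4, 5, 3, 4, 5] ![0, 1, 1, 2, 0, 3, 4, 0, 3, 4]

/-- The exponents `e` of the basis elements `b u⁻ᵉ` of the first page. -/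
def expQ : Fin 14 ⊕ Fin 10 → Fin 4 :=
  Sum.elim ![0, 1, 2, 3, 0, 0, 1, 1, 0, 0, 0, 2, 2, 2] ![2, 2, 3, 3, 1, 1, 1, 3, 3, 3]

/-- The target of a differential. -/
def tgtQ (s : Fin 10) : Fin 14 := Fin.natAdd 4 s

/-- The length of a differential. -/
def ordQ : Fin 10 → ℕ := ![2, 2, 2, 2, 1, 1, 1, 1, 1, 1]

/-- Cocycles that represent the classes `b`. -/
def leadQ (r : G → F4) : Fin 14 ⊕ Fin 10 → Coch G F4 :=
  let S := fun y => cS r * y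
  let R := fun y => c1 r * y
  Sum.elim ![1, S 1, S (S 1), S (S (S 1)), S 1, S (S 1), S (S 1), S (S (S 1)),
      R 1, R (R 1), R (R (R 1)), R 1, R (R 1), R (R (R 1))]
    ![1, S 1, S 1, S (S 1), 1, R 1, R (R 1), 1, R 1, R (R 1)]

/-- The cocycle `τ²` with values in the functions on `V`. -/
abbrev tau2 (q : QCoord r t) := (phi3 q).f ((phi3 q).f ((1, 0), 0))

/-- The cocycle `τ³` with values in the functions on `V`. -/
abbrev tau3 (q : QCoord r t) := (phi3 q).f (tau2 q)

/-- The correction terms of the lifts of the basis elements. -/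
def tailQ (q : QCoord r t) (w v : A) : Fin 14 ⊕ Fin 10 → Coch G A :=
  let S := fun y => cS r * y
  let R := fun y => c1 r * y
  let T := fun y => c1 t * y
  let K := fun y => cK r * y
  let i := fun y => scal G A y
  Sum.elim ![0, i (T 1), w • i (tau2 q).1.2 + v • i (tau2 q).1.1,
      w ^ 2 • i (tau3 q).2.1 + v • (w • i (tau3 q).1.2 + v • i (tau3 q).1.1),
      0, 0, i (K (S 1) + S (T 1)), i (K (S (S 1)) + S (T (S 1))), 0, 0, 0,
      w • i (S 1) + v • i (K 1), w • i (S (R 1)) + v • i (K (R 1)),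
      w • i (S (R (R 1))) + v • i (K (R (R 1)))]
    ![0, 0, w ^ 2 • i (T 1), w ^ 2 • i (T (S 1)), 0, 0, 0, 0, 0, 0]

/-- The lifts of the basis elements. -/
def baseQ (q : QCoord r t) (w v : A) (a : Fin 14 ⊕ Fin 10) : Coch G A :=
  w ^ (expQ a : ℕ) • scal G A (leadQ r a) + v • tailQ q w v a

/-- The differentials `d₂(b u⁻²) = h_{1,0} b` for `b = 1, h_{1,0}`, `d₂(b u⁻³) = h_{1,0} b u⁻¹` for
`b = h_{1,0}, h_{1,0}²`, `d₁(b u⁻¹) = h_{1,1} b` and `d₁(b u⁻³) = h_{1,1} b u⁻²` for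
`b = 1, h_{1,1}, h_{1,1}²`. -/
theorem d_baseQ_inr (q : QCoord r t) (h : IsTwist ρ r w v) (s : Fin 10) :
    d ρ (baseQ q w v (.inr s)) = v ^ ordQ s • baseQ q w v (.inl (tgtQ s)) := by
  have e1 : dF (1 : Coch G F4) = 0 := d_one
  have mulS : ∀ y : Coch G F4, dF y = 0 → dF (cS r * y) = 0 := fun y hy => by
    rw [d_mul_C, d_cS q.r_mul, hy, zero_mul, mul_zero, add_zero]
  have mulR : ∀ y : Coch G F4, dF y = 0 → dF (c1 r * y) = 0 := fun y hy => by
    rw [d_mul_C, d_cR q.r_mul, hy, zero_mul, mul_zero, add_zero]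
  have o1 : ∀ y : Coch G F4, dF y = 0 → d ρ (w ^ 1 • scal G A y + v • (0 : Coch G A)) =
      v ^ 1 • (w ^ 0 • scal G A (c1 r * y) + v • (0 : Coch G A)) := fun y hy => by
    rw [pow_one w, pow_zero, one_smul, smul_zero, add_zero, add_zero]
    exact h.d1_w hy
  have o1' : ∀ y : Coch G F4, dF y = 0 → d ρ (w ^ 3 • scal G A y + v • (0 : Coch G A)) =
      v ^ 1 • (w ^ 2 • scal G A (c1 r * y) + v • (w • scal G A (cS r * y) + v • scal G A (cK r * y))) :=
    fun y hy => by
      rw [smul_zero, add_zero]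
      exact h.d1_w3 hy
  have o2 : ∀ y : Coch G F4, dF y = 0 → d ρ (w ^ 2 • scal G A y + v • (0 : Coch G A)) =
      v ^ 2 • (w ^ 0 • scal G A (cS r * y) + v • (0 : Coch G A)) := fun y hy => by
    rw [pow_zero, one_smul, smul_zero, add_zero, add_zero]
    exact h.d2_w2 hy
  have o2' : ∀ y : Coch G F4, dF y = 0 →
      d ρ (w ^ 3 • scal G A (cS r * y) + v • w ^ 2 • scal G A (c1 t * y)) =
      v ^ 2 • (w ^ 1 • scal G A (cS r * (cS r * y)) +
        v • scal G A (cK r * (cS r * y) + cS r * (c1 t * y))) := fun y hy => by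
    rw [pow_one w]
    exact h.d2_w3 hy q
  fin_cases s
  exacts [o2 _ e1, o2 _ (mulS _ e1), o2' _ e1, o2' _ (mulS _ e1), o1 _ e1, o1 _ (mulR _ e1),
    o1 _ (mulR _ (mulR _ e1)), o1' _ e1, o1' _ (mulR _ e1), o1' _ (mulR _ (mulR _ e1))]

theorem tau2_snd (q : QCoord r t) : (tau2 q).2 = (cS r * (cS r * 1), 0) := by
  rw [tau2, IsStage.phi3_phi3_y]

theorem tau3_snd_snd (q : QCoord r t) : (tau3 q).2.2 = cS r * (cS r * (cS r * 1)) := by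
  rw [tau3, phi3_apply, tau2_snd]
  change cS r * (cS r * (cS r * 1)) + (cK r + c1 t) * 0 = _
  rw [mul_zero, add_zero]

theorem d_tau2 (q : QCoord r t) : (X2 q.r_mul).d (tau2 q) = 0 := by
  have h : (X2 q.r_mul).d ((1, 0), 0) = 0 := by
    rw [X2_d, d_one]
    simp
  rw [tau2, (phi3 q).comm, (phi3 q).comm, h, map_zero, map_zero]

theorem d_tau3 (q : QCoord r t) : (X2 q.r_mul).d (tau3 q) = 0 := by
  rw [tau3, (phi3 q).comm, d_tau2, map_zero]

/-- The first four lifts are cocycles because they are the powers `1, τ, τ², τ³`, homogenized with `v`;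
the others are targets of differentials. -/
theorem d_baseQ_inl (q : QCoord r t) (h : IsTwist ρ r w v)
    (hv : ∀ (n : ℕ) (x : Coch G A), v ^ n • x = 0 → x = 0) (a : Fin 14) :
    d ρ (baseQ q w v (.inl a)) = 0 := by
  -- The differential of a target is annihilated by a power of `v`, so it is zero.
  have target : ∀ s, d ρ (baseQ q w v (.inl (tgtQ s))) = 0 := fun s => by
    refine hv (ordQ s) _ ?_
    rw [← d_smul_of_invariant h.map_mul (fun g => by rw [h.map_pow, h.map_v]), ← d_baseQ_inr q h, d_d]
  fin_cases a
  · change d ρ (w ^ 0 • scal G A 1 + v • (0 : Coch G A)) = 0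
    rw [pow_zero, one_smul, smul_zero, add_zero, h.d_scal, d_one, map_zero]
  · change d ρ (w ^ 1 • scal G A (cS r * 1) + v • scal G A (c1 t * 1)) = 0
    rw [pow_one w]
    exact h.d_tower_one d_one q
  · change d ρ (w ^ 2 • scal G A (cS r * (cS r * 1)) + v • (w • scal G A (tau2 q).1.2 +
      v • scal G A (tau2 q).1.1)) = 0
    have := h.d_tower_two q.r_mul (d_tau2 q) (congrArg Prod.snd (tau2_snd q))
    rwa [tau2_snd] at this
  · have := h.d_tower q.r_mul (d_tau3 q)
    rwa [tau3_snd_snd] at this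
  exacts [target 0, target 1, target 2, target 3, target 4, target 5, target 6, target 7, target 8,
    target 9]

end QuaternionLifts

section QuaternionBasis
variable {G : Type} [Group G] {ρ : Representation F4 G EV0} {r t : G → F4}

theorem isRep_leadQ (q : QCoord r t) (a : Fin 14 ⊕ Fin 10) :
    IsRep (leadQ r a) (monQ q.r_mul (monIdxQ a)) := by
  have mul : ∀ {x : G → F4} (hx : IsAdd x) {y : Coch G F4} {n : ℕ},
      IsRep y (homCls hx ^ n) → IsRep (c1 x * y) (homCls hx ^ (n + 1)) := fun hx y n hy => by
    rw [pow_succ']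
    exact (isRep_homCls hx).mul hy
  have zero : ∀ {x : G → F4} (hx : IsAdd x), IsRep (1 : Coch G F4) (homCls hx ^ 0) := fun hx => by
    rw [pow_zero]
    exact isRep_one
  have one : ∀ {x : G → F4} (hx : IsAdd x), IsRep (c1 x * 1) (homCls hx) := fun hx => by
    rw [← pow_one (homCls hx)]
    exact mul hx (zero hx)
  have S1 := one q.r_mul.sq
  have R1 := one q.r_mul
  have S2 := mul q.r_mul.sq (mul q.r_mul.sq (zero _))
  have R2 := mul q.r_mul (mul q.r_mul (zero _))
  have S3 := mul q.r_mul.sq S2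
  have R3 := mul q.r_mul R2
  have h3 : IsRep (cS r * (cS r * (cS r * 1))) (h11 q.r_mul ^ 3) := by
    rw [← h10_pow_three q]
    exact S3
  rcases a with a | a
  · fin_cases a
    exacts [isRep_one, S1, S2, h3, S1, S2, S2, h3, R1, R2, R3, R1, R2, R3]
  · fin_cases a
    exacts [isRep_one, S1, S1, S2, isRep_one, R1, R2, isRep_one, R1, R2]

/-- The bijection of the names of the basis elements of the first page with the products of the basis
elements of `H^*(Q₈; F₄)` and powers of `u`. -/
theorem bijective_monIdxQ_expQ : Function.Bijective fun a => (monIdxQ a, expQ a) := by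
  decide

/-- Every integer is uniquely of the form `-4 j - e` with `0 ≤ e ≤ 3`. -/
theorem bijective_neg_four_mul_sub : Function.Bijective fun x : ℤ × Fin 4 => -(x.2 : ℤ) + -4 * x.1 := by
  constructor
  · rintro ⟨j, e⟩ ⟨j', e'⟩ h
    have h : -(e : ℤ) + -4 * j = -(e' : ℤ) + -4 * j' := h
    have he := e.2
    have he' := e'.2
    refine Prod.ext ?_ (Fin.ext ?_)
    · change j = j'
      omega
    · change (e : ℕ) = e'
      omega
  · intro m
    refine ⟨(-m / 4, ⟨(-m % 4).toNat, by omega⟩), ?_⟩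
    change -(((-m % 4).toNat : ℕ) : ℤ) + -4 * (-m / 4) = m
    omega

/-- The names of the basis elements of the first page. -/
def indexQ : (ℤ × ℕ × Fin 14) ⊕ (ℤ × ℕ × Fin 10) ≃ (Fin 6 × ℕ) × ℤ :=
  let e1 : Fin 14 ⊕ Fin 10 ≃ Fin 6 × Fin 4 := Equiv.ofBijective _ bijective_monIdxQ_expQ
  let e2 : ℤ × Fin 4 ≃ ℤ := Equiv.ofBijective _ bijective_neg_four_mul_sub
  { toFun := Sum.elim
      (fun x => ((monIdxQ (.inl x.2.2), x.2.1), e2 (x.1, expQ (.inl x.2.2))))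
      (fun x => ((monIdxQ (.inr x.2.2), x.2.1), e2 (x.1, expQ (.inr x.2.2))))
    invFun := fun y =>
      match e1.symm (y.1.1, (e2.symm y.2).2) with
      | .inl a => .inl ((e2.symm y.2).1, y.1.2, a)
      | .inr a => .inr ((e2.symm y.2).1, y.1.2, a)
    left_inv := by
      rintro (⟨j, k, a⟩ | ⟨j, k, a⟩)
      · have h : e1.symm (monIdxQ (.inl a), expQ (.inl a)) = .inl a := e1.symm_apply_apply _
        simp [h]
      · have h : e1.symm (monIdxQ (.inr a), expQ (.inr a)) = .inr a := e1.symm_apply_apply _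
        simp [h]
    right_inv := by
      rintro ⟨⟨i, k⟩, m⟩
      obtain ⟨⟨j, e⟩, rfl⟩ := e2.surjective m
      obtain ⟨a, ha⟩ := e1.surjective (i, e)
      have h1 : monIdxQ a = i := congrArg Prod.fst ha
      have h2 : expQ a = e := congrArg Prod.snd ha
      rcases a with a | a <;> simp [← ha, h1, h2] }

theorem mul_mem_Hdeg_E1 {c : HRing F4 G F4} {n : ℕ} (hc : c ∈ Hdeg F4 G F4 n) (m : ℤ) :
    toE1 G c * uPow G m ∈ Hdeg F4 G EV0bar n := by
  obtain ⟨z, hz, hzc⟩ := exists_isRep_of_mem_Hdeg hc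
  refine (hzc.toE1.const_smul _).mem_Hdeg (n := n) ?_
  obtain ⟨f, rfl⟩ := exists_of_mem_cdeg hz
  have e1 : scal G EV0bar (of _ n f) = of (CochDeg G EV0bar) n _ := cochMap_of _ _ n f
  rw [e1]
  exact ⟨_, DirectSum.of_smul EV0bar n _ _⟩

theorem isRep_multiple_leading {z : Coch G F4} {c : HRing F4 G F4} (h : IsRep z c) (e : ℕ)
    (x : Coch G EV0) (j : ℤ) {z' : Coch G F4} {c' : HRing F4 G F4} (h' : IsRep z' c') :
    IsRep (redCoch (multiple j z' (wE ^ e • scal G EV0 z + v1 • x)))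
      (toE1 G (c * c') * uPow G (-(e : ℤ) + -4 * j)) := by
  have := isRep_multiple j h' (isRep_leading h e x)
  rwa [mul_assoc (toE1 G c), uPow_comm, ← mul_assoc, mul_assoc, ← uPow_add, ← map_mul] at this

theorem gensQ8_toE1 (q : QCoord r t) (a : Fin 14) :
    (gensQ8 a).toE1 (h10 q.r_mul) (h11 q.r_mul) =
      toE1 G (monQ q.r_mul (monIdxQ (.inl a))) * uPow G (-(expQ (.inl a) : ℕ)) := by
  have h3 := h10_pow_three q
  have one : (h10 q.r_mul) ^ 0 * h11 q.r_mul ^ 0 = 1 := by rw [pow_zero, pow_zero, one_mul]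
  have p : ∀ n : ℕ, (h10 q.r_mul) ^ n * h11 q.r_mul ^ 0 = h10 q.r_mul ^ n := fun n => by
    rw [pow_zero, mul_one]
  have p' : ∀ n : ℕ, (h10 q.r_mul) ^ 0 * h11 q.r_mul ^ n = h11 q.r_mul ^ n := fun n => by
    rw [pow_zero, one_mul]
  have p3 := (p 3).trans h3
  have p1 := (p 1).trans (pow_one _)
  have p1' := (p' 1).trans (pow_one _)
  have e : ∀ {x y : HRing F4 G F4} (m : ℤ), x = y → toE1 G x * uPow G m = toE1 G y * uPow G m :=
    fun m h => by rw [h]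
  fin_cases a
  exacts [e _ one, e _ p1, e _ (p 2), e _ p3, e _ p1, e _ (p 2), e _ (p 2), e _ p3, e _ p1', e _ (p' 2),
    e _ (p' 3), e _ p1', e _ (p' 2), e _ (p' 3)]

variable [Finite G] {g0 : HRing F4 G F4} {γ : Coch G F4}

/-- The basis of the first page for `Q₈`, with the lifts `baseQ`, multiplied by powers of `g₀` and of the
invariant unit `unitD`. -/
def bocksteinBasisQ (hρ : IsBockstein ρ r) (q : QCoord r t) (hγ : IsRep γ g0)
    (b : Module.Basis ((Fin 6 × ℕ) × ℤ) F4 (E1 G))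
    (hb : ∀ i, b i = toE1 G (monQ q.r_mul i.1.1 * g0 ^ i.1.2) * uPow G i.2) :
    BocksteinBasis ρ (ℤ × ℕ × Fin 14) (ℤ × ℕ × Fin 10) where
  b := b.reindex indexQ.symm
  X := Sum.elim (fun x => multiple x.1 (γ ^ x.2.1) (baseQ q wE v1 (.inl x.2.2)))
    (fun x => multiple x.1 (γ ^ x.2.1) (baseQ q wE v1 (.inr x.2.2)))
  tgt x := (x.1, x.2.1, tgtQ x.2.2)
  o x := ordQ x.2.2
  isRep := by
    rintro (⟨j, k, a⟩ | ⟨j, k, a⟩)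
    · rw [Module.Basis.reindex_apply, hb]
      exact isRep_multiple_leading (isRep_leadQ q (.inl a)) _ _ j (hγ.pow k)
    · rw [Module.Basis.reindex_apply, hb]
      exact isRep_multiple_leading (isRep_leadQ q (.inr a)) _ _ j (hγ.pow k)
  tgt_injective := by
    rintro ⟨j, k, a⟩ ⟨j', k', a'⟩ h
    simp only [Prod.mk.injEq] at h ⊢
    exact ⟨h.1, h.2.1, Fin.natAdd_injective _ _ h.2.2⟩
  o_ne_zero := by
    rintro ⟨j, k, s⟩
    fin_cases s
    all_goals simp [ordQ]
  d_inl := by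
    rintro ⟨j, k, a⟩
    change d ρ (multiple j (γ ^ k) _) = 0
    rw [hρ.d_multiple j (hγ.pow k).d_eq_zero,
      d_baseQ_inl q hρ.isTwist (fun n x hx => v1_pow_smul_eq_zero hx), multiple_zero]
  d_inr := by
    rintro ⟨j, k, s⟩
    change d ρ (multiple j (γ ^ k) _) = v1 ^ ordQ s • multiple j (γ ^ k) _
    rw [hρ.d_multiple j (hγ.pow k).d_eq_zero, d_baseQ_inr q hρ.isTwist, multiple_smul]

theorem einfIsDirectSum_Q (hρ : IsBockstein ρ r) (q : QCoord r t) (hg0 : g0 ∈ Hdeg F4 G F4 4)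
    (b : Module.Basis (Fin 6 × ℕ) F4 (HRing F4 G F4)) (hb : ∀ i, b i = monQ q.r_mul i.1 * g0 ^ i.2) :
    EinfIsDirectSum ρ (fun _ => True)
      (fun i : ℤ × ℕ × Fin 14 => toE1 G (g0 ^ i.2.1) * uPow G (-4 * i.1) *
        (gensQ8 i.2.2).toE1 (h10 q.r_mul) (h11 q.r_mul))
      (fun i => 4 * i.2.1 + (gensQ8 i.2.2).deg) (fun i => (gensQ8 i.2.2).ord) := by
  obtain ⟨γ, hγ⟩ := exists_isRep g0
  obtain ⟨b', hb'⟩ := exists_basis_E1 b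
  have hb'' : ∀ i, b' i = toE1 G (monQ q.r_mul i.1.1 * g0 ^ i.1.2) * uPow G i.2 := fun i => by
    rw [hb', hb]
  let D := bocksteinBasisQ hρ q hγ b' hb''
  have hD : ∀ a j k, b' ((monIdxQ a, k), -(expQ a : ℕ) + -4 * j) =
      toE1 G (monQ q.r_mul (monIdxQ a) * g0 ^ k) * uPow G (-(expQ a : ℕ) + -4 * j) :=
    fun a j k => hb'' _
  have hDl : ∀ j k a, D.b (.inl (j, k, a)) = b' ((monIdxQ (.inl a), k), -(expQ (.inl a) : ℕ) + -4 * j) :=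
    fun j k a => Module.Basis.reindex_apply _ _ _
  have hDr : ∀ j k a, D.b (.inr (j, k, a)) = b' ((monIdxQ (.inr a), k), -(expQ (.inr a) : ℕ) + -4 * j) :=
    fun j k a => Module.Basis.reindex_apply _ _ _
  have hdeg : ∀ a k m, toE1 G (monQ q.r_mul (monIdxQ a) * g0 ^ k) * uPow G m ∈
      Hdeg F4 G EV0bar (4 * k + degQ (monIdxQ a)) := fun a k m => by
    rw [Nat.add_comm]
    exact mul_mem_Hdeg_E1 (HRing.mul_mem_Hdeg (monQ_mem _ _) (HRing.pow_mem_Hdeg hg0 k)) m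
  have key := D.einfIsDirectSum hρ
    (Sum.elim (fun x => 4 * x.2.1 + degQ (monIdxQ (.inl x.2.2)))
      (fun x => 4 * x.2.1 + degQ (monIdxQ (.inr x.2.2))))
    (by
      rintro (⟨j, k, a⟩ | ⟨j, k, a⟩)
      · rw [hDl, hD]
        exact hdeg _ _ _
      · rw [hDr, hD]
        exact hdeg _ _ _)
    (fun i => (gensQ8 i.2.2).ord)
    (by
      rintro ⟨j, k, s⟩
      change (gensQ8 (tgtQ s)).ord = (ordQ s : ℕ∞)
      fin_cases s <;> rfl)
    (by
      rintro ⟨j, k, a⟩ h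
      obtain ⟨s, rfl⟩ : ∃ s, tgtQ s = a := by
        induction a using Fin.addCases (m := 4) (n := 10) with
        | left a =>
          refine absurd ?_ h
          fin_cases a <;> rfl
        | right s => exact ⟨s, rfl⟩
      exact ⟨(j, k, s), rfl⟩)
  convert key using 2 with i i
  · obtain ⟨j, k, a⟩ := i
    have hc : toE1 G (g0 ^ k) * toE1 G (monQ q.r_mul (monIdxQ (.inl a))) =
        toE1 G (monQ q.r_mul (monIdxQ (.inl a))) * toE1 G (g0 ^ k) := by
      rw [← map_mul, comm_of_basis_Q (q := q) hb, map_mul]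
    rw [hDl, hD, gensQ8_toE1 q, uPow_add, map_mul, mul_assoc (toE1 G (g0 ^ k)), uPow_comm,
      mul_assoc (toE1 G (monQ q.r_mul _)) (uPow G _), ← mul_assoc (toE1 G (g0 ^ k)), hc]
  · obtain ⟨j, k, a⟩ := i
    change _ = 4 * k + degQ (monIdxQ (.inl a))
    fin_cases a <;> rfl

end QuaternionBasis

/-! ### The differentials for `V` -/

/-- The names of the permanent cycles in the basis of the first page for `V`, up to multiples of `u⁻⁴`:
the unit, the targets `h_{1,0}^(p+1)` of the differentials `d₂`, and the targets `h_{1,0}^p h_{1,1}^(q+1)`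
and `h_{1,0}^p h_{1,1}^(q+1) u⁻²` of the differentials `d₁`. -/
inductive CycleV
  | one : CycleV
  | two : ℕ → CycleV
  | single : Bool → ℕ → ℕ → CycleV

/-- The names of the other elements of the basis: the sources `h_{1,0}^p u⁻²` of the differentials
`d₂`, and the sources `h_{1,0}^p h_{1,1}^q u⁻¹` and `h_{1,0}^p h_{1,1}^q u⁻³` of the differentials
`d₁`. -/
inductive SourceV
  | two : ℕ → SourceV
  | single : Bool → ℕ → ℕ → SourceV

/-- The target of a differential. -/
def tgtV : SourceV → CycleV
  | .two p => .two p
  | .single b p q => .single b p q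

/-- The length of a differential. -/
def ordV : SourceV → ℕ
  | .two _ => 2
  | .single _ _ _ => 1

/-- The exponents of `h_{1,0}` and `h_{1,1}` in a basis element. -/
def monIdxV : CycleV ⊕ SourceV → ℕ × ℕ
  | .inl .one => (0, 0)
  | .inl (.two p) => (p + 1, 0)
  | .inl (.single _ p q) => (p, q + 1)
  | .inr (.two p) => (p, 0)
  | .inr (.single _ p q) => (p, q)

/-- The exponent of `u⁻¹` in a basis element. -/
def expV : CycleV ⊕ SourceV → Fin 4
  | .inl .one => 0
  | .inl (.two _) => 0
  | .inl (.single false _ _) => 0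
  | .inl (.single true _ _) => 2
  | .inr (.two _) => 2
  | .inr (.single false _ _) => 1
  | .inr (.single true _ _) => 3

theorem bijective_monIdxV_expV : Function.Bijective fun a => (monIdxV a, expV a) := by
  constructor
  · rintro ((_ | p | ⟨_ | _, p, q⟩) | (p | ⟨_ | _, p, q⟩)) ((_ | p' | ⟨_ | _, p', q'⟩) | (p' | ⟨_ | _, p', q'⟩)) h <;>
      simp [monIdxV, expV] at h ⊢ <;> assumption
  · rintro ⟨⟨p, q⟩, e⟩
    fin_cases e
    · rcases q with _ | q
      · rcases p with _ | p
        exacts [⟨.inl .one, rfl⟩, ⟨.inl (.two p), rfl⟩]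
      · exact ⟨.inl (.single false p q), rfl⟩
    · exact ⟨.inr (.single false p q), rfl⟩
    · rcases q with _ | q
      exacts [⟨.inr (.two p), rfl⟩, ⟨.inl (.single true p q), rfl⟩]
    · exact ⟨.inr (.single true p q), rfl⟩

/-- The names of the basis elements of the first page, with the power of `u⁻⁴` as a separate index. -/
def indexEquiv {I J K : Type} (f : I ⊕ J → K × Fin 4) (hf : Function.Bijective f) :
    (ℤ × I) ⊕ (ℤ × J) ≃ K × ℤ :=
  (Equiv.prodSumDistrib ℤ I J).symm.trans <|
    ((Equiv.refl ℤ).prodCongr ((Equiv.ofBijective f hf).trans (Equiv.prodComm K (Fin 4)))).trans <|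
      (Equiv.prodAssoc ℤ (Fin 4) K).symm.trans <|
        ((Equiv.ofBijective _ bijective_neg_four_mul_sub).prodCongr (Equiv.refl K)).trans
          (Equiv.prodComm ℤ K)

section KleinLifts
variable {G A : Type} [Group G] [CommRing A] [Algebra F4 A] {ρ : Representation F4 G A} {r : G → F4}
  {w v : A}

/-- The cocycle that represents `h_{1,0}^p h_{1,1}^q`. -/
def monCoch (r : G → F4) (p q : ℕ) : Coch G F4 := cS r ^ p * c1 r ^ q

theorem isRep_monCoch (hr : IsAdd r) (p q : ℕ) : IsRep (monCoch r p q) (monV hr (p, q)) :=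
  ((isRep_homCls hr.sq).pow p).mul ((isRep_homCls hr).pow q)

/-- Cocycles that represent the monomials in `h_{1,0}` and `h_{1,1}`. -/
def leadV (r : G → F4) : CycleV ⊕ SourceV → Coch G F4
  | .inl .one => 1
  | .inl (.two p) => cS r * monCoch r p 0
  | .inl (.single _ p q) => c1 r * monCoch r p q
  | .inr (.two p) => monCoch r p 0
  | .inr (.single _ p q) => monCoch r p q

theorem isRep_leadV (hr : IsAdd r) (a : CycleV ⊕ SourceV) : IsRep (leadV r a) (monV hr (monIdxV a)) := by
  rcases a with (_ | p | ⟨b, p, q⟩) | (p | ⟨b, p, q⟩)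
  · have := isRep_monCoch hr 0 0
    rwa [monCoch, pow_zero, pow_zero, mul_one] at this
  · have := (isRep_homCls hr.sq).mul (isRep_monCoch hr p 0)
    rw [monV, ← mul_assoc, ← pow_succ'] at this
    exact this
  · have := (isRep_homCls hr).mul (isRep_monCoch hr p q)
    rw [← monV_succ] at this
    exact this
  · exact isRep_monCoch hr p 0
  · exact isRep_monCoch hr p q

/-- The correction terms of the lifts of the basis elements. -/
def tailV (r : G → F4) (w v : A) : CycleV ⊕ SourceV → Coch G A
  | .inl (.single true p q) =>
    w • scal G A (cS r * monCoch r p q) + v • scal G A (cK r * monCoch r p q)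
  | _ => 0

/-- The lifts of the basis elements. -/
def baseV (r : G → F4) (w v : A) (a : CycleV ⊕ SourceV) : Coch G A :=
  w ^ (expV a : ℕ) • scal G A (leadV r a) + v • tailV r w v a

/-- The differentials `d₂(h_{1,0}^p u⁻²) = h_{1,0}^(p+1)`, `d₁(b u⁻¹) = h_{1,1} b` and
`d₁(b u⁻³) = h_{1,1} b u⁻²` for all monomials `b`. -/
theorem d_baseV_inr (hr : IsAdd r) (h : IsTwist ρ r w v) (s : SourceV) :
    d ρ (baseV r w v (.inr s)) = v ^ ordV s • baseV r w v (.inl (tgtV s)) := by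
  have hy : ∀ p q, dF (monCoch r p q) = 0 := fun p q => (isRep_monCoch hr p q).d_eq_zero
  rcases s with p | ⟨_ | _, p, q⟩
  · change d ρ (w ^ 2 • scal G A (monCoch r p 0) + v • (0 : Coch G A)) =
      v ^ 2 • (w ^ 0 • scal G A (cS r * monCoch r p 0) + v • (0 : Coch G A))
    rw [pow_zero, one_smul, smul_zero, add_zero, add_zero]
    exact h.d2_w2 (hy p 0)
  · change d ρ (w ^ 1 • scal G A (monCoch r p q) + v • (0 : Coch G A)) =
      v ^ 1 • (w ^ 0 • scal G A (c1 r * monCoch r p q) + v • (0 : Coch G A))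
    rw [pow_one w, pow_zero, one_smul, smul_zero, add_zero, add_zero]
    exact h.d1_w (hy p q)
  · change d ρ (w ^ 3 • scal G A (monCoch r p q) + v • (0 : Coch G A)) =
      v ^ 1 • (w ^ 2 • scal G A (c1 r * monCoch r p q) +
        v • (w • scal G A (cS r * monCoch r p q) + v • scal G A (cK r * monCoch r p q)))
    rw [smul_zero, add_zero]
    exact h.d1_w3 (hy p q)

theorem d_baseV_inl (hr : IsAdd r) (h : IsTwist ρ r w v)
    (hv : ∀ (n : ℕ) (x : Coch G A), v ^ n • x = 0 → x = 0) (a : CycleV) :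
    d ρ (baseV r w v (.inl a)) = 0 := by
  -- The differential of a target is annihilated by a power of `v`, so it is zero.
  have target : ∀ s, d ρ (baseV r w v (.inl (tgtV s))) = 0 := fun s => by
    refine hv (ordV s) _ ?_
    rw [← d_smul_of_invariant h.map_mul (fun g => by rw [h.map_pow, h.map_v]), ← d_baseV_inr hr h, d_d]
  rcases a with _ | p | ⟨b, p, q⟩
  · change d ρ (w ^ 0 • scal G A 1 + v • (0 : Coch G A)) = 0
    rw [pow_zero, one_smul, smul_zero, add_zero, h.d_scal, d_one, map_zero]
  · exact target (.two p)
  · exact target (.single b p q)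

end KleinLifts

section KleinBasis
variable {G : Type} [Group G] {ρ : Representation F4 G EV0} {r : G → F4}

/-- The basis of the first page for `V`, with the lifts `baseV`, multiplied by powers of the invariant unit
`unitD`. -/
def bocksteinBasisV (hρ : IsBockstein ρ r) (hr : IsAdd r)
    (b : Module.Basis ((ℕ × ℕ) × ℤ) F4 (E1 G))
    (hb : ∀ i, b i = toE1 G (monV hr i.1) * uPow G i.2) :
    BocksteinBasis ρ (ℤ × CycleV) (ℤ × SourceV) where
  b := b.reindex (indexEquiv _ bijective_monIdxV_expV).symm
  X := Sum.elim (fun x => multiple x.1 1 (baseV r wE v1 (.inl x.2)))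
    (fun x => multiple x.1 1 (baseV r wE v1 (.inr x.2)))
  tgt x := (x.1, tgtV x.2)
  o x := ordV x.2
  isRep := by
    have h := fun a j => isRep_multiple_leading (isRep_leadV hr a) (expV a) (tailV r wE v1 a) j isRep_one
    simp only [mul_one] at h
    rintro (⟨j, a⟩ | ⟨j, a⟩)
    · rw [Module.Basis.reindex_apply, hb]
      exact h (.inl a) j
    · rw [Module.Basis.reindex_apply, hb]
      exact h (.inr a) j
  tgt_injective := by
    rintro ⟨j, (p | ⟨b, p, q⟩)⟩ ⟨j', (p' | ⟨b', p', q'⟩)⟩ h <;> cases h <;> rfl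
  o_ne_zero := by
    rintro ⟨j, (p | ⟨b, p, q⟩)⟩
    exacts [two_ne_zero, one_ne_zero]
  d_inl := by
    rintro ⟨j, a⟩
    change d ρ (multiple j 1 _) = 0
    rw [hρ.d_multiple j d_one,
      d_baseV_inl hr hρ.isTwist (fun n x hx => v1_pow_smul_eq_zero hx), multiple_zero]
  d_inr := by
    rintro ⟨j, s⟩
    change d ρ (multiple j 1 _) = v1 ^ ordV s • multiple j 1 _
    rw [hρ.d_multiple j d_one, d_baseV_inr hr hρ.isTwist, multiple_smul]

/-- The order of `v₁` on a permanent cycle. -/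
def orderV : CycleV → ℕ∞
  | .one => ⊤
  | .two _ => 2
  | .single _ _ _ => 1

/-- The permanent cycles that are named by the generators in degrees at most three. -/
def cycV : Fin 16 → CycleV := ![.one, .two 0, .two 1, .two 2,
  .single false 0 0, .single false 0 1, .single false 1 0, .single false 2 0, .single false 1 1,
  .single false 0 2, .single true 0 0, .single true 0 1, .single true 1 0, .single true 2 0,
  .single true 0 2, .single true 1 1]

theorem exists_cycV {a : CycleV} (h : (monIdxV (.inl a)).1 + (monIdxV (.inl a)).2 ≤ 3) :
    ∃ i, cycV i = a := by
  rcases a with _ | p | ⟨b, p, q⟩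
  · exact ⟨0, rfl⟩
  · have h : p + 1 + 0 ≤ 3 := h
    obtain rfl | rfl | rfl : p = 0 ∨ p = 1 ∨ p = 2 := by omega
    exacts [⟨1, rfl⟩, ⟨2, rfl⟩, ⟨3, rfl⟩]
  · have h : p + (q + 1) ≤ 3 := h
    have : (p = 0 ∧ q = 0) ∨ (p = 0 ∧ q = 1) ∨ (p = 1 ∧ q = 0) ∨ (p = 2 ∧ q = 0) ∨ (p = 1 ∧ q = 1) ∨
      (p = 0 ∧ q = 2) := by omega
    obtain ⟨rfl, rfl⟩ | ⟨rfl, rfl⟩ | ⟨rfl, rfl⟩ | ⟨rfl, rfl⟩ | ⟨rfl, rfl⟩ | ⟨rfl, rfl⟩ := this <;> cases b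
    exacts [⟨4, rfl⟩, ⟨10, rfl⟩, ⟨5, rfl⟩, ⟨11, rfl⟩, ⟨6, rfl⟩, ⟨12, rfl⟩, ⟨7, rfl⟩, ⟨13, rfl⟩,
      ⟨8, rfl⟩, ⟨15, rfl⟩, ⟨9, rfl⟩, ⟨14, rfl⟩]

theorem cycV_injective : Function.Injective cycV := by
  intro i j h
  have hp := congrArg (fun a => (monIdxV (.inl a), expV (.inl a))) h
  have key : ∀ i j : Fin 16, (monIdxV (.inl (cycV i)), expV (.inl (cycV i))) =
    (monIdxV (.inl (cycV j)), expV (.inl (cycV j))) → i = j := by decide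
  exact key i j hp

theorem einfIsDirectSum_V [Finite G] (hρ : IsBockstein ρ r) (hr : IsAdd r)
    (h : (X2 hr).IsResolution ((1, 0), 0)) :
    EinfIsDirectSum ρ (fun s => s ≤ 3)
      (fun i : ℤ × Fin 16 => uPow G (-4 * i.1) * (gensV i.2).toE1 (h10 hr) (h11 hr))
      (fun i => (gensV i.2).deg) (fun i => (gensV i.2).ord) := by
  obtain ⟨b, hb⟩ := exists_basis_V hr h
  obtain ⟨b', hb'⟩ := exists_basis_E1 b
  have hb'' : ∀ i, b' i = toE1 G (monV hr i.1) * uPow G i.2 := fun i => by rw [hb', hb]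
  let D := bocksteinBasisV hρ hr b' hb''
  have hDl : ∀ j a, D.b (.inl (j, a)) =
      toE1 G (monV hr (monIdxV (.inl a))) * uPow G (-(expV (.inl a) : ℕ) + -4 * j) :=
    fun j a => (Module.Basis.reindex_apply _ _ _).trans (hb'' _)
  have hDr : ∀ j a, D.b (.inr (j, a)) =
      toE1 G (monV hr (monIdxV (.inr a))) * uPow G (-(expV (.inr a) : ℕ) + -4 * j) :=
    fun j a => (Module.Basis.reindex_apply _ _ _).trans (hb'' _)
  let deg (a : CycleV ⊕ SourceV) : ℕ := (monIdxV a).1 + (monIdxV a).2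
  have key := (D.einfIsDirectSum hρ (Sum.elim (fun x => deg (.inl x.2)) (fun x => deg (.inr x.2)))
    (by
      rintro (⟨j, a⟩ | ⟨j, a⟩)
      · rw [hDl]
        exact mul_mem_Hdeg_E1 (monV_mem hr _) _
      · rw [hDr]
        exact mul_mem_Hdeg_E1 (monV_mem hr _) _)
    (fun i => orderV i.2)
    (by
      rintro ⟨j, (p | ⟨b, p, q⟩)⟩
      exacts [rfl, rfl])
    (by
      rintro ⟨j, (_ | p | ⟨b, p, q⟩)⟩ h
      exacts [absurd rfl h, ⟨(j, .two p), rfl⟩, ⟨(j, .single b p q), rfl⟩])).reindex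
    (fun s => s ≤ 3) (fun i : ℤ × Fin 16 => (i.1, cycV i.2))
    (fun i j h => Prod.ext (Prod.mk.inj h).1 (cycV_injective (Prod.mk.inj h).2))
    (by
      rintro ⟨j, a⟩ ha
      obtain ⟨i, rfl⟩ := exists_cycV ha
      exact ⟨(j, i), rfl⟩)
  convert key using 2 with i i i
  · obtain ⟨j, a⟩ := i
    rw [hDl, uPow_add, ← mul_assoc, uPow_comm]
    refine congrArg (· * _) ?_
    fin_cases a <;> rfl
  · obtain ⟨j, a⟩ := i
    change _ = (monIdxV (.inl (cycV a))).1 + (monIdxV (.inl (cycV a))).2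
    fin_cases a <;> rfl
  · obtain ⟨j, a⟩ := i
    fin_cases a <;> rfl

end KleinBasis

/-! ### The eigenvalues of `ω` -/

section Eigenvalues
variable {G : Type} [Group G] {r : G → F4} (hr : IsAdd r) (ζ : F4ˣ) {α : G →* G}

theorem map_h11 (γ : AutC) (h : ∀ g, r (α g) = (ζ : F4) ^ 2 * r g) :
    HRing.map (k := F4) α (actBar γ) (toE1 G (h11 hr)) = (ζ : F4) ^ 2 • toE1 G (h11 hr) := by
  rw [map_toE1, map_homCls α hr h, map_smul]

/-- The class `h_{1,0}` is that of `r²`, and `(ζ²)² = ζ`. -/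
theorem map_h10 (γ : AutC) (h : ∀ g, r (α g) = (ζ : F4) ^ 2 * r g) :
    HRing.map (k := F4) α (actBar γ) (toE1 G (h10 hr)) = (ζ : F4) • toE1 G (h10 hr) := by
  have h' : ∀ g, r (α g) ^ 2 = (ζ : F4) * r g ^ 2 := fun g => by
    rw [h]
    linear_combination r g ^ 2 * F4_pow_four (ζ : F4)
  rw [map_toE1, map_homCls α hr.sq h', map_smul]

end Eigenvalues

/-- A degree with a single basis element is spanned by it. -/
theorem HRing.exists_eq_smul {k G A K : Type} [Field k] [CharP k 2] [Group G] [CommRing A] [Algebra k A]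
    {deg : K → ℕ} (b : Module.Basis K k (HRing k G A)) (hv : ∀ i, b i ∈ Hdeg k G A (deg i)) {n : ℕ}
    {i : K} (hi : ∀ j, deg j = n → j = i) {x : HRing k G A} (hx : x ∈ Hdeg k G A n) :
    ∃ a : k, x = a • b i := by
  classical
  refine ⟨b.repr x i, b.ext_elem fun j => ?_⟩
  rw [LinearEquiv.map_smul, b.repr_self, Finsupp.smul_apply, smul_eq_mul, Finsupp.single_apply]
  split_ifs with h
  · rw [← h, mul_one]
  · rw [mul_zero]
    exact HRing.repr_eq_zero b hv hx fun h4 => h (hi j h4).symm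

theorem eq_of_mem_fibreQ {i : Fin 6 × ℕ} (h : i ∈ fibreQ 4) : i = (0, 1) := by
  obtain ⟨h1, h2⟩ := Finset.mem_product.1 h
  have f0 : ({i : Fin 6 | degQ i = 0} : Finset (Fin 6)) = {0} := by decide
  have h1 : i.1 ∈ ({i : Fin 6 | degQ i = 0} : Finset (Fin 6)) := h1
  rw [f0] at h1
  exact Prod.ext (Finset.mem_singleton.1 h1) (Finset.mem_singleton.1 h2)

theorem exists_eq_smul_of_basis_Q {G : Type} [Group G] {r : G → F4} {hr : IsAdd r} {g0 : HRing F4 G F4}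
    (hg0 : g0 ∈ Hdeg F4 G F4 4) (b : Module.Basis (Fin 6 × ℕ) F4 (HRing F4 G F4))
    (hb : ∀ i, b i = monQ hr i.1 * g0 ^ i.2) {c : HRing F4 G F4} (hc : c ∈ Hdeg F4 G F4 4) :
    ∃ a : F4, c = a • b (0, 1) := by
  have hmem : ∀ i, b i ∈ Hdeg F4 G F4 (degQ i.1 + 4 * i.2) := fun i => by
    rw [hb]
    exact HRing.mul_mem_Hdeg (monQ_mem _ _) (HRing.pow_mem_Hdeg hg0 _)
  exact HRing.exists_eq_smul b hmem (fun i h4 => eq_of_mem_fibreQ ((mem_fibreQ 4 i).2 h4)) hc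

/-- The class `g₀` spans the cohomology of `Q₈` in degree four, so it is invariant. -/
theorem omegaQ8_g0 (ζ : F4ˣ) {g0 : HRing F4 Q8 F4} (hg0 : g0 ∈ Hdeg F4 Q8 F4 4)
    (b : Module.Basis (Fin 6 × ℕ) F4 (HRing F4 Q8 F4))
    (hb : ∀ i, b i = monQ qCoord.r_mul i.1 * g0 ^ i.2) :
    omegaQ8 ζ (toE1 Q8 g0) = toE1 Q8 g0 := by
  have hb1 : b (0, 1) = g0 := (hb _).trans (by
    rw [pow_one]
    exact one_mul g0)
  have h0 : g0 ≠ 0 := hb1 ▸ b.ne_zero _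
  have hinv : ∀ x, conjQ8 (omega ζ) (conjQ8 (omega ζ)⁻¹ x) = x := fun x => Subtype.ext (by
    rw [coe_conjQ8, coe_conjQ8]
    group)
  have := map_eq_self_of_span hinv hg0 h0 fun c hc => hb1 ▸ exists_eq_smul_of_basis_Q hg0 b hb hc
  rw [omegaQ8, map_toE1, this]

end V1BSS

end

open V1BSS in
theorem mainTheorem8 (ζ : V1BSS.F4ˣ) (hζ : IsPrimitiveRoot ζ 3) :
    act (omega ζ) (LaurentPolynomial.T 1) = (ζ : F4) • LaurentPolynomial.T 1 ∧
    (∃ g0 h10 h11 : HRing F4 Q8 F4,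
      g0 ∈ Hdeg F4 Q8 F4 4 ∧ h10 ∈ Hdeg F4 Q8 F4 1 ∧ h11 ∈ Hdeg F4 Q8 F4 1 ∧
      (∃ φ : RingQ8 ≃ₐ[F4] HRing F4 Q8 F4,
        φ (Ideal.Quotient.mk _ (MvPolynomial.X 0)) = g0 ∧
        φ (Ideal.Quotient.mk _ (MvPolynomial.X 1)) = h10 ∧
        φ (Ideal.Quotient.mk _ (MvPolynomial.X 2)) = h11) ∧
      EinfIsDirectSum rhoQ8 (fun _ => True)
        (fun i : ℤ × ℕ × Fin 14 =>
          toE1 Q8 (g0 ^ i.2.1) * uPow Q8 (-4 * i.1) * (gensQ8 i.2.2).toE1 h10 h11)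
        (fun i => 4 * i.2.1 + (gensQ8 i.2.2).deg) (fun i => (gensQ8 i.2.2).ord) ∧
      (∀ c, ActsOnEinf rhoQ8 (mulE1 (toE1 Q8 c))) ∧
      (∀ k : ℤ, ActsOnEinf rhoQ8 (mulE1 (uPow Q8 (-4 * k)))) ∧
      ActsOnEinf rhoQ8 (omegaQ8 ζ).toLinearMap ∧
      omegaQ8 ζ (uPow Q8 1) = (ζ : F4) • uPow Q8 1 ∧
      omegaQ8 ζ (toE1 Q8 h10) = (ζ : F4) • toE1 Q8 h10 ∧
      omegaQ8 ζ (toE1 Q8 h11) = (ζ : F4) ^ 2 • toE1 Q8 h11 ∧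
      omegaQ8 ζ (toE1 Q8 g0) = toE1 Q8 g0) ∧
    ∃ h10 h11 : HRing F4 V F4,
      h10 ∈ Hdeg F4 V F4 1 ∧ h11 ∈ Hdeg F4 V F4 1 ∧
      (∃ φ : MvPolynomial (Fin 2) F4 ≃ₐ[F4] HRing F4 V F4,
        φ (MvPolynomial.X 0) = h10 ∧ φ (MvPolynomial.X 1) = h11) ∧
      EinfIsDirectSum rhoV (fun s => s ≤ 3)
        (fun i : ℤ × Fin 16 => uPow V (-4 * i.1) * (gensV i.2).toE1 h10 h11)
        (fun i => (gensV i.2).deg) (fun i => (gensV i.2).ord) ∧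
      (∀ c, ActsOnEinf rhoV (mulE1 (toE1 V c))) ∧
      (∀ k : ℤ, ActsOnEinf rhoV (mulE1 (uPow V (-4 * k)))) ∧
      ActsOnEinf rhoV (omegaV ζ).toLinearMap ∧
      omegaV ζ (uPow V 1) = (ζ : F4) • uPow V 1 ∧
      omegaV ζ (toE1 V h10) = (ζ : F4) • toE1 V h10 ∧
      omegaV ζ (toE1 V h11) = (ζ : F4) ^ 2 • toE1 V h11 := by
  refine ⟨act_omega_T ζ, ?_, ?_⟩
  · obtain ⟨g0, hg0, b, hb⟩ := exists_basis_Q qCoord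
    have hc := comm_E1 b (comm_of_basis_Q (q := qCoord) hb)
    exact ⟨g0, h10 qCoord.r_mul, h11 qCoord.r_mul, hg0, homCls_mem _, homCls_mem _,
      exists_algEquiv_Q (q := qCoord) hb, einfIsDirectSum_Q isBockstein_Q8 qCoord hg0 b hb,
      isBockstein_Q8.actsOnEinf_mulE1_toE1 hc, isBockstein_Q8.actsOnEinf_mulE1_uPow,
      actsOnEinf_omegaQ8 ζ, map_uPow ζ _ (actBar_omega_T ζ), map_h10 _ ζ _ (rQ_conj ζ),
      map_h11 _ ζ _ (rQ_conj ζ), omegaQ8_g0 ζ hg0 b hb⟩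
  · obtain ⟨b, hb⟩ := exists_basis_V isAdd_rV X2_isResolution_V
    have hc := comm_E1 b (comm_of_X2 isAdd_rV X2_isResolution_V)
    exact ⟨h10 isAdd_rV, h11 isAdd_rV, homCls_mem _, homCls_mem _,
      exists_algEquiv_V isAdd_rV X2_isResolution_V,
      einfIsDirectSum_V isBockstein_V isAdd_rV X2_isResolution_V,
      isBockstein_V.actsOnEinf_mulE1_toE1 hc, isBockstein_V.actsOnEinf_mulE1_uPow,
      actsOnEinf_omegaV ζ, map_uPow ζ _ (actBar_omega_T ζ), map_h10 _ ζ _ (rV_conj ζ),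
      map_h11 _ ζ _ (rV_conj ζ)⟩
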